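/- Fix an integer $k\ge 2$ and a real $\varepsilon$ with $0<\varepsilon<\frac{k-1}{k+1}$. Let $H(n,k,p)$ be the binomial random $k$-uniform hypergraph: each $k$-subset of a fixed $n$-element vertex set is an edge independently with probability $p$. Let $\alpha(H)$ be the (weak) independence number, i.e. the maximum size of a set of vertices containing no edge. Let $X_s$ be the number of independent sets of size $s$ in $H(n,k,p)$, so that $\mathbb E[X_s]=\binom ns(1-p)^{\binom sk}$, and let $s_x=s_x(n)$ be the largest integer $s$ with $\mathbb E[X_s]>n^{2\varepsilon}$. Put $d=np^{1/(k-1)}$; $\log$ is the natural logarithm, and all asymptotics are as $n\to\infty$ with $k$ and $\varepsilon$ fixed. Let $p=p(n)$ satisfy $$n^{-\frac{(k-1)k}{k+1}+\varepsilon}<p<(\log n)^{-(k-1)}$$ for all sufficiently large $n$. Then there is a sequence of integers $s_z=s_z(n)$ such that $\mathbb P\big(\alpha(H(n,k,p))\in\{s_z,s_z+1\}\big)\to 1$. Moreover: 1. if $p=\omega\big(\log n\cdot n^{-(k-1)^2/k}\big)$, then $s_x-s_z=0$ for all sufficiently large $n$; 2. if $p=C\log n\cdot n^{-(k-1)^2/k}$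 for a constant $C>0$, then for all sufficiently large $n$, $s_x-s_z=\xi_n$ with $$\xi_n\in\left(\frac{((k-1)!)^{\frac k{k-1}}}{C^{\frac k{k-1}}e^k}-\frac k{k-1}-\frac12,\ \frac{((k-1)!)^{\frac k{k-1}}}{C^{\frac k{k-1}}e^k}+\frac32\right);$$ 3. if $p=o\big(\log n\cdot n^{-(k-1)^2/k}\big)$, then $$s_x-s_z\sim\frac{s_x^k}{e^kn^{k-1}}\sim\frac{(k!\log d)^{\frac k{k-1}}}{e^kp^{\frac k{k-1}}n^{k-1}}.$$ -/

import Mathlib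

open Filter Topology Asymptotics

namespace RandomHypergraph

noncomputable section

/-- The set of all `k`-uniform hypergraphs on the vertex set `Fin n`; a hypergraph is given by its
set of edges. -/
def uniformHypergraphs (n k : ℕ) : Finset (Finset (Finset (Fin n))) :=
  ((Finset.univ : Finset (Fin n)).powersetCard k).powerset

/-- The probability that the binomial random hypergraph `H(n, k, p)` equals the `k`-uniform
hypergraph `H`. -/
def weight (n k : ℕ) (p : ℝ) (H : Finset (Finset (Fin n))) : ℝ :=
  p ^ H.card * (1 - p) ^ (n.choose k - H.card)

/-- The expectation of a random variable `X` defined on `H(n, k, p)`. -/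
def expect (n k : ℕ) (p : ℝ) (X : Finset (Finset (Fin n)) → ℝ) : ℝ :=
  ∑ H ∈ uniformHypergraphs n k, weight n k p H * X H

open Classical in
/-- The probability that `H(n, k, p)` has the property `A`. -/
def prob (n k : ℕ) (p : ℝ) (A : Finset (Finset (Fin n)) → Prop) : ℝ :=
  ∑ H ∈ uniformHypergraphs n k with A H, weight n k p H

/-- (Weak) independence: no edge of `H` is contained in `S`. -/
def IsIndep {n : ℕ} (H : Finset (Finset (Fin n))) (S : Finset (Fin n)) : Prop :=
  ∀ e ∈ H, ¬ e ⊆ S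

open Classical in
/-- The (weak) independence number `α(H)`: the largest size of an independent set. -/
def indepNum {n : ℕ} (H : Finset (Finset (Fin n))) : ℕ :=
  ({S : Finset (Fin n) | IsIndep H S} : Finset (Finset (Fin n))).sup Finset.card

open Classical in
/-- The number `X_s` of independent sets of size `s`. -/
def numIndep {n : ℕ} (s : ℕ) (H : Finset (Finset (Fin n))) : ℕ :=
  ({S : Finset (Fin n) | IsIndep H S ∧ S.card = s} : Finset (Finset (Fin n))).card

/-- The first-moment threshold `s_x`: the largest `s` with `E[X_s] > n ^ (2 ε)`.
The set is always bounded, since `X_s = 0` for `s > n`. -/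
def firstMomentThreshold (n k : ℕ) (p ε : ℝ) : ℕ :=
  sSup {s : ℕ | (n : ℝ) ^ (2 * ε) < expect n k p (fun H => (numIndep s H : ℝ))}

end

end RandomHypergraph

/-! The first moment of $X_s$ overestimates $\alpha$ when $p$ is small, because independent sets
come in clusters: if a vertex $w$ outside an independent set $S$ forms only one edge with $S$, then
$w$ can be exchanged for any other vertex of that edge. The remedy is to count whole clusters. An
augmented independent set of order $s$ is a set $F$ with $|F|=s+r$ whose edges form a matching of
size $r$ and whose outside vertices all form at least two edges with $F$. Deleting a transversal of
the matching gives $\alpha\ge|F|-r$ (`IsAugmented.card_le`). Conversely, every hypergraph has such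
an $F$ of order exactly $\alpha$ (`exists_isAugmented`): take the largest set of size $\alpha+r$
that spans an $r$-edge matching. Hence $\mathbb P(\alpha=s)$ is at most the expected number of
augmented sets of order $s$ (`prob_indepNum_eq_le`), while a second moment computation gives lower
bounds on $\alpha$ (`one_le_prob_mul`, `tendsto_prob_le_indepNum_add`). That computation splits
pairs $F,F'$ into equal, nearly equal, intermediate and nearly disjoint ones.

The expected number of augmented sets of order $s$ with $r$ edges is roughly $\mathbb
E[X_s]\,\frac{\lambda^r}{r!}\,e^{-n\beta}$, where $\lambda$ is `augRate` and $\beta$ is the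
probability that an outside vertex has at most one edge (`atMostOne`). Summed over $r$ this gives
`augMain`, that is $\mathbb E[X_s]e^{\lambda-n\beta}$. Near the threshold $(1-p)^{\binom s{k-1}}\sim
e^{-k}(s/n)^k$, so that $n\beta-\lambda\sim A(k-1)\log(n/s)$ with $A=s^k/(e^kn^{k-1})$ (`critSize`).
One step down in $s$ multiplies $\mathbb E[X_s]$ by about $(n/s)^{k-1}$, up to a constant. Therefore
$\log$ `augMain`$(s-j)\approx\log\mathbb E[X_s]+(j-A)(k-1)\log(n/s)$ (`abs_log_augMain_sub_le`):
about $A$ steps down make up for the loss.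

The value $s_z$ is $s_x$ minus `augOffset`, the least $j$ at which `augMain` reaches
$n^\delta(1+n(s/n)^k)$. There the second moment method applies (`tendsto_prob_augOffset`). One step
higher `augMain` is below this bound, and each further step multiplies it by $O((s/n)^{k-1})$, so
nothing survives from $s_z+2$ on (`tendsto_prob_augOffset_add_two`). The lower bound on $p$ makes
$n(s/n)^{k+1}$ polynomially small, which controls the error terms; the upper bound makes $s/\log n$
tend to infinity. The three regimes are those in which $A$ tends to $0$, to a positive constant, or
to infinity. -/

namespace RandomHypergraph

noncomputable section

/-! ### Random subsets with independent elements: expectation, probability, independence. -/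

section ProductMeasure

variable {α ι : Type*}

/-- The expectation of `f` over a random subset of `E` that contains each element independently
with probability `p`. -/
def bernExpect (p : ℝ) (E : Finset α) (f : Finset α → ℝ) : ℝ :=
  ∑ H ∈ E.powerset, p ^ H.card * (1 - p) ^ (E.card - H.card) * f H

open Classical in
/-- The probability of the event `A` for a random subset of `E` that contains each element
independently with probability `p`. -/
def bernProb (p : ℝ) (E : Finset α) (A : Finset α → Prop) : ℝ :=
  bernExpect p E (fun H => if A H then 1 else 0)

theorem bernExpect_one (p : ℝ) (E : Finset α) : bernExpect p E (fun _ => 1) = 1 := by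
  have := Finset.sum_pow_mul_eq_add_pow p (1 - p) E
  simp only [bernExpect, mul_one, this]
  simp

theorem bernExpect_congr {p : ℝ} {E : Finset α} {f g : Finset α → ℝ}
    (h : ∀ H ⊆ E, f H = g H) : bernExpect p E f = bernExpect p E g :=
  Finset.sum_congr rfl fun H hH => by rw [h H (Finset.mem_powerset.1 hH)]

theorem bernExpect_mono {p : ℝ} (hp0 : 0 ≤ p) (hp1 : p ≤ 1) {E : Finset α} {f g : Finset α → ℝ}
    (h : ∀ H ⊆ E, f H ≤ g H) : bernExpect p E f ≤ bernExpect p E g :=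
  Finset.sum_le_sum fun H hH => mul_le_mul_of_nonneg_left (h H (Finset.mem_powerset.1 hH))
    (mul_nonneg (pow_nonneg hp0 _) (pow_nonneg (sub_nonneg.2 hp1) _))

theorem bernExpect_add (p : ℝ) (E : Finset α) (f g : Finset α → ℝ) :
    bernExpect p E (fun H => f H + g H) = bernExpect p E f + bernExpect p E g := by
  simp [bernExpect, mul_add, Finset.sum_add_distrib]

theorem bernExpect_sum (p : ℝ) (E : Finset α) (I : Finset ι) (f : ι → Finset α → ℝ) :
    bernExpect p E (fun H => ∑ i ∈ I, f i H) = ∑ i ∈ I, bernExpect p E (f i) := by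
  simp only [bernExpect, Finset.mul_sum]
  exact Finset.sum_comm

theorem bernProb_mono {p : ℝ} (hp0 : 0 ≤ p) (hp1 : p ≤ 1) {E : Finset α} {A B : Finset α → Prop}
    (h : ∀ H ⊆ E, A H → B H) : bernProb p E A ≤ bernProb p E B := by
  refine bernExpect_mono hp0 hp1 fun H hH => ?_
  by_cases hA : A H
  · simp [hA, h H hH hA]
  · simp only [hA, if_false]; split_ifs <;> norm_num

theorem bernProb_nonneg {p : ℝ} (hp0 : 0 ≤ p) (hp1 : p ≤ 1) (E : Finset α)
    (A : Finset α → Prop) : 0 ≤ bernProb p E A := by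
  refine Finset.sum_nonneg fun H _ => mul_nonneg
    (mul_nonneg (pow_nonneg hp0 _) (pow_nonneg (sub_nonneg.2 hp1) _)) ?_
  dsimp only
  split_ifs <;> norm_num

theorem bernProb_le_one {p : ℝ} (hp0 : 0 ≤ p) (hp1 : p ≤ 1) (E : Finset α)
    (A : Finset α → Prop) : bernProb p E A ≤ 1 := by
  rw [← bernExpect_one p E]
  refine bernExpect_mono hp0 hp1 fun H _ => ?_
  split_ifs <;> norm_num

theorem bernProb_not (p : ℝ) (E : Finset α) (A : Finset α → Prop) :
    bernProb p E (fun H => ¬ A H) = 1 - bernProb p E A := by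
  rw [eq_sub_iff_add_eq, bernProb, bernProb, ← bernExpect_add]
  refine Eq.trans ?_ (bernExpect_one p E)
  refine bernExpect_congr fun H _ => ?_
  by_cases h : A H <;> simp [h]

theorem bernProb_congr {p : ℝ} {E : Finset α} {A B : Finset α → Prop}
    (h : ∀ H ⊆ E, (A H ↔ B H)) : bernProb p E A = bernProb p E B :=
  bernExpect_congr fun H hH => by
    by_cases hB : B H
    · simp [hB, (h H hH).2 hB]
    · simp [hB, mt (h H hH).1 hB]

/-- The union bound. -/
theorem bernProb_exists_le {p : ℝ} (hp0 : 0 ≤ p) (hp1 : p ≤ 1) (E : Finset α) (I : Finset ι)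
    (A : ι → Finset α → Prop) :
    bernProb p E (fun H => ∃ i ∈ I, A i H) ≤ ∑ i ∈ I, bernProb p E (A i) := by
  classical
  simp only [bernProb]
  rw [← bernExpect_sum]
  refine bernExpect_mono hp0 hp1 fun H _ => ?_
  have hnn : ∀ i ∈ I, (0 : ℝ) ≤ if A i H then 1 else 0 := fun i _ => by split_ifs <;> norm_num
  split_ifs with h
  · obtain ⟨i, hi, hA⟩ := h
    calc (1 : ℝ) = if A i H then 1 else 0 := by simp [hA]
      _ ≤ _ := Finset.single_le_sum (f := fun i => if A i H then (1 : ℝ) else 0) hnn hi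
  · exact Finset.sum_nonneg hnn

variable [DecidableEq α]

/-- A subset of a disjoint union is a pair of subsets and its weight is the product of the two
weights. The independence statements below rest on this. -/
theorem bernExpect_union (p : ℝ) {E₁ E₂ : Finset α} (h : Disjoint E₁ E₂) (f g : Finset α → ℝ) :
    bernExpect p (E₁ ∪ E₂) (fun H => f (H ∩ E₁) * g (H ∩ E₂)) =
      bernExpect p E₁ f * bernExpect p E₂ g := by
  unfold bernExpect
  rw [Finset.sum_mul_sum, ← Finset.sum_product']
  symm
  refine Finset.sum_nbij' (fun x => x.1 ∪ x.2) (fun H => (H ∩ E₁, H ∩ E₂)) ?_ ?_ ?_ ?_ ?_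
  · rintro ⟨a, b⟩ hab
    simp only [Finset.mem_product, Finset.mem_powerset] at hab ⊢
    exact Finset.union_subset_union hab.1 hab.2
  · intro H _
    simp
  · rintro ⟨a, b⟩ hab
    simp only [Finset.mem_product, Finset.mem_powerset] at hab
    have h1 : Disjoint b E₁ := (h.mono_right hab.2).symm
    have h2 : Disjoint a E₂ := h.mono_left hab.1
    simp [Finset.union_inter_distrib_right, Finset.inter_eq_left.2 hab.1,
      Finset.inter_eq_left.2 hab.2, Finset.disjoint_iff_inter_eq_empty.1 h1,
      Finset.disjoint_iff_inter_eq_empty.1 h2]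
  · intro H hH
    simp only [Finset.mem_powerset] at hH
    simp [← Finset.inter_union_distrib_left, Finset.inter_eq_left.2 hH]
  · rintro ⟨a, b⟩ hab
    simp only [Finset.mem_product, Finset.mem_powerset] at hab
    have h1 : Disjoint b E₁ := (h.mono_right hab.2).symm
    have h2 : Disjoint a E₂ := h.mono_left hab.1
    have h3 : Disjoint a b := h2.mono_right hab.2
    have e1 : (a ∪ b) ∩ E₁ = a := by
      simp [Finset.union_inter_distrib_right, Finset.inter_eq_left.2 hab.1,
        Finset.disjoint_iff_inter_eq_empty.1 h1]
    have e2 : (a ∪ b) ∩ E₂ = b := by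
      simp [Finset.union_inter_distrib_right, Finset.inter_eq_left.2 hab.2,
        Finset.disjoint_iff_inter_eq_empty.1 h2]
    have c1 := Finset.card_le_card hab.1
    have c2 := Finset.card_le_card hab.2
    have e3 : E₁.card + E₂.card - (a.card + b.card) =
        (E₁.card - a.card) + (E₂.card - b.card) := by omega
    simp only [e1, e2, Finset.card_union_of_disjoint h3, Finset.card_union_of_disjoint h, e3,
      pow_add]
    ring

theorem bernExpect_subset (p : ℝ) {E E' : Finset α} (h : E' ⊆ E) (f : Finset α → ℝ) :
    bernExpect p E (fun H => f (H ∩ E')) = bernExpect p E' f := by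
  have := bernExpect_union p (Finset.disjoint_sdiff (s := E') (t := E)) f (fun _ => 1)
  rw [Finset.union_sdiff_of_subset h, bernExpect_one] at this
  simpa using this

theorem bernExpect_biUnion (p : ℝ) (I : Finset ι) (E : ι → Finset α)
    (hE : ∀ i ∈ I, ∀ j ∈ I, i ≠ j → Disjoint (E i) (E j)) (f : ι → Finset α → ℝ) :
    bernExpect p (I.biUnion E) (fun H => ∏ i ∈ I, f i (H ∩ E i)) =
      ∏ i ∈ I, bernExpect p (E i) (f i) := by
  classical
  induction I using Finset.induction_on with
  | empty => simp [bernExpect]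
  | insert a I ha ih =>
    have hdis : Disjoint (E a) (I.biUnion E) := by
      rw [Finset.disjoint_biUnion_right]
      intro i hi
      exact hE a (Finset.mem_insert_self _ _) i (Finset.mem_insert_of_mem hi)
        (fun h => ha (h ▸ hi))
    rw [Finset.biUnion_insert, Finset.prod_insert ha,
      ← ih fun i hi j hj => hE i (Finset.mem_insert_of_mem hi) j (Finset.mem_insert_of_mem hj),
      ← bernExpect_union p hdis]
    refine bernExpect_congr fun H _ => ?_
    rw [Finset.prod_insert ha]
    congr 1
    refine Finset.prod_congr rfl fun i hi => ?_
    rw [Finset.inter_assoc, Finset.inter_eq_right.2 (Finset.subset_biUnion_of_mem E hi)]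

/-- Events depending on disjoint sets of coordinates are independent. -/
theorem bernProb_forall (p : ℝ) {E : Finset α} (I : Finset ι) (D : ι → Finset α)
    (hDE : ∀ i ∈ I, D i ⊆ E)
    (hD : ∀ i ∈ I, ∀ j ∈ I, i ≠ j → Disjoint (D i) (D j)) (A : ι → Finset α → Prop) :
    bernProb p E (fun H => ∀ i ∈ I, A i (H ∩ D i)) = ∏ i ∈ I, bernProb p (D i) (A i) := by
  classical
  simp only [bernProb]
  rw [← bernExpect_biUnion p I D hD, ← bernExpect_subset p (Finset.biUnion_subset.2 hDE)]
  refine bernExpect_congr fun H _ => ?_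
  have : ∀ i ∈ I, H ∩ I.biUnion D ∩ D i = H ∩ D i := fun i hi => by
    rw [Finset.inter_assoc, Finset.inter_eq_right.2 (Finset.subset_biUnion_of_mem D hi)]
  rw [Finset.prod_congr rfl fun i hi => by rw [this i hi]]
  rw [Finset.prod_ite_zero]
  simp

theorem bernProb_subset (p : ℝ) {E E' : Finset α} (h : E' ⊆ E) (A : Finset α → Prop) :
    bernProb p E (fun H => A (H ∩ E')) = bernProb p E' A :=
  bernExpect_subset p h (fun H => @ite ℝ (A H) (Classical.propDecidable _) 1 0)

theorem bernProb_and (p : ℝ) {E E₁ E₂ : Finset α} (h₁ : E₁ ⊆ E) (h₂ : E₂ ⊆ E)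
    (h : Disjoint E₁ E₂) (A B : Finset α → Prop) :
    bernProb p E (fun H => A (H ∩ E₁) ∧ B (H ∩ E₂)) = bernProb p E₁ A * bernProb p E₂ B := by
  rw [bernProb, bernProb, bernProb, ← bernExpect_union p h,
    ← bernExpect_subset p (Finset.union_subset h₁ h₂)]
  refine bernExpect_congr fun H _ => ?_
  have e1 : H ∩ (E₁ ∪ E₂) ∩ E₁ = H ∩ E₁ := by
    rw [Finset.inter_assoc, Finset.inter_eq_right.2 Finset.subset_union_left]
  have e2 : H ∩ (E₁ ∪ E₂) ∩ E₂ = H ∩ E₂ := by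
    rw [Finset.inter_assoc, Finset.inter_eq_right.2 Finset.subset_union_right]
  rw [e1, e2]
  by_cases hA : A (H ∩ E₁) <;> by_cases hB : B (H ∩ E₂) <;> simp [hA, hB]

theorem bernProb_eq (p : ℝ) {E M : Finset α} (h : M ⊆ E) :
    bernProb p E (fun H => H = M) = p ^ M.card * (1 - p) ^ (E.card - M.card) := by
  simp [bernProb, bernExpect, h]

/-- The probability that a binomial random variable with parameters `B` and `p` is at most
one. -/
def atMostOne (p : ℝ) (B : ℕ) : ℝ := (1 - p) ^ B + B * p * (1 - p) ^ (B - 1)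

theorem bernProb_card_le_one (p : ℝ) (E : Finset α) :
    bernProb p E (fun H => H.card ≤ 1) = atMostOne p E.card := by
  have h : ∀ H ⊆ E, (if H.card ≤ 1 then (1 : ℝ) else 0) =
      (if H = ∅ then 1 else 0) + ∑ e ∈ E, if H = {e} then (1 : ℝ) else 0 := by
    intro H hH
    rcases Nat.lt_trichotomy H.card 1 with hc | hc | hc
    · have : H = ∅ := Finset.card_eq_zero.1 (by omega)
      subst this
      simp [(Finset.singleton_ne_empty _).symm]
    · obtain ⟨e, rfl⟩ := Finset.card_eq_one.1 hc
      have he : e ∈ E := by simpa using hH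
      simp [he]
    · have h0 : H ≠ ∅ := by rintro rfl; simp at hc
      have h1 : ∀ e ∈ E, (if H = {e} then (1 : ℝ) else 0) = 0 := by
        intro e _
        rw [if_neg]; rintro rfl; simp at hc
      rw [Finset.sum_eq_zero h1, if_neg h0, if_neg (by omega)]; simp
  have e1 := bernProb_eq p (Finset.empty_subset E)
  have e2 : ∀ e ∈ E, bernProb p E (fun H => H = {e}) = p * (1 - p) ^ (E.card - 1) := by
    intro e he
    rw [bernProb_eq p (Finset.singleton_subset_iff.2 he)]; simp
  have e3 : bernProb p E (fun H => H.card ≤ 1) = bernProb p E (fun H => H = ∅) +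
      ∑ e ∈ E, bernProb p E (fun H => H = {e}) := by
    simp only [bernProb]
    rw [← bernExpect_sum, ← bernExpect_add]
    refine bernExpect_congr fun H hH => ?_
    convert h H hH
  rw [e3, Finset.sum_congr rfl e2, e1, atMostOne]
  simp [mul_assoc]

theorem bernProb_two_le (p : ℝ) (E : Finset α) :
    bernProb p E (fun H => 2 ≤ H.card) = 1 - atMostOne p E.card := by
  rw [← bernProb_card_le_one, ← bernProb_not]
  exact bernProb_congr fun H _ => by omega

/-- Bernoulli's inequality, applied to both terms of `atMostOne`, cancels the constant and linear
parts in `E.card * p`. -/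
theorem bernProb_two_le_le {p : ℝ} (hp0 : 0 ≤ p) (hp1 : p ≤ 1) (E : Finset α) :
    bernProb p E (fun H => 2 ≤ H.card) ≤ (E.card * p) ^ 2 := by
  rw [bernProb_two_le, atMostOne]
  have h1 : 1 - (E.card : ℝ) * p ≤ (1 - p) ^ E.card := by
    have := one_add_mul_le_pow (a := -p) (by linarith) E.card
    rw [show (1 : ℝ) + -p = 1 - p by ring] at this
    linarith
  rcases Nat.eq_zero_or_pos E.card with h0 | h0
  · simp [h0]
  · obtain ⟨m, hm⟩ := Nat.exists_eq_succ_of_ne_zero h0.ne'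
    rw [hm] at h1 ⊢
    have h2 : 1 - (m : ℝ) * p ≤ (1 - p) ^ m := by
      have := one_add_mul_le_pow (a := -p) (by linarith) m
      rw [show (1 : ℝ) + -p = 1 - p by ring] at this
      linarith
    have h3 : (0 : ℝ) ≤ ((m.succ : ℕ) : ℝ) * p := by positivity
    have h4 := mul_le_mul_of_nonneg_left h2 h3
    simp only [Nat.succ_sub_one]
    push_cast at *
    nlinarith [mul_nonneg hp0 hp0]

theorem bernProb_one_le_le {p : ℝ} (hp1 : p ≤ 1) (E : Finset α) :
    bernProb p E (fun H => 1 ≤ H.card) ≤ E.card * p := by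
  have e : bernProb p E (fun H => 1 ≤ H.card) = 1 - bernProb p E (fun H => H = ∅) := by
    rw [← bernProb_not]
    refine bernProb_congr fun H _ => ?_
    rw [← Finset.card_eq_zero]; omega
  rw [e, bernProb_eq p (Finset.empty_subset E)]
  have := one_add_mul_le_pow (a := -p) (by linarith) E.card
  rw [show (1 : ℝ) + -p = 1 - p by ring] at this
  simp only [Finset.card_empty, pow_zero, one_mul, Nat.sub_zero]
  linarith

end ProductMeasure

end

end RandomHypergraph

namespace RandomHypergraph

noncomputable section

/-! ### Counting matchings in the complete uniform hypergraph. -/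

section Matchings

variable {V : Type*} [DecidableEq V]

/-- The set of all `r`-element sets of pairwise disjoint `k`-subsets of `F`. -/
def matchings (k : ℕ) (F : Finset V) (r : ℕ) : Finset (Finset (Finset V)) :=
  ((F.powersetCard k).powersetCard r).filter fun M => ∀ e ∈ M, ∀ f ∈ M, e ≠ f → Disjoint e f

theorem mem_matchings {k r : ℕ} {F : Finset V} {M : Finset (Finset V)} :
    M ∈ matchings k F r ↔ (M ⊆ F.powersetCard k ∧ M.card = r) ∧
      ∀ e ∈ M, ∀ f ∈ M, e ≠ f → Disjoint e f := by
  simp [matchings, Finset.mem_powersetCard]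

/-- Double counting of pairs `e ∈ M`: deleting `e` leaves a matching of `F \ e`. Since `1 ≤ k`, the
edge `e` is nonempty and hence not in that smaller matching, so the deletion can be undone. -/
theorem succ_mul_card_matchings {k : ℕ} (hk : 1 ≤ k) (F : Finset V) (r : ℕ) :
    (r + 1) * (matchings k F (r + 1)).card =
      ∑ e ∈ F.powersetCard k, (matchings k (F \ e) r).card := by
  have h1 : (r + 1) * (matchings k F (r + 1)).card =
      ∑ M ∈ matchings k F (r + 1), ∑ e ∈ F.powersetCard k, if e ∈ M then 1 else 0 := by
    rw [Finset.sum_congr rfl (g := fun _ => r + 1)]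
    · simp [mul_comm]
    · intro M hM
      rw [mem_matchings] at hM
      rw [← Finset.sum_filter, ← Finset.card_eq_sum_ones, Finset.filter_mem_eq_inter,
        Finset.inter_eq_right.2 hM.1.1, hM.1.2]
  rw [h1, Finset.sum_comm]
  refine Finset.sum_congr rfl fun e he => ?_
  rw [← Finset.sum_filter, ← Finset.card_eq_sum_ones]
  rw [Finset.mem_powersetCard] at he
  have hne : e.Nonempty := Finset.card_pos.1 (by omega)
  refine Finset.card_nbij' (fun M => M.erase e) (fun M => insert e M) ?_ ?_ ?_ ?_
  · intro M hM
    simp only [Finset.coe_filter, Set.mem_ofPred_eq, Finset.mem_coe, mem_matchings] at hM ⊢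
    obtain ⟨⟨⟨hM1, hM2⟩, hM3⟩, heM⟩ := hM
    refine ⟨⟨fun f hf => ?_, by rw [Finset.card_erase_of_mem heM]; omega⟩, fun f hf g hg =>
      hM3 f (Finset.mem_of_mem_erase hf) g (Finset.mem_of_mem_erase hg)⟩
    rw [Finset.mem_erase] at hf
    have := Finset.mem_powersetCard.1 (hM1 hf.2)
    exact Finset.mem_powersetCard.2 ⟨Finset.subset_sdiff.2 ⟨this.1, hM3 f hf.2 e heM hf.1⟩, this.2⟩
  · intro M hM
    simp only [Finset.coe_filter, Set.mem_ofPred_eq, Finset.mem_coe, mem_matchings] at hM ⊢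
    obtain ⟨⟨hM1, hM2⟩, hM3⟩ := hM
    have hd : ∀ f ∈ M, Disjoint f e := fun f hf =>
      (Finset.subset_sdiff.1 (Finset.mem_powersetCard.1 (hM1 hf)).1).2
    have heM : e ∉ M := fun h => hne.ne_empty (disjoint_self.1 (hd e h))
    refine ⟨⟨⟨Finset.insert_subset (Finset.mem_powersetCard.2 he) fun f hf => ?_, ?_⟩, ?_⟩,
      Finset.mem_insert_self _ _⟩
    · have := Finset.mem_powersetCard.1 (hM1 hf)
      exact Finset.mem_powersetCard.2 ⟨this.1.trans Finset.sdiff_subset, this.2⟩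
    · rw [Finset.card_insert_of_notMem heM, hM2]
    · intro f hf g hg hfg
      rcases Finset.mem_insert.1 hf with rfl | hf' <;>
        rcases Finset.mem_insert.1 hg with rfl | hg'
      · exact absurd rfl hfg
      · exact (hd g hg').symm
      · exact hd f hf'
      · exact hM3 f hf' g hg' hfg
  · intro M hM
    simp only [Finset.coe_filter, Set.mem_ofPred_eq] at hM
    exact Finset.insert_erase hM.2
  · intro M hM
    simp only [Finset.mem_coe, mem_matchings] at hM
    have heM : e ∉ M := fun h => hne.ne_empty (disjoint_self.1
      (Finset.subset_sdiff.1 (Finset.mem_powersetCard.1 (hM.1.1 h)).1).2)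
    exact Finset.erase_insert heM

/-- Counts matchings with ordered edges: the next edge is any `k`-subset of the vertices still free.
Truncated subtraction is harmless, since the binomial coefficient is `0` once fewer than `k`
vertices are left. -/
theorem factorial_mul_card_matchings {k : ℕ} (hk : 1 ≤ k) (F : Finset V) (r : ℕ) :
    r.factorial * (matchings k F r).card = ∏ i ∈ Finset.range r, (F.card - k * i).choose k := by
  induction r generalizing F with
  | zero =>
    have : matchings k F 0 = {∅} := by
      ext M
      simp only [mem_matchings, Finset.card_eq_zero, Finset.mem_singleton]
      constructor
      · rintro ⟨⟨_, h⟩, _⟩; exact h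
      · rintro rfl; simp
    simp [this]
  | succ r ih =>
    rw [Nat.factorial_succ, mul_comm (r + 1), mul_assoc, succ_mul_card_matchings hk,
      Finset.mul_sum, Finset.prod_range_succ']
    rw [Finset.sum_congr rfl (g := fun _ => ∏ i ∈ Finset.range r, (F.card - k * (i + 1)).choose k)]
    · simp [mul_comm]
    · intro e he
      rw [Finset.mem_powersetCard] at he
      rw [ih]
      refine Finset.prod_congr rfl fun i _ => ?_
      rw [Finset.card_sdiff_of_subset he.1, he.2, Nat.sub_sub]
      congr 2
      ring

/-- The number of matchings with `r` edges in the complete `k`-uniform hypergraph on `v`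
vertices. -/
def numMatchings (k v r : ℕ) : ℕ := (matchings k (Finset.range v) r).card

theorem factorial_mul_numMatchings {k : ℕ} (hk : 1 ≤ k) (v r : ℕ) :
    r.factorial * numMatchings k v r = ∏ i ∈ Finset.range r, (v - k * i).choose k := by
  rw [numMatchings, factorial_mul_card_matchings hk, Finset.card_range]

theorem card_matchings {k : ℕ} (hk : 1 ≤ k) (F : Finset V) (r : ℕ) :
    (matchings k F r).card = numMatchings k F.card r := by
  have h := factorial_mul_card_matchings hk F r
  rw [← factorial_mul_numMatchings hk] at h
  exact Nat.eq_of_mul_eq_mul_left r.factorial_pos h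

/-- A factor `k!` turns each binomial coefficient of the product formula into a falling factorial of
length `k`, and consecutive falling factorials concatenate. -/
theorem factorial_mul_pow_mul_numMatchings {k : ℕ} (hk : 1 ≤ k) (v r : ℕ) :
    r.factorial * k.factorial ^ r * numMatchings k v r = v.descFactorial (k * r) := by
  rw [mul_right_comm, factorial_mul_numMatchings hk]
  induction r with
  | zero => simp
  | succ r ih =>
    rw [Finset.prod_range_succ, pow_succ, mul_mul_mul_comm, ih, mul_comm _ k.factorial,
      ← Nat.descFactorial_eq_factorial_mul_choose, mul_add, mul_one]
    clear ih
    generalize k * r = m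
    clear hk
    induction k with
    | zero => simp
    | succ k ih =>
      rw [Nat.descFactorial_succ, ← add_assoc, Nat.descFactorial_succ, mul_left_comm, ih,
        Nat.sub_sub]

/-- A transversal of a matching can be removed to obtain a set that contains no edge. -/
theorem exists_transversal {k r : ℕ} {F : Finset V} {M : Finset (Finset V)}
    (hM : M ∈ matchings k F r) (c : Finset V → V) (hc : ∀ e ∈ M, c e ∈ e) :
    (F \ M.image c).card + r = F.card := by
  rw [mem_matchings] at hM
  have hsub : M.image c ⊆ F := by
    intro x hx
    obtain ⟨e, he, rfl⟩ := Finset.mem_image.1 hx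
    exact (Finset.mem_powersetCard.1 (hM.1.1 he)).1 (hc e he)
  have hinj : Set.InjOn c M := by
    intro e he f hf hef
    by_contra hne
    exact Finset.disjoint_left.1 (hM.2 e he f hf hne) (hc e he) (hef ▸ hc f hf)
  rw [Finset.card_sdiff_of_subset hsub, Finset.card_image_of_injOn hinj, hM.1.2]
  have := Finset.card_le_card hsub
  rw [Finset.card_image_of_injOn hinj, hM.1.2] at this
  omega

end Matchings

/-! ### Links of outside vertices and augmented independent sets. -/

section Links

variable {V : Type*} [DecidableEq V]

/-- The `k`-sets consisting of `w` and `k - 1` elements of `F`. -/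
def link (k : ℕ) (F : Finset V) (w : V) : Finset (Finset V) :=
  (F.powersetCard (k - 1)).image (insert w)

theorem mem_link {k : ℕ} {F : Finset V} {w : V} (hw : w ∉ F) {e : Finset V} (hk : 1 ≤ k) :
    e ∈ link k F w ↔ w ∈ e ∧ e.card = k ∧ e ⊆ insert w F := by
  simp only [link, Finset.mem_image, Finset.mem_powersetCard]
  constructor
  · rintro ⟨g, ⟨hg, hgk⟩, rfl⟩
    refine ⟨Finset.mem_insert_self _ _, ?_, Finset.insert_subset_insert _ hg⟩
    rw [Finset.card_insert_of_notMem fun h => hw (hg h), hgk]; omega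
  · rintro ⟨h1, h2, h3⟩
    refine ⟨e.erase w, ⟨?_, by rw [Finset.card_erase_of_mem h1, h2]⟩, Finset.insert_erase h1⟩
    rwa [← Finset.subset_insert_iff]

theorem card_link {k : ℕ} {F : Finset V} {w : V} (hw : w ∉ F) :
    (link k F w).card = F.card.choose (k - 1) := by
  rw [link, Finset.card_image_of_injOn, Finset.card_powersetCard]
  intro g hg g' hg' h
  rw [Finset.mem_coe, Finset.mem_powersetCard] at hg hg'
  have h1 : w ∉ g := fun h => hw (hg.1 h)
  have h2 : w ∉ g' := fun h => hw (hg'.1 h)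
  rw [← Finset.erase_insert h1, h, Finset.erase_insert h2]

/-- At a common outside vertex the two conditions depend on each other only through the potential
edges over `F ∩ G`. -/
theorem link_inter {k : ℕ} (hk : 1 ≤ k) {F G : Finset V} {w : V} (hF : w ∉ F) (hG : w ∉ G) :
    link k F w ∩ link k G w = link k (F ∩ G) w := by
  ext e
  have hFG : w ∉ F ∩ G := fun h => hF (Finset.mem_inter.1 h).1
  rw [Finset.mem_inter, mem_link hF hk, mem_link hG hk, mem_link hFG hk,
    Finset.insert_inter_distrib, Finset.subset_inter_iff]
  tauto

/-- An edge of the first link contains `w`, whereas an edge of the second lies in `insert x G`,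
which misses `w`. Hence the conditions at different outside vertices are independent. -/
theorem disjoint_link_link {k : ℕ} (hk : 1 ≤ k) {F G : Finset V} {w x : V} (hw : w ∉ F)
    (hx : x ∉ G) (hwG : w ∉ G) (hwx : w ≠ x) : Disjoint (link k F w) (link k G x) := by
  rw [Finset.disjoint_left]
  intro e he he'
  rw [mem_link hw hk] at he
  rw [mem_link hx hk] at he'
  rcases Finset.mem_insert.1 (he'.2.2 he.1) with h | h
  · exact hwx h
  · exact hwG h

theorem disjoint_powersetCard_link {k : ℕ} (hk : 1 ≤ k) {F G : Finset V} {w : V} (hw : w ∉ F)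
    (hwG : w ∉ G) : Disjoint (G.powersetCard k) (link k F w) := by
  rw [Finset.disjoint_left]
  intro e he he'
  rw [mem_link hw hk] at he'
  exact hwG ((Finset.mem_powersetCard.1 he).1 he'.1)

/-- `F` is an augmented independent set of `H` with `r` edges: the edges of `H` inside `F` form
a matching with `r` edges, and every vertex outside `F` forms at least two edges of `H` together
with vertices of `F`. -/
def IsAugmented (k r : ℕ) (H : Finset (Finset V)) (F : Finset V) : Prop :=
  H ∩ F.powersetCard k ∈ matchings k F r ∧ ∀ w, w ∉ F → 2 ≤ (H ∩ link k F w).card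

end Links

/-! ### Augmented independent sets determine the independence number. -/

section IndependenceNumber

variable {n : ℕ}

theorem IsIndep.card_le_indepNum {H : Finset (Finset (Fin n))} {S : Finset (Fin n)}
    (h : IsIndep H S) : S.card ≤ indepNum H :=
  Finset.le_sup (f := Finset.card) (by simpa using h)

theorem exists_isIndep_card_eq_indepNum (H : Finset (Finset (Fin n))) (h0 : ∅ ∉ H) :
    ∃ S, IsIndep H S ∧ S.card = indepNum H := by
  classical
  have hne : ({S : Finset (Fin n) | IsIndep H S} : Finset (Finset (Fin n))).Nonempty := by
    refine ⟨∅, ?_⟩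
    simp only [Finset.mem_filter, Finset.mem_univ, true_and]
    intro e he hsub
    rw [Finset.subset_empty] at hsub
    exact h0 (hsub ▸ he)
  obtain ⟨S, hS, hcard⟩ := Finset.exists_mem_eq_sup _ hne Finset.card
  refine ⟨S, by simpa using hS, ?_⟩
  rw [indepNum, ← hcard]

theorem IsIndep.exists_subset_card {H : Finset (Finset (Fin n))} {S : Finset (Fin n)}
    (h : IsIndep H S) {s : ℕ} (hs : s ≤ S.card) : ∃ S', IsIndep H S' ∧ S'.card = s := by
  obtain ⟨S', h1, h2⟩ := Finset.exists_subset_card_eq hs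
  exact ⟨S', fun e he hsub => h e he (hsub.trans h1), h2⟩

variable {k : ℕ} {H : Finset (Finset (Fin n))}

theorem isIndep_sdiff_transversal (hH : ∀ e ∈ H, e.card = k) {F : Finset (Fin n)}
    (c : Finset (Fin n) → Fin n) (hc : ∀ e ∈ H ∩ F.powersetCard k, c e ∈ e) :
    IsIndep H (F \ (H ∩ F.powersetCard k).image c) := by
  intro e he hsub
  have heM : e ∈ H ∩ F.powersetCard k := Finset.mem_inter.2
    ⟨he, Finset.mem_powersetCard.2 ⟨hsub.trans Finset.sdiff_subset, hH e he⟩⟩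
  exact (Finset.mem_sdiff.1 (hsub (hc e heM))).2 (Finset.mem_image_of_mem c heM)

theorem exists_choice [Nonempty (Fin n)] (hk : 1 ≤ k) (hH : ∀ e ∈ H, e.card = k) :
    ∃ c : Finset (Fin n) → Fin n, ∀ e ∈ H, c e ∈ e := by
  classical
  have hne : ∀ e ∈ H, e.Nonempty := fun e he => Finset.card_pos.1 (by rw [hH e he]; omega)
  refine ⟨fun e => if h : e.Nonempty then h.choose else Classical.arbitrary _, fun e he => ?_⟩
  simp only [hne e he, dif_pos]
  exact (hne e he).choose_spec

/-- Deleting one vertex from each of the `r` disjoint edges destroys every edge inside `F` and costs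
exactly `r` vertices. -/
theorem IsAugmented.card_le (hk : 1 ≤ k) (hH : ∀ e ∈ H, e.card = k) {r : ℕ} {F : Finset (Fin n)}
    (h : IsAugmented k r H F) : F.card ≤ indepNum H + r := by
  rcases F.eq_empty_or_nonempty with rfl | ⟨x, -⟩
  · simp
  have : Nonempty (Fin n) := ⟨x⟩
  obtain ⟨c, hc⟩ := exists_choice hk hH
  have h1 := exists_transversal h.1 c fun e he => hc e (Finset.mem_inter.1 he).1
  have h2 := (isIndep_sdiff_transversal hH c fun e he =>
    hc e (Finset.mem_inter.1 he).1 : IsIndep H (F \ _)).card_le_indepNum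
  omega

/-- Take `F` of maximum size among the sets with `indepNum H + r` vertices that span a matching of
`r` edges; a maximum independent set is one, with `r = 0`. An outside vertex with at most one edge
would yield either a larger such set or an independent set larger than `indepNum H`. -/
theorem exists_isAugmented (hk : 1 ≤ k) (hH : ∀ e ∈ H, e.card = k) :
    ∃ r, ∃ F : Finset (Fin n), F.card = indepNum H + r ∧ IsAugmented k r H F := by
  classical
  obtain ⟨S, hS, hScard⟩ := exists_isIndep_card_eq_indepNum H
    (fun h => by have := hH _ h; simp at this; omega)
  let P : Finset (Finset (Fin n)) := Finset.univ.filter fun F =>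
    ∃ r, F.card = indepNum H + r ∧ H ∩ F.powersetCard k ∈ matchings k F r
  have hP : P.Nonempty := by
    refine ⟨S, ?_⟩
    simp only [P, Finset.mem_filter, Finset.mem_univ, true_and]
    refine ⟨0, by simpa using hScard, ?_⟩
    have : H ∩ S.powersetCard k = ∅ := by
      ext e
      simp only [Finset.mem_inter, Finset.mem_powersetCard, Finset.notMem_empty, iff_false]
      exact fun h => hS e h.1 h.2.1
    rw [this, mem_matchings]; simp
  obtain ⟨F, hF, hmax⟩ := Finset.exists_max_image P Finset.card hP
  simp only [P, Finset.mem_filter, Finset.mem_univ, true_and] at hF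
  obtain ⟨r, hFr, hM⟩ := hF
  refine ⟨r, F, hFr, hM, fun w hw => ?_⟩
  by_contra hlt
  have hle : (H ∩ link k F w).card ≤ 1 := by omega
  have : Nonempty (Fin n) := ⟨w⟩
  obtain ⟨c₀, hc₀⟩ := exists_choice hk hH
  -- Removing the transversal given by `c` and adding `w` leaves `indepNum H + 1` vertices, too many
  -- for an independent set; an edge that remains must pass through `w`.
  have key : ∀ c : Finset (Fin n) → Fin n, (∀ e ∈ H ∩ F.powersetCard k, c e ∈ e) →
      ∃ e ∈ H ∩ link k F w, e ⊆ insert w (F \ (H ∩ F.powersetCard k).image c) := by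
    intro c hc
    by_contra hno
    push Not at hno
    have h1 := exists_transversal hM c hc
    have hw' : w ∉ F \ (H ∩ F.powersetCard k).image c := fun h => hw (Finset.mem_sdiff.1 h).1
    have h2 : IsIndep H (insert w (F \ (H ∩ F.powersetCard k).image c)) := by
      intro e he hsub
      by_cases hwe : w ∈ e
      · refine hno e (Finset.mem_inter.2 ⟨he, (mem_link hw hk).2 ⟨hwe, hH e he, hsub.trans
          (Finset.insert_subset_insert _ Finset.sdiff_subset)⟩⟩) hsub
      · exact isIndep_sdiff_transversal hH c hc e he ((Finset.subset_insert_iff_of_notMem hwe).1 hsub)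
    have h3 := h2.card_le_indepNum
    rw [Finset.card_insert_of_notMem hw'] at h3
    omega
  obtain ⟨e, he, -⟩ := key c₀ fun e he => hc₀ e (Finset.mem_inter.1 he).1
  have huniq : ∀ f ∈ H ∩ link k F w, f = e := fun f hf => Finset.card_le_one.1 hle f hf e he
  obtain ⟨heH, hel⟩ := Finset.mem_inter.1 he
  rw [mem_link hw hk] at hel
  -- If the single edge `e` at `w` avoids the matching, then `insert w F` spans `r + 1` disjoint
  -- edges, against maximality.
  by_cases hdis : ∀ f ∈ H ∩ F.powersetCard k, Disjoint e f
  · have heq : H ∩ (insert w F).powersetCard k = insert e (H ∩ F.powersetCard k) := by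
      ext f
      simp only [Finset.mem_inter, Finset.mem_powersetCard, Finset.mem_insert]
      constructor
      · rintro ⟨h1, h2, h3⟩
        by_cases hwf : w ∈ f
        · exact Or.inl (huniq f (Finset.mem_inter.2 ⟨h1, (mem_link hw hk).2 ⟨hwf, h3, h2⟩⟩))
        · exact Or.inr ⟨h1, (Finset.subset_insert_iff_of_notMem hwf).1 h2, h3⟩
      · rintro (rfl | ⟨h1, h2, h3⟩)
        · exact ⟨heH, hel.2.2, hel.2.1⟩
        · exact ⟨h1, h2.trans (Finset.subset_insert _ _), h3⟩
    have hnot : e ∉ H ∩ F.powersetCard k := fun h =>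
      hw ((Finset.mem_powersetCard.1 (Finset.mem_inter.1 h).2).1 hel.1)
    have := hmax (insert w F) (by
      simp only [P, Finset.mem_filter, Finset.mem_univ, true_and]
      refine ⟨r + 1, by rw [Finset.card_insert_of_notMem hw]; omega, ?_⟩
      rw [mem_matchings] at hM ⊢
      refine ⟨⟨Finset.inter_subset_right, ?_⟩, ?_⟩
      · rw [heq, Finset.card_insert_of_notMem hnot, hM.1.2]
      · rw [heq]
        intro f hf g hg hfg
        rcases Finset.mem_insert.1 hf with rfl | hf' <;>
        rcases Finset.mem_insert.1 hg with rfl | hg'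
        · exact absurd rfl hfg
        · exact hdis g hg'
        · exact (hdis f hf').symm
        · exact hM.2 f hf' g hg' hfg)
    rw [Finset.card_insert_of_notMem hw] at this
    omega
  -- If `e` meets a matching edge `f` in `u`, a transversal that picks `u` from `f` destroys `e`,
  -- which contradicts `key`.
  · push Not at hdis
    obtain ⟨f, hf, hfe⟩ := hdis
    obtain ⟨u, hue, huf⟩ := Finset.not_disjoint_iff.1 hfe
    obtain ⟨g, hg, hgsub⟩ := key (Function.update c₀ f u) (by
      intro g hg
      by_cases hgf : g = f
      · subst hgf; simpa using huf
      · rw [Function.update_of_ne hgf]; exact hc₀ g (Finset.mem_inter.1 hg).1)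
    rw [huniq g hg] at hgsub
    rcases Finset.mem_insert.1 (hgsub hue) with h | h
    · exact hw (h ▸ (Finset.mem_powersetCard.1 (Finset.mem_inter.1 hf).2).1 huf)
    · refine (Finset.mem_sdiff.1 h).2 (Finset.mem_image.2 ⟨f, hf, by simp⟩)

end IndependenceNumber

end

end RandomHypergraph

namespace RandomHypergraph

noncomputable section

/-! ### First moments, and the Cauchy–Schwarz form of the second moment method. -/

section FirstMoment

theorem bernProb_and_forall {α ι : Type*} [DecidableEq α] (p : ℝ) {E E₀ : Finset α} (I : Finset ι)
    (D : ι → Finset α) (h₀ : E₀ ⊆ E) (hDE : ∀ i ∈ I, D i ⊆ E) (h₀D : ∀ i ∈ I, Disjoint E₀ (D i))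
    (hD : ∀ i ∈ I, ∀ j ∈ I, i ≠ j → Disjoint (D i) (D j)) (A₀ : Finset α → Prop)
    (A : ι → Finset α → Prop) :
    bernProb p E (fun H => A₀ (H ∩ E₀) ∧ ∀ i ∈ I, A i (H ∩ D i)) =
      bernProb p E₀ A₀ * ∏ i ∈ I, bernProb p (D i) (A i) := by
  rw [← bernProb_forall p I D (fun i hi => Finset.subset_biUnion_of_mem D hi) hD A,
    ← bernProb_and p h₀ (Finset.biUnion_subset.2 hDE) ((Finset.disjoint_biUnion_right _ _ _).2 h₀D)]
  refine bernProb_congr fun H _ => and_congr_right fun _ => forall₂_congr fun i hi => ?_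
  rw [Finset.inter_assoc, Finset.inter_eq_right.2 (Finset.subset_biUnion_of_mem D hi)]

variable (n k : ℕ) (p : ℝ)

theorem expect_eq_bernExpect (X : Finset (Finset (Fin n)) → ℝ) :
    expect n k p X = bernExpect p (Finset.univ.powersetCard k) X := by
  simp [expect, bernExpect, uniformHypergraphs, weight]

theorem prob_eq_bernProb (A : Finset (Finset (Fin n)) → Prop) :
    prob n k p A = bernProb p (Finset.univ.powersetCard k) A := by
  classical
  simp only [prob, bernProb, bernExpect, uniformHypergraphs, weight, Finset.sum_filter]
  refine Finset.sum_congr rfl fun H _ => ?_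
  by_cases h : A H <;> simp [h]

/-- The expected number of independent sets of size `s`. -/
def expIndep (s : ℕ) : ℝ := n.choose s * (1 - p) ^ s.choose k

/-- The expected number of augmented independent sets with `v` vertices and `r` edges. -/
def expAug (v r : ℕ) : ℝ :=
  n.choose v * (numMatchings k v r * (p ^ r * (1 - p) ^ (v.choose k - r)) *
    (1 - atMostOne p (v.choose (k - 1))) ^ (n - v))

variable {n k p}

theorem bernProb_isIndep (S : Finset (Fin n)) :
    bernProb p (Finset.univ.powersetCard k) (fun H => IsIndep H S) =
      (1 - p) ^ S.card.choose k := by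
  have h : S.powersetCard k ⊆ (Finset.univ : Finset (Fin n)).powersetCard k :=
    Finset.powersetCard_mono (Finset.subset_univ S)
  have := bernProb_subset p h (fun H => H = ∅)
  rw [bernProb_eq p (Finset.empty_subset _)] at this
  simp only [Finset.card_empty, pow_zero, one_mul, Nat.sub_zero, Finset.card_powersetCard] at this
  rw [← this]
  refine bernProb_congr fun H hH => ?_
  rw [Finset.eq_empty_iff_forall_notMem]
  simp only [Finset.mem_inter, Finset.mem_powersetCard, not_and]
  exact forall₂_congr fun _ he => ⟨fun h1 h2 => absurd h2 h1, fun h1 h2 =>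
    h1 h2 (Finset.mem_powersetCard.1 (hH he)).2⟩

theorem expect_numIndep (s : ℕ) :
    expect n k p (fun H => (numIndep s H : ℝ)) = expIndep n k p s := by
  classical
  have h : ∀ H : Finset (Finset (Fin n)), (numIndep s H : ℝ) =
      ∑ S ∈ (Finset.univ : Finset (Fin n)).powersetCard s, if IsIndep H S then (1 : ℝ) else 0 := by
    intro H
    rw [← Finset.sum_filter, numIndep, Finset.card_eq_sum_ones]
    push_cast
    refine Finset.sum_congr ?_ fun _ _ => rfl
    ext S
    simp [Finset.mem_powersetCard, and_comm]
  rw [expect_eq_bernExpect, bernExpect_congr fun H _ => h H, bernExpect_sum]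
  rw [Finset.sum_congr rfl (g := fun _ => (1 - p) ^ s.choose k)]
  · simp [expIndep]
  · intro S hS
    rw [← (Finset.mem_powersetCard.1 hS).2, ← bernProb_isIndep, bernProb]

theorem prob_le_indepNum_le (hp0 : 0 ≤ p) (hp1 : p ≤ 1) (hk : 1 ≤ k) (s : ℕ) :
    prob n k p (fun H => s ≤ indepNum H) ≤ expIndep n k p s := by
  rw [prob_eq_bernProb]
  calc _ ≤ bernProb p ((Finset.univ : Finset (Fin n)).powersetCard k)
        (fun H => ∃ S ∈ (Finset.univ : Finset (Fin n)).powersetCard s, IsIndep H S) := by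
        refine bernProb_mono hp0 hp1 fun H hH hs => ?_
        obtain ⟨S, hS, hc⟩ := exists_isIndep_card_eq_indepNum H fun h => by
          have := (Finset.mem_powersetCard.1 (hH h)).2
          simp at this; omega
        obtain ⟨S', h1, h2⟩ := hS.exists_subset_card (hs.trans hc.ge)
        exact ⟨S', Finset.mem_powersetCard.2 ⟨Finset.subset_univ _, h2⟩, h1⟩
    _ ≤ _ := bernProb_exists_le hp0 hp1 _ _ _
    _ = _ := by
        rw [Finset.sum_congr rfl (g := fun _ => (1 - p) ^ s.choose k)]
        · simp [expIndep]
        · intro S hS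
          rw [bernProb_isIndep, (Finset.mem_powersetCard.1 hS).2]

theorem link_subset_powersetCard_univ {F : Finset (Fin n)} {w : Fin n} (hk : 1 ≤ k) (hw : w ∉ F) :
    link k F w ⊆ Finset.univ.powersetCard k := fun _ he =>
  Finset.mem_powersetCard.2 ⟨Finset.subset_univ _, ((mem_link hw hk).1 he).2.1⟩

theorem bernProb_inner_eq {r : ℕ} {F : Finset (Fin n)} {M : Finset (Finset (Fin n))}
    (hM : M ∈ matchings k F r) : bernProb p (F.powersetCard k) (fun H => H = M) =
      p ^ r * (1 - p) ^ (F.card.choose k - r) := by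
  rw [mem_matchings] at hM
  rw [bernProb_eq p hM.1.1, hM.1.2, Finset.card_powersetCard]

theorem bernProb_inner (hk : 1 ≤ k) (r : ℕ) (F : Finset (Fin n)) :
    bernProb p (F.powersetCard k) (fun H => H ∈ matchings k F r) =
      numMatchings k F.card r * (p ^ r * (1 - p) ^ (F.card.choose k - r)) := by
  classical
  rw [← card_matchings hk, Finset.card_eq_sum_ones, Nat.cast_sum, Finset.sum_mul]
  simp only [Nat.cast_one, one_mul]
  rw [← Finset.sum_congr rfl fun M hM => bernProb_inner_eq (p := p) hM]
  simp only [bernProb]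
  rw [← bernExpect_sum]
  refine bernExpect_congr fun H _ => ?_
  by_cases h : H ∈ matchings k F r
  · rw [if_pos h]
    symm
    refine (Finset.sum_eq_single_of_mem H h fun M _ hne => ?_).trans ?_
    · exact if_neg hne.symm
    · exact if_pos rfl
  · rw [if_neg h]
    symm
    refine Finset.sum_eq_zero fun M hM => ?_
    refine if_neg fun hHM => h ?_
    rw [hHM]; exact hM

/-- The `k`-subsets of `F` and the links of the outside vertices are pairwise disjoint sets of
potential edges, so the probability factorises, with one equal factor for each outside vertex. -/
theorem bernProb_isAugmented (hk : 1 ≤ k) (r : ℕ) (F : Finset (Fin n)) :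
    bernProb p (Finset.univ.powersetCard k) (fun H => IsAugmented k r H F) =
      numMatchings k F.card r * (p ^ r * (1 - p) ^ (F.card.choose k - r)) *
    (1 - atMostOne p (F.card.choose (k - 1))) ^ (n - F.card) := by
  have h := bernProb_and_forall p (E := (Finset.univ : Finset (Fin n)).powersetCard k)
    (E₀ := F.powersetCard k) Fᶜ (link k F) (Finset.powersetCard_mono (Finset.subset_univ _))
    (fun w hw => link_subset_powersetCard_univ hk (Finset.mem_compl.1 hw))
    (fun w hw => disjoint_powersetCard_link hk (Finset.mem_compl.1 hw) (Finset.mem_compl.1 hw))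
    (fun w hw x hx hne => disjoint_link_link hk (Finset.mem_compl.1 hw) (Finset.mem_compl.1 hx)
      (Finset.mem_compl.1 hw) hne) (fun H => H ∈ matchings k F r) (fun _ H => 2 ≤ H.card)
  simp only [Finset.mem_compl] at h
  simp only [IsAugmented]
  rw [h, bernProb_inner hk, Finset.prod_congr rfl
    (g := fun _ => 1 - atMostOne p (F.card.choose (k - 1))), Finset.prod_const,
    Finset.card_compl, Fintype.card_fin]
  intro w hw
  rw [bernProb_two_le, card_link (Finset.mem_compl.1 hw)]

/-- By `exists_isAugmented` the event forces an augmented set of order `s`; then a union bound over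
all candidates. The range of `r` suffices because `s + r ≤ n`. -/
theorem prob_indepNum_eq_le (hp0 : 0 ≤ p) (hp1 : p ≤ 1) (hk : 1 ≤ k) (s : ℕ) :
    prob n k p (fun H => indepNum H = s) ≤
      ∑ r ∈ Finset.range (n + 1), expAug n k p (s + r) r := by
  rw [prob_eq_bernProb]
  calc _ ≤ bernProb p ((Finset.univ : Finset (Fin n)).powersetCard k)
        (fun H => ∃ r ∈ Finset.range (n + 1), ∃ F ∈ (Finset.univ : Finset (Fin n)).powersetCard
          (s + r), IsAugmented k r H F) := by
        refine bernProb_mono hp0 hp1 fun H hH hs => ?_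
        obtain ⟨r, F, h1, h2⟩ := exists_isAugmented (k := k) (H := H) hk fun _ he =>
          (Finset.mem_powersetCard.1 (hH he)).2
        have h3 := F.card_le_univ
        rw [Fintype.card_fin] at h3
        exact ⟨r, Finset.mem_range.2 (by omega), F, Finset.mem_powersetCard.2
          ⟨Finset.subset_univ _, by omega⟩, h2⟩
    _ ≤ _ := bernProb_exists_le hp0 hp1 _ _ _
    _ ≤ _ := Finset.sum_le_sum fun r _ => (bernProb_exists_le hp0 hp1 _ _ _).trans_eq (by
        rw [Finset.sum_congr rfl fun F hF => by
          rw [bernProb_isAugmented hk r F, (Finset.mem_powersetCard.1 hF).2]]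
        simp [expAug])

/-- Let `Y` count the augmented sets with `v` vertices and `r` edges. Cauchy–Schwarz gives $(\mathbb
E Y)^2\le\mathbb P(Y>0)\,\mathbb E[Y^2]$, and `Y > 0` implies `v ≤ indepNum H + r` by
`IsAugmented.card_le`. -/
theorem sq_expAug_le (hp0 : 0 ≤ p) (hp1 : p ≤ 1) (hk : 1 ≤ k) (v r : ℕ) :
    expAug n k p v r ^ 2 ≤ prob n k p (fun H => v ≤ indepNum H + r) *
      ∑ F ∈ (Finset.univ : Finset (Fin n)).powersetCard v,
        ∑ F' ∈ (Finset.univ : Finset (Fin n)).powersetCard v,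
          bernProb p (Finset.univ.powersetCard k)
            (fun H => IsAugmented k r H F ∧ IsAugmented k r H F') := by
  classical
  rw [prob_eq_bernProb]
  set E := (Finset.univ : Finset (Fin n)).powersetCard k
  set Q := (Finset.univ : Finset (Fin n)).powersetCard v
  let Y : Finset (Finset (Fin n)) → ℝ := fun H => ∑ F ∈ Q, if IsAugmented k r H F then 1 else 0
  let w : Finset (Finset (Fin n)) → ℝ := fun H => p ^ H.card * (1 - p) ^ (E.card - H.card)
  have hw : ∀ H, 0 ≤ w H := fun H =>
    mul_nonneg (pow_nonneg hp0 _) (pow_nonneg (sub_nonneg.2 hp1) _)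
  have h1 : expAug n k p v r = ∑ H ∈ E.powerset, w H * Y H := by
    have : ∑ H ∈ E.powerset, w H * Y H = ∑ F ∈ Q, bernProb p E (fun H => IsAugmented k r H F) := by
      simp only [bernProb]
      rw [← bernExpect_sum]; rfl
    rw [this, Finset.sum_congr rfl fun F hF => by
      rw [bernProb_isAugmented hk r F, (Finset.mem_powersetCard.1 hF).2]]
    simp [expAug, Q]
  have h2 : ∑ F ∈ Q, ∑ F' ∈ Q, bernProb p E
      (fun H => IsAugmented k r H F ∧ IsAugmented k r H F') = ∑ H ∈ E.powerset, w H * Y H ^ 2 := by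
    simp only [bernProb]
    rw [Finset.sum_congr rfl fun F _ => (bernExpect_sum p E Q _).symm, ← bernExpect_sum]
    refine bernExpect_congr fun H _ => ?_
    simp only [Y]
    rw [sq, Finset.sum_mul_sum]
    refine Finset.sum_congr rfl fun F _ => Finset.sum_congr rfl fun F' _ => ?_
    by_cases h : IsAugmented k r H F <;> by_cases h' : IsAugmented k r H F' <;> simp [h, h']
  let z : Finset (Finset (Fin n)) → ℝ := fun H => if v ≤ indepNum H + r then 1 else 0
  have h3 : bernProb p E (fun H => v ≤ indepNum H + r) = ∑ H ∈ E.powerset, w H * z H := by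
    simp only [bernProb, bernExpect]
    refine Finset.sum_congr rfl fun H _ => ?_
    by_cases h : v ≤ indepNum H + r <;> simp [z, h, w]
  rw [h1, h2, h3]
  -- `Y` vanishes wherever the indicator `z` does, so each summand splits into the two factors
  -- needed for Cauchy–Schwarz.
  have h4 : ∀ H ∈ E.powerset, w H * Y H = Real.sqrt (w H * z H) * Real.sqrt (w H * Y H ^ 2) := by
    intro H hH
    have hYnn : 0 ≤ Y H := Finset.sum_nonneg fun F _ => by split_ifs <;> norm_num
    have hzY : z H * Y H = Y H := by
      by_cases h : v ≤ indepNum H + r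
      · simp [z, h]
      · have : Y H = 0 := Finset.sum_eq_zero fun F hF => by
          rw [if_neg]
          intro hA
          have := hA.card_le hk fun e he =>
            (Finset.mem_powersetCard.1 (Finset.mem_powerset.1 hH he)).2
          rw [(Finset.mem_powersetCard.1 hF).2] at this
          exact h this
        rw [this]; simp
    have hznn : 0 ≤ z H := by simp only [z]; split_ifs <;> norm_num
    rw [← Real.sqrt_mul (mul_nonneg (hw H) hznn)]
    symm
    rw [Real.sqrt_eq_iff_mul_self_eq (by have := hw H; positivity) (mul_nonneg (hw H) hYnn)]
    symm
    calc w H * Y H * (w H * Y H) = w H * w H * (Y H * Y H) := by ring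
      _ = w H * w H * ((z H * Y H) * Y H) := by rw [hzY]
      _ = _ := by ring
  have h5 : ∀ H ∈ E.powerset, 0 ≤ w H * z H := fun H _ =>
    mul_nonneg (hw H) (by simp only [z]; split_ifs <;> norm_num)
  have h6 : ∀ H ∈ E.powerset, 0 ≤ w H * Y H ^ 2 := fun H _ => mul_nonneg (hw H) (sq_nonneg _)
  rw [Finset.sum_congr rfl h4]
  refine (Finset.sum_mul_sq_le_sq_mul_sq _ _ _).trans_eq ?_
  rw [Finset.sum_congr rfl fun H hH => Real.sq_sqrt (h5 H hH),
    Finset.sum_congr rfl fun H hH => Real.sq_sqrt (h6 H hH)]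

end FirstMoment

end

end RandomHypergraph

namespace RandomHypergraph

noncomputable section

/-! ### Joint probabilities for two sets with a given intersection. -/

section Overlap

theorem succ_mul_numMatchings {k : ℕ} (hk : 1 ≤ k) (v r : ℕ) :
    (r + 1) * numMatchings k v (r + 1) = v.choose k * numMatchings k (v - k) r := by
  rw [numMatchings, succ_mul_card_matchings hk, Finset.sum_congr rfl
    (g := fun _ => numMatchings k (v - k) r)]
  · simp
  · intro e he
    rw [Finset.mem_powersetCard] at he
    rw [card_matchings hk, Finset.card_sdiff_of_subset he.1, he.2, Finset.card_range]

/-- Fixing one edge of the matching divides the number of choices by `(v - k * m).choose k / (r -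
m)`, which is at least `(1 - p) / p` by `hr`. This is iterated `m` times. It shows that the edges
shared by two matchings do not raise the joint probability. -/
theorem numMatchings_sub_mul_le {k v r : ℕ} {p : ℝ} (hp0 : 0 ≤ p) (hp1 : p ≤ 1) (hk : 1 ≤ k)
    (hr : r * (1 - p) ≤ p * (v - k * r).choose k) {m : ℕ} (hm : m ≤ r) :
    numMatchings k (v - k * m) (r - m) * (1 - p) ^ m ≤ p ^ m * numMatchings k v r := by
  induction m with
  | zero => simp
  | succ m ih =>
    have ih := ih (by omega)
    have h1 := succ_mul_numMatchings hk (v - k * m) (r - m - 1)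
    rw [Nat.sub_add_cancel (by omega)] at h1
    have h2 : v - k * (m + 1) = v - k * m - k := by rw [mul_add, mul_one, Nat.sub_sub]
    rw [h2, ← Nat.sub_sub]
    set N := numMatchings k (v - k * m - k) (r - m - 1)
    have h1' : ((r - m : ℕ) : ℝ) * numMatchings k (v - k * m) (r - m) =
        (v - k * m).choose k * N := by exact_mod_cast h1
    have h3 : ((r - m : ℕ) : ℝ) * (1 - p) ≤ p * (v - k * m).choose k := by
      calc ((r - m : ℕ) : ℝ) * (1 - p) ≤ r * (1 - p) :=
            mul_le_mul_of_nonneg_right (by exact_mod_cast Nat.sub_le _ _) (by linarith)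
        _ ≤ _ := hr
        _ ≤ _ := by
          refine mul_le_mul_of_nonneg_left ?_ hp0
          exact_mod_cast Nat.choose_le_choose k (Nat.sub_le_sub_left (Nat.mul_le_mul_left k (by omega)) v)
    have hpos : (0 : ℝ) < ((r - m : ℕ) : ℝ) := by exact_mod_cast (by omega : 0 < r - m)
    have h4 : (N : ℝ) * (1 - p) ≤ p * numMatchings k (v - k * m) (r - m) := by
      refine le_of_mul_le_mul_left ?_ hpos
      calc _ = N * (((r - m : ℕ) : ℝ) * (1 - p)) := by ring
        _ ≤ N * (p * (v - k * m).choose k) := mul_le_mul_of_nonneg_left h3 (Nat.cast_nonneg _)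
        _ = p * ((v - k * m).choose k * N) := by ring
        _ = _ := by rw [← h1']; ring
    calc (N : ℝ) * (1 - p) ^ (m + 1) = N * (1 - p) * (1 - p) ^ m := by ring
      _ ≤ p * numMatchings k (v - k * m) (r - m) * (1 - p) ^ m :=
          mul_le_mul_of_nonneg_right h4 (pow_nonneg (by linarith) _)
      _ = p * (numMatchings k (v - k * m) (r - m) * (1 - p) ^ m) := by ring
      _ ≤ p * (p ^ m * numMatchings k v r) := mul_le_mul_of_nonneg_left ih hp0
      _ = _ := by ring

/-- Once the trace `N` on `P` is fixed, the rest `M \ N` is a matching on the vertices not covered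
by `N`. -/
theorem card_matchings_filter_inter_le {V : Type*} [DecidableEq V] {k r : ℕ} (hk : 1 ≤ k)
    (F : Finset V) (P N : Finset (Finset V)) :
    ((matchings k F r).filter fun M => M ∩ P = N).card ≤
      numMatchings k (F.card - k * N.card) (r - N.card) := by
  rcases Finset.eq_empty_or_nonempty ((matchings k F r).filter fun M => M ∩ P = N) with h | ⟨M₀, hM₀⟩
  · rw [h]; simp
  rw [Finset.mem_filter, mem_matchings] at hM₀
  have hN : N ⊆ M₀ := hM₀.2 ▸ Finset.inter_subset_left
  have hcard : (F \ N.biUnion id).card = F.card - k * N.card := by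
    rw [Finset.card_sdiff_of_subset, Finset.card_biUnion]
    · rw [Finset.sum_congr rfl (g := fun _ => k), Finset.sum_const, smul_eq_mul, mul_comm]
      exact fun e he => (Finset.mem_powersetCard.1 (hM₀.1.1.1 (hN he))).2
    · exact fun e he f hf hne => hM₀.1.2 e (hN he) f (hN hf) hne
    · exact Finset.biUnion_subset.2 fun e he => (Finset.mem_powersetCard.1 (hM₀.1.1.1 (hN he))).1
  rw [← hcard, ← card_matchings hk]
  refine Finset.card_le_card_of_injOn (fun M => M \ N) ?_ ?_
  · intro M hM
    rw [Finset.mem_coe, Finset.mem_filter, mem_matchings] at hM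
    have hNM : N ⊆ M := hM.2 ▸ Finset.inter_subset_left
    rw [Finset.mem_coe, mem_matchings]
    refine ⟨⟨fun e he => ?_, by rw [Finset.card_sdiff_of_subset hNM, hM.1.1.2]⟩, fun e he f hf =>
      hM.1.2 e (Finset.sdiff_subset he) f (Finset.sdiff_subset hf)⟩
    rw [Finset.mem_sdiff] at he
    have h1 := Finset.mem_powersetCard.1 (hM.1.1.1 he.1)
    refine Finset.mem_powersetCard.2 ⟨Finset.subset_sdiff.2 ⟨h1.1, ?_⟩, h1.2⟩
    rw [Finset.disjoint_biUnion_right]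
    exact fun f hf => hM.1.2 e he.1 f (hNM hf) fun h => he.2 (h ▸ hf)
  · intro M hM M' hM' h
    rw [Finset.mem_coe, Finset.mem_filter] at hM hM'
    have h1 : N ⊆ M := hM.2 ▸ Finset.inter_subset_left
    have h2 : N ⊆ M' := hM'.2 ▸ Finset.inter_subset_left
    have h3 : M \ N = M' \ N := h
    rw [← Finset.sdiff_union_of_subset h1, h3, Finset.sdiff_union_of_subset h2]

variable {n k r : ℕ} {p : ℝ}

/-- The probability that the edges inside a fixed set of `v` vertices form a matching with `r`
edges. -/
def probMatching (k : ℕ) (p : ℝ) (v r : ℕ) : ℝ :=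
  numMatchings k v r * (p ^ r * (1 - p) ^ (v.choose k - r))

/-- Two matchings can occur together only if they agree on the common `k`-sets. For a fixed `M` with
`m` common edges, `card_matchings_filter_inter_le` bounds the choices of `M'`, and
`numMatchings_sub_mul_le` pays for the missing factor `p ^ m`. What remains is the factor
$(1-p)^{-\binom{|F\cap F'|}{k}}$ for potential edges counted twice. -/
theorem bernProb_inner_inner_le (hp0 : 0 ≤ p) (hp1 : p ≤ 1) (hk : 1 ≤ k) {v : ℕ}
    (hr : r * (1 - p) ≤ p * (v - k * r).choose k) {F F' : Finset (Fin n)} (hF : F.card = v)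
    (hF' : F'.card = v) :
    bernProb p (F.powersetCard k ∪ F'.powersetCard k) (fun H =>
      H ∩ F.powersetCard k ∈ matchings k F r ∧ H ∩ F'.powersetCard k ∈ matchings k F' r) *
      (1 - p) ^ (F ∩ F').card.choose k ≤ probMatching k p v r ^ 2 := by
  classical
  set P := F.powersetCard k with hP
  set P' := F'.powersetCard k with hP'
  have hPP : P ∩ P' = (F ∩ F').powersetCard k := by
    ext e; simp only [hP, hP', Finset.mem_inter, Finset.mem_powersetCard, Finset.subset_inter_iff]
    tauto
  have hcI : (P ∩ P').card = (F ∩ F').card.choose k := by rw [hPP, Finset.card_powersetCard]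
  have hcU : (P ∪ P').card + (F ∩ F').card.choose k = 2 * v.choose k := by
    rw [← hcI, Finset.card_union_add_card_inter, hP, hP', Finset.card_powersetCard,
      Finset.card_powersetCard, hF, hF', two_mul]
  have hq : 0 ≤ 1 - p := by linarith
  have step : bernProb p (P ∪ P') (fun H => H ∩ P ∈ matchings k F r ∧ H ∩ P' ∈ matchings k F' r) ≤
      ∑ M ∈ matchings k F r, ∑ M' ∈ (matchings k F' r).filter (fun M' => M' ∩ P = M ∩ P'),
        bernProb p (P ∪ P') (fun H => H = M ∪ M') := by
    refine (bernProb_mono hp0 hp1 (B := fun H => ∃ M ∈ matchings k F r,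
      ∃ M' ∈ (matchings k F' r).filter (fun M' => M' ∩ P = M ∩ P'), H = M ∪ M') ?_).trans ?_
    · rintro H hH ⟨h1, h2⟩
      refine ⟨_, h1, _, Finset.mem_filter.2 ⟨h2, ?_⟩, ?_⟩
      · rw [Finset.inter_right_comm]
      · rw [← Finset.inter_union_distrib_left, Finset.inter_eq_left.2 hH]
    · exact (bernProb_exists_le hp0 hp1 _ _ _).trans
        (Finset.sum_le_sum fun M _ => bernProb_exists_le hp0 hp1 _ _ _)
  refine (mul_le_mul_of_nonneg_right step (pow_nonneg hq _)).trans ?_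
  rw [Finset.sum_mul]
  have main : ∀ M ∈ matchings k F r,
      (∑ M' ∈ (matchings k F' r).filter (fun M' => M' ∩ P = M ∩ P'),
        bernProb p (P ∪ P') (fun H => H = M ∪ M')) * (1 - p) ^ (F ∩ F').card.choose k ≤
      numMatchings k v r * (p ^ r * (1 - p) ^ (v.choose k - r)) ^ 2 := by
    intro M hM
    rw [mem_matchings] at hM
    set m := (M ∩ P').card with hm
    have hmr : m ≤ r := hM.1.2 ▸ Finset.card_le_card Finset.inter_subset_left
    have hrC : r ≤ v.choose k := by
      have := Finset.card_le_card hM.1.1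
      rwa [hM.1.2, Finset.card_powersetCard, hF] at this
    -- The union of the matchings has `2 * r - m` edges; the extra power of `1 - p` completes the
    -- number of potential edges to `2 * v.choose k`.
    have hterm : ∀ M' ∈ (matchings k F' r).filter (fun M' => M' ∩ P = M ∩ P'),
        bernProb p (P ∪ P') (fun H => H = M ∪ M') * (1 - p) ^ (F ∩ F').card.choose k =
          p ^ (2 * r - m) * (1 - p) ^ (2 * v.choose k - 2 * r + m) := by
      intro M' hM'
      rw [Finset.mem_filter, mem_matchings] at hM'
      have hsub : M ∪ M' ⊆ P ∪ P' := Finset.union_subset_union hM.1.1 hM'.1.1.1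
      have hint : M ∩ M' = M ∩ P' := by
        refine subset_antisymm (Finset.inter_subset_inter_left hM'.1.1.1) ?_
        refine Finset.subset_inter Finset.inter_subset_left ?_
        rw [← hM'.2]; exact Finset.inter_subset_left
      have hc : (M ∪ M').card + m = 2 * r := by
        rw [hm, ← hint, Finset.card_union_add_card_inter, hM.1.2, hM'.1.1.2, two_mul]
      have hle := Finset.card_le_card hsub
      rw [bernProb_eq p hsub, mul_assoc, ← pow_add]
      congr 2 <;> omega
    rw [Finset.sum_mul, Finset.sum_congr rfl hterm, Finset.sum_const, nsmul_eq_mul]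
    have hcard : (((matchings k F' r).filter (fun M' => M' ∩ P = M ∩ P')).card : ℝ) ≤
        numMatchings k (v - k * m) (r - m) := by
      have := card_matchings_filter_inter_le hk F' P (M ∩ P') (r := r)
      rw [hF'] at this
      exact_mod_cast this
    have h1 := numMatchings_sub_mul_le hp0 hp1 hk hr hmr
    calc _ ≤ (numMatchings k (v - k * m) (r - m) : ℝ) *
          (p ^ (2 * r - m) * (1 - p) ^ (2 * v.choose k - 2 * r + m)) :=
          mul_le_mul_of_nonneg_right hcard (mul_nonneg (pow_nonneg hp0 _) (pow_nonneg hq _))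
      _ = (numMatchings k (v - k * m) (r - m) * (1 - p) ^ m) *
          (p ^ (2 * r - m) * (1 - p) ^ (2 * v.choose k - 2 * r)) := by rw [pow_add]; ring
      _ ≤ (p ^ m * numMatchings k v r) *
          (p ^ (2 * r - m) * (1 - p) ^ (2 * v.choose k - 2 * r)) :=
          mul_le_mul_of_nonneg_right h1 (mul_nonneg (pow_nonneg hp0 _) (pow_nonneg hq _))
      _ = numMatchings k v r * (p ^ (m + (2 * r - m)) * (1 - p) ^ (2 * v.choose k - 2 * r)) := by
          rw [pow_add]; ring
      _ = _ := by
          rw [mul_pow, ← pow_mul, ← pow_mul]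
          congr 3 <;> omega
  refine (Finset.sum_le_sum main).trans_eq ?_
  rw [Finset.sum_const, card_matchings hk, hF, nsmul_eq_mul, probMatching]
  ring

theorem bernProb_and_add {α : Type*} (p : ℝ) (E : Finset α) (A B : Finset α → Prop) :
    bernProb p E (fun H => A H ∧ B H) =
      1 - bernProb p E (fun H => ¬ A H) - bernProb p E (fun H => ¬ B H) +
        bernProb p E (fun H => ¬ A H ∧ ¬ B H) := by
  have h : bernProb p E (fun H => A H ∧ B H) + (bernProb p E (fun H => ¬ A H) +
      bernProb p E (fun H => ¬ B H)) = 1 + bernProb p E (fun H => ¬ A H ∧ ¬ B H) := by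
    rw [← bernExpect_one p E]
    simp only [bernProb]
    rw [← bernExpect_add, ← bernExpect_add, ← bernExpect_add]
    refine bernExpect_congr fun H _ => ?_
    by_cases h : A H <;> by_cases h' : B H <;> simp [h, h']
  linarith

theorem atMostOne_nonneg (hp0 : 0 ≤ p) (hp1 : p ≤ 1) (B : ℕ) : 0 ≤ atMostOne p B := by
  have : 0 ≤ 1 - p := by linarith
  unfold atMostOne; positivity

theorem atMostOne_eq (hp1 : p < 1) (B : ℕ) :
    atMostOne p B = (1 - p) ^ B * (1 + B * (p / (1 - p))) := by
  have h : 1 - p ≠ 0 := by linarith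
  rcases B with _ | B
  · simp [atMostOne]
  · simp only [atMostOne, Nat.add_sub_cancel, pow_succ]
    field_simp

theorem atMostOne_sub_le (hp0 : 0 ≤ p) (hp1 : p < 1) {B o : ℕ} (ho : o ≤ B) :
    atMostOne p (B - o) ≤ atMostOne p B / (1 - p) ^ o := by
  have h : 0 < 1 - p := by linarith
  rw [le_div_iff₀ (pow_pos h _), atMostOne_eq hp1, atMostOne_eq hp1]
  calc _ = (1 - p) ^ (B - o + o) * (1 + ((B - o : ℕ) : ℝ) * (p / (1 - p))) := by rw [pow_add]; ring
    _ = (1 - p) ^ B * (1 + ((B - o : ℕ) : ℝ) * (p / (1 - p))) := by rw [Nat.sub_add_cancel ho]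
    _ ≤ _ := by
      refine mul_le_mul_of_nonneg_left ?_ (pow_nonneg h.le _)
      have : ((B - o : ℕ) : ℝ) ≤ B := by exact_mod_cast Nat.sub_le _ _
      gcongr

/-- Inclusion–exclusion over the two failures. Both failures together imply at most one edge in `A`
and at most one in `A' \ A`, which are independent events. -/
theorem bernProb_two_le_two_le {α : Type*} [DecidableEq α] (hp0 : 0 ≤ p) (hp1 : p < 1)
    {A A' : Finset α} {B o : ℕ} (hA : A.card = B) (hA' : A'.card = B) (ho : (A ∩ A').card = o) :
    bernProb p (A ∪ A') (fun H => 2 ≤ (H ∩ A).card ∧ 2 ≤ (H ∩ A').card) ≤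
      1 - 2 * atMostOne p B + atMostOne p B ^ 2 / (1 - p) ^ o := by
  have e1 : bernProb p (A ∪ A') (fun H => ¬ 2 ≤ (H ∩ A).card) = atMostOne p B := by
    rw [← hA, ← bernProb_card_le_one,
      ← bernProb_subset p (Finset.subset_union_left (s₂ := A')) (fun H => H.card ≤ 1)]
    exact bernProb_congr fun H _ => not_le.trans Nat.lt_succ_iff
  have e2 : bernProb p (A ∪ A') (fun H => ¬ 2 ≤ (H ∩ A').card) = atMostOne p B := by
    rw [← hA', ← bernProb_card_le_one,
      ← bernProb_subset p (Finset.subset_union_right (s₁ := A)) (fun H => H.card ≤ 1)]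
    exact bernProb_congr fun H _ => not_le.trans Nat.lt_succ_iff
  have e3 : bernProb p (A ∪ A') (fun H => ¬ 2 ≤ (H ∩ A).card ∧ ¬ 2 ≤ (H ∩ A').card) ≤
      atMostOne p B * (atMostOne p B / (1 - p) ^ o) := by
    refine (bernProb_mono hp0 hp1.le (B := fun H => (H ∩ A).card ≤ 1 ∧ (H ∩ (A' \ A)).card ≤ 1)
      ?_).trans ?_
    · rintro H - ⟨h1, h2⟩
      refine ⟨by omega, ?_⟩
      have := Finset.card_le_card (Finset.inter_subset_inter_left (s := H)
        (Finset.sdiff_subset (s := A') (t := A)))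
      omega
    · rw [bernProb_and p Finset.subset_union_left
        (Finset.sdiff_subset.trans Finset.subset_union_right) Finset.disjoint_sdiff
        (fun H => H.card ≤ 1) (fun H => H.card ≤ 1),
        bernProb_card_le_one, bernProb_card_le_one, hA]
      have hc : (A' \ A).card = B - o := by
        rw [Finset.card_sdiff, ho, hA']
      have hoB : o ≤ B := by rw [← ho, ← hA]; exact Finset.card_le_card Finset.inter_subset_left
      rw [hc]
      exact mul_le_mul_of_nonneg_left (atMostOne_sub_le hp0 hp1 hoB)
        (atMostOne_nonneg hp0 hp1.le _)
  rw [bernProb_and_add, e1, e2]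
  have : atMostOne p B ^ 2 / (1 - p) ^ o = atMostOne p B * (atMostOne p B / (1 - p) ^ o) := by ring
  linarith

/-- Keep only the conditions at vertices outside `F ∪ F'`: they are independent of one another and
of the edges inside `F` and `F'`. Used for nearly disjoint pairs. -/
theorem bernProb_isAugmented_and_le (hp0 : 0 ≤ p) (hp1 : p < 1) (hk : 1 ≤ k) {v : ℕ}
    (hr : r * (1 - p) ≤ p * (v - k * r).choose k) {F F' : Finset (Fin n)} (hF : F.card = v)
    (hF' : F'.card = v) :
    bernProb p (Finset.univ.powersetCard k)
      (fun H => IsAugmented k r H F ∧ IsAugmented k r H F') * (1 - p) ^ (F ∩ F').card.choose k ≤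
    probMatching k p v r ^ 2 * (1 - 2 * atMostOne p (v.choose (k - 1)) +
      atMostOne p (v.choose (k - 1)) ^ 2 / (1 - p) ^ (F ∩ F').card.choose (k - 1)) ^
        (n - (F ∪ F').card) := by
  have hq : 0 < 1 - p := by linarith
  have hnot : ∀ w ∈ (F ∪ F')ᶜ, w ∉ F ∧ w ∉ F' := fun w hw => by
    simpa [not_or] using hw
  have h := bernProb_and_forall p (E := (Finset.univ : Finset (Fin n)).powersetCard k)
    (E₀ := F.powersetCard k ∪ F'.powersetCard k) (F ∪ F')ᶜ (fun w => link k F w ∪ link k F' w)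
    (Finset.union_subset (Finset.powersetCard_mono (Finset.subset_univ _))
      (Finset.powersetCard_mono (Finset.subset_univ _)))
    (fun w hw => Finset.union_subset (link_subset_powersetCard_univ hk (hnot w hw).1)
      (link_subset_powersetCard_univ hk (hnot w hw).2))
    (fun w hw => by
      rw [Finset.disjoint_union_left, Finset.disjoint_union_right, Finset.disjoint_union_right]
      obtain ⟨h1, h2⟩ := hnot w hw
      exact ⟨⟨disjoint_powersetCard_link hk h1 h1, disjoint_powersetCard_link hk h2 h1⟩,
        disjoint_powersetCard_link hk h1 h2, disjoint_powersetCard_link hk h2 h2⟩)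
    (fun w hw x hx hne => by
      rw [Finset.disjoint_union_left, Finset.disjoint_union_right, Finset.disjoint_union_right]
      obtain ⟨h1, h2⟩ := hnot w hw
      obtain ⟨h3, h4⟩ := hnot x hx
      exact ⟨⟨disjoint_link_link hk h1 h3 h1 hne, disjoint_link_link hk h1 h4 h2 hne⟩,
        disjoint_link_link hk h2 h3 h1 hne, disjoint_link_link hk h2 h4 h2 hne⟩)
    (fun H => H ∩ F.powersetCard k ∈ matchings k F r ∧ H ∩ F'.powersetCard k ∈ matchings k F' r)
    (fun w H => 2 ≤ (H ∩ link k F w).card ∧ 2 ≤ (H ∩ link k F' w).card)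
  have hle : bernProb p (Finset.univ.powersetCard k)
      (fun H => IsAugmented k r H F ∧ IsAugmented k r H F') ≤ _ :=
    (bernProb_mono hp0 hp1.le ?_).trans_eq h
  · refine (mul_le_mul_of_nonneg_right hle (pow_nonneg hq.le _)).trans ?_
    rw [mul_right_comm]
    refine mul_le_mul (bernProb_inner_inner_le hp0 hp1.le hk hr hF hF') ?_
      (Finset.prod_nonneg fun w _ => bernProb_nonneg hp0 hp1.le _ _) (sq_nonneg _)
    have hcard : (F ∪ F')ᶜ.card = n - (F ∪ F').card := by rw [Finset.card_compl, Fintype.card_fin]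
    rw [← hcard, ← Finset.prod_const]
    refine Finset.prod_le_prod (fun w _ => bernProb_nonneg hp0 hp1.le _ _) fun w hw => ?_
    obtain ⟨h1, h2⟩ := hnot w hw
    refine bernProb_two_le_two_le hp0 hp1 (by rw [card_link h1, hF]) (by rw [card_link h2, hF']) ?_
    rw [link_inter hk h1 h2, card_link fun h => h1 (Finset.mem_inter.1 h).1]
  · rintro H - ⟨⟨h1, h2⟩, h3, h4⟩
    have c1 : H ∩ (F.powersetCard k ∪ F'.powersetCard k) ∩ F.powersetCard k =
        H ∩ F.powersetCard k := by
      rw [Finset.inter_assoc, Finset.inter_eq_right.2 Finset.subset_union_left]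
    have c2 : H ∩ (F.powersetCard k ∪ F'.powersetCard k) ∩ F'.powersetCard k =
        H ∩ F'.powersetCard k := by
      rw [Finset.inter_assoc, Finset.inter_eq_right.2 Finset.subset_union_right]
    refine ⟨⟨by rwa [c1], by rwa [c2]⟩, fun w hw => ?_⟩
    obtain ⟨hw1, hw2⟩ := hnot w hw
    have c3 : H ∩ (link k F w ∪ link k F' w) ∩ link k F w = H ∩ link k F w := by
      rw [Finset.inter_assoc, Finset.inter_eq_right.2 Finset.subset_union_left]
    have c4 : H ∩ (link k F w ∪ link k F' w) ∩ link k F' w = H ∩ link k F' w := by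
      rw [Finset.inter_assoc, Finset.inter_eq_right.2 Finset.subset_union_right]
    exact ⟨by rw [c3]; exact h2 w hw1, by rw [c4]; exact h4 w hw2⟩

/-- Cruder variant that drops every condition at outside vertices; it serves for intermediate
intersections. -/
theorem bernProb_isAugmented_and_le' (hp0 : 0 ≤ p) (hp1 : p < 1) (hk : 1 ≤ k) {v : ℕ}
    (hr : r * (1 - p) ≤ p * (v - k * r).choose k) {F F' : Finset (Fin n)} (hF : F.card = v)
    (hF' : F'.card = v) :
    bernProb p (Finset.univ.powersetCard k)
      (fun H => IsAugmented k r H F ∧ IsAugmented k r H F') * (1 - p) ^ (F ∩ F').card.choose k ≤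
    probMatching k p v r ^ 2 := by
  have hq : 0 < 1 - p := by linarith
  refine (mul_le_mul_of_nonneg_right ?_ (pow_nonneg hq.le _)).trans
    (bernProb_inner_inner_le hp0 hp1.le hk hr hF hF')
  rw [← bernProb_subset p (Finset.union_subset (Finset.powersetCard_mono (Finset.subset_univ F))
    (Finset.powersetCard_mono (Finset.subset_univ F')))]
  refine bernProb_mono hp0 hp1.le ?_
  rintro H - ⟨⟨h1, -⟩, h3, -⟩
  refine ⟨?_, ?_⟩
  · rwa [Finset.inter_assoc, Finset.inter_eq_right.2 Finset.subset_union_left]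
  · rwa [Finset.inter_assoc, Finset.inter_eq_right.2 Finset.subset_union_right]

end Overlap

end

end RandomHypergraph

namespace RandomHypergraph

noncomputable section

/-! ### Joint probabilities for two sets that differ in few vertices. -/

section NearlyEqualPairs

theorem pow_succ_add_le {x y : ℝ} (hx : 0 ≤ x) (hy : 0 ≤ y) (j : ℕ) :
    x ^ (j + 1) + (j + 1) * y * x ^ j ≤ (x + y) ^ (j + 1) := by
  induction j with
  | zero => simp
  | succ j ih =>
    have h := mul_le_mul_of_nonneg_right ih (add_nonneg hx hy)
    have h2 : 0 ≤ (j + 1) * y * x ^ j * y := by positivity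
    push_cast
    calc _ ≤ (x ^ (j + 1) + (j + 1) * y * x ^ j) * (x + y) := by
          ring_nf at h2 ⊢; linarith
      _ ≤ _ := h
      _ = _ := by ring

/-- Expanding the `j`-th power of the sum produces each product over a `j`-set `j!` times, and all
other terms are nonnegative. -/
theorem sum_powersetCard_prod_le {α : Type*} [DecidableEq α] (S : Finset α) (y : α → ℝ)
    (hy : ∀ a, 0 ≤ y a) (j : ℕ) :
    ∑ U ∈ S.powersetCard j, ∏ u ∈ U, y u ≤ (∑ a ∈ S, y a) ^ j / j.factorial := by
  induction S using Finset.induction_on generalizing j with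
  | empty =>
    rcases j with _ | j
    · simp
    · rw [Finset.powersetCard_eq_empty.2 (by simp)]; simp
  | insert a S ha ih =>
    rcases j with _ | j
    · simp
    · rw [Finset.powersetCard_succ_insert ha, Finset.sum_union, Finset.sum_image,
        Finset.sum_insert ha]
      · have h1 : ∑ U ∈ S.powersetCard j, ∏ u ∈ insert a U, y u =
            y a * ∑ U ∈ S.powersetCard j, ∏ u ∈ U, y u := by
          rw [Finset.mul_sum]
          refine Finset.sum_congr rfl fun U hU => Finset.prod_insert fun h => ?_
          exact ha ((Finset.mem_powersetCard.1 hU).1 h)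
        rw [h1]
        have hX : 0 ≤ ∑ a ∈ S, y a := Finset.sum_nonneg fun a _ => hy a
        have h2 := pow_succ_add_le hX (hy a) j
        calc _ ≤ (∑ a ∈ S, y a) ^ (j + 1) / (j + 1).factorial +
              y a * ((∑ a ∈ S, y a) ^ j / j.factorial) :=
              add_le_add (ih _) (mul_le_mul_of_nonneg_left (ih _) (hy a))
          _ = ((∑ a ∈ S, y a) ^ (j + 1) + (j + 1) * y a * (∑ a ∈ S, y a) ^ j) /
              (j + 1).factorial := by
              rw [Nat.factorial_succ]; push_cast
              have : (j.factorial : ℝ) ≠ 0 := by positivity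
              field_simp
          _ ≤ _ := by rw [add_comm (y a)]; gcongr
      · intro U hU U' hU' h
        have h1 : a ∉ U := fun h => ha ((Finset.mem_powersetCard.1 hU).1 h)
        have h2 : a ∉ U' := fun h => ha ((Finset.mem_powersetCard.1 hU').1 h)
        rw [← Finset.erase_insert h1, h, Finset.erase_insert h2]
      · rw [Finset.disjoint_left]
        intro U hU hU'
        obtain ⟨U', -, rfl⟩ := Finset.mem_image.1 hU'
        exact ha ((Finset.mem_powersetCard.1 hU).1 (Finset.mem_insert_self _ _))

theorem card_filter_meets_le {V : Type*} [DecidableEq V] (S X : Finset V) (m : ℕ) :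
    ((S.powersetCard (m + 1)).filter fun e => 1 ≤ (e ∩ X).card).card ≤ X.card * S.card ^ m := by
  calc _ ≤ ((X ×ˢ S.powersetCard m).image fun a => insert a.1 a.2).card := by
        refine Finset.card_le_card fun e he => ?_
        simp only [Finset.mem_filter, Finset.mem_powersetCard] at he
        obtain ⟨⟨h1, h2⟩, h3⟩ := he
        obtain ⟨x, hx⟩ := Finset.card_pos.1 h3
        obtain ⟨hxe, hx⟩ := Finset.mem_inter.1 hx
        refine Finset.mem_image.2 ⟨(x, e.erase x), ?_, Finset.insert_erase hxe⟩
        rw [Finset.mem_product, Finset.mem_powersetCard]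
        exact ⟨hx, (Finset.erase_subset _ _).trans h1, by
          rw [Finset.card_erase_of_mem hxe, h2]; rfl⟩
    _ ≤ (X ×ˢ S.powersetCard m).card := Finset.card_image_le
    _ ≤ _ := by
        rw [Finset.card_product, Finset.card_powersetCard]
        exact Nat.mul_le_mul_left _ (Nat.choose_le_pow _ _)

theorem card_filter_two_le_inter_le {V : Type*} [DecidableEq V] (S X : Finset V) (m : ℕ) :
    ((S.powersetCard (m + 2)).filter fun e => 2 ≤ (e ∩ X).card).card ≤
      X.card ^ 2 * S.card ^ m := by
  calc _ ≤ ((X ×ˢ (S.powersetCard (m + 1)).filter fun e => 1 ≤ (e ∩ X).card).image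
        fun a => insert a.1 a.2).card := by
        refine Finset.card_le_card fun e he => ?_
        simp only [Finset.mem_filter, Finset.mem_powersetCard] at he
        obtain ⟨⟨h1, h2⟩, h3⟩ := he
        obtain ⟨x, hx, y, hy, hxy⟩ := Finset.one_lt_card.1 h3
        rw [Finset.mem_inter] at hx hy
        refine Finset.mem_image.2 ⟨(x, e.erase x), ?_, Finset.insert_erase hx.1⟩
        rw [Finset.mem_product, Finset.mem_filter, Finset.mem_powersetCard]
        exact ⟨hx.2, ⟨(Finset.erase_subset _ _).trans h1, by
          rw [Finset.card_erase_of_mem hx.1, h2]; rfl⟩, Finset.card_pos.2 ⟨y, Finset.mem_inter.2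
          ⟨Finset.mem_erase.2 ⟨hxy.symm, hy.1⟩, hy.2⟩⟩⟩
    _ ≤ (X ×ˢ (S.powersetCard (m + 1)).filter fun e => 1 ≤ (e ∩ X).card).card :=
        Finset.card_image_le
    _ ≤ _ := by
        rw [Finset.card_product, sq, mul_assoc]
        exact Nat.mul_le_mul_left _ (card_filter_meets_le S X m)

/-- An edge through `w ∈ F'` over `F` that is not inside `F'` must use a vertex of `F \ F'`. -/
theorem card_link_sdiff_le {V : Type*} [DecidableEq V] {k : ℕ} (hk : 2 ≤ k) {F F' : Finset V}
    {w : V} (hw : w ∈ F') (hwF : w ∉ F) :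
    (link k F w \ F'.powersetCard k).card ≤ (F \ F').card * F.card ^ (k - 2) := by
  obtain ⟨m, rfl⟩ := Nat.exists_eq_add_of_le' hk
  refine le_trans ?_ (card_filter_meets_le F (F \ F') m)
  refine le_trans (Finset.card_le_card ?_) (Finset.card_image_le (f := insert w))
  intro e he
  rw [Finset.mem_sdiff, link, Finset.mem_image] at he
  obtain ⟨⟨g, hg, rfl⟩, hnot⟩ := he
  refine Finset.mem_image.2 ⟨g, Finset.mem_filter.2 ⟨hg, ?_⟩, rfl⟩
  refine Finset.card_pos.2 ?_
  by_contra hno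
  rw [Finset.mem_powersetCard] at hg
  have hgF' : g ⊆ F' := fun x hx => by
    by_contra hx'
    exact hno ⟨x, Finset.mem_inter.2 ⟨hx, Finset.mem_sdiff.2 ⟨hg.1 hx, hx'⟩⟩⟩
  refine hnot (Finset.mem_powersetCard.2 ⟨Finset.insert_subset hw hgF', ?_⟩)
  rw [Finset.card_insert_of_notMem fun hwg => hwF (hg.1 hwg), hg.2]; rfl

variable {n k r : ℕ} {p : ℝ}

open Classical in
/-- The number of edges through `w` that are required apart from the edges inside the second
set, when `N` is the set of edges inside the second set that meet `W`. -/
def requiredEdges {V : Type*} [DecidableEq V] (W : Finset V) (N : Finset (Finset V)) (w : V) : ℕ :=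
  if ∃ e ∈ N, e ∩ W = {w} then 1 else 2

/-- Both sets span `r` edges, so `F'` has as many edges outside `F` as `M` has edges outside `F'`. A
vertex `w` outside `F` needs two edges over `F`, of which at most one can lie inside `F'`; the
others lie among potential edges not used for `F'`. -/
theorem isAugmented_pair_imp (hk : 1 ≤ k) {F F' : Finset (Fin n)} {H M : Finset (Finset (Fin n))}
    (hH : H ∩ F.powersetCard k = M) (hF : IsAugmented k r H F) (hF' : IsAugmented k r H F') :
    H ∩ (F'.powersetCard k \ F.powersetCard k) ∈
      ((F'.powersetCard k \ F.powersetCard k).powersetCard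
        (M.filter fun e => ¬ e ⊆ F').card).filter
        (fun N => ∀ e ∈ N, ∀ f ∈ N, e ≠ f → Disjoint e f) ∧
    ∀ w ∈ Fᶜ, requiredEdges (F' \ F) (H ∩ (F'.powersetCard k \ F.powersetCard k)) w ≤
      (H ∩ (link k F w \ F'.powersetCard k)).card := by
  classical
  have hM' := mem_matchings.1 hF'.1
  have hM := mem_matchings.1 hF.1
  constructor
  · rw [Finset.mem_filter, Finset.mem_powersetCard]
    refine ⟨⟨Finset.inter_subset_right, ?_⟩, fun e he f hf => hM'.2 e ?_ f ?_⟩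
    · have h1 : H ∩ (F'.powersetCard k \ F.powersetCard k) =
          (H ∩ F'.powersetCard k) \ (M.filter fun e => e ⊆ F') := by
        ext e
        simp only [← hH, Finset.mem_inter, Finset.mem_sdiff, Finset.mem_filter,
          Finset.mem_powersetCard]
        tauto
      have h2 : (M.filter fun e => e ⊆ F') ⊆ H ∩ F'.powersetCard k := by
        intro e
        simp only [← hH, Finset.mem_inter, Finset.mem_filter, Finset.mem_powersetCard]
        tauto
      rw [h1, Finset.card_sdiff_of_subset h2, hM'.1.2, ← hM.1.2, hH,
        ← Finset.card_filter_add_card_filter_not (s := M) (fun e => e ⊆ F')]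
      omega
    · exact Finset.inter_subset_inter_left Finset.sdiff_subset he
    · exact Finset.inter_subset_inter_left Finset.sdiff_subset hf
  · intro w hw
    rw [Finset.mem_compl] at hw
    have h2 := hF.2 w hw
    have hsplit : (H ∩ link k F w).card = (H ∩ (link k F w \ F'.powersetCard k)).card +
        (H ∩ (link k F w ∩ F'.powersetCard k)).card := by
      rw [← Finset.card_union_of_disjoint, ← Finset.inter_union_distrib_left,
        Finset.sdiff_union_inter]
      exact (Finset.disjoint_sdiff_inter _ _).mono Finset.inter_subset_right
        Finset.inter_subset_right
    -- Edges of `H` inside `F'` are pairwise disjoint, so at most one of them contains `w`.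
    have hone : (H ∩ (link k F w ∩ F'.powersetCard k)).card ≤ 1 := by
      rw [Finset.card_le_one]
      intro e he f hf
      simp only [Finset.mem_inter] at he hf
      by_contra hne
      refine Finset.disjoint_left.1 (hM'.2 e (Finset.mem_inter.2 ⟨he.1, he.2.2⟩) f
        (Finset.mem_inter.2 ⟨hf.1, hf.2.2⟩) hne) ((mem_link hw hk).1 he.2.1).1
        ((mem_link hw hk).1 hf.2.1).1
    rw [requiredEdges]
    split_ifs with hex
    · omega
    -- An edge through `w` over `F` that lies in `F'` meets `F' \ F` in `w` alone, and its existence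
    -- is exactly what lowers the requirement from two to one.
    · have : H ∩ (link k F w ∩ F'.powersetCard k) = ∅ := by
        rw [Finset.eq_empty_iff_forall_notMem]
        intro e he
        simp only [Finset.mem_inter] at he
        obtain ⟨h3, h4, h5⟩ := (mem_link hw hk).1 he.2.1
        have h6 := (Finset.mem_powersetCard.1 he.2.2).1
        refine hex ⟨e, ?_, ?_⟩
        · rw [Finset.mem_inter, Finset.mem_sdiff]
          exact ⟨he.1, he.2.2, fun h => hw ((Finset.mem_powersetCard.1 h).1 h3)⟩
        · ext x
          simp only [Finset.mem_inter, Finset.mem_sdiff, Finset.mem_singleton]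
          constructor
          · rintro ⟨hx, -, hxF⟩
            exact (Finset.mem_insert.1 (h5 hx)).resolve_right hxF
          · rintro rfl
            exact ⟨h3, h6 h3, hw⟩
      rw [this] at hsplit
      simp at hsplit
      omega

/-- Sum over the set `N` of edges of `F'` outside `F`. For a fixed `N` the edges inside `F ∪ F'`
that are prescribed and the reduced links involve disjoint potential edges, hence the product. -/
theorem bernProb_pair_le (hp0 : 0 ≤ p) (hp1 : p ≤ 1) (hk : 1 ≤ k) {F F' : Finset (Fin n)}
    {M : Finset (Finset (Fin n))} (hM : M ∈ matchings k F r) :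
    bernProb p (Finset.univ.powersetCard k) (fun H => H ∩ F.powersetCard k = M ∧
      IsAugmented k r H F ∧ IsAugmented k r H F') ≤
    ∑ N ∈ ((F'.powersetCard k \ F.powersetCard k).powersetCard
        (M.filter fun e => ¬ e ⊆ F').card).filter
        (fun N => ∀ e ∈ N, ∀ f ∈ N, e ≠ f → Disjoint e f),
      p ^ r * (1 - p) ^ (F.card.choose k - r) * (p ^ (M.filter fun e => ¬ e ⊆ F').card *
        (1 - p) ^ ((F'.powersetCard k \ F.powersetCard k).card -
          (M.filter fun e => ¬ e ⊆ F').card)) *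
        ∏ w ∈ Fᶜ, bernProb p (link k F w \ F'.powersetCard k)
          (fun H => requiredEdges (F' \ F) N w ≤ H.card) := by
  classical
  set P := F.powersetCard k with hP
  set D := F'.powersetCard k \ F.powersetCard k with hD
  set t := (M.filter fun e => ¬ e ⊆ F').card
  set S := (D.powersetCard t).filter (fun N => ∀ e ∈ N, ∀ f ∈ N, e ≠ f → Disjoint e f)
  have hPu : P ⊆ (Finset.univ : Finset (Fin n)).powersetCard k :=
    Finset.powersetCard_mono (Finset.subset_univ _)
  have hDu : D ⊆ (Finset.univ : Finset (Fin n)).powersetCard k :=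
    Finset.sdiff_subset.trans (Finset.powersetCard_mono (Finset.subset_univ _))
  have hPD : Disjoint P D := Finset.disjoint_sdiff
  calc _ ≤ bernProb p (Finset.univ.powersetCard k) (fun H => ∃ N ∈ S,
        (H ∩ (P ∪ D) ∩ P = M ∧ H ∩ (P ∪ D) ∩ D = N) ∧
        ∀ w ∈ Fᶜ, requiredEdges (F' \ F) N w ≤ (H ∩ (link k F w \ F'.powersetCard k)).card) := by
        refine bernProb_mono hp0 hp1 ?_
        rintro H - ⟨h1, h2, h3⟩
        obtain ⟨h4, h5⟩ := isAugmented_pair_imp hk h1 h2 h3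
        refine ⟨_, h4, ⟨?_, ?_⟩, h5⟩
        · rw [Finset.inter_assoc, Finset.inter_eq_right.2 Finset.subset_union_left]; exact h1
        · rw [Finset.inter_assoc, Finset.inter_eq_right.2 Finset.subset_union_right]
    _ ≤ _ := bernProb_exists_le hp0 hp1 _ _ _
    _ = _ := Finset.sum_congr rfl fun N hN => ?_
  rw [Finset.mem_filter, Finset.mem_powersetCard] at hN
  have h := bernProb_and_forall p (E := (Finset.univ : Finset (Fin n)).powersetCard k)
    (E₀ := P ∪ D) Fᶜ (fun w => link k F w \ F'.powersetCard k) (Finset.union_subset hPu hDu)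
    (fun w hw => Finset.sdiff_subset.trans
      (link_subset_powersetCard_univ hk (Finset.mem_compl.1 hw)))
    (fun w hw => by
      rw [Finset.disjoint_union_left]
      exact ⟨(disjoint_powersetCard_link hk (Finset.mem_compl.1 hw)
        (Finset.mem_compl.1 hw)).mono_right Finset.sdiff_subset,
        Finset.disjoint_sdiff.mono_left Finset.sdiff_subset⟩)
    (fun w hw x hx hne => (disjoint_link_link hk (Finset.mem_compl.1 hw) (Finset.mem_compl.1 hx)
      (Finset.mem_compl.1 hw) hne).mono Finset.sdiff_subset Finset.sdiff_subset)
    (fun H => H ∩ P = M ∧ H ∩ D = N) (fun w H => requiredEdges (F' \ F) N w ≤ H.card)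
  rw [h]
  congr 1
  rw [bernProb_and p Finset.subset_union_left Finset.subset_union_right hPD (fun H => H = M)
    (fun H => H = N), bernProb_inner_eq hM, bernProb_eq p hN.1.1, hN.1.2]

/-- Each vertex of `W` contributes `c ^ 2`, except that an edge of `N` meeting `W` in one vertex
saves one factor there. Disjointness of the edges makes these vertices distinct, so a product over
vertices becomes a product over edges. -/
theorem prod_pow_requiredEdges {V : Type*} [DecidableEq V] (W : Finset V)
    {N : Finset (Finset V)} (hN : ∀ e ∈ N, ∀ f ∈ N, e ≠ f → Disjoint e f) {c : ℝ} (hc : c ≠ 0) :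
    ∏ w ∈ W, c ^ requiredEdges W N w =
      c ^ (2 * W.card) * ∏ e ∈ N, if (e ∩ W).card = 1 then c⁻¹ else 1 := by
  classical
  have h1 : ∀ w ∈ W, c ^ requiredEdges W N w =
      c ^ 2 * if ∃ e ∈ N, e ∩ W = {w} then c⁻¹ else 1 := by
    intro w _
    rw [requiredEdges]
    split_ifs
    · field_simp
    · simp
  rw [Finset.prod_congr rfl h1, Finset.prod_mul_distrib, Finset.prod_const, ← pow_mul,
    Finset.prod_ite, Finset.prod_ite]
  simp only [Finset.prod_const, one_pow, mul_one]
  have h2 : (W.filter fun w => ∃ e ∈ N, e ∩ W = {w}) =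
      (N.filter fun e => (e ∩ W).card = 1).biUnion fun e => e ∩ W := by
    ext w
    simp only [Finset.mem_filter, Finset.mem_biUnion]
    constructor
    · rintro ⟨_, e, he, hew⟩
      exact ⟨e, ⟨he, by rw [hew, Finset.card_singleton]⟩, by rw [hew]; simp⟩
    · rintro ⟨e, ⟨he, hcard⟩, hw⟩
      obtain ⟨x, hx⟩ := Finset.card_eq_one.1 hcard
      have : w = x := by rw [hx] at hw; simpa using hw
      exact ⟨(Finset.mem_inter.1 hw).2, e, he, this ▸ hx⟩
  rw [h2, Finset.card_biUnion, Finset.sum_congr rfl fun e he => (Finset.mem_filter.1 he).2]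
  · simp
  · intro e he f hf hne
    exact (hN e (Finset.mem_filter.1 he).1 f (Finset.mem_filter.1 hf).1 hne).mono
      Finset.inter_subset_left Finset.inter_subset_left

/-- At most $jv^{k-1}$ edges meet `F' \ F` in one vertex, and each has weight $1/(jv^{k-2})$, which
gives the term `v`. The others meet it in at least two vertices; there are at most $j^2v^{k-2}$ of
them, each of weight `p`. -/
theorem sum_weight_new_edges_le (hp0 : 0 < p) (hk : 2 ≤ k) {F F' : Finset (Fin n)} {v j : ℕ}
    (hF' : F'.card = v) (hj : (F' \ F).card = j) (hj0 : 1 ≤ j) :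
    ∑ e ∈ F'.powersetCard k \ F.powersetCard k,
      p * (if (e ∩ (F' \ F)).card = 1 then (p * j * (v : ℝ) ^ (k - 2))⁻¹ else 1) ≤
      v + p * j ^ 2 * (v : ℝ) ^ (k - 2) := by
  classical
  obtain ⟨m, rfl⟩ := Nat.exists_eq_add_of_le' hk
  rw [Nat.add_sub_cancel]
  have hv : 0 < v := by
    have := Finset.card_le_card (Finset.sdiff_subset (s := F') (t := F)); omega
  have hv' : (0 : ℝ) < v := by exact_mod_cast hv
  have hj' : (0 : ℝ) < j := by exact_mod_cast hj0
  rw [← Finset.mul_sum, Finset.sum_ite, Finset.sum_const, Finset.sum_const, nsmul_eq_mul,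
    nsmul_eq_mul, mul_one, mul_add]
  set D := F'.powersetCard (m + 2) \ F.powersetCard (m + 2) with hD
  have h1 : ((D.filter fun e => (e ∩ (F' \ F)).card = 1).card : ℝ) ≤ j * (v : ℝ) ^ (m + 1) := by
    have : (D.filter fun e => (e ∩ (F' \ F)).card = 1).card ≤ j * v ^ (m + 1) := by
      rw [← hj, ← hF']
      refine le_trans (Finset.card_le_card fun e he => ?_)
        (card_filter_meets_le F' (F' \ F) (m + 1))
      rw [Finset.mem_filter, hD, Finset.mem_sdiff] at he
      exact Finset.mem_filter.2 ⟨he.1.1, he.2.ge⟩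
    exact_mod_cast this
  have h2 : ((D.filter fun e => ¬ (e ∩ (F' \ F)).card = 1).card : ℝ) ≤ j ^ 2 * (v : ℝ) ^ m := by
    have : (D.filter fun e => ¬ (e ∩ (F' \ F)).card = 1).card ≤ j ^ 2 * v ^ m := by
      rw [← hj, ← hF']
      refine le_trans (Finset.card_le_card fun e he => ?_)
        (card_filter_two_le_inter_le F' (F' \ F) m)
      rw [Finset.mem_filter, hD, Finset.mem_sdiff] at he
      refine Finset.mem_filter.2 ⟨he.1.1, ?_⟩
      have hne : (e ∩ (F' \ F)).Nonempty := by
        by_contra hemp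
        rw [Finset.not_nonempty_iff_eq_empty] at hemp
        refine he.1.2 ?_
        have h3 := Finset.mem_powersetCard.1 he.1.1
        refine Finset.mem_powersetCard.2 ⟨fun x hx => ?_, h3.2⟩
        by_contra hxF
        have : x ∈ e ∩ (F' \ F) := Finset.mem_inter.2 ⟨hx, Finset.mem_sdiff.2 ⟨h3.1 hx, hxF⟩⟩
        rw [hemp] at this; simp at this
      have := hne.card_pos
      omega
    exact_mod_cast this
  refine add_le_add ?_ ?_
  · calc _ ≤ p * ((j * (v : ℝ) ^ (m + 1)) * (p * j * (v : ℝ) ^ m)⁻¹) := by gcongr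
      _ = _ := by field_simp; ring
  · calc _ ≤ p * (j ^ 2 * (v : ℝ) ^ m) := by gcongr
      _ = _ := by ring

/-- With $c=pjv^{k-2}$, a vertex of `F' \ F` meets its requirement with probability at most `c` or
`c ^ 2`, while vertices outside `F ∪ F'` keep their full factor. The sum over `N` is then an
elementary symmetric polynomial in the edge weights. -/
theorem bernProb_pair_le' (hp0 : 0 < p) (hp1 : p < 1) (hk : 2 ≤ k) {F F' : Finset (Fin n)}
    {v j : ℕ} (hF : F.card = v) (hF' : F'.card = v) (hj : (F' \ F).card = j) (hj0 : 1 ≤ j)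
    {M : Finset (Finset (Fin n))} (hM : M ∈ matchings k F r) :
    bernProb p (Finset.univ.powersetCard k) (fun H => H ∩ F.powersetCard k = M ∧
      IsAugmented k r H F ∧ IsAugmented k r H F') ≤
    p ^ r * (1 - p) ^ (v.choose k - r) * (1 - atMostOne p (v.choose (k - 1))) ^ (n - v - j) *
      (p * j * (v : ℝ) ^ (k - 2)) ^ (2 * j) * (1 - p) ^ (v.choose k - (v - j).choose k) *
      ((v + p * j ^ 2 * (v : ℝ) ^ (k - 2)) / (1 - p)) ^ (M.filter fun e => ¬ e ⊆ F').card := by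
  classical
  refine (bernProb_pair_le hp0.le hp1.le (by omega) hM).trans ?_
  set t := (M.filter fun e => ¬ e ⊆ F').card
  set c := p * j * (v : ℝ) ^ (k - 2) with hc
  set D := F'.powersetCard k \ F.powersetCard k with hD
  set β := atMostOne p (v.choose (k - 1)) with hβ
  have hv : 0 < v := by
    have := Finset.card_le_card (Finset.sdiff_subset (s := F') (t := F)); omega
  have hv' : (0 : ℝ) < v := by exact_mod_cast hv
  have hj' : (0 : ℝ) < j := by exact_mod_cast hj0
  have hc0 : 0 < c := by positivity
  have hq : 0 < 1 - p := by linarith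
  have hcI : (F' ∩ F).card = v - j := by
    have := Finset.card_sdiff_add_card_inter F' F; omega
  have hcardD : D.card = v.choose k - (v - j).choose k := by
    have hPP : F.powersetCard k ∩ F'.powersetCard k = (F' ∩ F).powersetCard k := by
      ext e; simp only [Finset.mem_inter, Finset.mem_powersetCard, Finset.subset_inter_iff]
      tauto
    rw [hD, Finset.card_sdiff, hPP, Finset.card_powersetCard, Finset.card_powersetCard, hF', hcI]
  have hβ1 : 0 ≤ 1 - β := by
    have h := bernProb_two_le p (Finset.range (v.choose (k - 1)))
    rw [Finset.card_range] at h
    rw [hβ, ← h]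
    exact bernProb_nonneg hp0.le hp1.le _ _
  have hcompl : Fᶜ = (F' \ F) ∪ (F ∪ F')ᶜ := by
    ext x; simp only [Finset.mem_compl, Finset.mem_union, Finset.mem_sdiff]; tauto
  have hdisj : Disjoint (F' \ F) (F ∪ F')ᶜ := by
    rw [Finset.disjoint_left]
    intro x hx hx'
    simp only [Finset.mem_compl, Finset.mem_union, Finset.mem_sdiff] at hx hx'
    tauto
  have hprod : ∀ N ∈ (D.powersetCard t).filter (fun N => ∀ e ∈ N, ∀ f ∈ N, e ≠ f → Disjoint e f),
      ∏ w ∈ Fᶜ, bernProb p (link k F w \ F'.powersetCard k)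
          (fun H => requiredEdges (F' \ F) N w ≤ H.card) ≤
        (c ^ (2 * j) * ∏ e ∈ N, if (e ∩ (F' \ F)).card = 1 then c⁻¹ else 1) *
          (1 - β) ^ (n - v - j) := by
    intro N hN
    rw [Finset.mem_filter] at hN
    rw [hcompl, Finset.prod_union hdisj]
    refine mul_le_mul ?_ ?_ (Finset.prod_nonneg fun w _ => bernProb_nonneg hp0.le hp1.le _ _) ?_
    · rw [← hj, ← prod_pow_requiredEdges _ hN.2 hc0.ne']
      refine Finset.prod_le_prod (fun w _ => bernProb_nonneg hp0.le hp1.le _ _) fun w hw => ?_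
      rw [Finset.mem_sdiff] at hw
      have hcard : ((link k F w \ F'.powersetCard k).card : ℝ) * p ≤ c := by
        have h1 := card_link_sdiff_le hk hw.1 hw.2
        have h2 : (F \ F').card = j := by
          rw [← hj]; exact Finset.card_sdiff_comm (hF.trans hF'.symm)
        rw [h2, hF] at h1
        have h3 : ((link k F w \ F'.powersetCard k).card : ℝ) ≤ j * (v : ℝ) ^ (k - 2) := by
          exact_mod_cast h1
        calc _ ≤ j * (v : ℝ) ^ (k - 2) * p := by gcongr
          _ = c := by rw [hc]; ring
      rw [requiredEdges]
      split_ifs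
      · rw [pow_one]
        exact (bernProb_one_le_le hp1.le _).trans hcard
      · refine (bernProb_two_le_le hp0.le hp1.le _).trans ?_
        gcongr
    · have hcard : (F ∪ F')ᶜ.card = n - v - j := by
        rw [Finset.card_compl, Fintype.card_fin, ← Finset.union_sdiff_self_eq_union,
          Finset.card_union_of_disjoint Finset.disjoint_sdiff, hF, hj, Nat.sub_sub]
      rw [← hcard, ← Finset.prod_const]
      refine (Finset.prod_congr rfl fun w hw => ?_).le
      have hw' : w ∉ F ∧ w ∉ F' := by simpa [not_or] using hw
      have hsd : link k F w \ F'.powersetCard k = link k F w :=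
        Finset.sdiff_eq_self_of_disjoint
          (disjoint_powersetCard_link (by omega) hw'.1 hw'.2).symm
      have hreq : requiredEdges (F' \ F) N w = 2 := by
        rw [requiredEdges, if_neg]
        rintro ⟨e, -, he⟩
        have : w ∈ e ∩ (F' \ F) := by rw [he]; simp
        exact hw'.2 (Finset.mem_sdiff.1 (Finset.mem_inter.1 this).2).1
      rw [hsd, hreq, bernProb_two_le, card_link hw'.1, hF]
    · exact mul_nonneg (by positivity) (Finset.prod_nonneg fun e _ => by
        split_ifs <;> positivity)
  have hN1 : ∀ N ∈ (D.powersetCard t).filter (fun N => ∀ e ∈ N, ∀ f ∈ N, e ≠ f → Disjoint e f),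
      p ^ r * (1 - p) ^ (F.card.choose k - r) * (p ^ t * (1 - p) ^ (D.card - t)) *
        ∏ w ∈ Fᶜ, bernProb p (link k F w \ F'.powersetCard k)
          (fun H => requiredEdges (F' \ F) N w ≤ H.card) ≤
      (p ^ r * (1 - p) ^ (v.choose k - r) * (1 - β) ^ (n - v - j) * c ^ (2 * j) *
        ((1 - p) ^ D.card / (1 - p) ^ t)) *
        ∏ e ∈ N, (p * if (e ∩ (F' \ F)).card = 1 then c⁻¹ else 1) := by
    intro N hN
    have hN' := Finset.mem_powersetCard.1 (Finset.mem_filter.1 hN).1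
    have htD : t ≤ D.card := hN'.2 ▸ Finset.card_le_card hN'.1
    have e1 : (1 - p) ^ (D.card - t) = (1 - p) ^ D.card / (1 - p) ^ t := by
      rw [eq_div_iff (pow_pos hq _).ne', ← pow_add, Nat.sub_add_cancel htD]
    rw [hF, e1]
    refine (mul_le_mul_of_nonneg_left (hprod N hN) (by positivity)).trans_eq ?_
    rw [Finset.prod_mul_distrib, Finset.prod_const, hN'.2]
    ring
  refine (Finset.sum_le_sum hN1).trans ?_
  rw [← Finset.mul_sum]
  set y : Finset (Fin n) → ℝ := fun e => p * if (e ∩ (F' \ F)).card = 1 then c⁻¹ else 1 with hy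
  have hy0 : ∀ e, 0 ≤ y e := fun e => by simp only [hy]; split_ifs <;> positivity
  have hsum : ∑ N ∈ (D.powersetCard t).filter (fun N => ∀ e ∈ N, ∀ f ∈ N, e ≠ f → Disjoint e f),
      ∏ e ∈ N, y e ≤ (v + p * j ^ 2 * (v : ℝ) ^ (k - 2)) ^ t := by
    calc _ ≤ ∑ N ∈ D.powersetCard t, ∏ e ∈ N, y e :=
          Finset.sum_le_sum_of_subset_of_nonneg (Finset.filter_subset _ _)
            fun N _ _ => Finset.prod_nonneg fun e _ => hy0 e
      _ ≤ (∑ e ∈ D, y e) ^ t / t.factorial := sum_powersetCard_prod_le D y hy0 t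
      _ ≤ (∑ e ∈ D, y e) ^ t := div_le_self (pow_nonneg (Finset.sum_nonneg fun e _ => hy0 e) _)
          (by exact_mod_cast t.factorial_pos)
      _ ≤ _ := pow_le_pow_left₀ (Finset.sum_nonneg fun e _ => hy0 e)
          (sum_weight_new_edges_le hp0 hk hF' hj hj0) _
  refine (mul_le_mul_of_nonneg_left hsum (by positivity)).trans_eq ?_
  rw [hcardD, div_pow]
  ring

end NearlyEqualPairs

end

end RandomHypergraph

namespace RandomHypergraph

noncomputable section

/-! ### The second moment method with explicit error terms. -/

section SecondMoment

variable {n k r : ℕ} {p : ℝ}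

/-- The contribution, relative to the first moment, of the pairs of sets with `v` elements that
differ in `j` elements. -/
def nearTerm (n k : ℕ) (p : ℝ) (v r j : ℕ) : ℝ :=
  ((1 - atMostOne p (v.choose (k - 1))) ^ j)⁻¹ * (p * j * (v : ℝ) ^ (k - 2)) ^ (2 * j) *
    (1 - p) ^ (v.choose k - (v - j).choose k) * ((n : ℝ) ^ j / j.factorial *
    ((v + k * r * ((v + p * j ^ 2 * (v : ℝ) ^ (k - 2)) / (1 - p))) ^ j / j.factorial))

/-- The contribution, relative to the square of the first moment, of the pairs of sets with `v`
elements that have `i` elements in common. -/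
def midTerm (n k : ℕ) (p : ℝ) (v i : ℕ) : ℝ :=
  v.choose i * ((v : ℝ) / n) ^ i * ((1 - p) ^ i.choose k)⁻¹ *
    ((1 - atMostOne p (v.choose (k - 1))) ^ (2 * (n - v)))⁻¹

theorem atMostOne_le_one (hp0 : 0 ≤ p) (hp1 : p ≤ 1) (B : ℕ) : atMostOne p B ≤ 1 := by
  have h := bernProb_card_le_one p (Finset.range B)
  rw [Finset.card_range] at h
  rw [← h]
  exact bernProb_le_one hp0 hp1 _ _

/-- Each edge of `M` not inside `F'` loses a vertex of `F \ F'`, and disjoint edges lose different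
ones. -/
theorem card_filter_not_subset_le {V : Type*} [DecidableEq V] {F F' : Finset V}
    {M : Finset (Finset V)} (hM : M ∈ matchings k F r) :
    (M.filter fun e => ¬ e ⊆ F').card ≤ ((F \ F') ∩ M.biUnion id).card := by
  rw [mem_matchings] at hM
  have h1 : ((M.filter fun e => ¬ e ⊆ F').biUnion fun e => e \ F').card =
      ∑ e ∈ M.filter fun e => ¬ e ⊆ F', (e \ F').card := by
    refine Finset.card_biUnion fun e he f hf hne => ?_
    exact (hM.2 e (Finset.mem_filter.1 he).1 f (Finset.mem_filter.1 hf).1 hne).mono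
      Finset.sdiff_subset Finset.sdiff_subset
  calc _ = ∑ e ∈ M.filter fun e => ¬ e ⊆ F', 1 := Finset.card_eq_sum_ones _
    _ ≤ ∑ e ∈ M.filter fun e => ¬ e ⊆ F', (e \ F').card := by
        refine Finset.sum_le_sum fun e he => Finset.card_pos.2 ?_
        exact Finset.sdiff_nonempty.2 (Finset.mem_filter.1 he).2
    _ ≤ _ := by
        rw [← h1]
        refine Finset.card_le_card (Finset.biUnion_subset.2 fun e he => ?_)
        have heM := (Finset.mem_filter.1 he).1
        refine Finset.subset_inter (Finset.sdiff_subset_sdiff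
          (Finset.mem_powersetCard.1 (hM.1.1 heM)).1 le_rfl) ?_
        exact Finset.sdiff_subset.trans (Finset.subset_biUnion_of_mem id heM)

/-- The set `F'` is determined by the removed and the added `j`-sets. The sum over removed sets is
an elementary symmetric polynomial with weight `Z` on the at most `k * r` vertices covered by `M`
and weight `1` elsewhere. -/
theorem sum_pow_card_inter_le {F : Finset (Fin n)} {v j : ℕ} (hF : F.card = v)
    {M : Finset (Finset (Fin n))} (hM : M ∈ matchings k F r) {Z : ℝ} (hZ : 1 ≤ Z) :
    ∑ F' ∈ ((Finset.univ : Finset (Fin n)).powersetCard v).filter (fun F' => (F' \ F).card = j),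
      Z ^ ((F \ F') ∩ M.biUnion id).card ≤
    (n : ℝ) ^ j / j.factorial * ((v + k * r * Z) ^ j / j.factorial) := by
  classical
  have hZ0 : 0 ≤ Z := by linarith
  set S := ((Finset.univ : Finset (Fin n)).powersetCard v).filter (fun F' => (F' \ F).card = j)
  set X := M.biUnion id
  let φ : Finset (Fin n) → Finset (Fin n) × Finset (Fin n) := fun F' => (F \ F', F' \ F)
  have hinj : Set.InjOn φ S := by
    intro A _ B _ h
    have h1 : F \ A = F \ B := congrArg Prod.fst h
    have h2 : A \ F = B \ F := congrArg Prod.snd h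
    ext x
    have e1 := Finset.ext_iff.1 h1 x
    have e2 := Finset.ext_iff.1 h2 x
    simp only [Finset.mem_sdiff] at e1 e2
    tauto
  have hsub : S.image φ ⊆ F.powersetCard j ×ˢ (Fᶜ).powersetCard j := by
    intro x hx
    obtain ⟨F', hF', rfl⟩ := Finset.mem_image.1 hx
    rw [Finset.mem_filter, Finset.mem_powersetCard] at hF'
    rw [Finset.mem_product, Finset.mem_powersetCard, Finset.mem_powersetCard]
    refine ⟨⟨Finset.sdiff_subset, ?_⟩, fun y hy => ?_, hF'.2⟩
    · rw [← hF'.2]; exact Finset.card_sdiff_comm (hF.trans hF'.1.2.symm)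
    · exact Finset.mem_compl.2 (Finset.mem_sdiff.1 hy).2
  have h1 : ∑ F' ∈ S, Z ^ ((F \ F') ∩ X).card ≤
      ∑ x ∈ F.powersetCard j ×ˢ (Fᶜ).powersetCard j, Z ^ (x.1 ∩ X).card := by
    calc _ = ∑ x ∈ S.image φ, Z ^ (x.1 ∩ X).card := by rw [Finset.sum_image hinj]
      _ ≤ _ := Finset.sum_le_sum_of_subset_of_nonneg hsub fun x _ _ => pow_nonneg hZ0 _
  refine h1.trans ?_
  rw [Finset.sum_product_right]
  dsimp only
  rw [Finset.sum_const, nsmul_eq_mul, Finset.card_powersetCard]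
  refine mul_le_mul ?_ ?_ (Finset.sum_nonneg fun _ _ => pow_nonneg hZ0 _) (by positivity)
  · refine le_trans ?_ (Nat.choose_le_pow_div j n)
    have : Fᶜ.card ≤ n := by simpa using Finset.card_le_univ Fᶜ
    exact_mod_cast Nat.choose_le_choose j this
  · have h2 : ∀ U ∈ F.powersetCard j, Z ^ (U ∩ X).card = ∏ u ∈ U, if u ∈ X then Z else 1 := by
      intro U _
      rw [Finset.prod_ite, Finset.prod_const, Finset.prod_const_one, mul_one,
        Finset.filter_mem_eq_inter]
    rw [Finset.sum_congr rfl h2]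
    refine (sum_powersetCard_prod_le F _ (fun u => by split_ifs <;> linarith) j).trans ?_
    have hM' := mem_matchings.1 hM
    have hX : ((F.filter fun u => u ∈ X).card : ℝ) ≤ k * r := by
      have h3 : (F.filter fun u => u ∈ X).card ≤ k * r := by
        calc _ ≤ X.card := Finset.card_le_card fun u hu => (Finset.mem_filter.1 hu).2
          _ ≤ ∑ e ∈ M, (id e).card := Finset.card_biUnion_le
          _ = ∑ e ∈ M, k := Finset.sum_congr rfl fun e he =>
            (Finset.mem_powersetCard.1 (hM'.1.1 he)).2
          _ = k * r := by rw [Finset.sum_const, hM'.1.2, smul_eq_mul, mul_comm]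
      exact_mod_cast h3
    gcongr
    · rw [Finset.sum_ite, Finset.sum_const, Finset.sum_const, nsmul_eq_mul, nsmul_eq_mul, mul_one,
        add_comm]
      gcongr
      rw [← hF]
      exact_mod_cast Finset.card_filter_le _ _

/-- Condition on the matching `M` inside `F` and exchange the sums; the bound for the sum over `F'`
does not depend on `M`, and the number of matchings rebuilds `probMatching`. -/
theorem sum_near_le (hp0 : 0 < p) (hp1 : p < 1) (hk : 2 ≤ k) {F : Finset (Fin n)} {v j : ℕ}
    (hF : F.card = v) (hj0 : 1 ≤ j) (hjv : j ≤ v) (hvn : 2 * v ≤ n)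
    (hβ : atMostOne p (v.choose (k - 1)) < 1) :
    ∑ F' ∈ ((Finset.univ : Finset (Fin n)).powersetCard v).filter (fun F' => (F' \ F).card = j),
      bernProb p (Finset.univ.powersetCard k)
        (fun H => IsAugmented k r H F ∧ IsAugmented k r H F') ≤
    probMatching k p v r * (1 - atMostOne p (v.choose (k - 1))) ^ (n - v) *
      nearTerm n k p v r j := by
  classical
  set S := ((Finset.univ : Finset (Fin n)).powersetCard v).filter (fun F' => (F' \ F).card = j)
    with hS
  set β := atMostOne p (v.choose (k - 1)) with hβd
  set Z := (v + p * j ^ 2 * (v : ℝ) ^ (k - 2)) / (1 - p) with hZd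
  have hv1 : (1 : ℝ) ≤ v := by exact_mod_cast hj0.trans hjv
  have hq : 0 < 1 - p := by linarith
  have hb : 0 < 1 - β := by linarith
  have hZ : 1 ≤ Z := by
    rw [hZd, le_div_iff₀ hq]
    have : 0 ≤ p * j ^ 2 * (v : ℝ) ^ (k - 2) := by positivity
    linarith
  set K := p ^ r * (1 - p) ^ (v.choose k - r) * (1 - β) ^ (n - v - j) *
      (p * j * (v : ℝ) ^ (k - 2)) ^ (2 * j) * (1 - p) ^ (v.choose k - (v - j).choose k) with hK
  have hK0 : 0 ≤ K := by positivity
  have h1 : ∀ F' ∈ S, bernProb p (Finset.univ.powersetCard k)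
        (fun H => IsAugmented k r H F ∧ IsAugmented k r H F') ≤
      ∑ M ∈ matchings k F r, K * Z ^ ((F \ F') ∩ M.biUnion id).card := by
    intro F' hF'
    rw [hS, Finset.mem_filter, Finset.mem_powersetCard] at hF'
    refine (bernProb_mono hp0.le hp1.le (B := fun H => ∃ M ∈ matchings k F r,
      H ∩ F.powersetCard k = M ∧ IsAugmented k r H F ∧ IsAugmented k r H F') ?_).trans ?_
    · rintro H - ⟨h1, h2⟩
      exact ⟨_, h1.1, rfl, h1, h2⟩
    · refine (bernProb_exists_le hp0.le hp1.le _ _ _).trans (Finset.sum_le_sum fun M hM => ?_)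
      refine (bernProb_pair_le' hp0 hp1 hk hF hF'.1.2 hF'.2 hj0 hM).trans ?_
      exact mul_le_mul_of_nonneg_left (pow_le_pow_right₀ hZ (card_filter_not_subset_le hM)) hK0
  refine (Finset.sum_le_sum h1).trans ?_
  rw [Finset.sum_comm]
  calc _ ≤ ∑ M ∈ matchings k F r,
        K * ((n : ℝ) ^ j / j.factorial * ((v + k * r * Z) ^ j / j.factorial)) := by
        refine Finset.sum_le_sum fun M hM => ?_
        rw [← Finset.mul_sum]
        exact mul_le_mul_of_nonneg_left (sum_pow_card_inter_le hF hM hZ) hK0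
    _ = _ := by
        rw [Finset.sum_const, nsmul_eq_mul, card_matchings (by omega), hF, hK, nearTerm,
          probMatching]
        have e1 : (1 - β) ^ (n - v - j) = (1 - β) ^ (n - v) * ((1 - β) ^ j)⁻¹ := by
          rw [eq_mul_inv_iff_mul_eq₀ (pow_pos hb _).ne', ← pow_add, Nat.sub_add_cancel (by omega)]
        rw [e1]
        ring

/-- Each step multiplies by `(v - i) / (n - i)`, which is at most `v / n`. -/
theorem choose_sub_sub_le {v i : ℕ} (hvn : v ≤ n) (hi : i ≤ v) :
    ((n - i).choose (v - i) : ℝ) ≤ n.choose v * ((v : ℝ) / n) ^ i := by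
  induction i with
  | zero => simp
  | succ i ih =>
    have ih := ih (by omega)
    have h1 : (n - i) * (n - (i + 1)).choose (v - (i + 1)) = (n - i).choose (v - i) * (v - i) := by
      have := Nat.add_one_mul_choose_eq (n - (i + 1)) (v - (i + 1))
      rwa [show n - (i + 1) + 1 = n - i by omega, show v - (i + 1) + 1 = v - i by omega] at this
    have h2 : ((n - i : ℕ) : ℝ) * ((n - (i + 1)).choose (v - (i + 1)) : ℝ) =
        ((n - i).choose (v - i) : ℝ) * ((v - i : ℕ) : ℝ) := by exact_mod_cast h1
    have hpos : (0 : ℝ) < ((n - i : ℕ) : ℝ) := by exact_mod_cast (by omega : 0 < n - i)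
    have hn : (0 : ℝ) < n := by exact_mod_cast (by omega : 0 < n)
    have h3 : ((v - i : ℕ) : ℝ) / ((n - i : ℕ) : ℝ) ≤ v / n := by
      rw [div_le_div_iff₀ hpos hn, Nat.cast_sub (by omega), Nat.cast_sub (by omega)]
      have : (v : ℝ) ≤ n := by exact_mod_cast hvn
      nlinarith [(Nat.cast_nonneg i : (0 : ℝ) ≤ i)]
    calc ((n - (i + 1)).choose (v - (i + 1)) : ℝ) =
        ((n - i).choose (v - i) : ℝ) * (((v - i : ℕ) : ℝ) / ((n - i : ℕ) : ℝ)) := by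
          rw [mul_div_assoc', ← h2, mul_div_cancel_left₀ _ hpos.ne']
      _ ≤ n.choose v * ((v : ℝ) / n) ^ i * (v / n) := by gcongr
      _ = _ := by ring

theorem card_filter_inter_le {F : Finset (Fin n)} {v i : ℕ} (hF : F.card = v) :
    (((Finset.univ : Finset (Fin n)).powersetCard v).filter
      (fun F' => (F ∩ F').card = i)).card ≤ v.choose i * (n - i).choose (v - i) := by
  classical
  calc _ ≤ ((F.powersetCard i).biUnion fun I =>
        ((Iᶜ).powersetCard (v - i)).image fun J => I ∪ J).card := by
        refine Finset.card_le_card fun F' hF' => ?_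
        rw [Finset.mem_filter, Finset.mem_powersetCard] at hF'
        refine Finset.mem_biUnion.2 ⟨F ∩ F', Finset.mem_powersetCard.2
          ⟨Finset.inter_subset_left, hF'.2⟩, Finset.mem_image.2 ⟨F' \ (F ∩ F'), ?_, ?_⟩⟩
        · refine Finset.mem_powersetCard.2 ⟨fun x hx => Finset.mem_compl.2
            (Finset.mem_sdiff.1 hx).2, ?_⟩
          rw [Finset.card_sdiff_of_subset Finset.inter_subset_right, hF'.2, hF'.1.2]
        · exact Finset.union_sdiff_of_subset Finset.inter_subset_right
    _ ≤ ∑ I ∈ F.powersetCard i, (((Iᶜ).powersetCard (v - i)).image fun J => I ∪ J).card :=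
        Finset.card_biUnion_le
    _ ≤ ∑ I ∈ F.powersetCard i, (n - i).choose (v - i) := by
        refine Finset.sum_le_sum fun I hI => Finset.card_image_le.trans_eq ?_
        rw [Finset.card_powersetCard, Finset.card_compl, Fintype.card_fin,
          (Finset.mem_powersetCard.1 hI).2]
    _ = _ := by rw [Finset.sum_const, Finset.card_powersetCard, hF, smul_eq_mul]

/-- The second moment method for augmented independent sets. -/
theorem one_le_prob_mul (hp0 : 0 < p) (hp1 : p < 1) (hk : 2 ≤ k) {v J I₀ : ℕ} (hvn : 2 * v ≤ n)
    (hv : 1 ≤ v) (hβ : atMostOne p (v.choose (k - 1)) < 1)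
    (hr : r * (1 - p) ≤ p * (v - k * r).choose k) (hT : 0 < expAug n k p v r) {δ ν μ : ℝ}
    (hδ : ∀ i ≤ I₀, i ≤ v → (1 - 2 * atMostOne p (v.choose (k - 1)) +
      atMostOne p (v.choose (k - 1)) ^ 2 / (1 - p) ^ i.choose (k - 1)) ^ (n - (2 * v - i)) ≤
        (1 + δ) * (1 - atMostOne p (v.choose (k - 1))) ^ (2 * (n - v)) * (1 - p) ^ i.choose k)
    (hδ0 : 0 ≤ δ)
    (hν : ∑ j ∈ Finset.Icc 1 J, nearTerm n k p v r j ≤ ν)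
    (hμ : ∑ i ∈ (Finset.range (v - J)).filter (fun i => I₀ < i), midTerm n k p v i ≤ μ) :
    1 ≤ prob n k p (fun H => v ≤ indepNum H + r) *
      ((1 + ν) / expAug n k p v r + (1 + δ + μ)) := by
  classical
  have hk1 : 1 ≤ k := by omega
  set T := expAug n k p v r with hTd
  set β := atMostOne p (v.choose (k - 1)) with hβd
  set π := probMatching k p v r * (1 - β) ^ (n - v) with hπ
  have hq : 0 < 1 - p := by linarith
  have hb : 0 < 1 - β := by linarith
  have hTπ : T = n.choose v * π := rfl
  set E := (Finset.univ : Finset (Fin n)).powersetCard k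
  set Q := (Finset.univ : Finset (Fin n)).powersetCard v with hQ
  have hprobM : 0 ≤ probMatching k p v r := by unfold probMatching; positivity
  have hπ0 : 0 ≤ π := by positivity
  let g : Finset (Fin n) → Finset (Fin n) → ℝ := fun F F' =>
    bernProb p E (fun H => IsAugmented k r H F ∧ IsAugmented k r H F')
  have hg0 : ∀ F F', 0 ≤ g F F' := fun F F' => bernProb_nonneg hp0.le hp1.le _ _
  have hmain : ∀ F ∈ Q, ∑ F' ∈ Q, g F F' ≤ π + π * ν + T * π * (1 + δ) + T * π * μ := by
    intro F hF
    have hFv := (Finset.mem_powersetCard.1 hF).2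
    have hsd : ∀ F' ∈ Q, (F' \ F).card + (F ∩ F').card = v := by
      intro F' hF'
      rw [Finset.inter_comm, Finset.card_sdiff_add_card_inter, (Finset.mem_powersetCard.1 hF').2]
    -- Four classes of `F'`: equal to `F`, differing in at most `J` vertices, meeting `F` in at most
    -- `I₀`, and the rest. They may overlap, since only an upper bound is needed.
    have hcover : Q ⊆ ({F} ∪ (Finset.Icc 1 J).biUnion fun j => Q.filter fun F' => (F' \ F).card = j)
        ∪ ((Q.filter fun F' => (F ∩ F').card ≤ I₀) ∪
          ((Finset.range (v - J)).filter fun i => I₀ < i).biUnion fun i =>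
            Q.filter fun F' => (F ∩ F').card = i) := by
      intro F' hF'
      simp only [Finset.mem_union, Finset.mem_biUnion, Finset.mem_filter, Finset.mem_singleton,
        Finset.mem_Icc, Finset.mem_range]
      have h1 := hsd F' hF'
      by_cases h0 : (F' \ F).card = 0
      · left; left
        rw [Finset.card_eq_zero, Finset.sdiff_eq_empty_iff_subset] at h0
        exact Finset.eq_of_subset_of_card_le h0
          (by rw [hFv, (Finset.mem_powersetCard.1 hF').2])
      · by_cases hJ : (F' \ F).card ≤ J
        · exact Or.inl (Or.inr ⟨_, ⟨by omega, hJ⟩, hF', rfl⟩)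
        · by_cases hI : (F ∩ F').card ≤ I₀
          · exact Or.inr (Or.inl ⟨hF', hI⟩)
          · exact Or.inr (Or.inr ⟨_, ⟨by omega, by omega⟩, hF', rfl⟩)
    have hunion : ∀ A B : Finset (Finset (Fin n)), ∑ F' ∈ A ∪ B, g F F' ≤
        ∑ F' ∈ A, g F F' + ∑ F' ∈ B, g F F' := by
      intro A B
      rw [← Finset.sum_union_inter]
      exact le_add_of_nonneg_right (Finset.sum_nonneg fun F' _ => hg0 F F')
    have hbiU : ∀ (I : Finset ℕ) (A : ℕ → Finset (Finset (Fin n))),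
        ∑ F' ∈ I.biUnion A, g F F' ≤ ∑ i ∈ I, ∑ F' ∈ A i, g F F' := by
      intro I A
      induction I using Finset.induction_on with
      | empty => simp
      | insert a I ha ih =>
        rw [Finset.biUnion_insert, Finset.sum_insert ha]
        exact (hunion _ _).trans (add_le_add le_rfl ih)
    have hdiag : ∑ F' ∈ {F}, g F F' = π := by
      rw [Finset.sum_singleton]
      have : g F F = bernProb p E (fun H => IsAugmented k r H F) :=
        bernProb_congr fun H _ => and_self_iff
      rw [this, bernProb_isAugmented hk1, hFv, hπ, probMatching]
    have hnear : ∑ F' ∈ (Finset.Icc 1 J).biUnion fun j => Q.filter fun F' => (F' \ F).card = j,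
        g F F' ≤ π * ν := by
      refine (hbiU _ _).trans ?_
      refine le_trans ?_ (mul_le_mul_of_nonneg_left hν hπ0)
      rw [Finset.mul_sum]
      refine Finset.sum_le_sum fun j hj => ?_
      rw [Finset.mem_Icc] at hj
      rcases le_or_gt j v with hjv | hjv
      · exact sum_near_le hp0 hp1 hk hFv hj.1 hjv hvn hβ
      -- No `F'` differs from `F` in more than `v` vertices, so these classes are empty.
      · rw [Finset.sum_eq_zero]
        · refine mul_nonneg hπ0 ?_
          unfold nearTerm
          positivity
        · intro F' hF'
          rw [Finset.mem_filter] at hF'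
          have := hsd F' hF'.1
          omega
    have hinter : ∀ F' ∈ Q, (F ∪ F').card = 2 * v - (F ∩ F').card := by
      intro F' hF'
      have := Finset.card_union_add_card_inter F F'
      rw [hFv, (Finset.mem_powersetCard.1 hF').2] at this
      omega
    have hfar : ∑ F' ∈ Q.filter fun F' => (F ∩ F').card ≤ I₀, g F F' ≤ T * π * (1 + δ) := by
      have hterm : ∀ F' ∈ Q.filter fun F' => (F ∩ F').card ≤ I₀, g F F' ≤ π ^ 2 * (1 + δ) := by
        intro F' hF'
        rw [Finset.mem_filter] at hF'
        have hF'v := (Finset.mem_powersetCard.1 hF'.1).2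
        have h1 := bernProb_isAugmented_and_le hp0.le hp1 hk1 hr hFv hF'v
        have h2 := hδ _ hF'.2 (by have := hsd F' hF'.1; omega)
        rw [hinter F' hF'.1] at h1
        have h3 := h1.trans (mul_le_mul_of_nonneg_left h2 (sq_nonneg _))
        refine le_of_mul_le_mul_right (h3.trans_eq ?_) (pow_pos hq ((F ∩ F').card.choose k))
        rw [hπ]; ring
      refine (Finset.sum_le_sum hterm).trans ?_
      rw [Finset.sum_const, nsmul_eq_mul, hTπ]
      have hc : ((Q.filter fun F' => (F ∩ F').card ≤ I₀).card : ℝ) ≤ n.choose v := by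
        have := Finset.card_filter_le Q (fun F' => (F ∩ F').card ≤ I₀)
        rw [hQ, Finset.card_powersetCard, Finset.card_univ, Fintype.card_fin] at this
        exact_mod_cast this
      calc _ ≤ (n.choose v : ℝ) * (π ^ 2 * (1 + δ)) :=
            mul_le_mul_of_nonneg_right hc (by positivity)
        _ = _ := by ring
    have hmid : ∑ F' ∈ ((Finset.range (v - J)).filter fun i => I₀ < i).biUnion fun i =>
        Q.filter fun F' => (F ∩ F').card = i, g F F' ≤ T * π * μ := by
      refine (hbiU _ _).trans ?_
      refine le_trans ?_ (mul_le_mul_of_nonneg_left hμ (by positivity))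
      rw [Finset.mul_sum]
      refine Finset.sum_le_sum fun i hi => ?_
      rw [Finset.mem_filter, Finset.mem_range] at hi
      have hterm : ∀ F' ∈ Q.filter fun F' => (F ∩ F').card = i,
          g F F' ≤ probMatching k p v r ^ 2 * ((1 - p) ^ i.choose k)⁻¹ := by
        intro F' hF'
        rw [Finset.mem_filter] at hF'
        have h1 := bernProb_isAugmented_and_le' hp0.le hp1 hk1 hr hFv
          (Finset.mem_powersetCard.1 hF'.1).2
        rw [hF'.2] at h1
        rwa [← div_eq_mul_inv, le_div_iff₀ (pow_pos hq _)]
      refine (Finset.sum_le_sum hterm).trans ?_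
      rw [Finset.sum_const, nsmul_eq_mul]
      have hc : ((Q.filter fun F' => (F ∩ F').card = i).card : ℝ) ≤
          v.choose i * (n.choose v * ((v : ℝ) / n) ^ i) := by
        have h1 : ((Q.filter fun F' => (F ∩ F').card = i).card : ℝ) ≤
            v.choose i * (n - i).choose (v - i) := by
          exact_mod_cast card_filter_inter_le hFv
        refine h1.trans (mul_le_mul_of_nonneg_left (choose_sub_sub_le (by omega) (by omega))
          (Nat.cast_nonneg _))
      refine (mul_le_mul_of_nonneg_right hc (by positivity)).trans_eq ?_
      rw [hTπ, midTerm, hπ, ← hβd, pow_mul']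
      have hbne : (1 - β) ^ (n - v) ≠ 0 := (pow_pos hb _).ne'
      field_simp
    calc ∑ F' ∈ Q, g F F' ≤ _ :=
          Finset.sum_le_sum_of_subset_of_nonneg hcover fun F' _ _ => hg0 F F'
      _ ≤ _ := hunion _ _
      _ ≤ _ := add_le_add (hunion _ _) (hunion _ _)
      _ ≤ _ := add_le_add (add_le_add hdiag.le hnear) (add_le_add hfar hmid)
      _ = _ := by ring
  have h2 := sq_expAug_le (n := n) (r := r) hp0.le hp1.le hk1 v
  have h3 : ∑ F ∈ Q, ∑ F' ∈ Q, g F F' ≤ T ^ 2 * ((1 + ν) / T + (1 + δ + μ)) := by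
    refine (Finset.sum_le_sum hmain).trans_eq ?_
    rw [Finset.sum_const, nsmul_eq_mul, hQ, Finset.card_powersetCard, Finset.card_univ,
      Fintype.card_fin]
    have : T ^ 2 * ((1 + ν) / T + (1 + δ + μ)) = T * (1 + ν) + T * T * (1 + δ + μ) := by
      field_simp
    rw [this]
    nth_rw 3 [hTπ]
    nth_rw 3 [hTπ]
    ring
  have hprob : 0 ≤ prob n k p (fun H => v ≤ indepNum H + r) := by
    rw [prob_eq_bernProb]; exact bernProb_nonneg hp0.le hp1.le _ _
  have h4 := h2.trans (mul_le_mul_of_nonneg_left h3 hprob)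
  have hT2 : 0 < T ^ 2 := by positivity
  refine le_of_mul_le_mul_left ?_ hT2
  calc T ^ 2 * 1 = T ^ 2 := mul_one _
    _ ≤ _ := h4
    _ = _ := by ring

end SecondMoment

end

end RandomHypergraph

namespace RandomHypergraph

noncomputable section

/-! ### Geometric bounds for the near and intermediate terms. -/

section Estimates

theorem pow_div_factorial_le (j : ℕ) : (j : ℝ) ^ j / j.factorial ≤ Real.exp 1 ^ j := by
  have := Real.pow_div_factorial_le_exp (j : ℝ) (Nat.cast_nonneg j) j
  rwa [← Real.exp_one_pow] at this

theorem inv_one_sub_le_exp {x : ℝ} (hx0 : 0 ≤ x) (hx1 : x ≤ 1 / 2) :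
    (1 - x)⁻¹ ≤ Real.exp (2 * x) := by
  have h1 : 1 + 2 * x ≤ Real.exp (2 * x) := by linarith [Real.add_one_le_exp (2 * x)]
  refine le_trans ?_ h1
  rw [inv_le_iff_one_le_mul₀ (by linarith)]
  nlinarith

theorem inv_one_sub_pow_le_exp {x : ℝ} (hx0 : 0 ≤ x) (hx1 : x ≤ 1 / 2) (m : ℕ) :
    ((1 - x) ^ m)⁻¹ ≤ Real.exp (2 * x * m) := by
  have h := inv_one_sub_le_exp hx0 hx1
  rw [← inv_pow]
  refine (pow_le_pow_left₀ (inv_nonneg.2 (by linarith)) h m).trans_eq ?_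
  rw [← Real.exp_nat_mul]
  ring_nf

theorem tendsto_log_pow_mul_rpow_neg (m : ℕ) {c : ℝ} (hc : 0 < c) :
    Tendsto (fun n : ℕ => Real.log n ^ m * (n : ℝ) ^ (-c)) atTop (𝓝 0) := by
  have h := (isLittleO_log_rpow_rpow_atTop (m : ℝ) hc).tendsto_div_nhds_zero
  have h2 := h.comp tendsto_natCast_atTop_atTop
  refine h2.congr fun n => ?_
  simp only [Function.comp_apply, Real.rpow_natCast]
  rw [Real.rpow_neg (Nat.cast_nonneg n), div_eq_mul_inv]

theorem tendsto_log_natCast : Tendsto (fun n : ℕ => Real.log n) atTop atTop :=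
  Real.tendsto_log_atTop.comp tendsto_natCast_atTop_atTop

theorem choose_sub_choose_ge {v k j : ℕ} (hk : 1 ≤ k) (h : j ≤ v) :
    j * (v - j).choose (k - 1) ≤ v.choose k - (v - j).choose k := by
  obtain ⟨m, rfl⟩ := Nat.exists_eq_succ_of_ne_zero (by omega : k ≠ 0)
  obtain ⟨w, rfl⟩ := Nat.exists_eq_add_of_le h
  rw [Nat.add_sub_cancel_left, Nat.succ_sub_one]
  have : j * w.choose m + w.choose m.succ ≤ (j + w).choose m.succ := by
    clear h hk
    induction j with
    | zero => simp
    | succ j ih =>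
      rw [show j + 1 + w = (j + w) + 1 by ring, Nat.choose_succ_succ]
      have h1 := Nat.choose_le_choose m (Nat.le_add_left w j)
      have h2 : (j + 1) * w.choose m = j * w.choose m + w.choose m := by ring
      omega
  omega

theorem choose_le_add_mul_pow (a d m : ℕ) :
    (a + d).choose (m + 1) ≤ a.choose (m + 1) + d * (a + d) ^ m := by
  induction d with
  | zero => simp
  | succ d ih =>
    rw [← add_assoc, Nat.choose_succ_succ]
    have h1 : (a + d).choose m ≤ (a + d + 1) ^ m :=
      (Nat.choose_le_pow _ _).trans (Nat.pow_le_pow_left (by omega) m)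
    have h2 : (a + d) ^ m ≤ (a + d + 1) ^ m := Nat.pow_le_pow_left (by omega) m
    have h3 := Nat.mul_le_mul_left d h2
    have h4 : (d + 1) * (a + d + 1) ^ m = d * (a + d + 1) ^ m + (a + d + 1) ^ m := by ring
    have h5 : (a + d).choose m.succ = (a + d).choose (m + 1) := rfl
    omega

/-- Removing a small fraction of the vertices costs only a comparable fraction of the binomial
coefficient; thus powers of `1 - p` change by a small power of `n` only. -/
theorem one_sub_mul_choose_le {v J m : ℕ} {η : ℝ} (hm : 1 ≤ m) (hv : 2 * m ≤ v)
    (hJ : (J : ℝ) ≤ η * v) :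
    (1 - 2 * m * η) * v.choose m ≤ (v - J).choose m := by
  have hη : 0 ≤ η := by
    have hv0 : (0 : ℝ) < v := by exact_mod_cast (by omega : 0 < v)
    by_contra h
    have := mul_neg_of_neg_of_pos (not_le.1 h) hv0
    linarith [(Nat.cast_nonneg J : (0 : ℝ) ≤ J)]
  obtain ⟨m, rfl⟩ := Nat.exists_eq_succ_of_ne_zero (by omega : m ≠ 0)
  -- the loss is at most `J` times the next smaller binomial coefficient
  have h1 : v.choose (m + 1) ≤ (v - J).choose (m + 1) + J * v.choose m := by
    have h : ∀ d w : ℕ, (w + d).choose (m + 1) ≤ w.choose (m + 1) + d * (w + d).choose m := by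
      intro d w
      induction d with
      | zero => simp
      | succ d ih =>
        rw [← add_assoc, Nat.choose_succ_succ]
        have h1 := Nat.choose_le_choose m (Nat.le_succ (w + d))
        have h2 := Nat.mul_le_mul_left d h1
        have h3 : (d + 1) * (w + d + 1).choose m = d * (w + d + 1).choose m + (w + d + 1).choose m := by
          ring
        have h5 : (w + d).choose m.succ = (w + d).choose (m + 1) := rfl
        simp only [Nat.succ_eq_add_one] at *
        omega
    rcases le_or_gt J v with hJv | hJv
    · have := h J (v - J)
      rwa [Nat.sub_add_cancel hJv] at this
    · have := h v 0
      rw [zero_add] at this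
      calc _ ≤ _ := this
        _ ≤ _ := by
          have : v * v.choose m ≤ J * v.choose m := Nat.mul_le_mul_right _ hJv.le
          have h0 : Nat.choose 0 (m + 1) ≤ (v - J).choose (m + 1) := by simp
          omega
  have h2 : v.choose (m + 1) * (m + 1) = v.choose m * (v - m) := Nat.choose_succ_right_eq v m
  have h3 : (v.choose (m + 1) : ℝ) * (m + 1) = v.choose m * ((v - m : ℕ) : ℝ) := by
    exact_mod_cast h2
  have h4 : (v : ℝ) / 2 ≤ ((v - m : ℕ) : ℝ) := by
    rw [Nat.cast_sub (by omega)]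
    have : (2 : ℝ) * (m + 1) ≤ v := by exact_mod_cast hv
    linarith
  have h5 : (v.choose (m + 1) : ℝ) ≤ (v - J).choose (m + 1) + J * v.choose m := by exact_mod_cast h1
  have h6 : (v.choose m : ℝ) * (v / 2) ≤ v.choose (m + 1) * (m + 1) := by rw [h3]; gcongr
  have h7 : (J : ℝ) * v.choose m ≤ η * v * v.choose m := by gcongr
  have h8 : η * ((v.choose m : ℝ) * (v / 2)) ≤ η * (v.choose (m + 1) * (m + 1)) := by gcongr
  push_cast
  simp only [Nat.succ_eq_add_one] at *
  nlinarith

/-- Absorption identities reduce the claim to monotonicity of binomial coefficients in the upper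
index. It bounds the exponent for an intersection of size `i` by the one at `v`, scaled by `i / v`
per element. -/
theorem choose_mul_mul_le {i v k : ℕ} (hk : 2 ≤ k) (hi : i ≤ v) :
    (i.choose k : ℝ) * k * v ≤ i ^ 2 * v.choose (k - 1) := by
  obtain ⟨m, rfl⟩ := Nat.exists_eq_add_of_le' hk
  rw [show m + 2 - 1 = m + 1 by omega]
  rcases Nat.eq_zero_or_pos i with rfl | hi0
  · simp
  obtain ⟨i', rfl⟩ := Nat.exists_eq_succ_of_ne_zero hi0.ne'
  obtain ⟨v', rfl⟩ := Nat.exists_eq_succ_of_ne_zero (by omega : v ≠ 0)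
  have h1 : (i' + 1) * i'.choose (m + 1) = (i' + 1).choose (m + 2) * (m + 2) :=
    Nat.add_one_mul_choose_eq i' (m + 1)
  have h2 : (i' + 1) * i'.choose m = (i' + 1).choose (m + 1) * (m + 1) :=
    Nat.add_one_mul_choose_eq i' m
  have h3 : (v' + 1) * v'.choose m = (v' + 1).choose (m + 1) * (m + 1) :=
    Nat.add_one_mul_choose_eq v' m
  have h4 : i'.choose m ≤ v'.choose m := Nat.choose_le_choose m (by omega)
  have h5 : i'.choose (m + 1) ≤ (i' + 1).choose (m + 1) := Nat.choose_le_choose _ (by omega)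
  have h6 : (m + 1) * ((i' + 1).choose (m + 2) * (m + 2) * (v' + 1)) ≤
      (m + 1) * ((i' + 1) ^ 2 * (v' + 1).choose (m + 1)) := by
    calc _ = (m + 1) * ((i' + 1) * i'.choose (m + 1) * (v' + 1)) := by rw [h1]
      _ ≤ (m + 1) * ((i' + 1) * (i' + 1).choose (m + 1) * (v' + 1)) := by gcongr
      _ = (i' + 1) * (v' + 1) * ((i' + 1).choose (m + 1) * (m + 1)) := by ring
      _ = (i' + 1) * (v' + 1) * ((i' + 1) * i'.choose m) := by rw [h2]
      _ ≤ (i' + 1) * (v' + 1) * ((i' + 1) * v'.choose m) := by gcongr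
      _ = (i' + 1) ^ 2 * ((v' + 1) * v'.choose m) := by ring
      _ = _ := by rw [h3]; ring
  have h7 := Nat.le_of_mul_le_mul_left h6 (by omega)
  exact_mod_cast h7

variable {n k r v : ℕ} {p : ℝ}

/-- Everything in `nearTerm` is an exact `j`-th power except $(j^j/j!)^2$, which is at most
$e^{2j}$; so the terms are dominated by a geometric progression. -/
theorem nearTerm_le {j : ℕ} {Q : ℝ} (hp0 : 0 < p) (hp1 : p ≤ 1 / 2) (hk : 2 ≤ k) (hj0 : 1 ≤ j)
    (hjv : j ≤ v) (hβ : atMostOne p (v.choose (k - 1)) ≤ 1 / 2)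
    (hQ : (1 - p) ^ (v.choose k - (v - j).choose k) ≤ Q ^ j) (hQ0 : 0 ≤ Q) :
    nearTerm n k p v r j ≤ (2 * Real.exp 1 ^ 2 * (p * (v : ℝ) ^ (k - 1)) ^ 2 * Q * (n / v) *
      (1 + 2 * k * r * (1 + p * (v : ℝ) ^ (k - 1)))) ^ j := by
  set β := atMostOne p (v.choose (k - 1))
  have hv0 : (0 : ℝ) < v := by exact_mod_cast (by omega : 0 < v)
  have hjv' : (j : ℝ) ≤ v := by exact_mod_cast hjv
  have hkv : (v : ℝ) ^ (k - 1) = v ^ (k - 2) * v := by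
    rw [← pow_succ]; congr 1; omega
  set L := p * (v : ℝ) ^ (k - 1) with hL
  have hL' : p * (v : ℝ) ^ (k - 2) = L / v := by rw [hL, hkv]; field_simp
  have hL0 : 0 < L := by positivity
  have hZ : (v + p * j ^ 2 * (v : ℝ) ^ (k - 2)) / (1 - p) ≤ 2 * v * (1 + L) := by
    rw [div_le_iff₀ (by linarith)]
    have h1 : p * j ^ 2 * (v : ℝ) ^ (k - 2) ≤ L * v := by
      calc _ = (p * (v : ℝ) ^ (k - 2)) * j ^ 2 := by ring
        _ ≤ (p * (v : ℝ) ^ (k - 2)) * v ^ 2 := by gcongr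
        _ = L * v := by rw [hL']; field_simp
    have h2 : 2 * v * (1 + L) * (1 / 2) ≤ 2 * v * (1 + L) * (1 - p) := by
      gcongr; linarith
    nlinarith
  have hX : v + k * r * ((v + p * j ^ 2 * (v : ℝ) ^ (k - 2)) / (1 - p)) ≤
      v * (1 + 2 * k * r * (1 + L)) := by
    calc _ ≤ v + k * r * (2 * v * (1 + L)) := by gcongr
      _ = _ := by ring
  have hβ2 : ((1 - β) ^ j)⁻¹ ≤ 2 ^ j := by
    rw [← inv_pow]
    refine pow_le_pow_left₀ (inv_nonneg.2 (by linarith)) ?_ j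
    rw [inv_le_comm₀ (by linarith) (by norm_num)]
    linarith
  have hX0 : 0 ≤ v + k * r * ((v + p * j ^ 2 * (v : ℝ) ^ (k - 2)) / (1 - p)) := by
    have : 0 < 1 - p := by linarith
    positivity
  calc nearTerm n k p v r j
      ≤ 2 ^ j * (p * j * (v : ℝ) ^ (k - 2)) ^ (2 * j) * Q ^ j * ((n : ℝ) ^ j / j.factorial *
        ((v * (1 + 2 * k * r * (1 + L))) ^ j / j.factorial)) := by
        have h1p : (0 : ℝ) ≤ (1 - p) ^ (v.choose k - (v - j).choose k) :=
          pow_nonneg (by linarith) _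
        unfold nearTerm
        gcongr
    _ = 2 ^ j * ((L / v) ^ 2) ^ j * Q ^ j * n ^ j * (v * (1 + 2 * k * r * (1 + L))) ^ j *
        ((j : ℝ) ^ j / j.factorial) ^ 2 := by
        rw [show p * j * (v : ℝ) ^ (k - 2) = L / v * j by rw [← hL']; ring, mul_pow (L / v),
          pow_mul, pow_mul', div_pow]
        ring
    _ ≤ 2 ^ j * ((L / v) ^ 2) ^ j * Q ^ j * n ^ j * (v * (1 + 2 * k * r * (1 + L))) ^ j *
        (Real.exp 1 ^ j) ^ 2 := by
        have := pow_div_factorial_le j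
        gcongr
    _ = (2 * Real.exp 1 ^ 2 * L ^ 2 * Q * (n / v) * (1 + 2 * k * r * (1 + L))) ^ j := by
        rw [← pow_mul (Real.exp 1), mul_comm j 2, pow_mul (Real.exp 1), ← mul_pow, ← mul_pow,
          ← mul_pow, ← mul_pow, ← mul_pow]
        congr 1
        field_simp

theorem sum_pow_Icc_le {w : ℝ} (hw0 : 0 ≤ w) (hw1 : w ≤ 1 / 2) (J : ℕ) :
    ∑ j ∈ Finset.Icc 1 J, w ^ j ≤ 2 * w := by
  have h : ∑ j ∈ Finset.Icc 1 J, w ^ j ≤ 2 * w - 2 * (w ^ J * w) := by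
    induction J with
    | zero => simp
    | succ J ih =>
      rw [Finset.sum_Icc_succ_top (by omega)]
      have : w ^ J * w * (1 / 2) ≥ w ^ J * w * w := by gcongr
      rw [pow_succ]
      linarith
  have := mul_nonneg (pow_nonneg hw0 J) hw0
  linarith

/-- Each of the three groups of factors is bounded by an `i`-th power; in the application `Λ` is
$\log(n/v)$, `K` a constant and `E = 1`. -/
theorem midTerm_le {i : ℕ} {K Λ E : ℝ} (hp0 : 0 < p) (hp1 : p ≤ 1 / 2) (hk : 2 ≤ k) (hi0 : 1 ≤ i)
    (hiv : i ≤ v) (hn : 0 < n) (hβ0 : 0 ≤ atMostOne p (v.choose (k - 1)))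
    (hβ : atMostOne p (v.choose (k - 1)) ≤ 1 / 2)
    (hΛ : -(v.choose (k - 1) * Real.log (1 - p)) ≤ k * (Λ + K)) (hK : 0 ≤ K)
    (hE : 4 * atMostOne p (v.choose (k - 1)) * n ≤ E * i) :
    midTerm n k p v i ≤ Real.exp (1 + Real.log (v * (v / n) / i) + i / v * Λ + K + E) ^ i := by
  set β := atMostOne p (v.choose (k - 1))
  have hi0' : (0 : ℝ) < i := by exact_mod_cast hi0
  have hv0 : (0 : ℝ) < v := by exact_mod_cast (by omega : 0 < v)
  have hn' : (0 : ℝ) < n := by exact_mod_cast hn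
  have hk0 : (0 : ℝ) < k := by exact_mod_cast (by omega : 0 < k)
  have hq : 0 < 1 - p := by linarith
  have h1 : (v.choose i : ℝ) * ((v : ℝ) / n) ^ i ≤
      (Real.exp 1 * (v * (v / n) / i)) ^ i := by
    have h2 : (v.choose i : ℝ) ≤ (v : ℝ) ^ i / i.factorial := Nat.choose_le_pow_div i v
    have h3 := pow_div_factorial_le i
    have h4 : ((i.factorial : ℝ))⁻¹ ≤ (Real.exp 1 / i) ^ i := by
      rw [div_pow, le_div_iff₀ (pow_pos hi0' _)]
      calc _ = (i : ℝ) ^ i / i.factorial := by rw [mul_comm, div_eq_mul_inv]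
        _ ≤ _ := h3
    calc _ ≤ (v : ℝ) ^ i * (Real.exp 1 / i) ^ i * ((v : ℝ) / n) ^ i := by
          gcongr
          refine h2.trans ?_
          rw [div_eq_mul_inv]
          gcongr
      _ = _ := by rw [← mul_pow, ← mul_pow]; congr 1; ring
  have h2 : ((1 - p) ^ i.choose k)⁻¹ ≤ Real.exp (i / v * Λ + K) ^ i := by
    rw [← Real.exp_log (inv_pos.2 (pow_pos hq (i.choose k))), ← Real.exp_nat_mul,
      Real.exp_le_exp, Real.log_inv, Real.log_pow]
    have h3 := choose_mul_mul_le hk hiv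
    have hlog : 0 ≤ -Real.log (1 - p) := by
      have := Real.log_nonpos hq.le (by linarith); linarith
    have h4 : (i.choose k : ℝ) ≤ i ^ 2 * v.choose (k - 1) / (k * v) := by
      rw [le_div_iff₀ (by positivity)]; linarith
    have hiv' : (i : ℝ) / v ≤ 1 := by
      rw [div_le_one hv0]; exact_mod_cast hiv
    calc -((i.choose k : ℝ) * Real.log (1 - p)) = i.choose k * -Real.log (1 - p) := by ring
      _ ≤ i ^ 2 * v.choose (k - 1) / (k * v) * -Real.log (1 - p) := by gcongr
      _ = i * (i / v) * (-(v.choose (k - 1) * Real.log (1 - p)) / k) := by field_simp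
      _ ≤ i * (i / v) * (Λ + K) := by
          have : -(v.choose (k - 1) * Real.log (1 - p)) / k ≤ Λ + K := by
            rw [div_le_iff₀ hk0]; linarith
          gcongr
      _ = i * (i / v * Λ + i / v * K) := by ring
      _ ≤ i * (i / v * Λ + 1 * K) := by gcongr
      _ = _ := by ring
  have h3 : ((1 - β) ^ (2 * (n - v)))⁻¹ ≤ Real.exp E ^ i := by
    refine (inv_one_sub_pow_le_exp hβ0 hβ _).trans ?_
    rw [← Real.exp_nat_mul, Real.exp_le_exp]
    have : ((2 * (n - v) : ℕ) : ℝ) ≤ 2 * n := by exact_mod_cast Nat.mul_le_mul_left 2 (Nat.sub_le n v)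
    calc 2 * β * ((2 * (n - v) : ℕ) : ℝ) ≤ 2 * β * (2 * n) := by gcongr
      _ = 4 * β * n := by ring
      _ ≤ _ := by linarith
  have h1b : 0 ≤ ((1 - β) ^ (2 * (n - v)))⁻¹ := inv_nonneg.2 (pow_nonneg (by linarith) _)
  calc midTerm n k p v i ≤ (Real.exp 1 * (v * (v / n) / i)) ^ i * Real.exp (i / v * Λ + K) ^ i *
        Real.exp E ^ i := by
        unfold midTerm
        gcongr
    _ = _ := by
        rw [← mul_pow, ← mul_pow]
        congr 1
        rw [Real.exp_add _ E, add_assoc _ _ K, Real.exp_add _ (_ + K), Real.exp_add 1,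
          Real.exp_log (by positivity)]

end Estimates

end

end RandomHypergraph

namespace RandomHypergraph

noncomputable section

/-! ### Smallness of the error terms in the second moment. -/

section SecondMomentAsymptotics

variable {n k r v : ℕ} {p K c : ℝ}

/-- In `atMostOne_eq` the power of `1 - p` is of order $x^k$ and the bracket is of order `l`, the
logarithm of `n`. -/
theorem atMostOne_le_of_le {l x : ℝ} (hp0 : 0 < p) (hp1 : p ≤ 1 / 2) (hK : 1 ≤ K) (hl : 1 ≤ l)
    (hx0 : 0 ≤ x) (hL : p * (v : ℝ) ^ (k - 1) ≤ K * l)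
    (hq : (1 - p) ^ v.choose (k - 1) ≤ K * x ^ k) :
    atMostOne p (v.choose (k - 1)) ≤ 3 * K ^ 2 * l * x ^ k := by
  rw [atMostOne_eq (by linarith)]
  have h1 : (v.choose (k - 1) : ℝ) ≤ (v : ℝ) ^ (k - 1) := by
    exact_mod_cast Nat.choose_le_pow v (k - 1)
  have h2 : p / (1 - p) ≤ 2 * p := by
    rw [div_le_iff₀ (by linarith)]; nlinarith
  have h3 : 1 + (v.choose (k - 1) : ℝ) * (p / (1 - p)) ≤ 3 * K * l := by
    have : (v.choose (k - 1) : ℝ) * (p / (1 - p)) ≤ (v : ℝ) ^ (k - 1) * (2 * p) := by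
      have : 0 ≤ p / (1 - p) := div_nonneg hp0.le (by linarith)
      gcongr
    have h4 : 1 ≤ K * l := by nlinarith
    nlinarith
  have h0 : 0 ≤ 1 + (v.choose (k - 1) : ℝ) * (p / (1 - p)) := by
    have : 0 ≤ p / (1 - p) := div_nonneg hp0.le (by linarith)
    positivity
  calc _ ≤ (K * x ^ k) * (3 * K * l) := by
        have : 0 ≤ K * x ^ k := by positivity
        gcongr
    _ = _ := by ring

/-- Going from `v` to `v - J` raises the bound to the power $1-\theta$. Since $x\ge 1/N$, this costs
at most $N^{k\theta}\le N^{c/2}$. -/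
theorem one_sub_pow_le_of_le {N x q η : ℝ} {J m : ℕ} (hq0 : 0 < q) (hq1 : q ≤ 1) (hK : 1 ≤ K)
    (hN : 1 ≤ N) (hx : N⁻¹ ≤ x) (hq : q ^ v.choose m ≤ K * x ^ k) (hm : 1 ≤ m) (hv : 2 * m ≤ v)
    (hJ : (J : ℝ) ≤ η * v) (hη : k * (2 * m * η) ≤ c / 2) (hη1 : 2 * m * η ≤ 1) :
    q ^ (v - J).choose m ≤ K * x ^ k * N ^ (c / 2) := by
  have hN0 : 0 < N := by linarith
  have hx0 : 0 < x := (inv_pos.2 hN0).trans_le hx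
  have hKx : 0 < K * x ^ k := by positivity
  have hη0 : 0 ≤ η := by
    have hv0 : (0 : ℝ) < v := by exact_mod_cast (by omega : 0 < v)
    by_contra h
    have := mul_neg_of_neg_of_pos (not_le.1 h) hv0
    linarith [(Nat.cast_nonneg J : (0 : ℝ) ≤ J)]
  have hθ0 : 0 ≤ 2 * m * η := by positivity
  have h1 := one_sub_mul_choose_le hm hv hJ
  generalize 2 * m * η = θ at *
  have h2 : q ^ (v - J).choose m ≤ (q ^ v.choose m) ^ (1 - θ) := by
    rw [← Real.rpow_natCast, ← Real.rpow_natCast, ← Real.rpow_mul hq0.le]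
    refine Real.rpow_le_rpow_of_exponent_ge hq0 hq1 ?_
    rw [mul_comm]; exact h1
  have h3 : (q ^ v.choose m) ^ (1 - θ) ≤ (K * x ^ k) ^ (1 - θ) :=
    Real.rpow_le_rpow (by positivity) hq (by linarith)
  refine (h2.trans h3).trans ?_
  rw [Real.rpow_sub hKx, Real.rpow_one, div_eq_mul_inv, ← Real.rpow_neg hKx.le]
  refine mul_le_mul_of_nonneg_left ?_ hKx.le
  have h4 : N⁻¹ ^ k ≤ K * x ^ k := by
    have h5 : N⁻¹ ^ k ≤ x ^ k := by gcongr
    have : 0 < x ^ k := by positivity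
    nlinarith
  calc (K * x ^ k) ^ (-θ) ≤ (N⁻¹ ^ k) ^ (-θ) :=
        Real.rpow_le_rpow_of_nonpos (by positivity) h4 (by linarith)
    _ = N ^ (k * θ) := by
        rw [inv_pow, Real.inv_rpow (by positivity), Real.rpow_neg (by positivity), inv_inv,
          ← Real.rpow_natCast, ← Real.rpow_mul hN0.le]
    _ ≤ _ := Real.rpow_le_rpow_of_exponent_le hN hη

/-- Up to logarithms and $N^{c/2}$, the ratio is $x^{k-1}(1+Nx^k)$. Both parts are at most $N^{-c}$:
the first because $k\ge2$, the second because $2k-1\ge k+1$. -/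
theorem nearTerm_base_le {l x N L Q R W : ℝ} (hk : 2 ≤ k) (hK : 1 ≤ K) (hl : 1 ≤ l)
    (hR : 0 ≤ R) (hL0 : 0 ≤ L) (hL : L ≤ K * l) (hQ0 : 0 ≤ Q) (hQ : Q ≤ K * x ^ k * N ^ (c / 2))
    (hx0 : 0 < x) (hx1 : x ≤ 1) (hN : 0 < N) (hx : x ≤ N ^ (-c))
    (hx' : N * x ^ (k + 1) ≤ N ^ (-c)) (hr : R ≤ K * l * (N * x ^ k)) (hW : W = x⁻¹) :
    2 * Real.exp 1 ^ 2 * L ^ 2 * Q * W * (1 + 2 * k * R * (1 + L)) ≤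
      16 * Real.exp 1 ^ 2 * k * K ^ 5 * (l ^ 4 * N ^ (-(c / 2))) := by
  have hl0 : 0 < l := by linarith
  have hk0 : (2 : ℝ) ≤ k := by exact_mod_cast hk
  have hKl : 1 ≤ K * l := by nlinarith
  have h1 : 1 + 2 * k * R * (1 + L) ≤ 4 * k * K ^ 2 * l ^ 2 * (1 + N * x ^ k) := by
    have e0 : 1 + L ≤ 2 * (K * l) := by linarith
    have e1 : 2 * k * R * (1 + L) ≤ 2 * k * (K * l * (N * x ^ k)) * (2 * (K * l)) := by
      gcongr
    have e2 : (1 : ℝ) ≤ 4 * k * K ^ 2 * l ^ 2 := by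
      have : (1 : ℝ) ≤ (K * l) ^ 2 := one_le_pow₀ hKl
      nlinarith
    calc _ ≤ 4 * k * K ^ 2 * l ^ 2 + 2 * k * (K * l * (N * x ^ k)) * (2 * (K * l)) := by linarith
      _ = _ := by ring
  have hxk : x ^ k * x⁻¹ = x ^ (k - 1) := by
    rw [← div_eq_mul_inv, div_eq_iff hx0.ne', ← pow_succ]; congr 1; omega
  have hxx : x ^ (k - 1) * (1 + N * x ^ k) ≤ 2 * N ^ (-c) := by
    have e1 : x ^ (k - 1) ≤ x := by
      calc _ ≤ x ^ 1 := pow_le_pow_of_le_one hx0.le hx1 (by omega)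
        _ = x := pow_one x
    have e2 : x ^ (k - 1) * (N * x ^ k) ≤ N * x ^ (k + 1) := by
      calc _ ≤ x * (N * x ^ k) := by gcongr
        _ = _ := by ring
    linarith
  have hNc : N ^ (c / 2) * N ^ (-c) = N ^ (-(c / 2)) := by
    rw [← Real.rpow_add hN]; congr 1; ring
  have hNp : 0 ≤ N ^ (c / 2) := Real.rpow_nonneg hN.le _
  have hW0 : 0 ≤ W := by rw [hW]; positivity
  have h1L : 0 ≤ 1 + 2 * k * R * (1 + L) := by positivity
  have s1 : 2 * Real.exp 1 ^ 2 * L ^ 2 * Q * W ≤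
      2 * Real.exp 1 ^ 2 * (K * l) ^ 2 * (K * x ^ k * N ^ (c / 2)) * W := by gcongr
  calc _ ≤ 2 * Real.exp 1 ^ 2 * (K * l) ^ 2 * (K * x ^ k * N ^ (c / 2)) * W *
        (4 * k * K ^ 2 * l ^ 2 * (1 + N * x ^ k)) :=
        mul_le_mul s1 h1 h1L (by positivity)
    _ = 8 * Real.exp 1 ^ 2 * k * K ^ 5 * l ^ 4 * N ^ (c / 2) *
        ((x ^ k * x⁻¹) * (1 + N * x ^ k)) := by rw [hW]; ring
    _ ≤ 8 * Real.exp 1 ^ 2 * k * K ^ 5 * l ^ 4 * N ^ (c / 2) * (2 * N ^ (-c)) := by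
        rw [hxk]
        exact mul_le_mul_of_nonneg_left hxx (by positivity)
    _ = 16 * Real.exp 1 ^ 2 * k * K ^ 5 * (l ^ 4 * (N ^ (c / 2) * N ^ (-c))) := by ring
    _ = _ := by rw [hNc]

/-- The fraction $c/(4k^2)$ of differing vertices is small enough that `one_sub_pow_le_of_le` loses
only $n^{c/2}$, half of the available saving $n^{-c}$. -/
theorem sum_nearTerm_le (hp0 : 0 < p) (hp1 : p ≤ 1 / 2) (hk : 2 ≤ k) (hK : 1 ≤ K) (hc : 0 < c)
    (hc1 : c ≤ 1) (hl : 1 ≤ Real.log n) (hv : 2 * k ≤ v)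
    (hβ : atMostOne p (v.choose (k - 1)) ≤ 1 / 2)
    (hx : (v / n : ℝ) ≤ (n : ℝ) ^ (-c)) (hx1 : (v / n : ℝ) ≤ 1)
    (hx' : (n : ℝ) * (v / n : ℝ) ^ (k + 1) ≤ (n : ℝ) ^ (-c))
    (hL : p * (v : ℝ) ^ (k - 1) ≤ K * Real.log n)
    (hq : (1 - p) ^ v.choose (k - 1) ≤ K * (v / n : ℝ) ^ k)
    (hr : (r : ℝ) ≤ K * Real.log n * (n * (v / n : ℝ) ^ k))
    (hw : 16 * Real.exp 1 ^ 2 * k * K ^ 5 * (Real.log n ^ 4 * (n : ℝ) ^ (-(c / 2))) ≤ 1 / 2) :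
    ∑ j ∈ Finset.Icc 1 ⌊c / (4 * k ^ 2) * v⌋₊, nearTerm n k p v r j ≤
      2 * (16 * Real.exp 1 ^ 2 * k * K ^ 5 * (Real.log n ^ 4 * (n : ℝ) ^ (-(c / 2)))) := by
  set l := Real.log n
  set x : ℝ := (v / n : ℝ) with hxd
  set η := c / (4 * (k : ℝ) ^ 2) with hη
  set J := ⌊η * v⌋₊ with hJ
  have hk0 : (2 : ℝ) ≤ k := by exact_mod_cast hk
  have hn0 : (0 : ℝ) < n := by
    rcases Nat.eq_zero_or_pos n with h | h
    · simp [l, h] at hl; linarith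
    · exact_mod_cast h
  have hn1 : (1 : ℝ) ≤ n := by exact_mod_cast Nat.cast_pos.1 hn0
  have hv0 : (0 : ℝ) < v := by exact_mod_cast (by omega : 0 < v)
  have hv1 : (1 : ℝ) ≤ v := by exact_mod_cast (by omega : 1 ≤ v)
  have hx0 : 0 < x := by positivity
  have hη0 : 0 < η := by positivity
  have hη1 : η ≤ 1 := by
    rw [hη, div_le_one (by positivity)]; nlinarith
  have hJv : (J : ℝ) ≤ η * v := Nat.floor_le (by positivity)
  have hJv' : J ≤ v := by
    have : (J : ℝ) ≤ v := hJv.trans (by nlinarith)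
    exact_mod_cast this
  set Q := (1 - p) ^ (v - J).choose (k - 1) with hQ
  have hq0 : 0 < 1 - p := by linarith
  set θ := 2 * ((k - 1 : ℕ) : ℝ) * η with hθ
  have hkc : ((k - 1 : ℕ) : ℝ) = k - 1 := by rw [Nat.cast_sub (by omega)]; simp
  have hθk : k * θ ≤ c / 2 := by
    rw [hθ, hkc, hη]
    rw [show (k : ℝ) * (2 * (k - 1) * (c / (4 * (k : ℝ) ^ 2))) = (c / 2) * ((k - 1) / k) by
      field_simp; ring]
    have : ((k : ℝ) - 1) / k ≤ 1 := by rw [div_le_one (by linarith)]; linarith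
    nlinarith
  have hθ0 : 0 ≤ θ := by positivity
  have hθ1 : θ ≤ 1 := by nlinarith
  have hQle : Q ≤ K * x ^ k * (n : ℝ) ^ (c / 2) := by
    have hnx : (n : ℝ)⁻¹ ≤ x := by
      rw [hxd, div_eq_mul_inv]
      have := inv_pos.2 hn0
      nlinarith
    exact one_sub_pow_le_of_le (η := η) hq0 (by linarith) hK hn1 hnx hq (by omega) (by omega) hJv
      hθk hθ1
  set w := 16 * Real.exp 1 ^ 2 * k * K ^ 5 * (l ^ 4 * (n : ℝ) ^ (-(c / 2))) with hwd
  have hw0 : 0 ≤ w := by positivity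
  refine le_trans (Finset.sum_le_sum (g := fun j => w ^ j) fun j hj => ?_)
    (sum_pow_Icc_le hw0 hw J)
  rw [Finset.mem_Icc] at hj
  have hQj : (1 - p) ^ (v.choose k - (v - j).choose k) ≤ Q ^ j := by
    rw [hQ, ← pow_mul]
    refine pow_le_pow_of_le_one hq0.le (by linarith) ?_
    refine le_trans ?_ (choose_sub_choose_ge (by omega) (hj.2.trans hJv'))
    rw [mul_comm]
    exact Nat.mul_le_mul_left j (Nat.choose_le_choose _ (by omega))
  refine (nearTerm_le hp0 hp1 hk hj.1 (hj.2.trans hJv') hβ hQj (by positivity)).trans ?_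
  refine pow_le_pow_left₀ (by positivity) ?_ j
  exact nearTerm_base_le hk hK hl (by linarith) (by positivity) hL (by positivity) hQle hx0 hx1 hn0
    hx hx' hr (by rw [hxd, inv_div])

/-- Here `y` is the overlap ratio `i / v`. Entropy gives `log (x / y)` and the common potential
edges cost `y * -log x`; three ranges of `y` are treated separately. -/
theorem log_div_add_mul_le {x y l η δ : ℝ} (hx0 : 0 < x) (hy0 : 0 < y) (hy1 : y ≤ 1 - η)
    (hη : 0 ≤ η) (hc : 0 < c) (hl : 0 ≤ l) (hΛ : c * l ≤ -Real.log x)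
    (hδ : Real.log (x / y) ≤ -δ * l) {c' : ℝ} (h1 : c' ≤ δ) (h2 : c' ≤ c / 4) (h3 : c' ≤ c * η) :
    Real.log (x / y) + y * -Real.log x ≤ 2 - c' * l := by
  have hcl : 0 ≤ c * l := by positivity
  have e1 : c' * l ≤ δ * l := by gcongr
  have e2 : c' * l ≤ c / 4 * l := by gcongr
  have e3 : c' * l ≤ c * η * l := by gcongr
  have hlog : Real.log (x / y) = Real.log x - Real.log y := Real.log_div hx0.ne' hy0.ne'
  set Λ := -Real.log x with hΛd
  have h4 : Real.log 4 ≤ 2 := by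
    have : Real.log 4 = 2 * Real.log 2 := by
      rw [show (4 : ℝ) = 2 ^ 2 by norm_num, Real.log_pow]; norm_num
    rw [this]; linarith [Real.log_two_lt_d9]
  -- For $y\le\sqrt x$ the second term is at most $2y\log(1/y)\le2$, and `hδ` makes the first one
  -- negative.
  rcases le_or_gt (y ^ 2) x with hyx | hyx
  · have e4 : Λ ≤ 2 * -Real.log y := by
      have := Real.log_le_log (by positivity) hyx
      rw [Real.log_pow] at this
      push_cast at this
      linarith
    have e5 : y * -Real.log y ≤ 1 := by
      have := Real.one_sub_inv_le_log_of_pos hy0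
      calc y * -Real.log y ≤ y * (y⁻¹ - 1) := by gcongr; linarith
        _ = 1 - y := by field_simp
        _ ≤ 1 := by linarith
    have e6 : y * Λ ≤ y * (2 * -Real.log y) := by gcongr
    linarith
  -- For $\sqrt x<y\le1/4$ the first term is at most half of `log x`, which beats a quarter of `-log
  -- x`. For $y>1/4$ only the gap $1-y\ge\eta$ remains, and it saves $\eta\log(1/x)$.
  · rcases le_or_gt y (1 / 4) with h5 | h5
    · have e4 : 2 * -Real.log y ≤ Λ := by
        have := Real.log_le_log hx0 hyx.le
        rw [Real.log_pow] at this
        push_cast at this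
        linarith
      have e5 : y * Λ ≤ 1 / 4 * Λ := by gcongr; linarith
      linarith
    · have e4 : -Real.log y ≤ Real.log 4 := by
        rw [← Real.log_inv]
        refine Real.log_le_log (by positivity) ?_
        rw [inv_le_comm₀ hy0 (by norm_num)]; linarith
      have e5 : y * Λ ≤ (1 - η) * Λ := by gcongr; linarith
      have e6 : η * (c * l) ≤ η * Λ := by gcongr
      nlinarith

/-- Each term is at most the `i`-th power of a fixed negative power of `n`, by `midTerm_le` and
`log_div_add_mul_le`. The cut-off near equality supplies $i/v\le1-\eta$, the other cut-off supplies
`hδ`. -/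
theorem sum_midTerm_le (hp0 : 0 < p) (hp1 : p ≤ 1 / 2) (hk : 2 ≤ k) (hK : 1 ≤ K) (hc : 0 < c)
    (hl : 1 ≤ Real.log n) (hv : 1 ≤ v)
    (hβ : atMostOne p (v.choose (k - 1)) ≤ 1 / 2)
    (hβ' : atMostOne p (v.choose (k - 1)) ≤ 3 * K ^ 2 * Real.log n * (v / n : ℝ) ^ k)
    (hx : (v / n : ℝ) ≤ (n : ℝ) ^ (-c)) (hx1 : (v / n : ℝ) ≤ 1)
    (hq : (v / n : ℝ) ^ k ≤ K * (1 - p) ^ v.choose (k - 1))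
    (hE : 12 * K ^ 2 * Real.log n ≤ (n : ℝ) ^ (c / (2 * k)))
    {c' : ℝ} (h1 : c' ≤ c / (2 * k)) (h2 : c' ≤ c / 4) (h3 : c' ≤ c * (c / (4 * k ^ 2)))
    (hw : Real.exp (4 + Real.log K) * (n : ℝ) ^ (-c') ≤ 1 / 2) :
    ∑ i ∈ (Finset.range (v - ⌊c / (4 * k ^ 2) * v⌋₊)).filter
      (fun i => ⌊(n : ℝ) ^ (c / (2 * k)) * (n * (v / n : ℝ) ^ 2)⌋₊ < i), midTerm n k p v i ≤
      2 * (Real.exp (4 + Real.log K) * (n : ℝ) ^ (-c')) := by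
  set l := Real.log n with hld
  set x : ℝ := (v / n : ℝ) with hxd
  set η := c / (4 * (k : ℝ) ^ 2) with hη
  set δ := c / (2 * (k : ℝ)) with hδ
  have hk0 : (2 : ℝ) ≤ k := by exact_mod_cast hk
  have hn0 : (0 : ℝ) < n := by
    rcases Nat.eq_zero_or_pos n with h | h
    · simp [l, h] at hl; linarith
    · exact_mod_cast h
  have hv0 : (0 : ℝ) < v := by exact_mod_cast (by omega : 0 < v)
  have hx0 : 0 < x := by positivity
  have hη0 : 0 < η := by positivity
  have hlogK : 0 ≤ Real.log K := Real.log_nonneg hK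
  have hq0 : 0 < 1 - p := by linarith
  set w := Real.exp (4 + Real.log K) * (n : ℝ) ^ (-c') with hwd
  have hw0 : 0 ≤ w := by positivity
  have hwexp : w = Real.exp (4 + Real.log K - c' * l) := by
    rw [hwd, Real.rpow_def_of_pos hn0, ← Real.exp_add, ← hld]; ring_nf
  refine le_trans ?_ (sum_pow_Icc_le hw0 hw v)
  have hsub : (Finset.range (v - ⌊η * v⌋₊)).filter (fun i => ⌊(n : ℝ) ^ δ * (n * x ^ 2)⌋₊ < i) ⊆
      Finset.Icc 1 v := by
    intro i hi
    rw [Finset.mem_filter, Finset.mem_range] at hi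
    rw [Finset.mem_Icc]; omega
  refine le_trans (Finset.sum_le_sum fun i hi => ?_)
    (Finset.sum_le_sum_of_subset_of_nonneg hsub fun i _ _ => pow_nonneg hw0 i)
  have hi' := Finset.mem_Icc.1 (hsub hi)
  rw [Finset.mem_filter, Finset.mem_range] at hi
  have hi0 : (0 : ℝ) < i := by exact_mod_cast hi'.1
  have hI : (n : ℝ) ^ δ * (n * x ^ 2) < i := (Nat.floor_lt (by positivity)).1 hi.2
  have hiη : (i : ℝ) ≤ (1 - η) * v := by
    have e1 : i + 1 + ⌊η * v⌋₊ ≤ v := by omega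
    have e2 : (i : ℝ) + 1 + ⌊η * v⌋₊ ≤ v := by exact_mod_cast e1
    have e3 := Nat.lt_floor_add_one (η * (v : ℝ))
    linarith
  -- Above the lower cut-off, dropping all conditions at outside vertices costs at most $e^i$.
  have hEi : 4 * atMostOne p (v.choose (k - 1)) * n ≤ 1 * i := by
    have e1 : x ^ k ≤ x ^ 2 := pow_le_pow_of_le_one hx0.le hx1 hk
    calc _ ≤ 4 * (3 * K ^ 2 * l * x ^ k) * n := by gcongr
      _ ≤ 4 * (3 * K ^ 2 * l * x ^ 2) * n := by gcongr
      _ = (12 * K ^ 2 * l) * (n * x ^ 2) := by ring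
      _ ≤ (n : ℝ) ^ δ * (n * x ^ 2) := by gcongr
      _ ≤ _ := by linarith
  have hΛ : -(v.choose (k - 1) * Real.log (1 - p)) ≤ k * (-Real.log x + Real.log K) := by
    have e1 := Real.log_le_log (by positivity) hq
    rw [Real.log_mul (by positivity) (by positivity), Real.log_pow, Real.log_pow] at e1
    nlinarith
  have hm := midTerm_le (E := 1) hp0 hp1 hk hi'.1 hi'.2 (by exact_mod_cast hn0)
    (atMostOne_nonneg hp0.le (by linarith) _) hβ hΛ hlogK hEi
  refine hm.trans (pow_le_pow_left₀ (Real.exp_pos _).le ?_ i)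
  rw [hwexp, Real.exp_le_exp]
  have hvx : (v : ℝ) * (v / n) / i = x / (i / v) := by rw [hxd]; field_simp
  have hlogx : c * l ≤ -Real.log x := by
    have := Real.log_le_log hx0 hx
    rw [Real.log_rpow hn0] at this
    linarith
  have hδl : Real.log (x / (i / v)) ≤ -δ * l := by
    rw [← Real.log_rpow hn0]
    refine Real.log_le_log (by positivity) ?_
    rw [← hvx, div_le_iff₀ hi0, Real.rpow_neg hn0.le, inv_mul_eq_div,
      le_div_iff₀ (by positivity)]
    have : (v : ℝ) * (v / n) = n * x ^ 2 := by rw [hxd]; field_simp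
    rw [this]; linarith
  have := log_div_add_mul_le (c := c) hx0 (by positivity : (0 : ℝ) < i / v)
    (by rwa [div_le_iff₀ hv0]) hη0.le hc (by linarith) hlogx hδl h1 h2 h3
  rw [hvx]
  linarith

/-- For small intersections the base is at most $(1-\beta)^2e^{4\beta^2}$. Vertices in the symmetric
difference were dropped from the exponent, at a cost of $e^{4\beta v}$, and the common potential
edges cost $e^z$. -/
theorem far_pow_le {i : ℕ} {z : ℝ} (hp0 : 0 < p) (hp1 : p ≤ 1 / 2) (hk : 2 ≤ k) (hvn : 2 * v ≤ n)
    (hi : i ≤ v) (hβ : atMostOne p (v.choose (k - 1)) ≤ 1 / 2) (hz : 2 * p * (i : ℝ) ^ k ≤ z)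
    (hz2 : z ≤ Real.log 2) :
    (1 - 2 * atMostOne p (v.choose (k - 1)) +
      atMostOne p (v.choose (k - 1)) ^ 2 / (1 - p) ^ i.choose (k - 1)) ^ (n - (2 * v - i)) ≤
    Real.exp (4 * atMostOne p (v.choose (k - 1)) ^ 2 * n +
      4 * atMostOne p (v.choose (k - 1)) * v + z) *
      (1 - atMostOne p (v.choose (k - 1))) ^ (2 * (n - v)) * (1 - p) ^ i.choose k := by
  have hβ0 := atMostOne_nonneg hp0.le (by linarith) (v.choose (k - 1))
  set β := atMostOne p (v.choose (k - 1))
  have hq0 : 0 < 1 - p := by linarith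
  have hb : 0 < 1 - β := by linarith
  have hg1 : ((1 - p) ^ i.choose (k - 1))⁻¹ ≤ 2 := by
    rcases Nat.eq_zero_or_pos i with rfl | hi0
    · rw [Nat.choose_eq_zero_of_lt (by omega)]; norm_num
    · refine (inv_one_sub_pow_le_exp hp0.le hp1 _).trans ?_
      rw [← Real.le_log_iff_exp_le (by norm_num)]
      refine le_trans ?_ hz2
      refine le_trans ?_ hz
      have h1 : (i.choose (k - 1) : ℝ) ≤ (i : ℝ) ^ k := by
        have h2 : i.choose (k - 1) ≤ i ^ k :=
          (Nat.choose_le_pow _ _).trans (Nat.pow_le_pow_right hi0 (by omega))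
        exact_mod_cast h2
      gcongr
  have hg2 : ((1 - p) ^ i.choose k)⁻¹ ≤ Real.exp z := by
    refine (inv_one_sub_pow_le_exp hp0.le hp1 _).trans (Real.exp_le_exp.2 ?_)
    refine le_trans ?_ hz
    have h1 : (i.choose k : ℝ) ≤ (i : ℝ) ^ k := by exact_mod_cast Nat.choose_le_pow _ _
    gcongr
  have hbase : 1 - 2 * β + β ^ 2 / (1 - p) ^ i.choose (k - 1) ≤
      (1 - β) ^ 2 * Real.exp (4 * β ^ 2) := by
    have h1 : 1 + 4 * β ^ 2 ≤ Real.exp (4 * β ^ 2) := by linarith [Real.add_one_le_exp (4 * β ^ 2)]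
    have h2 : β ^ 2 / (1 - p) ^ i.choose (k - 1) ≤ β ^ 2 * 2 := by
      rw [div_eq_mul_inv]; gcongr
    have h3 : (1 - β) ^ 2 * (1 + 4 * β ^ 2) ≤ (1 - β) ^ 2 * Real.exp (4 * β ^ 2) := by gcongr
    have h4 : β ^ 2 ≤ 4 * (1 - β) ^ 2 * β ^ 2 := by
      have : 1 ≤ 4 * (1 - β) ^ 2 := by nlinarith
      nlinarith [sq_nonneg β]
    nlinarith
  have hbase0 : 0 ≤ 1 - 2 * β + β ^ 2 / (1 - p) ^ i.choose (k - 1) := by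
    have h1 : β ^ 2 ≤ β ^ 2 / (1 - p) ^ i.choose (k - 1) :=
      le_div_self (sq_nonneg _) (pow_pos hq0 _) (pow_le_one₀ hq0.le (by linarith))
    nlinarith [sq_nonneg (1 - β)]
  set m := n - (2 * v - i) with hm
  have hmn : (m : ℝ) ≤ n := by exact_mod_cast Nat.sub_le _ _
  have h1 := pow_le_pow_left₀ hbase0 hbase m
  have h2 : (1 - β) ^ (2 * m) ≤ (1 - β) ^ (2 * (n - v)) * Real.exp (4 * β * v) := by
    have e1 : 2 * (n - v) = 2 * m + 2 * (v - i) := by omega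
    have e2 := inv_one_sub_pow_le_exp hβ0 hβ (2 * (v - i))
    have e3 : Real.exp (2 * β * ((2 * (v - i) : ℕ) : ℝ)) ≤ Real.exp (4 * β * v) := by
      rw [Real.exp_le_exp]
      have : ((2 * (v - i) : ℕ) : ℝ) ≤ 2 * v := by
        exact_mod_cast Nat.mul_le_mul_left 2 (Nat.sub_le v i)
      calc _ ≤ 2 * β * (2 * v) := by gcongr
        _ = _ := by ring
    calc (1 - β) ^ (2 * m) = (1 - β) ^ (2 * (n - v)) * ((1 - β) ^ (2 * (v - i)))⁻¹ := by
          rw [eq_mul_inv_iff_mul_eq₀ (pow_pos hb _).ne', ← pow_add, e1]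
      _ ≤ _ := by gcongr; exact e2.trans e3
  have h3 : Real.exp (4 * β ^ 2) ^ m ≤ Real.exp (4 * β ^ 2 * n) := by
    rw [← Real.exp_nat_mul, Real.exp_le_exp, mul_comm]; gcongr
  calc _ ≤ ((1 - β) ^ 2 * Real.exp (4 * β ^ 2)) ^ m := h1
    _ = (1 - β) ^ (2 * m) * Real.exp (4 * β ^ 2) ^ m := by rw [mul_pow, pow_mul]
    _ ≤ ((1 - β) ^ (2 * (n - v)) * Real.exp (4 * β * v)) * Real.exp (4 * β ^ 2 * n) := by gcongr
    _ = ((1 - β) ^ (2 * (n - v)) * Real.exp (4 * β * v)) * Real.exp (4 * β ^ 2 * n) * 1 := by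
        rw [mul_one]
    _ ≤ ((1 - β) ^ (2 * (n - v)) * Real.exp (4 * β * v)) * Real.exp (4 * β ^ 2 * n) *
        (Real.exp z * (1 - p) ^ i.choose k) := by
        gcongr
        rwa [inv_le_iff_one_le_mul₀ (pow_pos hq0 _)] at hg2
    _ = _ := by rw [Real.exp_add, Real.exp_add]; ring

end SecondMomentAsymptotics

end

end RandomHypergraph

/-! ### The second moment method in the limit. -/

namespace RandomHypergraph

noncomputable section

theorem prob_nonneg {n k : ℕ} {p : ℝ} (hp0 : 0 ≤ p) (hp1 : p ≤ 1)
    (A : Finset (Finset (Fin n)) → Prop) : 0 ≤ prob n k p A := by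
  rw [prob_eq_bernProb]; exact bernProb_nonneg hp0 hp1 _ _

theorem prob_le_one {n k : ℕ} {p : ℝ} (hp0 : 0 ≤ p) (hp1 : p ≤ 1)
    (A : Finset (Finset (Fin n)) → Prop) : prob n k p A ≤ 1 := by
  rw [prob_eq_bernProb]; exact bernProb_le_one hp0 hp1 _ _

/-- Collects the near, intermediate and far contributions in `one_le_prob_mul`: every error is a
power of $\log n$ times a negative power of $n$, so the factor multiplying the probability tends to
`1`. -/
theorem tendsto_prob_le_indepNum_add {k : ℕ} (hk : 2 ≤ k) {p : ℕ → ℝ} {v r : ℕ → ℕ} {K c : ℝ}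
    (hK : 1 ≤ K) (hc : 0 < c) (hc1 : c ≤ 1) (hp : ∀ᶠ n in atTop, 0 < p n)
    (hp0 : Tendsto p atTop (𝓝 0)) (hv : Tendsto v atTop atTop)
    (hx : ∀ᶠ n : ℕ in atTop, (v n / n : ℝ) ≤ (n : ℝ) ^ (-c))
    (hx' : ∀ᶠ n : ℕ in atTop, (n : ℝ) * (v n / n : ℝ) ^ (k + 1) ≤ (n : ℝ) ^ (-c))
    (hL : ∀ᶠ n : ℕ in atTop, p n * (v n : ℝ) ^ (k - 1) ≤ K * Real.log n)
    (hq : ∀ᶠ n : ℕ in atTop, (1 - p n) ^ (v n).choose (k - 1) ≤ K * (v n / n : ℝ) ^ k)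
    (hq' : ∀ᶠ n : ℕ in atTop, (v n / n : ℝ) ^ k ≤ K * (1 - p n) ^ (v n).choose (k - 1))
    (hr : ∀ᶠ n : ℕ in atTop, (r n : ℝ) ≤ K * Real.log n * (n * (v n / n : ℝ) ^ k))
    (hr' : ∀ᶠ n : ℕ in atTop, (r n : ℝ) * (1 - p n) ≤ p n * (v n - k * r n).choose k)
    (hT : Tendsto (fun n => expAug n k (p n) (v n) (r n)) atTop atTop) :
    Tendsto (fun n => prob n k (p n) (fun H => v n ≤ indepNum H + r n)) atTop (𝓝 1) := by
  have hk0 : (2 : ℝ) ≤ k := by exact_mod_cast hk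
  set c' := min (min (c / (2 * k)) (c / 4)) (c * (c / (4 * k ^ 2))) with hc'
  have hc'0 : 0 < c' := by positivity
  have h1 : c' ≤ c / (2 * k) := (min_le_left _ _).trans (min_le_left _ _)
  have h2 : c' ≤ c / 4 := (min_le_left _ _).trans (min_le_right _ _)
  have h3 : c' ≤ c * (c / (4 * k ^ 2)) := min_le_right _ _
  set ν : ℕ → ℝ := fun n =>
    16 * Real.exp 1 ^ 2 * k * K ^ 5 * (Real.log n ^ 4 * (n : ℝ) ^ (-(c / 2))) with hν
  have hν0 : Tendsto ν atTop (𝓝 0) := by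
    simpa using (tendsto_log_pow_mul_rpow_neg 4 (c := c / 2) (by positivity)).const_mul
      (16 * Real.exp 1 ^ 2 * k * K ^ 5)
  set μ : ℕ → ℝ := fun n => Real.exp (4 + Real.log K) * (n : ℝ) ^ (-c') with hμ
  have hμ0 : Tendsto μ atTop (𝓝 0) := by
    simpa using (tendsto_log_pow_mul_rpow_neg 0 hc'0).const_mul (Real.exp (4 + Real.log K))
  set z : ℕ → ℝ := fun n => 2 * K * (Real.log n ^ 1 * (n : ℝ) ^ (-(c / 2))) with hz
  have hz0 : Tendsto z atTop (𝓝 0) := by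
    simpa [hz] using (tendsto_log_pow_mul_rpow_neg 1 (c := c / 2) (by positivity)).const_mul (2 * K)
  -- The three terms bound $4\beta^2n$, $4\beta v$ and the cost of common potential edges, using
  -- $\beta\le3K^2\log n\,(v/n)^k$.
  set e : ℕ → ℝ := fun n => 36 * K ^ 4 * (Real.log n ^ 2 * (n : ℝ) ^ (-c)) +
    12 * K ^ 2 * (Real.log n ^ 1 * (n : ℝ) ^ (-c)) + z n with he
  have he0 : Tendsto e atTop (𝓝 0) := by
    simpa [he] using (((tendsto_log_pow_mul_rpow_neg 2 hc).const_mul (36 * K ^ 4)).add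
      ((tendsto_log_pow_mul_rpow_neg 1 hc).const_mul (12 * K ^ 2))).add hz0
  set β : ℕ → ℝ := fun n => 3 * K ^ 2 * (Real.log n ^ 1 * (n : ℝ) ^ (-c)) with hβd
  have hβ0 : Tendsto β atTop (𝓝 0) := by
    simpa [hβd] using (tendsto_log_pow_mul_rpow_neg 1 hc).const_mul (3 * K ^ 2)
  have hnc : Tendsto (fun n : ℕ => (n : ℝ) ^ (-c)) atTop (𝓝 0) := by
    simpa using tendsto_log_pow_mul_rpow_neg 0 hc
  have hE : Tendsto (fun n : ℕ => 12 * K ^ 2 * (Real.log n ^ 1 * (n : ℝ) ^ (-(c / (2 * k)))))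
      atTop (𝓝 0) := by
    simpa using (tendsto_log_pow_mul_rpow_neg 1 (c := c / (2 * k)) (by positivity)).const_mul
      (12 * K ^ 2)
  set G : ℕ → ℝ := fun n => (1 + 2 * ν n) / expAug n k (p n) (v n) (r n) +
    (1 + (Real.exp (e n) - 1) + 2 * μ n) with hG
  have hG1 : Tendsto G atTop (𝓝 1) := by
    have h4 : Tendsto (fun n => Real.exp (e n)) atTop (𝓝 1) := by
      simpa [Function.comp_def] using (Real.continuous_exp.tendsto 0).comp he0
    have h5 := ((hν0.const_mul 2).const_add 1).div_atTop hT
    have h6 := h5.add (((h4.sub_const 1).const_add 1).add (hμ0.const_mul 2))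
    simpa [hG] using h6
  have key : ∀ᶠ n in atTop, 0 < p n ∧ p n ≤ 1 ∧ 0 < G n ∧
      1 ≤ prob n k (p n) (fun H => v n ≤ indepNum H + r n) * G n := by
    filter_upwards [hp, hp0.eventually (ge_mem_nhds (by norm_num : (0 : ℝ) < 1 / 2)),
      hv.eventually_ge_atTop (2 * k), hx, hx', hL, hq, hq', hr, hr', hT.eventually_gt_atTop 0,
      tendsto_log_natCast.eventually_ge_atTop 1,
      hν0.eventually (ge_mem_nhds (by norm_num : (0 : ℝ) < 1 / 2)),
      hμ0.eventually (ge_mem_nhds (by norm_num : (0 : ℝ) < 1 / 2)),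
      hz0.eventually (ge_mem_nhds (Real.log_pos (by norm_num : (1 : ℝ) < 2))),
      hβ0.eventually (ge_mem_nhds (by norm_num : (0 : ℝ) < 1 / 2)),
      hnc.eventually (ge_mem_nhds (by norm_num : (0 : ℝ) < 1 / 2)),
      hE.eventually (ge_mem_nhds (by norm_num : (0 : ℝ) < 1)),
      hG1.eventually (lt_mem_nhds (by norm_num : (0 : ℝ) < 1)), eventually_gt_atTop 0] with n
      hp hp1 hv hx hx' hL hq hq' hr hr' hT hl hν hμ hz1 hβ1 hnc hE hG hn
    refine ⟨hp, by linarith, hG, ?_⟩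
    have hn0 : (0 : ℝ) < n := by exact_mod_cast hn
    set x : ℝ := (v n / n : ℝ) with hxd
    have hvx : (v n : ℝ) = n * x := by rw [hxd]; field_simp
    have hv0 : (0 : ℝ) < v n := by exact_mod_cast (by omega : 0 < v n)
    have hx0 : 0 < x := by positivity
    have hx1 : x ≤ 1 := by linarith
    have hb := atMostOne_le_of_le hp hp1 hK hl hx0.le hL hq
    have hlc : Real.log n * x ^ k ≤ Real.log n * (n : ℝ) ^ (-c) := by
      refine mul_le_mul_of_nonneg_left (le_trans ?_ hx) (by linarith)
      exact pow_le_of_le_one hx0.le hx1 (by omega)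
    have hb' : atMostOne (p n) ((v n).choose (k - 1)) ≤ 1 / 2 := by
      refine le_trans hb (le_trans ?_ hβ1)
      simp only [hβd, pow_one]
      have := mul_le_mul_of_nonneg_left hlc (by positivity : 0 ≤ 3 * K ^ 2)
      linarith
    have hb0 := atMostOne_nonneg hp.le (by linarith) ((v n).choose (k - 1))
    have hvn : 2 * v n ≤ n := by
      have : (2 * v n : ℝ) ≤ n := by rw [hvx]; nlinarith
      exact_mod_cast this
    have hx2k : (n : ℝ) * x ^ (2 * k) ≤ (n : ℝ) ^ (-c) := by
      refine le_trans ?_ hx'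
      exact mul_le_mul_of_nonneg_left (pow_le_pow_of_le_one hx0.le hx1 (by omega)) hn0.le
    have hnear := sum_nearTerm_le hp hp1 hk hK hc hc1 hl hv hb' hx hx1 hx' hL hq hr hν
    have hE' : 12 * K ^ 2 * Real.log n ≤ (n : ℝ) ^ (c / (2 * k)) := by
      have h4 : (n : ℝ) ^ (-(c / (2 * k))) * (n : ℝ) ^ (c / (2 * k)) = 1 := by
        rw [← Real.rpow_add hn0]; simp
      have h5 : (0 : ℝ) < (n : ℝ) ^ (c / (2 * k)) := by positivity
      calc 12 * K ^ 2 * Real.log n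
          = 12 * K ^ 2 * (Real.log n ^ 1 * (n : ℝ) ^ (-(c / (2 * k)))) * (n : ℝ) ^ (c / (2 * k)) := by
            linear_combination (-12 * K ^ 2 * Real.log n) * h4
        _ ≤ 1 * (n : ℝ) ^ (c / (2 * k)) := by gcongr
        _ = _ := one_mul _
    have hmid := sum_midTerm_le hp hp1 hk hK hc hl (by omega) hb' hb hx hx1 hq' hE' h1 h2 h3 hμ
    refine (one_le_prob_mul hp (by linarith) hk hvn (by omega) (by linarith) hr' hT
      (δ := Real.exp (e n) - 1) ?_ ?_ hnear hmid)
    · intro i hi hiv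
      have hfar := far_pow_le (z := z n) hp hp1 hk hvn hiv hb' ?_ hz1
      · refine hfar.trans ?_
        have hb2 : (0 : ℝ) ≤ 1 - atMostOne (p n) ((v n).choose (k - 1)) := by linarith
        have hp2 : (0 : ℝ) ≤ 1 - p n := by linarith
        rw [add_sub_cancel]
        gcongr
        simp only [he, pow_one]
        have e1 : atMostOne (p n) ((v n).choose (k - 1)) ^ 2 * n ≤
            9 * K ^ 4 * (Real.log n ^ 2 * (n : ℝ) ^ (-c)) := by
          calc atMostOne (p n) ((v n).choose (k - 1)) ^ 2 * n
              ≤ (3 * K ^ 2 * Real.log n * x ^ k) ^ 2 * n := by gcongr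
            _ = 9 * K ^ 4 * (Real.log n ^ 2 * (n * x ^ (2 * k))) := by ring
            _ ≤ _ := by gcongr
        have e2 : atMostOne (p n) ((v n).choose (k - 1)) * v n ≤
            3 * K ^ 2 * (Real.log n * (n : ℝ) ^ (-c)) := by
          calc atMostOne (p n) ((v n).choose (k - 1)) * v n
              ≤ (3 * K ^ 2 * Real.log n * x ^ k) * (n * x) := by rw [hvx]; gcongr
            _ = 3 * K ^ 2 * (Real.log n * (n * x ^ (k + 1))) := by ring
            _ ≤ _ := by gcongr
        linarith
      · have h4 : (i : ℝ) ≤ (n : ℝ) ^ (c / (2 * k)) * (n * x ^ 2) :=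
          (Nat.cast_le.2 hi).trans (Nat.floor_le (by positivity))
        have h5 : ((n : ℝ) ^ (c / (2 * k))) ^ k = (n : ℝ) ^ (c / 2) := by
          rw [← Real.rpow_natCast, ← Real.rpow_mul hn0.le]; congr 1; field_simp
        have h6 : (n : ℝ) ^ (c / 2) * (n : ℝ) ^ (-c) = (n : ℝ) ^ (-(c / 2)) := by
          rw [← Real.rpow_add hn0]; congr 1; ring
        obtain ⟨m, rfl⟩ : ∃ m, k = m + 1 := ⟨k - 1, by omega⟩
        simp only [Nat.add_sub_cancel] at hL
        -- With $x=v/n$ and $k=m+1$, one has $p(nx^2)^k=pv^{k-1}\cdot nx^{k+1}$; the first factor is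
        -- $O(\log n)$ and the second at most $n^{-c}$.
        calc 2 * p n * (i : ℝ) ^ (m + 1)
            ≤ 2 * p n * ((n : ℝ) ^ (c / (2 * (m + 1 : ℕ))) * (n * x ^ 2)) ^ (m + 1) := by gcongr
          _ = 2 * (p n * (v n : ℝ) ^ m) * (n * x ^ (m + 1 + 1)) * (n : ℝ) ^ (c / 2) := by
              rw [mul_pow, h5, hvx]; ring
          _ ≤ 2 * (K * Real.log n) * (n : ℝ) ^ (-c) * (n : ℝ) ^ (c / 2) := by
              have : 0 ≤ K * Real.log n := by positivity
              gcongr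
          _ = z n := by
              simp only [z, pow_one]; rw [← h6]; ring
    · have : 0 ≤ e n := by
        have : 0 ≤ Real.log n := by linarith
        simp only [he, z]; positivity
      linarith [Real.add_one_le_exp (e n)]
  refine tendsto_of_tendsto_of_tendsto_of_le_of_le' (g := fun n => (G n)⁻¹) ?_ tendsto_const_nhds
    ?_ ?_
  · simpa using hG1.inv₀ one_ne_zero
  · filter_upwards [key] with n ⟨_, _, hG, h⟩
    rw [inv_eq_one_div, div_le_iff₀ hG]; exact h
  · filter_upwards [key] with n ⟨h1, h2, _, h⟩
    exact prob_le_one h1.le h2 _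

end

end RandomHypergraph

/-! ### Critical sequences of set sizes and their stability. -/

namespace RandomHypergraph

noncomputable section

/-- A sequence `s` of set sizes for which the expected number of independent sets of size `s n` has
a critical exponent, up to an error of smaller order. -/
structure IsCritical (k : ℕ) (p : ℕ → ℝ) (c : ℝ) (s : ℕ → ℕ) : Prop where
  two_le : 2 ≤ k
  c_pos : 0 < c
  pos : ∀ᶠ n in atTop, 0 < p n
  tendsto_p : Tendsto p atTop (𝓝 0)
  log_div : Tendsto (fun n : ℕ => Real.log n / s n) atTop (𝓝 0)
  small : Tendsto (fun n : ℕ => (n : ℝ) ^ c * (s n / n : ℝ)) atTop (𝓝 0)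
  small' : Tendsto (fun n : ℕ => (n : ℝ) ^ c * (n * (s n / n : ℝ) ^ (k + 1))) atTop (𝓝 0)
  -- This is $\frac ks\bigl(s(1+\log\frac ns)+\binom sk\log(1-p)\bigr)$ with $\frac ks\binom
  -- sk=\binom{s-1}{k-1}$ replaced by $\binom s{k-1}$: the logarithm of $\mathbb E[X_s]$ to leading
  -- order.
  crit : Tendsto (fun n : ℕ => (s n).choose (k - 1) * Real.log (1 - p n) +
    k * (1 + Real.log (n / s n))) atTop (𝓝 0)
  s_pos : ∀ᶠ n in atTop, 0 < s n

theorem tendsto_log_one_sub_div {p : ℕ → ℝ} (hp : ∀ᶠ n in atTop, 0 < p n)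
    (hp0 : Tendsto p atTop (𝓝 0)) :
    Tendsto (fun n => -Real.log (1 - p n) / p n) atTop (𝓝 1) := by
  have h1 : Tendsto (fun n => (1 - p n)⁻¹) atTop (𝓝 1) := by
    simpa using (hp0.const_sub 1).inv₀ (by norm_num)
  refine tendsto_of_tendsto_of_tendsto_of_le_of_le' (g := fun _ => 1) tendsto_const_nhds h1 ?_ ?_
  · filter_upwards [hp, hp0.eventually (gt_mem_nhds (by norm_num : (0 : ℝ) < 1))] with n h0 h1
    rw [le_div_iff₀ h0]
    have := Real.log_le_sub_one_of_pos (by linarith : 0 < 1 - p n)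
    linarith
  · filter_upwards [hp, hp0.eventually (gt_mem_nhds (by norm_num : (0 : ℝ) < 1))] with n h0 h1
    rw [div_le_iff₀ h0]
    have h2 : 0 < 1 - p n := by linarith
    have := Real.one_sub_inv_le_log_of_pos h2
    have h3 : (1 - p n)⁻¹ * p n = (1 - p n)⁻¹ - 1 := by field_simp; ring
    linarith

namespace IsCritical

variable {k : ℕ} {p : ℕ → ℝ} {c : ℝ} {s s' : ℕ → ℕ}

theorem eventually_basic (h : IsCritical k p c s) : ∀ᶠ n : ℕ in atTop, 0 < n ∧ 0 < s n ∧ 0 < p n ∧ 1 ≤ Real.log n := by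
  filter_upwards [h.pos, h.s_pos, tendsto_log_natCast.eventually_ge_atTop 1,
    eventually_gt_atTop 0] with n h1 h2 h3 h4
  exact ⟨h4, h2, h1, h3⟩

theorem tendsto_atTop (h : IsCritical k p c s) : Tendsto s atTop atTop := by
  rw [← tendsto_natCast_atTop_iff (R := ℝ)]
  refine tendsto_atTop_mono' _ ?_ tendsto_log_natCast
  filter_upwards [h.eventually_basic, h.log_div.eventually (gt_mem_nhds zero_lt_one)] with n hb hs
  have : (0 : ℝ) < s n := by exact_mod_cast hb.2.1
  rw [div_lt_one this] at hs
  exact hs.le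

theorem le_rpow (h : IsCritical k p c s) : ∀ᶠ n : ℕ in atTop, (s n / n : ℝ) ≤ (n : ℝ) ^ (-c) := by
  filter_upwards [h.eventually_basic, h.small.eventually (gt_mem_nhds zero_lt_one)] with n hb hs
  have hn : (0 : ℝ) < n := by exact_mod_cast hb.1
  rw [Real.rpow_neg hn.le, ← one_div, le_div_iff₀ (by positivity), mul_comm]
  exact hs.le

theorem le_rpow' (h : IsCritical k p c s) : ∀ᶠ n : ℕ in atTop, (n : ℝ) * (s n / n : ℝ) ^ (k + 1) ≤ (n : ℝ) ^ (-c) := by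
  filter_upwards [h.eventually_basic, h.small'.eventually (gt_mem_nhds zero_lt_one)] with n hb hs
  have hn : (0 : ℝ) < n := by exact_mod_cast hb.1
  rw [Real.rpow_neg hn.le, ← one_div, le_div_iff₀ (by positivity), mul_comm]
  exact hs.le

theorem tendsto_log_mul {f : ℕ → ℝ} (m : ℕ) (hf0 : ∀ᶠ n in atTop, 0 ≤ f n)
    (hf : ∀ᶠ n : ℕ in atTop, f n ≤ (n : ℝ) ^ (-c)) (hc : 0 < c) :
    Tendsto (fun n : ℕ => Real.log n ^ m * f n) atTop (𝓝 0) := by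
  refine squeeze_zero' ?_ ?_ (tendsto_log_pow_mul_rpow_neg m hc)
  · filter_upwards [hf0] with n h0
    have := Real.log_natCast_nonneg n
    positivity
  · filter_upwards [hf] with n h0
    have := Real.log_natCast_nonneg n
    gcongr

theorem lt_one (h : IsCritical k p c s) : ∀ᶠ n : ℕ in atTop, (s n / n : ℝ) < 1 := by
  have hnc : Tendsto (fun n : ℕ => (n : ℝ) ^ (-c)) atTop (𝓝 0) := by
    simpa using tendsto_log_pow_mul_rpow_neg 0 h.c_pos
  filter_upwards [h.le_rpow, hnc.eventually (gt_mem_nhds zero_lt_one)] with n h1 h2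
  linarith

theorem tendsto_log_mul_pow (h : IsCritical k p c s) (m : ℕ) {j : ℕ} (hj : 1 ≤ j) :
    Tendsto (fun n : ℕ => Real.log n ^ m * (s n / n : ℝ) ^ j) atTop (𝓝 0) := by
  refine tendsto_log_mul m (Eventually.of_forall fun n => by positivity) ?_ h.c_pos
  filter_upwards [h.le_rpow, h.lt_one] with n h1 h2
  exact (pow_le_of_le_one (by positivity) h2.le (by omega)).trans h1

theorem tendsto_log_mul_mul_pow (h : IsCritical k p c s) (m : ℕ) {j : ℕ} (hj : k + 1 ≤ j) :
    Tendsto (fun n : ℕ => Real.log n ^ m * (n * (s n / n : ℝ) ^ j)) atTop (𝓝 0) := by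
  refine tendsto_log_mul m (Eventually.of_forall fun n => by positivity) ?_ h.c_pos
  filter_upwards [h.le_rpow', h.lt_one] with n h1 h2
  refine le_trans ?_ h1
  exact mul_le_mul_of_nonneg_left (pow_le_pow_of_le_one (by positivity) h2.le hj) (by positivity)

theorem tendsto_div (h : IsCritical k p c s) : Tendsto (fun n : ℕ => (s n / n : ℝ)) atTop (𝓝 0) := by
  simpa using h.tendsto_log_mul_pow 0 le_rfl

theorem log_ge (h : IsCritical k p c s) : ∀ᶠ n : ℕ in atTop, c * Real.log n ≤ Real.log (n / s n) := by
  filter_upwards [h.le_rpow, h.eventually_basic] with n h1 h2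
  have hn : (0 : ℝ) < n := by exact_mod_cast h2.1
  have hs : (0 : ℝ) < s n := by exact_mod_cast h2.2.1
  have h3 := Real.log_le_log (by positivity) h1
  rw [Real.log_rpow hn] at h3
  have h4 : Real.log (n / s n) = - Real.log (s n / n) := by
    rw [← Real.log_inv, inv_div]
  linarith

theorem log_le (h : IsCritical k p c s) : ∀ᶠ n : ℕ in atTop, Real.log (n / s n) ≤ Real.log n := by
  filter_upwards [h.eventually_basic] with n h2
  have hn : (0 : ℝ) < n := by exact_mod_cast h2.1
  have hs : (1 : ℝ) ≤ s n := by exact_mod_cast h2.2.1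
  exact Real.log_le_log (by positivity) (div_le_self hn.le hs)

theorem tendsto_log (h : IsCritical k p c s) : Tendsto (fun n : ℕ => Real.log (n / s n)) atTop atTop :=
  tendsto_atTop_mono' _ h.log_ge (tendsto_log_natCast.const_mul_atTop h.c_pos)

theorem tendsto_choose (h : IsCritical k p c s) (m : ℕ) :
    Tendsto (fun n => ((s n).choose m : ℝ) / (s n : ℝ) ^ m) atTop (𝓝 (1 / m.factorial)) := by
  have h1 : Tendsto (fun n : ℕ => (n.choose m : ℝ) / (n : ℝ) ^ m) atTop
      (𝓝 (1 / m.factorial)) := by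
    have h2 := (isEquivalent_iff_tendsto_one (by
      filter_upwards [eventually_gt_atTop 0] with n hn
      have : (0 : ℝ) < n := by exact_mod_cast hn
      positivity)).1 (isEquivalent_choose m)
    have h3 := h2.mul_const (1 / (m.factorial : ℝ))
    rw [one_mul] at h3
    refine h3.congr fun n => ?_
    simp only [Pi.div_apply]
    have : (m.factorial : ℝ) ≠ 0 := by positivity
    rcases Nat.eq_zero_or_pos n with rfl | hn
    · rcases Nat.eq_zero_or_pos m with rfl | hm
      · simp
      · simp [hm.ne']
    · have : (0 : ℝ) < n := by exact_mod_cast hn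
      field_simp
  exact h1.comp h.tendsto_atTop

/-- The edge density at the critical size. -/
theorem tendsto_mul_pow_div (h : IsCritical k p c s) : Tendsto (fun n : ℕ => p n * (s n : ℝ) ^ (k - 1) / Real.log (n / s n))
    atTop (𝓝 k.factorial) := by
  have hk := h.two_le
  have h1 := h.crit.div_atTop h.tendsto_log
  have h2 : Tendsto (fun n : ℕ => (k : ℝ) * (1 / Real.log (n / s n) + 1)) atTop (𝓝 (k : ℝ)) := by
    simpa using (((tendsto_const_nhds (x := (1 : ℝ))).div_atTop h.tendsto_log).add_const 1).const_mul
      (k : ℝ)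
  have h3 := h2.sub h1
  have h4 := (((tendsto_log_one_sub_div h.pos h.tendsto_p).inv₀ one_ne_zero).mul
    ((h.tendsto_choose (k - 1)).inv₀ (by positivity))).mul h3
  have h5 : (1⁻¹ * (1 / ((k - 1).factorial : ℝ))⁻¹ * ((k : ℝ) - 0)) = k.factorial := by
    rw [← Nat.mul_factorial_pred (by omega : k ≠ 0)]; push_cast; simp; ring
  rw [h5] at h4
  refine h4.congr' ?_
  filter_upwards [h.eventually_basic, h.tendsto_log.eventually_gt_atTop 0,
    h.tendsto_p.eventually (gt_mem_nhds zero_lt_one),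
    h.tendsto_atTop.eventually_ge_atTop (k - 1)] with n h6 h7 h8 h9
  obtain ⟨hn, hs, hp, -⟩ := h6
  have hs' : (0 : ℝ) < s n := by exact_mod_cast hs
  have hc : (0 : ℝ) < (s n).choose (k - 1) := by
    exact_mod_cast Nat.choose_pos h9
  have hl : Real.log (1 - p n) < 0 := Real.log_neg (by linarith) (by linarith)
  have hl' := hl.ne
  have h7' := h7.ne'
  generalize Real.log (1 - p n) = w at *
  generalize Real.log (n / s n) = y at *
  field_simp
  ring

theorem tendsto_choose_mul_div (h : IsCritical k p c s) : Tendsto (fun n : ℕ => (s n).choose (k - 1) * p n /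
    Real.log (n / s n)) atTop (𝓝 k) := by
  have h1 := h.tendsto_mul_pow_div.mul (h.tendsto_choose (k - 1))
  have h5 : (k.factorial : ℝ) * (1 / ((k - 1).factorial : ℝ)) = k := by
    rw [← Nat.mul_factorial_pred (by have := h.two_le; omega : k ≠ 0)]; push_cast; field_simp
  rw [h5] at h1
  refine h1.congr' ?_
  filter_upwards [h.eventually_basic] with n h6
  have hs' : (0 : ℝ) < s n := by exact_mod_cast h6.2.1
  field_simp

theorem mul_pow_le (h : IsCritical k p c s) : ∀ᶠ n : ℕ in atTop, p n * (s n : ℝ) ^ (k - 1) ≤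
    2 * k.factorial * Real.log n := by
  have h0 : (k.factorial : ℝ) < 2 * k.factorial := by
    have : (0 : ℝ) < k.factorial := by positivity
    linarith
  filter_upwards [h.tendsto_mul_pow_div.eventually (ge_mem_nhds h0), h.log_le,
    h.tendsto_log.eventually_gt_atTop 0] with n h1 h2 h3
  rw [div_le_iff₀ h3] at h1
  refine h1.trans ?_
  gcongr

/-- The exponential of the critical relation; it is the source of every factor $e^{-k}$ in the
results. -/
theorem tendsto_pow_choose_div (h : IsCritical k p c s) : Tendsto (fun n : ℕ => (1 - p n) ^ (s n).choose (k - 1) /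
    (s n / n : ℝ) ^ k) atTop (𝓝 (Real.exp (-k))) := by
  have h1 : Tendsto (fun n : ℕ => Real.exp ((s n).choose (k - 1) * Real.log (1 - p n) +
    k * (1 + Real.log (n / s n)) - k)) atTop (𝓝 (Real.exp (-k))) := by
    refine (Real.continuous_exp.tendsto _).comp ?_
    simpa using h.crit.sub_const (k : ℝ)
  refine h1.congr' ?_
  filter_upwards [h.eventually_basic, h.tendsto_p.eventually (gt_mem_nhds zero_lt_one)] with n h6 h8
  obtain ⟨hn, hs, hp, -⟩ := h6
  have hs' : (0 : ℝ) < s n := by exact_mod_cast hs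
  have hn' : (0 : ℝ) < n := by exact_mod_cast hn
  have hp1 : 0 < 1 - p n := by linarith
  have : ((s n).choose (k - 1) * Real.log (1 - p n) + k * (1 + Real.log (n / s n)) - k) =
    (s n).choose (k - 1) * Real.log (1 - p n) + k * Real.log (n / s n) := by ring
  rw [this, Real.exp_add, Real.exp_nat_mul, Real.exp_nat_mul, Real.exp_log hp1,
    Real.exp_log (by positivity)]
  have h9 : (n / s n : ℝ) * (s n / n : ℝ) = 1 := by field_simp
  rw [eq_div_iff (by positivity), mul_assoc, ← mul_pow, h9, one_pow, mul_one]

theorem tendsto_ratio_one (h : IsCritical k p c s) (h' : Tendsto (fun n : ℕ => Real.log n * ((s' n : ℝ) - s n) / s n) atTop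
    (𝓝 0)) : Tendsto (fun n : ℕ => (s' n / s n : ℝ)) atTop (𝓝 1) := by
  have h1 := (tendsto_inv_atTop_zero.comp tendsto_log_natCast).mul h'
  have h2 := h1.const_add 1
  simp only [mul_zero, add_zero] at h2
  refine h2.congr' ?_
  filter_upwards [h.eventually_basic] with n ⟨hn, hs, hp, hl⟩
  have hs' : (0 : ℝ) < s n := by exact_mod_cast hs
  have : (0 : ℝ) < Real.log n := by linarith
  simp only [Function.comp_apply]
  field_simp
  ring

/-- A shift by $d=o(s/\log n)$ changes $\binom s{k-1}\log(1-p)$ by $O(ds^{k-2}p)=O(d\log n/s)$,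
which tends to `0`. So all sizes near the threshold share its asymptotics. -/
theorem of_near (h : IsCritical k p c s) (h' : Tendsto (fun n : ℕ => Real.log n * ((s' n : ℝ) - s n) / s n) atTop (𝓝 0)) :
    IsCritical k p c s' := by
  have hr := h.tendsto_ratio_one h'
  have hpos : ∀ᶠ n in atTop, 0 < s' n := by
    filter_upwards [hr.eventually (lt_mem_nhds zero_lt_one)] with n h1
    by_contra h2
    have : s' n = 0 := by omega
    simp [this] at h1
  refine ⟨h.two_le, h.c_pos, h.pos, h.tendsto_p, ?_, ?_, ?_, ?_, hpos⟩
  · have h1 := h.log_div.mul (hr.inv₀ one_ne_zero)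
    rw [zero_mul] at h1
    refine h1.congr' ?_
    filter_upwards [h.eventually_basic, hpos] with n ⟨hn, hs, hp, hl⟩ hs'
    have : (0 : ℝ) < s n := by exact_mod_cast hs
    have : (0 : ℝ) < s' n := by exact_mod_cast hs'
    field_simp
  · have h1 := h.small.mul hr
    rw [zero_mul] at h1
    refine h1.congr' ?_
    filter_upwards [h.eventually_basic, hpos] with n ⟨hn, hs, hp, hl⟩ hs'
    have : (0 : ℝ) < s n := by exact_mod_cast hs
    field_simp
  · have h1 := h.small'.mul (hr.pow (k + 1))
    rw [zero_mul] at h1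
    refine h1.congr' ?_
    filter_upwards [h.eventually_basic, hpos] with n ⟨hn, hs, hp, hl⟩ hs'
    have : (0 : ℝ) < s n := by exact_mod_cast hs
    rw [div_pow, div_pow, div_pow]
    field_simp
  · obtain ⟨m, rfl⟩ : ∃ m, k = m + 2 := ⟨k - 2, by have := h.two_le; omega⟩
    have hlog : Tendsto (fun n => Real.log (s' n / s n : ℝ)) atTop (𝓝 0) := by
      simpa using hr.log one_ne_zero
    have hdiff : Tendsto (fun n => (((s' n).choose (m + 1) : ℝ) - (s n).choose (m + 1)) *
        Real.log (1 - p n)) atTop (𝓝 0) := by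
      have hg : Tendsto (fun n : ℕ => 2 * (2 * (m + 2).factorial) *
          |Real.log n * ((s' n : ℝ) - s n) / s n| * (1 + (s' n / s n : ℝ)) ^ m) atTop (𝓝 0) := by
        have := (h'.abs.const_mul (2 * (2 * (m + 2).factorial : ℝ))).mul ((hr.const_add 1).pow m)
        simpa using this
      refine squeeze_zero_norm' ?_ hg
      filter_upwards [h.eventually_basic, hpos, h.mul_pow_le,
        h.tendsto_p.eventually (ge_mem_nhds (by norm_num : (0 : ℝ) < 1 / 2))]
        with n ⟨hn, hs, hp, hl⟩ hs' hps hp2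
      have hs0 : (0 : ℝ) < s n := by exact_mod_cast hs
      have hc : |((s' n).choose (m + 1) : ℝ) - (s n).choose (m + 1)| ≤
          |(s' n : ℝ) - s n| * (s n + s' n : ℝ) ^ m := by
        rcases le_total (s n) (s' n) with hle | hle
        · obtain ⟨d, hd⟩ := Nat.exists_eq_add_of_le hle
          have h1 : ((s' n).choose (m + 1) : ℝ) ≤ (s n).choose (m + 1) + d * (s' n : ℝ) ^ m := by
            rw [hd]; exact_mod_cast choose_le_add_mul_pow (s n) d m
          have h2 : ((s n).choose (m + 1) : ℝ) ≤ (s' n).choose (m + 1) := by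
            exact_mod_cast Nat.choose_le_choose _ hle
          have h3 : (s' n : ℝ) - s n = d := by rw [hd]; push_cast; ring
          rw [h3, abs_of_nonneg (by linarith), abs_of_nonneg (by positivity)]
          have : (d : ℝ) * (s' n : ℝ) ^ m ≤ d * (s n + s' n : ℝ) ^ m := by gcongr; linarith
          linarith
        · obtain ⟨d, hd⟩ := Nat.exists_eq_add_of_le hle
          have h1 : ((s n).choose (m + 1) : ℝ) ≤ (s' n).choose (m + 1) + d * (s n : ℝ) ^ m := by
            rw [hd]; exact_mod_cast choose_le_add_mul_pow (s' n) d m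
          have h2 : ((s' n).choose (m + 1) : ℝ) ≤ (s n).choose (m + 1) := by
            exact_mod_cast Nat.choose_le_choose _ hle
          have h3 : (s n : ℝ) - s' n = d := by rw [hd]; push_cast; ring
          rw [abs_sub_comm, abs_sub_comm (s' n : ℝ), h3, abs_of_nonneg (by linarith),
            abs_of_nonneg (by positivity)]
          have : (d : ℝ) * (s n : ℝ) ^ m ≤ d * (s n + s' n : ℝ) ^ m := by
            gcongr; linarith [Nat.cast_nonneg (α := ℝ) (s' n)]
          linarith
      have hlp : |Real.log (1 - p n)| ≤ 2 * p n := by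
        have h1 : 0 < 1 - p n := by linarith
        rw [abs_of_nonpos (Real.log_nonpos h1.le (by linarith))]
        have h2 := Real.one_sub_inv_le_log_of_pos h1
        have h3 : (1 - p n)⁻¹ ≤ 1 + 2 * p n := by
          rw [← one_div, div_le_iff₀ h1]; nlinarith
        linarith
      rw [Real.norm_eq_abs, abs_mul]
      simp only [show m + 2 - 1 = m + 1 by omega] at hps
      have hL : (0 : ℝ) < Real.log n := by linarith
      calc |((s' n).choose (m + 1) : ℝ) - (s n).choose (m + 1)| * |Real.log (1 - p n)|
          ≤ (|(s' n : ℝ) - s n| * (s n + s' n : ℝ) ^ m) * (2 * p n) := by gcongr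
        _ = 2 * (p n * (s n : ℝ) ^ (m + 1)) * (|(s' n : ℝ) - s n| / s n) *
            (1 + (s' n / s n : ℝ)) ^ m := by
            have : (s n + s' n : ℝ) = s n * (1 + (s' n / s n : ℝ)) := by field_simp
            rw [this, mul_pow]; field_simp; ring
        _ ≤ 2 * (2 * (m + 2).factorial * Real.log n) * (|(s' n : ℝ) - s n| / s n) *
            (1 + (s' n / s n : ℝ)) ^ m := by gcongr
        _ = _ := by
            rw [abs_div, abs_mul, abs_of_pos hL, abs_of_pos hs0]; ring
    have := (h.crit.add hdiff).sub (hlog.const_mul ((m + 2 : ℕ) : ℝ))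
    simp only [add_zero, mul_zero, sub_zero] at this
    refine this.congr' ?_
    filter_upwards [h.eventually_basic, hpos] with n ⟨hn, hs, hp, hl⟩ hs'
    have h1 : (0 : ℝ) < s n := by exact_mod_cast hs
    have h2 : (0 : ℝ) < s' n := by exact_mod_cast hs'
    have h3 : (0 : ℝ) < n := by exact_mod_cast hn
    rw [Real.log_div h2.ne' h1.ne', Real.log_div h3.ne' h1.ne', Real.log_div h3.ne' h2.ne']
    simp only [show m + 2 - 1 = m + 1 by omega]
    ring

end IsCritical

end

end RandomHypergraph

/-! ### Expected number of independent sets and the first-moment threshold. -/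

namespace RandomHypergraph

noncomputable section

/-- A Stirling-type bound by induction, from $(1-\frac1{t+1})^{t+1}\le e^{-1}$. -/
theorem factorial_le_pow_mul_exp {t : ℕ} (ht : 1 ≤ t) :
    (t.factorial : ℝ) ≤ (t : ℝ) ^ (t + 1) * Real.exp (1 - t) := by
  induction t, ht using Nat.le_induction with
  | base => simp
  | succ t ht ih =>
    have ht0 : (0 : ℝ) < t := by exact_mod_cast ht
    have h1 : ((t : ℝ) / (t + 1)) ^ (t + 1) ≤ Real.exp (-1) := by
      have h2 := Real.one_sub_div_pow_le_exp_neg (n := t + 1) (t := 1) (by push_cast; linarith)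
      have h3 : (t : ℝ) / (t + 1) = 1 - 1 / ((t + 1 : ℕ) : ℝ) := by push_cast; field_simp; ring
      rwa [h3]
    rw [Nat.factorial_succ]
    push_cast
    rw [div_pow, div_le_iff₀ (by positivity)] at h1
    calc ((t : ℝ) + 1) * t.factorial
        ≤ (t + 1) * ((t : ℝ) ^ (t + 1) * Real.exp (1 - t)) := by gcongr
      _ ≤ (t + 1) * (Real.exp (-1) * (t + 1 : ℝ) ^ (t + 1) * Real.exp (1 - t)) := by gcongr
      _ = (t + 1 : ℝ) ^ (t + 1 + 1) * Real.exp (1 - (t + 1)) := by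
        rw [show (1 : ℝ) - (t + 1) = -1 + (1 - t) by ring, Real.exp_add]; ring

theorem log_choose_ge {n t : ℕ} (ht : 1 ≤ t) (htn : t < n) :
    t * (Real.log (n - t) - Real.log t) - Real.log t + t - 1 ≤ Real.log (n.choose t) := by
  have ht0 : (0 : ℝ) < t := by exact_mod_cast ht
  have hnt : (0 : ℝ) < (n : ℝ) - t := by
    have : (t : ℝ) < n := by exact_mod_cast htn
    linarith
  have h1 : ((n : ℝ) - t) ^ t ≤ t.factorial * n.choose t := by
    have h2 := Nat.pow_le_choose (α := ℝ) t n
    rw [div_le_iff₀ (by positivity)] at h2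
    have h3 : (n : ℝ) - t ≤ ((n + 1 - t : ℕ) : ℝ) := by
      rw [Nat.cast_sub (by omega)]; push_cast; linarith
    calc ((n : ℝ) - t) ^ t ≤ ((n + 1 - t : ℕ) : ℝ) ^ t := by gcongr
      _ ≤ _ := by linarith
  have hc : (0 : ℝ) < n.choose t := by exact_mod_cast Nat.choose_pos htn.le
  have h4 := h1.trans (mul_le_mul_of_nonneg_right (factorial_le_pow_mul_exp ht) hc.le)
  have h5 := Real.log_le_log (by positivity) h4
  rw [Real.log_mul (by positivity) hc.ne', Real.log_mul (by positivity) (by positivity),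
    Real.log_exp, Real.log_pow, Real.log_pow] at h5
  push_cast at h5
  linarith

theorem log_choose_le {n t : ℕ} (ht : 1 ≤ t) (htn : t ≤ n) :
    Real.log (n.choose t) ≤ t * (1 + Real.log (n / t)) := by
  have ht0 : (0 : ℝ) < t := by exact_mod_cast ht
  have hn0 : (0 : ℝ) < n := by exact_mod_cast (by omega : 0 < n)
  have hc : (0 : ℝ) < n.choose t := by exact_mod_cast Nat.choose_pos htn
  have h1 : (n.choose t : ℝ) ≤ (Real.exp 1 * (n / t)) ^ t := by
    refine (Nat.choose_le_pow_div t n).trans ?_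
    have h2 := pow_div_factorial_le t
    rw [div_le_iff₀ (by positivity)] at h2 ⊢
    rw [mul_pow, div_pow]
    calc (n : ℝ) ^ t = (t : ℝ) ^ t * ((n : ℝ) ^ t / (t : ℝ) ^ t) := by field_simp
      _ ≤ (Real.exp 1 ^ t * t.factorial) * ((n : ℝ) ^ t / (t : ℝ) ^ t) := by gcongr
      _ = _ := by ring
  have h3 := Real.log_le_log hc h1
  rwa [Real.log_pow, Real.log_mul (Real.exp_pos 1).ne' (by positivity), Real.log_exp] at h3

theorem log_expIndep {n k s : ℕ} {p : ℝ} (hp : p < 1) (hs : s ≤ n) :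
    Real.log (expIndep n k p s) = Real.log (n.choose s) + s.choose k * Real.log (1 - p) := by
  have hc : (0 : ℝ) < n.choose s := by exact_mod_cast Nat.choose_pos hs
  have hp' : 0 < 1 - p := by linarith
  rw [expIndep, Real.log_mul hc.ne' (by positivity), Real.log_pow]

theorem expIndep_pos {n k s : ℕ} {p : ℝ} (hp : p < 1) (hs : s ≤ n) : 0 < expIndep n k p s := by
  have hc : (0 : ℝ) < n.choose s := by exact_mod_cast Nat.choose_pos hs
  have hp' : 0 < 1 - p := by linarith
  rw [expIndep]; positivity

theorem expIndep_eq_zero {n k s : ℕ} {p : ℝ} (hs : n < s) : expIndep n k p s = 0 := by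
  rw [expIndep, Nat.choose_eq_zero_of_lt hs]; simp

theorem neg_log_one_sub_le {p : ℝ} (hp0 : 0 < p) (hp : p ≤ 1 / 2) :
    -Real.log (1 - p) ≤ 2 * p := by
  have h1 : 0 < 1 - p := by linarith
  have h2 := Real.one_sub_inv_le_log_of_pos h1
  have h3 : (1 - p)⁻¹ ≤ 1 + 2 * p := by
    rw [← one_div, div_le_iff₀ h1]; nlinarith
  linarith

/-- The expected number of independent sets of size about `M log n` is large. -/
theorem eventually_rpow_lt_expIndep {k : ℕ} (hk : 2 ≤ k) {ε : ℝ} {p : ℕ → ℝ}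
    (hp0 : ∀ᶠ n in atTop, 0 < p n) (hp1 : Tendsto p atTop (𝓝 0))
    (hp2 : ∀ᶠ n : ℕ in atTop, p n * Real.log n ^ (k - 1) ≤ 1) {M : ℝ} (hM : 1 ≤ M) :
    ∀ᶠ n : ℕ in atTop, (n : ℝ) ^ (2 * ε) < expIndep n k (p n) ⌈M * Real.log n⌉₊ := by
  have hlim : Tendsto (fun n : ℕ => 4 * (M + 1) * (Real.log n ^ 1 * (n : ℝ) ^ (-(1 / 2 : ℝ)))) atTop
      (𝓝 0) := by
    simpa using (tendsto_log_pow_mul_rpow_neg 1 (c := 1 / 2) (by norm_num)).const_mul (4 * (M + 1))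
  filter_upwards [hp0, hp1.eventually (ge_mem_nhds (by norm_num : (0 : ℝ) < 1 / 2)), hp2,
    tendsto_log_natCast.eventually_ge_atTop 1,
    tendsto_log_natCast.eventually_ge_atTop (8 * (M + 1) ^ (k - 1)),
    tendsto_log_natCast.eventually_gt_atTop (8 * ε),
    hlim.eventually (ge_mem_nhds (by norm_num : (0 : ℝ) < 1)), eventually_gt_atTop 0]
    with n hp0 hp1 hp2 hL1 hL2 hL3 hlim hn
  have hn0 : (0 : ℝ) < n := by exact_mod_cast hn
  have hn1 : (1 : ℝ) ≤ n := by exact_mod_cast hn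
  set L := Real.log n with hL
  set t := ⌈M * L⌉₊ with ht
  have ht1 : M * L ≤ t := Nat.le_ceil _
  have ht2 : (t : ℝ) ≤ (M + 1) * L := by
    have := (Nat.ceil_lt_add_one (by positivity : 0 ≤ M * L)).le
    linarith
  have ht3 : L ≤ t := by nlinarith
  have ht0 : (1 : ℝ) ≤ t := by linarith
  have ht0' : 1 ≤ t := by exact_mod_cast ht0
  have hsq : (n : ℝ) ^ (1 / 2 : ℝ) * (n : ℝ) ^ (1 / 2 : ℝ) = n := by
    rw [← Real.rpow_add hn0]; norm_num
  have hsq1 : 1 ≤ (n : ℝ) ^ (1 / 2 : ℝ) := Real.one_le_rpow hn1 (by norm_num)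
  have hlim2 : 4 * ((M + 1) * L) ≤ (n : ℝ) ^ (1 / 2 : ℝ) := by
    rw [Real.rpow_neg hn0.le, pow_one] at hlim
    have : 4 * ((M + 1) * L) = 4 * (M + 1) * (L * ((n : ℝ) ^ (1 / 2 : ℝ))⁻¹) *
      (n : ℝ) ^ (1 / 2 : ℝ) := by field_simp
    rw [this]
    exact mul_le_of_le_one_left (by positivity) hlim
  set q := (n : ℝ) ^ (1 / 2 : ℝ) with hq
  have hnt : t * q ≤ n - t := by nlinarith
  have htn : (t : ℝ) < n := by nlinarith
  have htn' : t < n := by exact_mod_cast htn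
  have hlog : L / 2 ≤ Real.log (n - t) - Real.log t := by
    rw [← Real.log_div (by linarith) (by linarith)]
    have h1 : q ≤ (n - t) / t := by
      rw [le_div_iff₀ (by linarith)]; linarith
    have h2 := Real.log_le_log (by linarith) h1
    rw [hq, Real.log_rpow hn0] at h2
    linarith
  have hlt := Real.log_le_sub_one_of_pos (by linarith : (0 : ℝ) < t)
  have hch := log_choose_ge ht0' htn'
  -- Because $p(\log n)^{k-1}\le1$, a set of order $\log n$ pays only $O(t)$ for being independent,
  -- whereas the number of choices contributes about $\frac12t\log n$.
  have hck : (t.choose k : ℝ) * (-Real.log (1 - p n)) ≤ t * (2 * (M + 1) ^ (k - 1)) := by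
    have h1 : (t.choose k : ℝ) ≤ (t : ℝ) ^ k := by exact_mod_cast Nat.choose_le_pow t k
    have h2 := neg_log_one_sub_le hp0 hp1
    calc (t.choose k : ℝ) * (-Real.log (1 - p n)) ≤ (t : ℝ) ^ k * (2 * p n) := by
          refine mul_le_mul h1 h2 ?_ (by positivity)
          have := Real.log_nonpos (by linarith : 0 ≤ 1 - p n) (by linarith)
          linarith
      _ = t * (2 * (p n * (t : ℝ) ^ (k - 1))) := by
          obtain ⟨m, rfl⟩ : ∃ m, k = m + 1 := ⟨k - 1, by omega⟩
          simp only [Nat.add_sub_cancel]; ring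
      _ ≤ t * (2 * (p n * ((M + 1) * L) ^ (k - 1))) := by gcongr
      _ = t * (2 * (p n * L ^ (k - 1) * (M + 1) ^ (k - 1))) := by rw [mul_pow]; ring
      _ ≤ t * (2 * (1 * (M + 1) ^ (k - 1))) := by gcongr
      _ = _ := by ring
  have hmain : 2 * ε * L < Real.log (expIndep n k (p n) t) := by
    rw [log_expIndep (by linarith) htn'.le]
    have h1 : (t : ℝ) * (L / 2) ≤ t * (Real.log (n - t) - Real.log t) := by gcongr
    have h2 : (t : ℝ) * (L / 4) ≤ t * (L / 2) - t * (2 * (M + 1) ^ (k - 1)) := by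
      rw [← mul_sub]; gcongr; linarith
    have h3 : L * (L / 4) ≤ t * (L / 4) := by gcongr
    have h4 : 2 * ε * L < L * (L / 4) := by nlinarith
    linarith
  rw [← Real.log_lt_log_iff (by positivity) (expIndep_pos (by linarith) htn'.le),
    Real.log_rpow hn0]
  exact hmain

theorem firstMomentThreshold_eq (n k : ℕ) (p ε : ℝ) :
    firstMomentThreshold n k p ε = sSup {s : ℕ | (n : ℝ) ^ (2 * ε) < expIndep n k p s} := by
  simp only [firstMomentThreshold, expect_numIndep]

theorem bddAbove_expIndep (n k : ℕ) (p ε : ℝ) :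
    BddAbove {s : ℕ | (n : ℝ) ^ (2 * ε) < expIndep n k p s} := by
  refine ⟨n, fun s hs => ?_⟩
  by_contra h
  rw [Set.mem_ofPred_eq, expIndep_eq_zero (by omega)] at hs
  exact absurd hs (not_lt.2 (by positivity))

theorem le_firstMomentThreshold {n k t : ℕ} {p ε : ℝ} (h : (n : ℝ) ^ (2 * ε) < expIndep n k p t) :
    t ≤ firstMomentThreshold n k p ε := by
  rw [firstMomentThreshold_eq]
  exact le_csSup (bddAbove_expIndep n k p ε) h

theorem firstMomentThreshold_spec {n k t : ℕ} {p ε : ℝ}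
    (h : (n : ℝ) ^ (2 * ε) < expIndep n k p t) :
    (n : ℝ) ^ (2 * ε) < expIndep n k p (firstMomentThreshold n k p ε) := by
  rw [firstMomentThreshold_eq]
  exact Nat.sSup_mem ⟨t, h⟩ (bddAbove_expIndep n k p ε)

theorem expIndep_firstMomentThreshold_add_one_le (n k : ℕ) (p ε : ℝ) :
    expIndep n k p (firstMomentThreshold n k p ε + 1) ≤ (n : ℝ) ^ (2 * ε) := by
  by_contra! h
  have := le_firstMomentThreshold h
  omega

end

end RandomHypergraph

/-! ### The first-moment threshold is a critical sequence. -/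

namespace RandomHypergraph

noncomputable section

/-- Take logarithms, bound $\binom ns$ by $(en/s)^s$ and use $k\binom sk=s\binom{s-1}{k-1}$. -/
theorem choose_pred_mul_le {n k s : ℕ} {p : ℝ} (hk : 1 ≤ k) (hp : p < 1)
    (hs : 1 ≤ s) (hsn : s ≤ n) (h : 1 ≤ expIndep n k p s) :
    (s - 1).choose (k - 1) * -Real.log (1 - p) ≤ k * (1 + Real.log (n / s)) := by
  have h1 := Real.log_nonneg h
  rw [log_expIndep hp hsn] at h1
  have h2 := log_choose_le hs hsn
  have h3 : (k : ℝ) * s.choose k = s * (s - 1).choose (k - 1) := by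
    have := Nat.add_one_mul_choose_eq (s - 1) (k - 1)
    rw [Nat.sub_add_cancel hs, Nat.sub_add_cancel hk] at this
    rw [mul_comm]; exact_mod_cast this.symm
  have hs0 : (0 : ℝ) < s := by exact_mod_cast hs
  have hk0 : (0 : ℝ) < k := by exact_mod_cast hk
  have h4 : (s.choose k : ℝ) * -Real.log (1 - p) ≤ s * (1 + Real.log (n / s)) := by linarith
  have h5 := mul_le_mul_of_nonneg_left h4 hk0.le
  rw [← mul_assoc, h3] at h5
  refine le_of_mul_le_mul_left ?_ hs0
  linarith

/-- The converse estimate, at `s + 1`: there the absorption identity produces exactly `s.choose (k -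
1)`. -/
theorem choose_mul_ge {n k s : ℕ} {p b : ℝ} (hk : 1 ≤ k) (hp : p < 1)
    (hsn : s + 1 < n) (h : expIndep n k p (s + 1) ≤ b) :
    k * (Real.log (n - (s + 1 : ℕ)) - Real.log (s + 1 : ℕ) + 1 -
      (Real.log (s + 1 : ℕ) + 1 + Real.log b) / (s + 1 : ℕ)) ≤
      s.choose (k - 1) * -Real.log (1 - p) := by
  have h1 := Real.log_le_log (expIndep_pos hp hsn.le) h
  rw [log_expIndep hp hsn.le] at h1
  have h2 := log_choose_ge (by omega : 1 ≤ s + 1) hsn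
  have h3 : (k : ℝ) * (s + 1).choose k = (s + 1 : ℕ) * s.choose (k - 1) := by
    have := Nat.add_one_mul_choose_eq s (k - 1)
    rw [Nat.sub_add_cancel hk] at this
    rw [mul_comm]; exact_mod_cast this.symm
  have hs0 : (0 : ℝ) < (s + 1 : ℕ) := by positivity
  have hk0 : (0 : ℝ) < k := by exact_mod_cast hk
  have h4 : (s + 1 : ℕ) * (Real.log (n - (s + 1 : ℕ)) - Real.log (s + 1 : ℕ)) -
      Real.log (s + 1 : ℕ) + (s + 1 : ℕ) - 1 - Real.log b ≤
      (s + 1).choose k * -Real.log (1 - p) := by linarith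
  have h5 := mul_le_mul_of_nonneg_left h4 hk0.le
  rw [← mul_assoc, h3] at h5
  refine le_of_mul_le_mul_left ?_ hs0
  generalize ((s + 1 : ℕ) : ℝ) = t at *
  have h6 : t * (k * (Real.log (n - t) - Real.log t + 1 - (Real.log t + 1 + Real.log b) / t)) =
    k * (t * (Real.log (n - t) - Real.log t) - Real.log t + t - 1 - Real.log b) := by
    field_simp; ring
  rw [h6]
  linarith

theorem tendsto_zero_of_pow {f : ℕ → ℝ} {m : ℕ} (hm : 1 ≤ m) (hf : ∀ n, 0 ≤ f n)
    (h : Tendsto (fun n => f n ^ m) atTop (𝓝 0)) : Tendsto f atTop (𝓝 0) := by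
  have h1 := h.rpow_const (p := (m : ℝ)⁻¹) (Or.inr (by positivity))
  rw [Real.zero_rpow (by positivity)] at h1
  exact h1.congr fun n => Real.pow_rpow_inv_natCast (hf n) (by omega)

section Threshold

variable {k : ℕ} {ε : ℝ} {p : ℕ → ℝ} {s : ℕ → ℕ}

/-- An expectation of at least `1` forces $ps^{k-1}=O(\log n)$; the lower bound on `p` then turns
this into a bound on `s / n`. -/
theorem pow_div_le_of_expIndep (hk : 2 ≤ k)
    (hp0 : ∀ᶠ n in atTop, 0 < p n) (hp1 : Tendsto p atTop (𝓝 0))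
    (hlow : ∀ᶠ n : ℕ in atTop, (n : ℝ) ^ (-((((k : ℝ) - 1) * k) / ((k : ℝ) + 1)) + ε) < p n)
    (hs : Tendsto s atTop atTop) (hsn : ∀ᶠ n in atTop, s n ≤ n)
    (ha : ∀ᶠ n : ℕ in atTop, 1 ≤ expIndep n k (p n) (s n)) :
    ∀ᶠ n : ℕ in atTop, (s n / n : ℝ) ^ (k - 1) ≤
      2 ^ k * k.factorial * Real.log n * (n : ℝ) ^ (-(((k : ℝ) - 1) / (k + 1) + ε)) := by
  filter_upwards [hp0, hp1.eventually (gt_mem_nhds one_pos), hlow,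
    hs.eventually_ge_atTop (2 * k), hsn, ha, eventually_gt_atTop 0,
    tendsto_log_natCast.eventually_ge_atTop 1] with n hp0 hp1 hlow hs hsn ha hn hL
  have hn0 : (0 : ℝ) < n := by exact_mod_cast hn
  have hs0 : (0 : ℝ) < s n := by exact_mod_cast (by omega : 0 < s n)
  have hs1 : (1 : ℝ) ≤ s n := by exact_mod_cast (by omega : 1 ≤ s n)
  have h1 := choose_pred_mul_le (by omega) hp1 (by omega) hsn ha
  have h2 : p n ≤ -Real.log (1 - p n) := by
    have := Real.log_le_sub_one_of_pos (by linarith : 0 < 1 - p n)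
    linarith
  have h3 : Real.log (n / s n) ≤ Real.log n :=
    Real.log_le_log (by positivity) (div_le_self hn0.le hs1)
  have h4 : (s n / 2 : ℝ) ^ (k - 1) / (k - 1).factorial ≤ (s n - 1).choose (k - 1) := by
    refine le_trans ?_ (Nat.pow_le_choose (α := ℝ) (k - 1) (s n - 1))
    have : (s n / 2 : ℝ) ≤ ((s n - 1 + 1 - (k - 1) : ℕ) : ℝ) := by
      have h5 : s n ≤ 2 * (s n - 1 + 1 - (k - 1)) := by omega
      have h6 : (s n : ℝ) ≤ 2 * ((s n - 1 + 1 - (k - 1) : ℕ) : ℝ) := by exact_mod_cast h5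
      linarith
    gcongr
  have h5 : (s n / 2 : ℝ) ^ (k - 1) / (k - 1).factorial * p n ≤ k * (2 * Real.log n) := by
    calc (s n / 2 : ℝ) ^ (k - 1) / (k - 1).factorial * p n
        ≤ (s n - 1).choose (k - 1) * -Real.log (1 - p n) := by gcongr
      _ ≤ k * (1 + Real.log (n / s n)) := h1
      _ ≤ _ := by gcongr; linarith
  have h6 : (s n : ℝ) ^ (k - 1) * p n ≤ 2 ^ k * k.factorial * Real.log n := by
    have e1 : ((k.factorial : ℕ) : ℝ) = k * (k - 1).factorial := by
      rw [← Nat.mul_factorial_pred (by omega : k ≠ 0)]; push_cast; ring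
    have e2 : (2 : ℝ) ^ k = 2 ^ (k - 1) * 2 := by
      rw [← pow_succ, Nat.sub_add_cancel (by omega)]
    rw [div_pow, div_div, div_mul_eq_mul_div, div_le_iff₀ (by positivity)] at h5
    rw [e1, e2]
    linarith
  set b := -((((k : ℝ) - 1) * k) / ((k : ℝ) + 1)) + ε with hb
  have h7 : (s n : ℝ) ^ (k - 1) ≤ 2 ^ k * k.factorial * Real.log n * (n : ℝ) ^ (-b) := by
    rw [Real.rpow_neg hn0.le, ← div_eq_mul_inv, le_div_iff₀ (by positivity)]
    exact le_trans (by gcongr) h6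
  have hk1 : (((k - 1 : ℕ) : ℝ)) = (k : ℝ) - 1 := by rw [Nat.cast_sub (by omega)]; simp
  have h8 : (n : ℝ) ^ (-b) = (n : ℝ) ^ (-(((k : ℝ) - 1) / (k + 1) + ε)) * (n : ℝ) ^ (k - 1) := by
    rw [← Real.rpow_natCast, ← Real.rpow_add hn0, hk1]
    congr 1
    rw [hb]; field_simp; ring
  rw [div_pow, div_le_iff₀ (by positivity), mul_assoc _ _ ((n : ℝ) ^ (k - 1)), ← h8]
  exact h7

theorem tendsto_scale {D b : ℝ} {f : ℕ → ℝ} (m : ℕ) {d : ℝ} (hf0 : ∀ n, 0 ≤ f n) (hb : d < b)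
    (hf : ∀ᶠ n : ℕ in atTop, f n ≤ D * Real.log n ^ m * (n : ℝ) ^ (-b)) :
    Tendsto (fun n : ℕ => (n : ℝ) ^ d * f n) atTop (𝓝 0) := by
  have h1 := (tendsto_log_pow_mul_rpow_neg m (c := b - d) (by linarith)).const_mul D
  rw [mul_zero] at h1
  refine squeeze_zero' (Eventually.of_forall fun n => mul_nonneg (by positivity) (hf0 n)) ?_ h1
  filter_upwards [hf, eventually_gt_atTop 0] with n h2 hn
  have hn0 : (0 : ℝ) < n := by exact_mod_cast hn
  have h3 : (n : ℝ) ^ (-(b - d)) = (n : ℝ) ^ d * (n : ℝ) ^ (-b) := by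
    rw [← Real.rpow_add hn0]; congr 1; ring
  rw [h3]
  calc (n : ℝ) ^ d * f n ≤ (n : ℝ) ^ d * (D * Real.log n ^ m * (n : ℝ) ^ (-b)) := by gcongr
    _ = _ := by ring

/-- `choose_pred_mul_le` and `choose_mul_ge` enclose the critical expression between errors of order
$(\log n)/s$ and $s/n$; `pow_div_le_of_expIndep` gives the two smallness conditions. -/
theorem isCritical_of_expIndep (hk : 2 ≤ k) (hε : 0 < ε)
    (hε' : ε < ((k : ℝ) - 1) / ((k : ℝ) + 1))
    (hp0 : ∀ᶠ n in atTop, 0 < p n) (hp1 : Tendsto p atTop (𝓝 0))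
    (hlow : ∀ᶠ n : ℕ in atTop, (n : ℝ) ^ (-((((k : ℝ) - 1) * k) / ((k : ℝ) + 1)) + ε) < p n)
    (hld : Tendsto (fun n : ℕ => Real.log n / s n) atTop (𝓝 0))
    (hs0 : ∀ᶠ n in atTop, 0 < s n)
    (ha : ∀ᶠ n : ℕ in atTop, (n : ℝ) ^ (2 * ε) < expIndep n k (p n) (s n))
    (ha' : ∀ᶠ n : ℕ in atTop, expIndep n k (p n) (s n + 1) ≤ (n : ℝ) ^ (2 * ε)) :
    IsCritical k p (ε / (2 * k)) s ∧
      Tendsto (fun n : ℕ => (n : ℝ) ^ (2 * ε) * (s n / n : ℝ) ^ (k - 1)) atTop (𝓝 0) := by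
  have hk2 : (2 : ℝ) ≤ k := by exact_mod_cast hk
  have hk1 : (((k - 1 : ℕ) : ℝ)) = (k : ℝ) - 1 := by rw [Nat.cast_sub (by omega)]; simp
  have hst : Tendsto s atTop atTop := by
    rw [← tendsto_natCast_atTop_iff (R := ℝ)]
    refine tendsto_atTop_mono' _ ?_ tendsto_log_natCast
    filter_upwards [hs0, hld.eventually (gt_mem_nhds zero_lt_one)] with n hb hs
    have : (0 : ℝ) < s n := by exact_mod_cast hb
    rw [div_lt_one this] at hs
    exact hs.le
  have hsn : ∀ᶠ n in atTop, s n ≤ n := by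
    filter_upwards [ha] with n ha
    by_contra h
    rw [expIndep_eq_zero (by omega)] at ha
    exact absurd ha (not_lt.2 (by positivity))
  have ha1 : ∀ᶠ n : ℕ in atTop, 1 ≤ expIndep n k (p n) (s n) := by
    filter_upwards [ha, eventually_gt_atTop 0] with n ha hn
    exact (Real.one_le_rpow (by exact_mod_cast hn) (by positivity)).trans ha.le
  have hx := pow_div_le_of_expIndep hk hp0 hp1 hlow hst hsn ha1
  set θ := ((k : ℝ) - 1) / (k + 1) + ε with hθ
  set D : ℝ := 2 ^ k * k.factorial with hD
  have hθ0 : 0 < ((k : ℝ) - 1) / (k + 1) := div_pos (by linarith) (by linarith)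
  have hsmall : Tendsto (fun n : ℕ => (n : ℝ) ^ (ε / (2 * k)) * (s n / n : ℝ)) atTop (𝓝 0) := by
    refine tendsto_zero_of_pow (m := k - 1) (by omega) (fun n => by positivity) ?_
    have h1 : ε / (2 * k) * (k - 1 : ℕ) < θ := by
      have : ε / (2 * k) * (k - 1 : ℕ) ≤ ε := by
        rw [hk1, div_mul_eq_mul_div, div_le_iff₀ (by positivity)]
        nlinarith
      linarith
    refine (tendsto_scale 1 (D := D) (fun n => by positivity) h1 (f := fun n => (s n / n : ℝ) ^ (k - 1))
      (by simpa using hx)).congr fun n => ?_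
    rw [mul_pow, ← Real.rpow_natCast ((n : ℝ) ^ (ε / (2 * k))), ← Real.rpow_mul (by positivity)]
  have hsmall' : Tendsto (fun n : ℕ => (n : ℝ) ^ (ε / (2 * k)) * (n * (s n / n : ℝ) ^ (k + 1)))
      atTop (𝓝 0) := by
    refine tendsto_zero_of_pow (m := k - 1) (by omega) (fun n => by positivity) ?_
    -- Here `θ * (k + 1)` equals $k-1+\varepsilon(k+1)$. The exponent $-k(k-1)/(k+1)$ in the lower
    -- bound on `p` is what makes $n(s/n)^{k+1}$ polynomially small.
    have h1 : (ε / (2 * k) + 1) * (k - 1 : ℕ) < θ * (k + 1) := by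
      have e1 : θ * (k + 1) = (k - 1) + ε * (k + 1) := by
        rw [hθ, add_mul, div_mul_cancel₀]; linarith
      have : ε / (2 * k) * (k - 1 : ℕ) ≤ ε := by
        rw [hk1, div_mul_eq_mul_div, div_le_iff₀ (by positivity)]
        nlinarith
      rw [e1, add_mul, one_mul, hk1] at *
      nlinarith
    refine (tendsto_scale (k + 1) (D := D ^ (k + 1)) (f := fun n => ((s n / n : ℝ) ^ (k - 1)) ^ (k + 1))
      (fun n => by positivity) h1 ?_).congr' ?_
    · filter_upwards [hx] with n hx
      calc ((s n / n : ℝ) ^ (k - 1)) ^ (k + 1) ≤ (D * Real.log n * (n : ℝ) ^ (-θ)) ^ (k + 1) := by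
            gcongr
        _ = D ^ (k + 1) * Real.log n ^ (k + 1) * (n : ℝ) ^ (-(θ * (k + 1))) := by
            rw [mul_pow, mul_pow, ← Real.rpow_natCast ((n : ℝ) ^ (-θ)),
              ← Real.rpow_mul (by positivity)]
            push_cast; ring_nf
    · filter_upwards [eventually_gt_atTop 0] with n hn
      have hn0 : (0 : ℝ) < n := by exact_mod_cast hn
      rw [← mul_assoc, ← Real.rpow_add_one hn0.ne', mul_pow, ← Real.rpow_natCast ((n : ℝ) ^ _),
        ← Real.rpow_mul (by positivity), ← pow_mul, ← pow_mul, mul_comm (k - 1) (k + 1)]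
  -- The upper bound on `ε` is needed here: it gives $2\varepsilon<\frac{k-1}{k+1}+\varepsilon$.
  have hfirst : Tendsto (fun n : ℕ => (n : ℝ) ^ (2 * ε) * (s n / n : ℝ) ^ (k - 1)) atTop (𝓝 0) :=
    tendsto_scale 1 (D := D) (b := θ) (fun n => by positivity) (by linarith)
      (f := fun n => (s n / n : ℝ) ^ (k - 1)) (by simpa using hx)
  refine ⟨⟨hk, by positivity, hp0, hp1, hld, hsmall, hsmall', ?_, hs0⟩, hfirst⟩
  have hxt : Tendsto (fun n : ℕ => (s n / n : ℝ)) atTop (𝓝 0) := by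
    refine squeeze_zero' (Eventually.of_forall fun n => by positivity) ?_ hsmall
    filter_upwards [eventually_gt_atTop 0] with n hn
    exact le_mul_of_one_le_left (by positivity) (Real.one_le_rpow (by exact_mod_cast hn)
      (by positivity))
  have hinv : Tendsto (fun n => (s n : ℝ)⁻¹) atTop (𝓝 0) :=
    tendsto_inv_atTop_zero.comp (tendsto_natCast_atTop_atTop.comp hst)
  -- upper and lower bounds for the deficit
  have hlog : Tendsto (fun n : ℕ => Real.log ((1 - (s n / n + (n : ℝ)⁻¹)) / (1 + (s n : ℝ)⁻¹)))
      atTop (𝓝 0) := by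
    have h1 : Tendsto (fun n : ℕ => (n : ℝ)⁻¹) atTop (𝓝 0) := tendsto_inv_atTop_nhds_zero_nat
    have h2 := (((hxt.add h1).const_sub 1).div (hinv.const_add 1) (by norm_num)).log (by norm_num)
    simpa using h2
  have hlow' : Tendsto (fun n : ℕ => (k : ℝ) *
      (-Real.log ((1 - (s n / n + (n : ℝ)⁻¹)) / (1 + (s n : ℝ)⁻¹)) +
      (Real.log n / s n + (s n : ℝ)⁻¹ + 2 * ε * (Real.log n / s n)))) atTop (𝓝 0) := by
    have h1 := (hlog.neg.add ((hld.add hinv).add (hld.const_mul (2 * ε)))).const_mul (k : ℝ)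
    simpa using h1
  have hup : Tendsto (fun n : ℕ => -((k : ℝ) * (2 * (k - 1) * ((s n : ℝ)⁻¹ + Real.log n / s n))))
      atTop (𝓝 0) := by
    have h1 := (((hinv.add hld).const_mul (2 * ((k : ℝ) - 1))).const_mul (k : ℝ)).neg
    simpa using h1
  refine tendsto_of_tendsto_of_tendsto_of_le_of_le' hup hlow' ?_ ?_
  -- Lower bound, from $\mathbb E[X_s]\ge1$; passing from $\binom{s-1}{k-1}$ to $\binom s{k-1}$
  -- costs a relative error $O(1/s)$.
  · filter_upwards [hp0, hp1.eventually (gt_mem_nhds one_pos), hst.eventually_ge_atTop (2 * k), hsn,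
      ha1, eventually_gt_atTop 0] with n hp0 hp1 hs hsn ha hn
    have hn0 : (0 : ℝ) < n := by exact_mod_cast hn
    have hs0 : (0 : ℝ) < s n := by exact_mod_cast (by omega : 0 < s n)
    have hs1 : (1 : ℝ) ≤ s n := by exact_mod_cast (by omega : 1 ≤ s n)
    have h1 := choose_pred_mul_le (by omega) hp1 (by omega) hsn ha
    have h3 : Real.log (n / s n) ≤ Real.log n :=
      Real.log_le_log (by positivity) (div_le_self hn0.le hs1)
    have h3' : 0 ≤ Real.log (n / s n) := by
      refine Real.log_nonneg ?_
      rw [le_div_iff₀ hs0, one_mul]; exact_mod_cast hsn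
    have h4 : (s n : ℝ) * (s n - 1).choose (k - 1) = (s n).choose (k - 1) * (s n - (k - 1)) := by
      have h5 := Nat.choose_mul_succ_eq (s n - 1) (k - 1)
      rw [show s n - 1 + 1 = s n by omega] at h5
      have h6 : ((s n - (k - 1) : ℕ) : ℝ) = s n - (k - 1) := by
        rw [Nat.cast_sub (by omega), hk1]
      rw [← h6, mul_comm]; exact_mod_cast h5
    have hs2 : 2 * (k : ℝ) ≤ s n := by exact_mod_cast hs
    set w := -Real.log (1 - p n) with hw
    have hw0 : 0 ≤ w := by
      have := Real.log_nonpos (by linarith : 0 ≤ 1 - p n) (by linarith)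
      linarith
    set y := Real.log (n / s n)
    have h7 : (s n).choose (k - 1) * (s n - (k - 1)) * w ≤ s n * (k * (1 + y)) := by
      rw [← h4, mul_assoc]; gcongr
    have h8 : (s n).choose (k - 1) * w ≤ 2 * (k * (1 + y)) := by
      have e0 : (0 : ℝ) ≤ (s n).choose (k - 1) * w := by positivity
      refine le_of_mul_le_mul_left ?_ (half_pos hs0)
      nlinarith
    have h9 : (s n).choose (k - 1) * w - k * (1 + y) ≤
        (k : ℝ) * (2 * (k - 1) * ((s n : ℝ)⁻¹ + Real.log n / s n)) := by
      have e1 : (s n).choose (k - 1) * w * s n - s n * (k * (1 + y)) ≤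
          (k - 1) * ((s n).choose (k - 1) * w) := by linarith
      have e2 : (k - 1 : ℝ) * ((s n).choose (k - 1) * w) ≤ (k - 1) * (2 * (k * (1 + Real.log n))) := by
        refine mul_le_mul_of_nonneg_left (h8.trans ?_) (by linarith)
        gcongr
      refine le_of_mul_le_mul_left ?_ hs0
      have e3 : (s n : ℝ) * (k * (2 * (k - 1) * ((s n : ℝ)⁻¹ + Real.log n / s n))) =
        (k - 1) * (2 * (k * (1 + Real.log n))) := by field_simp
      rw [e3]
      linarith
    simp only [hw] at h9
    linarith
  -- Upper bound, from $\mathbb E[X_{s+1}]\le n^{2\varepsilon}$, whose logarithm is negligible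
  -- against `s`.
  · filter_upwards [hp1.eventually (gt_mem_nhds one_pos), hst.eventually_ge_atTop (2 * k),
      ha', hxt.eventually (gt_mem_nhds (by norm_num : (0 : ℝ) < 1 / 2)), eventually_ge_atTop 4]
      with n hp1 hs ha hx hn
    have hn0 : (4 : ℝ) ≤ n := by exact_mod_cast hn
    have hs0 : (0 : ℝ) < s n := by exact_mod_cast (by omega : 0 < s n)
    rw [div_lt_iff₀ (by linarith)] at hx
    have hsn' : (s n : ℝ) + 1 < n := by linarith
    have hsn : s n + 1 < n := by exact_mod_cast hsn'
    have h1 := choose_mul_ge (by omega) hp1 hsn ha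
    rw [Real.log_rpow (by linarith)] at h1
    push_cast at h1
    have h2 : Real.log (n - (s n + 1)) - Real.log (s n + 1) = Real.log (n / s n) +
        Real.log ((1 - (s n / n + (n : ℝ)⁻¹)) / (1 + (s n : ℝ)⁻¹)) := by
      have e1 : (1 - (s n / n + (n : ℝ)⁻¹)) / (1 + (s n : ℝ)⁻¹) =
          ((n - (s n + 1)) / (s n + 1)) / (n / s n) := by field_simp
      have e2 : (0 : ℝ) < (n - (s n + 1)) / (s n + 1) := div_pos (by linarith) (by linarith)
      rw [e1, Real.log_div e2.ne' (by positivity),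
        Real.log_div (x := (n : ℝ) - (s n + 1)) (by linarith) (by linarith)]
      ring
    have h3 : (Real.log (s n + 1) + 1 + 2 * ε * Real.log n) / (s n + 1) ≤
        Real.log n / s n + (s n : ℝ)⁻¹ + 2 * ε * (Real.log n / s n) := by
      have e1 : Real.log n / s n + (s n : ℝ)⁻¹ + 2 * ε * (Real.log n / s n) =
        (Real.log n + 1 + 2 * ε * Real.log n) / s n := by field_simp
      have e2 : Real.log (s n + 1) ≤ Real.log n := Real.log_le_log (by linarith) hsn'.le
      have e3 : 0 ≤ Real.log n := Real.log_nonneg (by linarith)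
      rw [e1]
      gcongr
      linarith
    rw [h2] at h1
    have hk0 : (0 : ℝ) ≤ k := by linarith
    have h4 := mul_le_mul_of_nonneg_left h3 hk0
    linarith

/-- The upper bound on `p` gives $s_x\ge M\log n$ for every fixed $M$, hence $(\log n)/s_x\to0$; the
rest is `isCritical_of_expIndep`. -/
theorem isCritical_firstMomentThreshold (hk : 2 ≤ k) (hε : 0 < ε)
    (hε' : ε < ((k : ℝ) - 1) / ((k : ℝ) + 1))
    (hp : ∀ᶠ n : ℕ in atTop,
      (n : ℝ) ^ (-((((k : ℝ) - 1) * k) / ((k : ℝ) + 1)) + ε) < p n ∧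
        p n < Real.log n ^ (-((k : ℝ) - 1))) :
    IsCritical k p (ε / (2 * k)) (fun n => firstMomentThreshold n k (p n) ε) ∧
      Tendsto (fun n : ℕ => (n : ℝ) ^ (2 * ε) *
        (firstMomentThreshold n k (p n) ε / n : ℝ) ^ (k - 1)) atTop (𝓝 0) ∧
      ∀ᶠ n : ℕ in atTop, (n : ℝ) ^ (2 * ε) <
        expIndep n k (p n) (firstMomentThreshold n k (p n) ε) := by
  have hk2 : (2 : ℝ) ≤ k := by exact_mod_cast hk
  have hk1 : (((k - 1 : ℕ) : ℝ)) = (k : ℝ) - 1 := by rw [Nat.cast_sub (by omega)]; simp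
  have hp0 : ∀ᶠ n in atTop, 0 < p n := by
    filter_upwards [hp, eventually_gt_atTop 0] with n hp hn
    have hn0 : (0 : ℝ) < n := by exact_mod_cast hn
    exact lt_trans (by positivity) hp.1
  have hp1 : Tendsto p atTop (𝓝 0) := by
    have h1 := (tendsto_rpow_neg_atTop (by linarith : (0 : ℝ) < k - 1)).comp tendsto_log_natCast
    refine squeeze_zero' (hp0.mono fun n h => h.le) ?_ h1
    filter_upwards [hp] with n hp using hp.2.le
  have hp2 : ∀ᶠ n : ℕ in atTop, p n * Real.log n ^ (k - 1) ≤ 1 := by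
    filter_upwards [hp, tendsto_log_natCast.eventually_gt_atTop 0] with n hp hL
    rw [Real.rpow_neg hL.le, ← hk1, Real.rpow_natCast, ← one_div] at hp
    exact ((lt_div_iff₀ (by positivity)).1 hp.2).le
  have ht := fun M hM => eventually_rpow_lt_expIndep (ε := ε) hk hp0 hp1 hp2 (M := M) hM
  set s : ℕ → ℕ := fun n => firstMomentThreshold n k (p n) ε with hs
  have hge : ∀ M : ℝ, 1 ≤ M → ∀ᶠ n : ℕ in atTop, M * Real.log n ≤ s n := fun M hM => by
    filter_upwards [ht M hM] with n h
    exact (Nat.le_ceil _).trans (by exact_mod_cast le_firstMomentThreshold h)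
  have hs0 : ∀ᶠ n in atTop, 0 < s n := by
    filter_upwards [hge 1 le_rfl, tendsto_log_natCast.eventually_gt_atTop 0] with n h1 h2
    have : (0 : ℝ) < s n := by linarith
    exact_mod_cast this
  have hld : Tendsto (fun n : ℕ => Real.log n / s n) atTop (𝓝 0) := by
    rw [Metric.tendsto_nhds]
    intro δ hδ
    filter_upwards [hge (max 1 (2 / δ)) (le_max_left _ _), hs0,
      tendsto_log_natCast.eventually_gt_atTop 0] with n h1 h2 h3
    have h4 : (0 : ℝ) < s n := by exact_mod_cast h2
    rw [Real.dist_eq, sub_zero, abs_of_nonneg (by positivity), div_lt_iff₀ h4]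
    have h5 : 2 / δ * Real.log n ≤ s n := le_trans (by gcongr; exact le_max_right _ _) h1
    have h6 : δ * (2 / δ * Real.log n) = 2 * Real.log n := by field_simp
    have h7 := mul_le_mul_of_nonneg_left h5 hδ.le
    linarith
  have ha : ∀ᶠ n : ℕ in atTop, (n : ℝ) ^ (2 * ε) < expIndep n k (p n) (s n) := by
    filter_upwards [ht 1 le_rfl] with n h using firstMomentThreshold_spec h
  obtain ⟨h1, h2⟩ := isCritical_of_expIndep hk hε hε' hp0 hp1 (hp.mono fun n h => h.1) hld hs0 ha
    (Eventually.of_forall fun n => expIndep_firstMomentThreshold_add_one_le _ _ _ _)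
  exact ⟨h1, h2, ha⟩

end Threshold

end

end RandomHypergraph

namespace RandomHypergraph

noncomputable section

/-! ### Expected number of augmented independent sets: a Poisson profile in `r`. -/

section AugmentedBounds

variable {n k s r : ℕ} {p : ℝ}

theorem atMostOne_add_ge (hp0 : 0 ≤ p) (hp1 : p < 1) (B d : ℕ) :
    (1 - p) ^ d * atMostOne p B ≤ atMostOne p (B + d) := by
  have h1 : 0 < 1 - p := by linarith
  rw [atMostOne_eq hp1, atMostOne_eq hp1, pow_add, ← mul_assoc, mul_comm ((1 - p) ^ d)]
  gcongr
  linarith [Nat.cast_nonneg (α := ℝ) d]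

theorem atMostOne_antitone (hp0 : 0 ≤ p) (hp1 : p < 1) : Antitone (atMostOne p) := by
  refine antitone_nat_of_succ_le fun B => ?_
  have h1 : 0 < 1 - p := by linarith
  rw [atMostOne_eq hp1, atMostOne_eq hp1, pow_succ, mul_assoc]
  gcongr
  have h2 : (1 - p) * (1 + ((B + 1 : ℕ) : ℝ) * (p / (1 - p))) = 1 + B * p := by
    push_cast; field_simp; ring
  rw [h2]
  gcongr
  rw [le_div_iff₀ h1]
  nlinarith

/-- Splits the $kr$ ordered matching vertices into `r` vertices added to a set of size `s` and `(k -
1) * r` vertices of that set. -/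
theorem choose_mul_descFactorial (n s r k : ℕ) (hk : 1 ≤ k) :
    n.choose (s + r) * (s + r).descFactorial (k * r) =
      n.choose s * (n - s).descFactorial r * s.descFactorial ((k - 1) * r) := by
  have h1 := Nat.descFactorial_mul_descFactorial (n := s + r) (k := r) (m := k * r)
    (Nat.le_mul_of_pos_left r hk)
  rw [Nat.add_sub_cancel] at h1
  rw [← h1, show (k - 1) * r = k * r - r by rw [Nat.sub_mul, one_mul]]
  have h2 : n.choose (s + r) * (s + r).descFactorial r = n.choose s * (n - s).descFactorial r := by
    refine Nat.eq_of_mul_eq_mul_left s.factorial_pos ?_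
    have h3 := Nat.factorial_mul_descFactorial (n := s + r) (k := r) (Nat.le_add_left _ _)
    rw [Nat.add_sub_cancel] at h3
    have h4 := Nat.descFactorial_mul_descFactorial (n := n) (k := s) (m := s + r)
      (Nat.le_add_right _ _)
    rw [Nat.add_sub_cancel_left] at h4
    calc s.factorial * (n.choose (s + r) * (s + r).descFactorial r)
        = s.factorial * (s + r).descFactorial r * n.choose (s + r) := by ring
      _ = (n - s).descFactorial r * n.descFactorial s := by
        rw [h3, h4, Nat.descFactorial_eq_factorial_mul_choose]
      _ = _ := by rw [Nat.descFactorial_eq_factorial_mul_choose n s]; ring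
  calc n.choose (s + r) * (s.descFactorial (k * r - r) * (s + r).descFactorial r)
      = n.choose (s + r) * (s + r).descFactorial r * s.descFactorial (k * r - r) := by ring
    _ = _ := by rw [h2]

theorem numMatchings_eq_zero {k v r : ℕ} (h : v.choose k < r) : numMatchings k v r = 0 := by
  rw [numMatchings, Finset.card_eq_zero, Finset.eq_empty_iff_forall_notMem]
  intro M hM
  rw [mem_matchings] at hM
  have h1 := Finset.card_le_card hM.1.1
  rw [Finset.card_powersetCard, Finset.card_range, hM.1.2] at h1
  omega

theorem expAug_eq (hk : 1 ≤ k) (hp1 : p < 1) (s r : ℕ) :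
    expAug n k p (s + r) r = n.choose s * (((n - s).descFactorial r : ℝ) *
      s.descFactorial ((k - 1) * r) / (r.factorial * k.factorial ^ r)) *
      (p / (1 - p)) ^ r * (1 - p) ^ (s + r).choose k *
      (1 - atMostOne p ((s + r).choose (k - 1))) ^ (n - (s + r)) := by
  have h1 := factorial_mul_pow_mul_numMatchings hk (s + r) r
  have h2 := choose_mul_descFactorial n s r k hk
  rw [← h1] at h2
  have h3 : (n.choose (s + r) : ℝ) * (r.factorial * k.factorial ^ r * numMatchings k (s + r) r) =
    n.choose s * (n - s).descFactorial r * s.descFactorial ((k - 1) * r) := by exact_mod_cast h2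
  have h4 : (n.choose s * (((n - s).descFactorial r : ℝ) *
      s.descFactorial ((k - 1) * r) / (r.factorial * k.factorial ^ r)) : ℝ) =
      n.choose (s + r) * numMatchings k (s + r) r := by
    rw [← mul_div_assoc, ← mul_assoc, ← h3]; field_simp
  rw [h4, expAug]
  -- When `r` exceeds the number of potential edges the exponent is truncated, but then no matching
  -- exists and both sides vanish.
  rcases lt_or_ge ((s + r).choose k) r with hr | hr
  · simp [numMatchings_eq_zero hr]
  · have h5 : (1 - p) ^ (s + r).choose k = (1 - p) ^ ((s + r).choose k - r) * (1 - p) ^ r := by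
      rw [← pow_add, Nat.sub_add_cancel hr]
    have h6 : 1 - p ≠ 0 := by linarith
    rw [h5, div_pow]
    field_simp

variable (n k p) in
/-- The expected number of edges in an augmented independent set of order `s`. -/
def augRate (s : ℕ) : ℝ :=
  n * (1 - p) ^ s.choose (k - 1) * ((s : ℝ) ^ (k - 1) * (p / (1 - p)) / k.factorial)

theorem augRate_nonneg (hp0 : 0 ≤ p) (hp1 : p < 1) (s : ℕ) : 0 ≤ augRate n k p s := by
  have : 0 < 1 - p := by linarith
  unfold augRate; positivity

variable (n k p) in
/-- The order of magnitude of the expected number of augmented independent sets of order `s`. -/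
def augMain (s : ℕ) : ℝ :=
  expIndep n k p s * Real.exp (augRate n k p s - n * atMostOne p (s.choose (k - 1)))

/-- Written in the shape of `expAug_eq`: the two differ by falling factorials against powers, by
$\binom{s+r}k$ against its linear part in `r`, and by the factor for outside vertices. -/
theorem expIndep_mul_augRate_pow (s r : ℕ) :
    expIndep n k p s * (augRate n k p s ^ r / r.factorial) =
      n.choose s * ((n : ℝ) ^ r * (s : ℝ) ^ ((k - 1) * r) / (r.factorial * k.factorial ^ r)) *
      (p / (1 - p)) ^ r * (1 - p) ^ (s.choose k + r * s.choose (k - 1)) := by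
  rw [expIndep, augRate, mul_pow, mul_pow, div_pow, mul_pow, pow_add, ← pow_mul, ← pow_mul,
    mul_comm r (s.choose (k - 1))]
  field_simp

theorem expAug_le (hp0 : 0 ≤ p) (hp1 : p < 1) (hk : 1 ≤ k) (s r : ℕ) :
    expAug n k p (s + r) r ≤ expIndep n k p s * (augRate n k p s ^ r / r.factorial) *
      (1 - atMostOne p ((s + r).choose (k - 1))) ^ (n - (s + r)) := by
  have hp : 0 < 1 - p := by linarith
  have hb := atMostOne_le_one hp0 hp1.le ((s + r).choose (k - 1))
  have hb' : 0 ≤ 1 - atMostOne p ((s + r).choose (k - 1)) := by linarith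
  rw [expAug_eq hk hp1, expIndep_mul_augRate_pow]
  have h1 : ((n - s).descFactorial r : ℝ) ≤ (n : ℝ) ^ r := by
    exact_mod_cast (Nat.descFactorial_le_pow _ _).trans (Nat.pow_le_pow_left (Nat.sub_le _ _) _)
  have h2 : (s.descFactorial ((k - 1) * r) : ℝ) ≤ (s : ℝ) ^ ((k - 1) * r) := by
    exact_mod_cast Nat.descFactorial_le_pow _ _
  have h3 : s.choose k + r * s.choose (k - 1) ≤ (s + r).choose k := by
    have h4 := choose_sub_choose_ge hk (Nat.le_add_left r s)
    rw [Nat.add_sub_cancel] at h4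
    have h5 := Nat.choose_le_choose k (Nat.le_add_right s r)
    omega
  have h6 := pow_le_pow_of_le_one hp.le (by linarith : 1 - p ≤ 1) h3
  gcongr

theorem choose_add_le (s r k : ℕ) (hk : 1 ≤ k) :
    (s + r).choose k ≤ s.choose k + r * (s + r).choose (k - 1) := by
  obtain ⟨m, rfl⟩ : ∃ m, k = m + 1 := ⟨k - 1, by omega⟩
  rw [Nat.add_sub_cancel]
  induction r with
  | zero => simp
  | succ r ih =>
    rw [← add_assoc, Nat.choose_succ_succ]
    have h1 := Nat.mul_le_mul_left r (Nat.choose_le_choose m (by omega : s + r ≤ s + r + 1))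
    have h2 := Nat.choose_le_choose m (by omega : s + r ≤ s + r + 1)
    have h3 : (r + 1) * (s + r + 1).choose m = r * (s + r + 1).choose m + (s + r + 1).choose m := by
      ring
    have h4 : (s + r).choose m.succ = (s + r).choose (m + 1) := rfl
    omega

theorem one_sub_mul_le_pow {x : ℝ} (hx : x ≤ 1) (m : ℕ) : 1 - m * x ≤ (1 - x) ^ m := by
  have := one_add_mul_le_pow (by linarith : -2 ≤ -x) m
  rw [← sub_eq_add_neg] at this
  linarith

/-- The losses `b₁`, `b₂`, `b₃` bound respectively $(n-s)_r$ against $n^r$, $(s)_{(k-1)r}$ against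
the power of `s`, and the part of $\binom{s+r}k$ that is quadratic in `r`. -/
theorem expAug_ge (hp0 : 0 ≤ p) (hp1 : p < 1) (hk : 2 ≤ k) (hs : 0 < s) (hsr : s + r ≤ n)
    (hr : (k - 1) * r ≤ s) {b₁ b₂ b₃ : ℝ} (h1 : r * (s + r) / n ≤ b₁)
    (h2 : ((k - 1) * r) ^ 2 / s ≤ b₂) (h3 : p * (r ^ 2 * (s + r : ℝ) ^ (k - 2)) ≤ b₃)
    (hb1 : b₁ ≤ 1) (hb2 : b₂ ≤ 1) (hb3 : b₃ ≤ 1) :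
    expIndep n k p s * (augRate n k p s ^ r / r.factorial) * ((1 - b₁) * (1 - b₂) * (1 - b₃)) *
      (1 - atMostOne p (s.choose (k - 1))) ^ n ≤ expAug n k p (s + r) r := by
  have hp : 0 < 1 - p := by linarith
  have hk1 : (((k - 1 : ℕ) : ℝ)) = (k : ℝ) - 1 := by rw [Nat.cast_sub (by omega)]; simp
  have hn0 : (0 : ℝ) < n := by exact_mod_cast (by omega : 0 < n)
  have hs0 : (0 : ℝ) < s := by exact_mod_cast hs
  have hsr' : (s + r : ℝ) ≤ n := by exact_mod_cast hsr
  have hr' : ((k : ℝ) - 1) * r ≤ s := by rw [← hk1]; exact_mod_cast hr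
  rw [expAug_eq (by omega) hp1, expIndep_mul_augRate_pow]
  have e1 : (n : ℝ) ^ r * (1 - b₁) ≤ (n - s).descFactorial r := by
    have a1 : ((n : ℝ) - (s + r)) ^ r ≤ (n - s).descFactorial r := by
      have a2 := Nat.pow_sub_le_descFactorial (n - s) r
      have a3 : ((n : ℝ) - (s + r)) ≤ ((n - s + 1 - r : ℕ) : ℝ) := by
        rw [Nat.cast_sub (by omega)]; push_cast [Nat.cast_sub (by omega : s ≤ n)]; linarith
      calc ((n : ℝ) - (s + r)) ^ r ≤ ((n - s + 1 - r : ℕ) : ℝ) ^ r := by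
            gcongr
        _ ≤ _ := by exact_mod_cast a2
    refine le_trans ?_ a1
    have a4 := one_sub_mul_le_pow (x := (s + r) / n) ((div_le_one hn0).2 hsr') r
    have a5 : (n : ℝ) - (s + r) = n * (1 - (s + r) / n) := by field_simp
    rw [a5, mul_pow]
    gcongr
    refine le_trans ?_ a4
    rw [← mul_div_assoc]; linarith
  have e2 : (s : ℝ) ^ ((k - 1) * r) * (1 - b₂) ≤ s.descFactorial ((k - 1) * r) := by
    have a1 : ((s : ℝ) - (k - 1) * r) ^ ((k - 1) * r) ≤ s.descFactorial ((k - 1) * r) := by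
      have a2 := Nat.pow_sub_le_descFactorial s ((k - 1) * r)
      have a3 : ((s : ℝ) - (k - 1) * r) ≤ ((s + 1 - (k - 1) * r : ℕ) : ℝ) := by
        rw [Nat.cast_sub (by omega)]; push_cast; rw [hk1]; linarith
      calc ((s : ℝ) - (k - 1) * r) ^ ((k - 1) * r)
          ≤ ((s + 1 - (k - 1) * r : ℕ) : ℝ) ^ ((k - 1) * r) := by gcongr
        _ ≤ _ := by exact_mod_cast a2
    refine le_trans ?_ a1
    have a4 := one_sub_mul_le_pow (x := (k - 1) * r / s) ((div_le_one hs0).2 hr') ((k - 1) * r)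
    have a5 : (s : ℝ) - (k - 1) * r = s * (1 - (k - 1) * r / s) := by field_simp
    rw [a5, mul_pow]
    gcongr
    refine le_trans ?_ a4
    push_cast
    rw [hk1, ← mul_div_assoc, ← pow_two]; linarith
  have e3 : (1 - p) ^ (s.choose k + r * s.choose (k - 1)) * (1 - b₃) ≤ (1 - p) ^ (s + r).choose k := by
    have a1 := choose_add_le s r k (by omega)
    have a2 : (s + r).choose (k - 1) ≤ s.choose (k - 1) + r * (s + r) ^ (k - 2) := by
      have := choose_le_add_mul_pow s r (k - 2)
      rwa [show k - 2 + 1 = k - 1 by omega] at this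
    have a3 : (s + r).choose k ≤ s.choose k + r * s.choose (k - 1) + r ^ 2 * (s + r) ^ (k - 2) := by
      have := Nat.mul_le_mul_left r a2
      calc (s + r).choose k ≤ s.choose k + r * (s + r).choose (k - 1) := a1
        _ ≤ s.choose k + r * (s.choose (k - 1) + r * (s + r) ^ (k - 2)) := by omega
        _ = _ := by ring
    refine le_trans ?_ (pow_le_pow_of_le_one hp.le (by linarith) a3)
    rw [pow_add (1 - p) (s.choose k + r * s.choose (k - 1))]
    gcongr
    refine le_trans ?_ (one_sub_mul_le_pow hp1.le _)
    push_cast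
    linarith
  have hβ := atMostOne_antitone hp0 hp1 (Nat.choose_le_choose (k - 1) (Nat.le_add_right s r))
  have hβ1 := atMostOne_le_one hp0 hp1.le (s.choose (k - 1))
  have e4 : (1 - atMostOne p (s.choose (k - 1))) ^ n ≤
      (1 - atMostOne p ((s + r).choose (k - 1))) ^ (n - (s + r)) := by
    refine (pow_le_pow_of_le_one (by linarith) ?_ (Nat.sub_le n (s + r))).trans ?_
    · linarith [atMostOne_nonneg hp0 hp1.le (s.choose (k - 1))]
    · gcongr
  have hb1' : 0 ≤ 1 - b₁ := by linarith
  have hb2' : 0 ≤ 1 - b₂ := by linarith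
  have hb3' : 0 ≤ 1 - b₃ := by linarith
  have hβ2 : 0 ≤ 1 - atMostOne p (s.choose (k - 1)) := by linarith
  calc _ = n.choose s * (((n : ℝ) ^ r * (1 - b₁)) * ((s : ℝ) ^ ((k - 1) * r) * (1 - b₂)) /
        (r.factorial * k.factorial ^ r)) * (p / (1 - p)) ^ r *
        ((1 - p) ^ (s.choose k + r * s.choose (k - 1)) * (1 - b₃)) *
        (1 - atMostOne p (s.choose (k - 1))) ^ n := by ring
    _ ≤ _ := by gcongr

theorem pow_div_factorial_le_exp_neg {x : ℝ} (hx : 0 ≤ x) {r : ℕ} (hr : Real.exp 2 * x ≤ r) :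
    x ^ r / r.factorial ≤ Real.exp (-r) := by
  have h1 := pow_div_factorial_le r
  rw [div_le_iff₀ (by positivity)] at h1 ⊢
  have h2 : Real.exp 1 ^ r * (Real.exp 1 * x) ^ r ≤ Real.exp 1 ^ r * r.factorial := by
    refine le_trans ?_ h1
    rw [← mul_pow, ← mul_assoc, ← Real.exp_add]
    norm_num
    gcongr
  have h3 : (Real.exp 1 * x) ^ r ≤ r.factorial := le_of_mul_le_mul_left h2 (by positivity)
  have h4 : Real.exp (-r) * Real.exp 1 ^ r = 1 := by
    rw [← Real.exp_nat_mul, ← Real.exp_add]; simp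
  calc x ^ r = Real.exp (-r) * (Real.exp 1 ^ r * x ^ r) := by rw [← mul_assoc, h4, one_mul]
    _ = Real.exp (-r) * (Real.exp 1 * x) ^ r := by rw [mul_pow]
    _ ≤ _ := by gcongr

/-- For `r ≤ R` the probability `atMostOne` at `s + r` is close to the one at `s`, and the Poisson
weights sum to at most `exp` of the rate. For `r > R` each weight is at most $e^{-R}$. -/
theorem sum_expAug_le (hp0 : 0 ≤ p) (hp1 : p < 1) (hk : 1 ≤ k) {R d : ℕ}
    (hR : Real.exp 2 * augRate n k p s ≤ R)
    (hd : (s + R).choose (k - 1) ≤ s.choose (k - 1) + d) :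
    ∑ r ∈ Finset.range (n + 1), expAug n k p (s + r) r ≤
      augMain n k p s * Real.exp (atMostOne p (s.choose (k - 1)) * (s + R + n * (d * p))) +
      expIndep n k p s * ((n + 1) * Real.exp (-R)) := by
  have hp : 0 < 1 - p := by linarith
  have hl := augRate_nonneg (n := n) (k := k) hp0 hp1 s
  have ha : 0 ≤ expIndep n k p s := by unfold expIndep; positivity
  set β := atMostOne p (s.choose (k - 1)) with hβ
  have hβ0 : 0 ≤ β := atMostOne_nonneg hp0 hp1.le _
  set lam := augRate n k p s with hlam
  have hterm : ∀ r ∈ Finset.range (n + 1), expAug n k p (s + r) r ≤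
      expIndep n k p s * (lam ^ r / r.factorial *
        Real.exp (-(n * β) + β * (s + R + n * (d * p)))) +
      expIndep n k p s * Real.exp (-R) := by
    intro r hr
    have h1 := expAug_le (n := n) hp0 hp1 hk s r
    have hb1 := atMostOne_le_one hp0 hp1.le ((s + r).choose (k - 1))
    have hb0 := atMostOne_nonneg hp0 hp1.le ((s + r).choose (k - 1))
    refine h1.trans ?_
    rcases le_or_gt r R with hrR | hrR
    · have h2 : (1 - atMostOne p ((s + r).choose (k - 1))) ^ (n - (s + r)) ≤
          Real.exp (-(n * β) + β * (s + R + n * (d * p))) := by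
        have h3 : (1 - p) ^ d * β ≤ atMostOne p ((s + r).choose (k - 1)) := by
          refine (atMostOne_add_ge hp0 hp1 _ d).trans (atMostOne_antitone hp0 hp1 ?_)
          exact (Nat.choose_le_choose _ (by omega)).trans hd
        have h4 : (1 - d * p) * β ≤ atMostOne p ((s + r).choose (k - 1)) := by
          refine le_trans ?_ h3
          gcongr
          exact one_sub_mul_le_pow hp1.le d
        have h5 : atMostOne p ((s + r).choose (k - 1)) ≤ β :=
          atMostOne_antitone hp0 hp1 (Nat.choose_le_choose _ (by omega))
        have h6 : (n : ℝ) - (s + R) ≤ ((n - (s + r) : ℕ) : ℝ) := by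
          have : n ≤ (n - (s + r)) + (s + R) := by omega
          have : (n : ℝ) ≤ ((n - (s + r) : ℕ) : ℝ) + (s + R) := by exact_mod_cast this
          linarith
        calc (1 - atMostOne p ((s + r).choose (k - 1))) ^ (n - (s + r))
            ≤ Real.exp (-atMostOne p ((s + r).choose (k - 1))) ^ (n - (s + r)) := by
              refine pow_le_pow_left₀ (by linarith) ?_ _
              linarith [Real.add_one_le_exp (-atMostOne p ((s + r).choose (k - 1)))]
          _ = Real.exp (((n - (s + r) : ℕ) : ℝ) * -atMostOne p ((s + r).choose (k - 1))) := by
              rw [Real.exp_nat_mul]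
          _ ≤ _ := by
              rw [Real.exp_le_exp]
              have h7 := mul_le_mul_of_nonneg_right h6 hb0
              have h8 := mul_le_mul_of_nonneg_left h4 (Nat.cast_nonneg (α := ℝ) n)
              have h9 := mul_le_mul_of_nonneg_left h5 (by positivity : (0 : ℝ) ≤ s + R)
              linarith
      calc expIndep n k p s * (lam ^ r / r.factorial) *
            (1 - atMostOne p ((s + r).choose (k - 1))) ^ (n - (s + r))
          ≤ expIndep n k p s * (lam ^ r / r.factorial) *
            Real.exp (-(n * β) + β * (s + R + n * (d * p))) := by gcongr
        _ ≤ _ := by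
          rw [mul_assoc]
          exact le_add_of_nonneg_right (by positivity)
    · have h2 : lam ^ r / r.factorial ≤ Real.exp (-R) := by
        have hrR' : (R : ℝ) ≤ r := by exact_mod_cast hrR.le
        refine (pow_div_factorial_le_exp_neg hl (hR.trans hrR')).trans ?_
        gcongr
      have h3 : (1 - atMostOne p ((s + r).choose (k - 1))) ^ (n - (s + r)) ≤ 1 :=
        pow_le_one₀ (by linarith) (by linarith)
      calc expIndep n k p s * (lam ^ r / r.factorial) *
            (1 - atMostOne p ((s + r).choose (k - 1))) ^ (n - (s + r))
          ≤ expIndep n k p s * Real.exp (-R) * 1 := by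
            gcongr
        _ ≤ _ := by
          rw [mul_one]
          exact le_add_of_nonneg_left (by positivity)
  refine (Finset.sum_le_sum hterm).trans ?_
  rw [Finset.sum_add_distrib, ← Finset.mul_sum, ← Finset.sum_mul, Finset.sum_const,
    Finset.card_range, nsmul_eq_mul]
  have h1 := Real.sum_le_exp_of_nonneg hl (n + 1)
  refine add_le_add ?_ (le_of_eq (by push_cast; ring))
  rw [augMain]
  calc expIndep n k p s * ((∑ i ∈ Finset.range (n + 1), lam ^ i / i.factorial) *
        Real.exp (-(n * β) + β * (s + R + n * (d * p))))
      ≤ expIndep n k p s * (Real.exp lam * Real.exp (-(n * β) + β * (s + R + n * (d * p)))) := by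
        gcongr
    _ = _ := by rw [mul_assoc, ← Real.exp_add, ← Real.exp_add, ← hβ, ← hlam]; ring_nf

/-- The Poisson weight at the integer part of the rate carries, up to a constant, at least a
fraction `1 / (1 + x)` of the total mass, so a single `r` suffices for the lower bound. -/
theorem pow_floor_div_factorial_ge {x : ℝ} (hx : 0 ≤ x) :
    Real.exp (x - 2) / (1 + x) ≤ x ^ ⌊x⌋₊ / (⌊x⌋₊).factorial := by
  set r := ⌊x⌋₊ with hr
  have h1 : (r : ℝ) ≤ x := Nat.floor_le hx
  have h2 : x < r + 1 := Nat.lt_floor_add_one x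
  rcases Nat.eq_zero_or_pos r with h0 | h0
  · rw [h0] at h2 ⊢
    simp only [Nat.cast_zero, zero_add, pow_zero, Nat.factorial_zero, Nat.cast_one, div_one] at *
    rw [div_le_one (by linarith)]
    have : Real.exp (x - 2) ≤ Real.exp 0 := by gcongr; linarith
    rw [Real.exp_zero] at this
    linarith
  · have hr0 : (0 : ℝ) < r := by exact_mod_cast h0
    have h3 := factorial_le_pow_mul_exp h0
    rw [div_le_div_iff₀ (by linarith) (by positivity)]
    calc Real.exp (x - 2) * r.factorial
        ≤ Real.exp (x - 2) * ((r : ℝ) ^ (r + 1) * Real.exp (1 - r)) := by gcongr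
      _ = (r : ℝ) ^ r * r * Real.exp (x - 2 + (1 - r)) := by
          rw [Real.exp_add (x - 2), pow_succ]; ring
      _ ≤ x ^ r * (1 + x) * Real.exp 0 := by
          gcongr
          · linarith
          · linarith
      _ = _ := by rw [Real.exp_zero, mul_one]

end AugmentedBounds

end

end RandomHypergraph

/-! ### Ratios of consecutive expectations along a critical sequence. -/

namespace RandomHypergraph

noncomputable section

theorem expIndep_succ_mul {n k s : ℕ} {p : ℝ} (hk : 1 ≤ k) (hs : s ≤ n) :
    expIndep n k p (s + 1) * (s + 1) =
      expIndep n k p s * ((n - s) * (1 - p) ^ s.choose (k - 1)) := by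
  have h1 : (n.choose (s + 1) : ℝ) * (s + 1) = n.choose s * (n - s) := by
    have := Nat.choose_succ_right_eq n s
    rw [← Nat.cast_sub hs]
    exact_mod_cast this
  have h2 : (s + 1).choose k = s.choose (k - 1) + s.choose k := by
    obtain ⟨m, rfl⟩ : ∃ m, k = m + 1 := ⟨k - 1, by omega⟩
    rw [Nat.choose_succ_succ, Nat.add_sub_cancel]
  rw [expIndep, expIndep, h2, pow_add]
  linear_combination ((1 - p) ^ s.choose (k - 1) * (1 - p) ^ s.choose k) * h1

theorem exp_le_one_add_two_mul {t : ℝ} (h1 : t ≤ 1 / 2) (h0 : 0 ≤ t) : Real.exp t ≤ 1 + 2 * t := by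
  have h2 := Real.one_sub_le_exp_neg t
  have h3 : Real.exp t * Real.exp (-t) = 1 := by rw [← Real.exp_add]; simp
  have h4 := Real.exp_pos t
  nlinarith

namespace IsCritical

variable {k : ℕ} {p : ℕ → ℝ} {c : ℝ} {s : ℕ → ℕ}

theorem p_le (h : IsCritical k p c s) {b : ℝ} (hb : 0 < b) : ∀ᶠ n in atTop, p n ≤ b :=
  h.tendsto_p.eventually (ge_mem_nhds hb)

theorem pow_choose_le (h : IsCritical k p c s) :
    ∀ᶠ n : ℕ in atTop, (1 - p n) ^ (s n).choose (k - 1) ≤ (s n / n : ℝ) ^ k := by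
  have h1 : Real.exp (-k) < 1 := by
    rw [Real.exp_lt_one_iff]
    have : (2 : ℝ) ≤ k := by exact_mod_cast h.two_le
    linarith
  filter_upwards [h.tendsto_pow_choose_div.eventually (ge_mem_nhds h1), h.eventually_basic]
    with n h2 ⟨hn, hs, _, _⟩
  have hn0 : (0 : ℝ) < n := by exact_mod_cast hn
  have hs0 : (0 : ℝ) < s n := by exact_mod_cast hs
  exact (div_le_one (by positivity)).1 h2

theorem pow_le_mul_pow_choose (h : IsCritical k p c s) :
    ∀ᶠ n : ℕ in atTop, (s n / n : ℝ) ^ k ≤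
      2 * Real.exp k * (1 - p n) ^ (s n).choose (k - 1) := by
  have h1 : Real.exp (-k) / 2 < Real.exp (-k) := half_lt_self (Real.exp_pos _)
  filter_upwards [h.tendsto_pow_choose_div.eventually (le_mem_nhds h1), h.eventually_basic]
    with n h2 ⟨hn, hs, _, _⟩
  have hn0 : (0 : ℝ) < n := by exact_mod_cast hn
  have hs0 : (0 : ℝ) < s n := by exact_mod_cast hs
  rw [le_div_iff₀ (by positivity)] at h2
  have h3 : Real.exp k * Real.exp (-k) = 1 := by rw [← Real.exp_add]; simp
  calc (s n / n : ℝ) ^ k = 2 * Real.exp k * (Real.exp (-k) / 2 * (s n / n : ℝ) ^ k) := by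
        linear_combination (-(s n / n : ℝ) ^ k) * h3
    _ ≤ _ := by gcongr

theorem augRate_le (h : IsCritical k p c s) :
    ∀ᶠ n : ℕ in atTop, augRate n k (p n) (s n) ≤ 4 * Real.log n * (n * (s n / n : ℝ) ^ k) := by
  filter_upwards [h.pow_choose_le, h.mul_pow_le, h.eventually_basic,
    h.p_le (by norm_num : (0 : ℝ) < 1 / 2)] with n h1 h2 ⟨hn, hs, hp, hL⟩ hp2
  have hp1 : 0 < 1 - p n := by linarith
  have h3 : (s n : ℝ) ^ (k - 1) * (p n / (1 - p n)) / k.factorial ≤ 4 * Real.log n := by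
    rw [div_le_iff₀ (by positivity)]
    have h4 : p n / (1 - p n) ≤ 2 * p n := by
      rw [div_le_iff₀ hp1]; nlinarith
    calc (s n : ℝ) ^ (k - 1) * (p n / (1 - p n)) ≤ (s n : ℝ) ^ (k - 1) * (2 * p n) := by gcongr
      _ = 2 * (p n * (s n : ℝ) ^ (k - 1)) := by ring
      _ ≤ 2 * (2 * k.factorial * Real.log n) := by gcongr
      _ = _ := by ring
  rw [augRate]
  calc (n : ℝ) * (1 - p n) ^ (s n).choose (k - 1) *
        ((s n : ℝ) ^ (k - 1) * (p n / (1 - p n)) / k.factorial)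
      ≤ n * (s n / n : ℝ) ^ k * (4 * Real.log n) := by gcongr
    _ = _ := by ring

theorem atMostOne_le (h : IsCritical k p c s) :
    ∀ᶠ n : ℕ in atTop, atMostOne (p n) ((s n).choose (k - 1)) ≤
      12 * (k.factorial : ℝ) ^ 2 * Real.log n * (s n / n : ℝ) ^ k := by
  filter_upwards [h.pow_choose_le, h.mul_pow_le, h.eventually_basic,
    h.p_le (by norm_num : (0 : ℝ) < 1 / 2)] with n h1 h2 ⟨hn, hs, hp, hL⟩ hp2
  have hK : (1 : ℝ) ≤ 2 * k.factorial := by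
    have : (1 : ℝ) ≤ k.factorial := by exact_mod_cast Nat.one_le_of_lt k.factorial_pos
    linarith
  have := atMostOne_le_of_le hp hp2 hK hL (x := (s n / n : ℝ)) (by positivity) h2
    (h1.trans (le_mul_of_one_le_left (by positivity) hK))
  refine this.trans (le_of_eq ?_)
  ring

/-- With $q=(1-p)^{\binom s{k-1}}$ and $y=\log(n/s)$, one has $n\beta\sim nq\cdot ky$ and
$\lambda\sim nq\cdot y$, while $q\sim e^{-k}(s/n)^k$. -/
theorem tendsto_gap (h : IsCritical k p c s) :
    Tendsto (fun n : ℕ => (n * atMostOne (p n) ((s n).choose (k - 1)) - augRate n k (p n) (s n)) /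
      (n * (s n / n : ℝ) ^ k * Real.log (n / s n))) atTop (𝓝 (Real.exp (-k) * (k - 1))) := by
  have hp : Tendsto (fun n => (1 - p n)⁻¹) atTop (𝓝 1) := by
    simpa using (h.tendsto_p.const_sub 1).inv₀ (by norm_num)
  have h1 := ((h.tendsto_choose_mul_div.mul hp).sub
    ((h.tendsto_mul_pow_div.mul hp).div_const (k.factorial : ℝ))).add
    ((tendsto_const_nhds (x := (1 : ℝ))).div_atTop h.tendsto_log)
  have h2 := h.tendsto_pow_choose_div.mul h1
  have hk : (k.factorial : ℝ) ≠ 0 := by positivity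
  rw [mul_one, mul_one, div_self hk, add_zero] at h2
  refine h2.congr' ?_
  filter_upwards [h.eventually_basic, h.p_le (by norm_num : (0 : ℝ) < 1 / 2),
    h.tendsto_log.eventually_gt_atTop 0] with n ⟨hn, hs, hp, hL⟩ hp2 hl
  have hn0 : (0 : ℝ) < n := by exact_mod_cast hn
  have hs0 : (0 : ℝ) < s n := by exact_mod_cast hs
  have hp1 : 1 - p n ≠ 0 := by linarith
  have hx : (0 : ℝ) < (s n / n : ℝ) ^ k := by positivity
  rw [atMostOne_eq (by linarith), augRate]
  generalize Real.log (n / s n) = y at *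
  generalize (s n / n : ℝ) ^ k = X at *
  have := hl.ne'
  have := hx.ne'
  field_simp
  ring

/-- The exact ratio is $\frac{n-s}{s+1}(1-p)^{\binom s{k-1}}$, and the power is asymptotic to
$e^{-k}(s/n)^k$. -/
theorem tendsto_expIndep_succ (h : IsCritical k p c s) :
    Tendsto (fun n : ℕ => expIndep n k (p n) (s n + 1) /
      (expIndep n k (p n) (s n) * (s n / n : ℝ) ^ (k - 1))) atTop (𝓝 (Real.exp (-k))) := by
  have hinv : Tendsto (fun n => (s n : ℝ)⁻¹) atTop (𝓝 0) :=
    tendsto_inv_atTop_zero.comp (tendsto_natCast_atTop_atTop.comp h.tendsto_atTop)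
  have h1 := ((h.tendsto_div.const_sub 1).div (hinv.const_add 1) (by norm_num)).mul
    h.tendsto_pow_choose_div
  simp only [sub_zero, add_zero, div_one, one_mul] at h1
  refine h1.congr' ?_
  filter_upwards [h.eventually_basic, h.p_le (by norm_num : (0 : ℝ) < 1 / 2), h.lt_one]
    with n ⟨hn, hs, hp, hL⟩ hp2 hx
  have hn0 : (0 : ℝ) < n := by exact_mod_cast hn
  have hs0 : (0 : ℝ) < s n := by exact_mod_cast hs
  have hsn : s n ≤ n := by
    rw [div_lt_one hn0] at hx
    exact_mod_cast hx.le
  have h2 := expIndep_succ_mul (p := p n) (k := k) (by have := h.two_le; omega) hsn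
  have h3 := expIndep_pos (k := k) (by linarith : p n < 1) hsn
  have h4 : (s n / n : ℝ) ^ k = (s n / n : ℝ) ^ (k - 1) * (s n / n) := by
    rw [← pow_succ, Nat.sub_add_cancel (by have := h.two_le; omega)]
  have h5 : expIndep n k (p n) (s n + 1) =
    expIndep n k (p n) (s n) * ((n - s n) * (1 - p n) ^ (s n).choose (k - 1)) / (s n + 1) := by
    rw [eq_div_iff (by positivity)]; exact h2
  rw [h5, h4]
  have hX : (0 : ℝ) < (s n / n : ℝ) ^ (k - 1) := by positivity
  generalize (s n / n : ℝ) ^ (k - 1) = X at *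
  simp only [Pi.div_apply]
  field_simp

theorem pow_mul_div (h : IsCritical k p c s) :
    ∀ᶠ n : ℕ in atTop, (n : ℝ) * (s n / n : ℝ) ^ k / s n = (s n / n : ℝ) ^ (k - 1) := by
  filter_upwards [h.eventually_basic] with n ⟨hn, hs, hp, hL⟩
  have hn0 : (0 : ℝ) < n := by exact_mod_cast hn
  have hs0 : (0 : ℝ) < s n := by exact_mod_cast hs
  have h4 : (s n / n : ℝ) ^ k = (s n / n : ℝ) ^ (k - 1) * (s n / n) := by
    rw [← pow_succ, Nat.sub_add_cancel (by have := h.two_le; omega)]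
  rw [h4]
  field_simp

/-- The exponent $\lambda-n\beta$ grows by at most `g`, which tends to `0`, from `s` to `s + 1`; the
constant $e^{-k}<1$ in `tendsto_expIndep_succ` leaves room for this. -/
theorem augMain_succ_le (h : IsCritical k p c s) :
    ∀ᶠ n : ℕ in atTop, augMain n k (p n) (s n + 1) ≤
      augMain n k (p n) (s n) * (s n / n : ℝ) ^ (k - 1) := by
  have hk := h.two_le
  set g : ℕ → ℝ := fun n => 8 * (k - 1) * (Real.log n ^ 1 * (s n / n : ℝ) ^ (k - 1)) +
    24 * (k.factorial : ℝ) ^ 3 * (Real.log n ^ 2 * (s n / n : ℝ) ^ (k - 1)) with hg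
  have hg0 : Tendsto g atTop (𝓝 0) := by
    have := ((h.tendsto_log_mul_pow 1 (by omega : 1 ≤ k - 1)).const_mul (8 * ((k : ℝ) - 1))).add
      ((h.tendsto_log_mul_pow 2 (by omega : 1 ≤ k - 1)).const_mul (24 * (k.factorial : ℝ) ^ 3))
    simpa only [mul_zero, add_zero] using this
  have hexp : Tendsto (fun n => expIndep n k (p n) (s n + 1) /
      (expIndep n k (p n) (s n) * (s n / n : ℝ) ^ (k - 1)) * Real.exp (g n)) atTop
      (𝓝 (Real.exp (-k))) := by
    have := h.tendsto_expIndep_succ.mul ((Real.continuous_exp.tendsto 0).comp hg0)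
    simpa using this
  have h1 : Real.exp (-k) < 1 := by
    rw [Real.exp_lt_one_iff]
    have : (2 : ℝ) ≤ k := by exact_mod_cast h.two_le
    linarith
  filter_upwards [h.eventually_basic, h.p_le (by norm_num : (0 : ℝ) < 1 / 2), h.lt_one,
    hexp.eventually (ge_mem_nhds h1), h.augRate_le, h.atMostOne_le, h.mul_pow_le, h.pow_mul_div,
    h.tendsto_atTop.eventually_ge_atTop (2 * k)]
    with n ⟨hn, hs, hp, hL⟩ hp2 hx he hlam hβ hps hdiv hsk
  have hn0 : (0 : ℝ) < n := by exact_mod_cast hn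
  have hs0 : (0 : ℝ) < s n := by exact_mod_cast hs
  have hsk' : 2 * (k : ℝ) ≤ s n := by exact_mod_cast hsk
  have hk2 : (2 : ℝ) ≤ k := by exact_mod_cast hk
  have hsn : s n ≤ n := by
    rw [div_lt_one hn0] at hx
    exact_mod_cast hx.le
  have hp1 : 0 < 1 - p n := by linarith
  have hk1 : (((k - 1 : ℕ) : ℝ)) = (k : ℝ) - 1 := by rw [Nat.cast_sub (by omega)]; simp
  have ha := expIndep_pos (k := k) (by linarith : p n < 1) hsn
  have hl0 := augRate_nonneg (n := n) (k := k) hp.le (by linarith : p n < 1) (s n)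
  have hβ0 := atMostOne_nonneg hp.le (by linarith : p n ≤ 1) ((s n).choose (k - 1))
  have hlam2 : augRate n k (p n) (s n + 1) - augRate n k (p n) (s n) ≤
      8 * (k - 1) * (Real.log n ^ 1 * (s n / n : ℝ) ^ (k - 1)) := by
    have e1 : augRate n k (p n) (s n + 1) ≤ augRate n k (p n) (s n) *
        (1 + (s n : ℝ)⁻¹) ^ (k - 1) := by
      have e2 : (((s n + 1 : ℕ) : ℝ)) = s n * (1 + (s n : ℝ)⁻¹) := by push_cast; field_simp
      have e3 := pow_le_pow_of_le_one hp1.le (by linarith : 1 - p n ≤ 1)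
        (Nat.choose_le_choose (k - 1) (Nat.le_add_right (s n) 1))
      rw [augRate, augRate, e2, mul_pow]
      calc (n : ℝ) * (1 - p n) ^ (s n + 1).choose (k - 1) *
            ((s n : ℝ) ^ (k - 1) * (1 + (s n : ℝ)⁻¹) ^ (k - 1) * (p n / (1 - p n)) / k.factorial)
          ≤ n * (1 - p n) ^ (s n).choose (k - 1) *
            ((s n : ℝ) ^ (k - 1) * (1 + (s n : ℝ)⁻¹) ^ (k - 1) * (p n / (1 - p n)) / k.factorial) := by
            gcongr
        _ = _ := by ring
    have e4 : (1 + (s n : ℝ)⁻¹) ^ (k - 1) ≤ 1 + 2 * ((k - 1) * (s n : ℝ)⁻¹) := by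
      calc (1 + (s n : ℝ)⁻¹) ^ (k - 1) ≤ Real.exp ((s n : ℝ)⁻¹) ^ (k - 1) := by
            gcongr; linarith [Real.add_one_le_exp ((s n : ℝ)⁻¹)]
        _ = Real.exp ((k - 1) * (s n : ℝ)⁻¹) := by rw [← Real.exp_nat_mul, hk1]
        _ ≤ _ := by
          refine exp_le_one_add_two_mul ?_ (mul_nonneg (by linarith) (by positivity))
          rw [← div_eq_mul_inv, div_le_iff₀ hs0]; linarith
    calc augRate n k (p n) (s n + 1) - augRate n k (p n) (s n)
        ≤ augRate n k (p n) (s n) * (1 + 2 * ((k - 1) * (s n : ℝ)⁻¹)) - augRate n k (p n) (s n) := by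
          have := mul_le_mul_of_nonneg_left e4 hl0
          linarith
      _ = augRate n k (p n) (s n) * (2 * ((k - 1) * (s n : ℝ)⁻¹)) := by ring
      _ ≤ 4 * Real.log n * (n * (s n / n : ℝ) ^ k) * (2 * ((k - 1) * (s n : ℝ)⁻¹)) := by
          refine mul_le_mul_of_nonneg_right hlam (mul_nonneg (by norm_num)
            (mul_nonneg (by linarith) (by positivity)))
      _ = 8 * (k - 1) * (Real.log n ^ 1 * (n * (s n / n : ℝ) ^ k / s n)) := by
          rw [div_eq_mul_inv]; ring
      _ = _ := by rw [hdiv]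
  have hβ2 : n * atMostOne (p n) ((s n).choose (k - 1)) -
      n * atMostOne (p n) ((s n + 1).choose (k - 1)) ≤
      24 * (k.factorial : ℝ) ^ 3 * (Real.log n ^ 2 * (s n / n : ℝ) ^ (k - 1)) := by
    obtain ⟨m, rfl⟩ : ∃ m, k = m + 2 := ⟨k - 2, by omega⟩
    simp only [show m + 2 - 1 = m + 1 by omega] at *
    have e1 := atMostOne_add_ge hp.le (by linarith : p n < 1) ((s n).choose (m + 1)) ((s n).choose m)
    have e2 : (s n + 1).choose (m + 1) = (s n).choose (m + 1) + (s n).choose m := by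
      rw [Nat.choose_succ_succ]; exact Nat.add_comm _ _
    rw [e2]
    have e3 := one_sub_mul_le_pow (by linarith : p n ≤ 1) ((s n).choose m)
    have e4 : ((s n).choose m : ℝ) * p n ≤ 2 * (m + 2).factorial * Real.log n * (s n : ℝ)⁻¹ := by
      rw [← div_eq_mul_inv, le_div_iff₀ hs0]
      have e5 : ((s n).choose m : ℝ) ≤ (s n : ℝ) ^ m := by exact_mod_cast Nat.choose_le_pow _ _
      calc ((s n).choose m : ℝ) * p n * s n ≤ (s n : ℝ) ^ m * p n * s n := by gcongr
        _ = p n * (s n : ℝ) ^ (m + 1) := by ring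
        _ ≤ _ := hps
    have e6 := mul_le_mul_of_nonneg_right e3 hβ0
    set β := atMostOne (p n) ((s n).choose (m + 1))
    calc n * β - n * atMostOne (p n) ((s n).choose (m + 1) + (s n).choose m)
        ≤ n * (((s n).choose m : ℝ) * p n * β) := by
          rw [← mul_sub]; gcongr; linarith
      _ ≤ n * ((2 * (m + 2).factorial * Real.log n * (s n : ℝ)⁻¹) *
          (12 * ((m + 2).factorial : ℝ) ^ 2 * Real.log n * (s n / n : ℝ) ^ (m + 2))) := by gcongr
      _ = 24 * ((m + 2).factorial : ℝ) ^ 3 * (Real.log n ^ 2 *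
          (n * (s n / n : ℝ) ^ (m + 2) / s n)) := by rw [div_eq_mul_inv (_ * _)]; ring
      _ = _ := by rw [hdiv]
  have hX : 0 < (s n / n : ℝ) ^ (k - 1) := by positivity
  rw [div_mul_eq_mul_div, div_le_one (by positivity)] at he
  rw [augMain, augMain]
  calc expIndep n k (p n) (s n + 1) *
        Real.exp (augRate n k (p n) (s n + 1) - n * atMostOne (p n) ((s n + 1).choose (k - 1)))
      ≤ expIndep n k (p n) (s n + 1) * (Real.exp (g n) *
        Real.exp (augRate n k (p n) (s n) - n * atMostOne (p n) ((s n).choose (k - 1)))) := by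
        rw [← Real.exp_add]
        have : 0 ≤ expIndep n k (p n) (s n + 1) := by unfold expIndep; positivity
        gcongr
        simp only [hg]; linarith
    _ = expIndep n k (p n) (s n + 1) * Real.exp (g n) *
        Real.exp (augRate n k (p n) (s n) - n * atMostOne (p n) ((s n).choose (k - 1))) := by ring
    _ ≤ expIndep n k (p n) (s n) * (s n / n : ℝ) ^ (k - 1) *
        Real.exp (augRate n k (p n) (s n) - n * atMostOne (p n) ((s n).choose (k - 1))) := by gcongr
    _ = _ := by ring

end IsCritical

end

end RandomHypergraph

/-! ### Sharp bounds for augmented sets along a critical sequence. -/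

namespace RandomHypergraph

noncomputable section

namespace IsCritical

variable {k : ℕ} {p : ℕ → ℝ} {c : ℝ} {s : ℕ → ℕ}

/-- For a cut-off of order $\log n\,(1+n(s/n)^k)$ the correction in the exponent of the general
bound tends to `0`, hence the factor `2`. -/
theorem sum_expAug_le (h : IsCritical k p c s) {R : ℕ → ℕ} {K : ℝ}
    (hR : ∀ᶠ n : ℕ in atTop, Real.exp 2 * (4 * Real.log n * (n * (s n / n : ℝ) ^ k)) ≤ R n)
    (hR' : ∀ᶠ n : ℕ in atTop, (R n : ℝ) ≤ K * Real.log n * (1 + n * (s n / n : ℝ) ^ k)) :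
    ∀ᶠ n : ℕ in atTop, ∑ r ∈ Finset.range (n + 1), expAug n k (p n) (s n + r) r ≤
      2 * augMain n k (p n) (s n) +
        expIndep n k (p n) (s n) * ((n + 1) * Real.exp (-R n)) := by
  have hk := h.two_le
  have hRs : Tendsto (fun n : ℕ => K * (Real.log n / s n) +
      K * (Real.log n ^ 1 * (s n / n : ℝ) ^ (k - 1))) atTop (𝓝 0) := by
    have := (h.log_div.const_mul K).add
      ((h.tendsto_log_mul_pow 1 (by omega : 1 ≤ k - 1)).const_mul K)
    simpa only [mul_zero, add_zero] using this
  set g : ℕ → ℝ := fun n =>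
    24 * (k.factorial : ℝ) ^ 2 * (Real.log n ^ 1 * (n * (s n / n : ℝ) ^ (k + 1))) +
    2 ^ (k - 2) * 24 * (k.factorial : ℝ) ^ 3 * K * (Real.log n ^ 3 * (s n / n : ℝ) ^ (k - 1)) +
    2 ^ (k - 2) * 24 * (k.factorial : ℝ) ^ 3 * K *
      (Real.log n ^ 3 * (n * (s n / n : ℝ) ^ (2 * k - 1))) with hg
  have hg0 : Tendsto g atTop (𝓝 0) := by
    have := (((h.tendsto_log_mul_mul_pow 1 le_rfl).const_mul (24 * (k.factorial : ℝ) ^ 2)).add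
      ((h.tendsto_log_mul_pow 3 (by omega : 1 ≤ k - 1)).const_mul
        (2 ^ (k - 2) * 24 * (k.factorial : ℝ) ^ 3 * K))).add
      ((h.tendsto_log_mul_mul_pow 3 (by omega : k + 1 ≤ 2 * k - 1)).const_mul
        (2 ^ (k - 2) * 24 * (k.factorial : ℝ) ^ 3 * K))
    simpa only [mul_zero, add_zero] using this
  filter_upwards [h.eventually_basic, h.p_le (by norm_num : (0 : ℝ) < 1 / 2), h.augRate_le,
    h.atMostOne_le, h.mul_pow_le, h.pow_mul_div, hR, hR', hRs.eventually (ge_mem_nhds zero_lt_one),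
    hg0.eventually (ge_mem_nhds (Real.log_pos (by norm_num : (1 : ℝ) < 2)))]
    with n ⟨hn, hs, hp, hL⟩ hp2 hlam hβ hps hdiv hR hR' hRs hg0
  have hn0 : (0 : ℝ) < n := by exact_mod_cast hn
  have hs0 : (0 : ℝ) < s n := by exact_mod_cast hs
  have hβ0 := atMostOne_nonneg hp.le (by linarith : p n ≤ 1) ((s n).choose (k - 1))
  have hR2 : (R n : ℝ) / s n ≤ K * (Real.log n / s n) +
      K * (Real.log n ^ 1 * (s n / n : ℝ) ^ (k - 1)) := by
    rw [← hdiv]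
    calc (R n : ℝ) / s n ≤ K * Real.log n * (1 + n * (s n / n : ℝ) ^ k) / s n := by gcongr
      _ = _ := by ring
  have hR3 : (R n : ℝ) ≤ s n := (div_le_one hs0).1 (hR2.trans hRs)
  have hd : (s n + R n).choose (k - 1) ≤ (s n).choose (k - 1) + R n * (s n + R n) ^ (k - 2) := by
    have := choose_le_add_mul_pow (s n) (R n) (k - 2)
    rwa [show k - 2 + 1 = k - 1 by omega] at this
  have hmain := RandomHypergraph.sum_expAug_le (n := n) hp.le (by linarith) (by omega : 1 ≤ k)
    (le_trans (by gcongr) hR) hd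
  refine hmain.trans ?_
  gcongr ?_ + _
  rw [mul_comm (2 : ℝ)]
  have hE : 0 ≤ augMain n k (p n) (s n) := by
    have : 0 < 1 - p n := by linarith
    unfold augMain expIndep; positivity
  refine mul_le_mul_of_nonneg_left ?_ hE
  rw [← Real.le_log_iff_exp_le (by norm_num)]
  refine le_trans ?_ hg0
  set β := atMostOne (p n) ((s n).choose (k - 1))
  have e1 : β * (s n + R n) ≤
      24 * (k.factorial : ℝ) ^ 2 * (Real.log n ^ 1 * (n * (s n / n : ℝ) ^ (k + 1))) := by
    calc β * (s n + R n) ≤ (12 * (k.factorial : ℝ) ^ 2 * Real.log n * (s n / n : ℝ) ^ k) *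
          (s n + s n) := by gcongr
      _ = 24 * (k.factorial : ℝ) ^ 2 * (Real.log n ^ 1 * (s n * (s n / n : ℝ) ^ k)) := by ring
      _ = _ := by
        have : (n : ℝ) * (s n / n : ℝ) ^ (k + 1) = s n * (s n / n : ℝ) ^ k := by
          rw [pow_succ]; field_simp
        rw [this]
  have e2 : β * (n * (((R n * (s n + R n) ^ (k - 2) : ℕ) : ℝ) * p n)) ≤
      2 ^ (k - 2) * 24 * (k.factorial : ℝ) ^ 3 * K * (Real.log n ^ 3 * (s n / n : ℝ) ^ (k - 1)) +
      2 ^ (k - 2) * 24 * (k.factorial : ℝ) ^ 3 * K *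
        (Real.log n ^ 3 * (n * (s n / n : ℝ) ^ (2 * k - 1))) := by
    have e3 : (n : ℝ) * (s n / n : ℝ) ^ (2 * k - 1) =
        n * (s n / n : ℝ) ^ k * (s n / n : ℝ) ^ (k - 1) := by
      rw [mul_assoc, ← pow_add]; congr 2; omega
    obtain ⟨m, rfl⟩ : ∃ m, k = m + 2 := ⟨k - 2, by omega⟩
    simp only [show m + 2 - 1 = m + 1 by omega, Nat.add_sub_cancel] at *
    push_cast
    set X := (s n / n : ℝ) ^ (m + 2)
    set F : ℝ := ((m + 2).factorial : ℝ)
    rw [e3, ← hdiv]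
    calc β * (n * ((R n : ℝ) * (s n + R n) ^ m * p n))
        ≤ (12 * F ^ 2 * Real.log n * X) * (n * ((R n : ℝ) * (s n + s n) ^ m * p n)) := by
          gcongr
      _ = 12 * F ^ 2 * Real.log n * X * n * 2 ^ m * (R n / s n) * (p n * (s n : ℝ) ^ (m + 1)) := by
          rw [← two_mul, mul_pow, pow_succ (s n : ℝ) m]; field_simp
      _ ≤ 12 * F ^ 2 * Real.log n * X * n * 2 ^ m * (R n / s n) * (2 * F * Real.log n) := by
          gcongr
      _ ≤ 12 * F ^ 2 * Real.log n * X * n * 2 ^ m *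
          (K * Real.log n * (1 + n * X) / s n) * (2 * F * Real.log n) := by
          gcongr
      _ = _ := by ring
  simp only [hg]
  linarith

theorem tendsto_augRate_div (h : IsCritical k p c s) (m : ℕ) :
    Tendsto (fun n : ℕ => Real.log n ^ m * augRate n k (p n) (s n) / s n) atTop (𝓝 0) := by
  have h1 := (h.tendsto_log_mul_pow (m + 1) (by have := h.two_le; omega : 1 ≤ k - 1)).const_mul 4
  rw [mul_zero] at h1
  refine squeeze_zero' ?_ ?_ h1
  · filter_upwards [h.eventually_basic, h.p_le (by norm_num : (0 : ℝ) < 1 / 2)]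
      with n ⟨hn, hs, hp, hL⟩ hp2
    have := augRate_nonneg (n := n) (k := k) hp.le (by linarith : p n < 1) (s n)
    positivity
  · filter_upwards [h.eventually_basic, h.augRate_le, h.pow_mul_div]
      with n ⟨hn, hs, hp, hL⟩ hlam hdiv
    rw [← hdiv]
    calc Real.log n ^ m * augRate n k (p n) (s n) / s n
        ≤ Real.log n ^ m * (4 * Real.log n * (n * (s n / n : ℝ) ^ k)) / s n := by gcongr
      _ = _ := by ring

theorem neg_add_sq_le_log {b : ℝ} (hb : b ≤ 1 / 2) :
    -(b + 2 * b ^ 2) ≤ Real.log (1 - b) := by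
  have h1 : 0 < 1 - b := by linarith
  refine le_trans ?_ (Real.one_sub_inv_le_log_of_pos h1)
  have h2 : (1 - b)⁻¹ ≤ 1 + (b + 2 * b ^ 2) := by
    rw [← one_div, div_le_iff₀ h1]; nlinarith [mul_nonneg (sq_nonneg b) (by linarith : 0 ≤ 1 - 2 * b)]
  linarith

/-- Each of the three losses of `expAug_ge` is at most `1 / 2`, and $(1-\beta)^n\ge e^{-n\beta}/2$;
together with $e^{-2}$ from `pow_floor_div_factorial_ge` this is the constant. -/
theorem expAug_floor_ge (h : IsCritical k p c s) :
    ∀ᶠ n : ℕ in atTop, Real.exp (-2) / 16 * (augMain n k (p n) (s n) /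
        (1 + augRate n k (p n) (s n))) ≤
      expAug n k (p n) (s n + ⌊augRate n k (p n) (s n)⌋₊) ⌊augRate n k (p n) (s n)⌋₊ := by
  have hk := h.two_le
  have hk2 : (2 : ℝ) ≤ k := by exact_mod_cast hk
  have hk1 : (((k - 1 : ℕ) : ℝ)) = (k : ℝ) - 1 := by rw [Nat.cast_sub (by omega)]; simp
  have t1 : Tendsto (fun n : ℕ => (k : ℝ) * (Real.log n ^ 0 * augRate n k (p n) (s n) / s n)) atTop
      (𝓝 0) := by simpa only [mul_zero] using (h.tendsto_augRate_div 0).const_mul (k : ℝ)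
  have t2 : Tendsto (fun n : ℕ => 8 * (Real.log n ^ 1 * (n * (s n / n : ℝ) ^ (k + 1)))) atTop
      (𝓝 0) := by simpa only [mul_zero] using (h.tendsto_log_mul_mul_pow 1 le_rfl).const_mul 8
  have t3 : Tendsto (fun n : ℕ => (16 * ((k : ℝ) - 1) ^ 2) *
      (Real.log n ^ 2 * (n * (s n / n : ℝ) ^ (2 * k - 1)))) atTop (𝓝 0) := by
    simpa only [mul_zero] using (h.tendsto_log_mul_mul_pow 2
      (by omega : k + 1 ≤ 2 * k - 1)).const_mul (16 * ((k : ℝ) - 1) ^ 2)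
  have t4 : Tendsto (fun n : ℕ => (2 ^ (k - 2) * 32 * (k.factorial : ℝ)) *
      (Real.log n ^ 3 * (n * (s n / n : ℝ) ^ (2 * k - 1)))) atTop (𝓝 0) := by
    simpa only [mul_zero] using (h.tendsto_log_mul_mul_pow 3
      (by omega : k + 1 ≤ 2 * k - 1)).const_mul (2 ^ (k - 2) * 32 * (k.factorial : ℝ))
  have t5 : Tendsto (fun n : ℕ => (2 * (12 * (k.factorial : ℝ) ^ 2) ^ 2) *
      (Real.log n ^ 2 * (n * (s n / n : ℝ) ^ (2 * k)))) atTop (𝓝 0) := by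
    simpa only [mul_zero] using (h.tendsto_log_mul_mul_pow 2
      (by omega : k + 1 ≤ 2 * k)).const_mul (2 * (12 * (k.factorial : ℝ) ^ 2) ^ 2)
  have t6 : Tendsto (fun n : ℕ => (12 * (k.factorial : ℝ) ^ 2) *
      (Real.log n ^ 1 * (s n / n : ℝ) ^ k)) atTop (𝓝 0) := by
    simpa only [mul_zero] using (h.tendsto_log_mul_pow 1
      (by omega : 1 ≤ k)).const_mul (12 * (k.factorial : ℝ) ^ 2)
  have hhalf : (0 : ℝ) < 1 / 2 := by norm_num
  filter_upwards [h.eventually_basic, h.p_le hhalf, h.augRate_le,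
    h.atMostOne_le, h.mul_pow_le, h.pow_mul_div, t1.eventually (ge_mem_nhds zero_lt_one),
    t2.eventually (ge_mem_nhds hhalf), t3.eventually (ge_mem_nhds hhalf),
    t4.eventually (ge_mem_nhds hhalf), t5.eventually (ge_mem_nhds (Real.log_pos one_lt_two)),
    t6.eventually (ge_mem_nhds hhalf), h.tendsto_div.eventually (ge_mem_nhds hhalf)]
    with n ⟨hn, hs, hp, hL⟩ hp2 hlam hβ hps hdiv t1 t2 t3 t4 t5 t6 hx
  have hn0 : (0 : ℝ) < n := by exact_mod_cast hn
  have hs0 : (0 : ℝ) < s n := by exact_mod_cast hs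
  have hβ0 := atMostOne_nonneg hp.le (by linarith : p n ≤ 1) ((s n).choose (k - 1))
  have hl0 := augRate_nonneg (n := n) (k := k) hp.le (by linarith : p n < 1) (s n)
  have ha : 0 ≤ expIndep n k (p n) (s n) := by
    have : 0 < 1 - p n := by linarith
    unfold expIndep; positivity
  set lam := augRate n k (p n) (s n) with hlamd
  set r := ⌊lam⌋₊ with hr
  have hrl : (r : ℝ) ≤ lam := Nat.floor_le hl0
  have hls : k * lam ≤ s n := by
    rw [pow_zero, one_mul, ← mul_div_assoc, div_le_one hs0] at t1
    exact t1
  have hkr : (k : ℝ) * r ≤ s n := le_trans (by gcongr) hls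
  have hkr' : k * r ≤ s n := by exact_mod_cast hkr
  have hrs : (r : ℝ) ≤ s n := by nlinarith [Nat.cast_nonneg (α := ℝ) r]
  have hrsn : r ≤ s n := by exact_mod_cast hrs
  have hsn : (s n : ℝ) ≤ n / 2 := by
    rw [div_le_iff₀ hn0] at hx; linarith
  have hsn' : s n + r ≤ n := by
    have : (s n : ℝ) + r ≤ n := by linarith
    exact_mod_cast this
  have hxk : (n : ℝ) * (s n / n : ℝ) ^ (2 * k - 1) = (n * (s n / n : ℝ) ^ k) ^ 2 / s n := by
    rw [pow_two, mul_div_assoc, hdiv, mul_assoc, ← pow_add]; congr 2; omega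
  have b1 : (r : ℝ) * (s n + r) / n ≤ 1 / 2 := by
    refine le_trans ?_ t2
    calc (r : ℝ) * (s n + r) / n ≤ (4 * Real.log n * (n * (s n / n : ℝ) ^ k)) * (s n + s n) / n := by
          gcongr
          exact hrl.trans hlam
      _ = _ := by rw [pow_succ (s n / n : ℝ) k]; ring
  have b2 : (((k : ℝ) - 1) * r) ^ 2 / s n ≤ 1 / 2 := by
    refine le_trans ?_ t3
    rw [hxk, mul_pow]
    calc ((k : ℝ) - 1) ^ 2 * (r : ℝ) ^ 2 / s n
        ≤ ((k : ℝ) - 1) ^ 2 * (4 * Real.log n * (n * (s n / n : ℝ) ^ k)) ^ 2 / s n := by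
          gcongr
          exact hrl.trans hlam
      _ = _ := by ring
  have b3 : p n * ((r : ℝ) ^ 2 * (s n + r : ℝ) ^ (k - 2)) ≤ 1 / 2 := by
    refine le_trans ?_ t4
    rw [hxk]
    obtain ⟨m, rfl⟩ : ∃ m, k = m + 2 := ⟨k - 2, by omega⟩
    simp only [show m + 2 - 1 = m + 1 by omega, Nat.add_sub_cancel] at *
    calc p n * ((r : ℝ) ^ 2 * (s n + r : ℝ) ^ m)
        ≤ p n * ((4 * Real.log n * (n * (s n / n : ℝ) ^ (m + 2))) ^ 2 * (s n + s n : ℝ) ^ m) := by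
          gcongr
          exact hrl.trans hlam
      _ = 2 ^ m * 16 * (Real.log n ^ 2 * ((n * (s n / n : ℝ) ^ (m + 2)) ^ 2 / s n)) *
          (p n * (s n : ℝ) ^ (m + 1)) := by
          rw [← two_mul, mul_pow 2 (s n : ℝ), pow_succ (s n : ℝ) m]; field_simp; ring
      _ ≤ 2 ^ m * 16 * (Real.log n ^ 2 * ((n * (s n / n : ℝ) ^ (m + 2)) ^ 2 / s n)) *
          (2 * (m + 2).factorial * Real.log n) := by gcongr
      _ = _ := by ring
  have hmain := expAug_ge hp.le (by linarith : p n < 1) hk hs hsn'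
    ((Nat.mul_le_mul_right r (Nat.sub_le k 1)).trans hkr') b1 b2 b3 (by norm_num) (by norm_num)
    (by norm_num)
  refine le_trans ?_ hmain
  set β := atMostOne (p n) ((s n).choose (k - 1))
  have hβ2 : β ≤ 1 / 2 := by
    refine hβ.trans (le_trans (le_of_eq ?_) t6); ring
  have hβn : Real.exp (-(n * β)) / 2 ≤ (1 - β) ^ n := by
    have e1 := neg_add_sq_le_log hβ2
    have e2 : (2 : ℝ) * β ^ 2 * n ≤ Real.log 2 := by
      refine le_trans ?_ t5
      calc (2 : ℝ) * β ^ 2 * n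
          ≤ 2 * (12 * (k.factorial : ℝ) ^ 2 * Real.log n * (s n / n : ℝ) ^ k) ^ 2 * n := by gcongr
        _ = _ := by ring
    have e3 : (1 - β) ^ n = Real.exp (n * Real.log (1 - β)) := by
      rw [Real.exp_nat_mul, Real.exp_log (by linarith)]
    rw [e3, div_le_iff₀ (by norm_num), ← Real.exp_log (by norm_num : (0 : ℝ) < 2), ← Real.exp_add,
      Real.exp_le_exp]
    have e4 := mul_le_mul_of_nonneg_left e1 hn0.le
    linarith
  have hfl := pow_floor_div_factorial_ge hl0
  calc Real.exp (-2) / 16 * (augMain n k (p n) (s n) / (1 + lam))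
      = expIndep n k (p n) (s n) * (Real.exp (lam - 2) / (1 + lam)) *
        ((1 - 1 / 2) * (1 - 1 / 2) * (1 - 1 / 2)) * (Real.exp (-(n * β)) / 2) := by
        rw [augMain, ← hlamd, sub_eq_add_neg, sub_eq_add_neg lam 2, Real.exp_add, Real.exp_add]; ring
    _ ≤ _ := by gcongr

/-- The second moment method is applied to sets with `s + r` vertices, where `r` is the integer part
of `augRate`. Since `r` is $o(s/\log n)$, this size is still critical. -/
theorem tendsto_prob_le_indepNum (h : IsCritical k p c s) (hc1 : c ≤ 1) {δ : ℝ} (hδ : 0 < δ)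
    (hE : ∀ᶠ n : ℕ in atTop, (n : ℝ) ^ δ * (1 + n * (s n / n : ℝ) ^ k) ≤ augMain n k (p n) (s n)) :
    Tendsto (fun n => prob n k (p n) (fun H => s n ≤ indepNum H)) atTop (𝓝 1) := by
  have hk := h.two_le
  have hk2 : (2 : ℝ) ≤ k := by exact_mod_cast hk
  have hk1 : (((k - 1 : ℕ) : ℝ)) = (k : ℝ) - 1 := by rw [Nat.cast_sub (by omega)]; simp
  set r : ℕ → ℕ := fun n => ⌊augRate n k (p n) (s n)⌋₊ with hr
  have hl0 : ∀ᶠ n in atTop, 0 ≤ augRate n k (p n) (s n) := by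
    filter_upwards [h.eventually_basic, h.p_le (by norm_num : (0 : ℝ) < 1 / 2)]
      with n ⟨hn, hs, hp, hL⟩ hp2
    exact augRate_nonneg hp.le (by linarith) _
  have hrs : Tendsto (fun n : ℕ => Real.log n * r n / s n) atTop (𝓝 0) := by
    refine squeeze_zero' ?_ ?_ (h.tendsto_augRate_div 1)
    · filter_upwards [h.eventually_basic] with n ⟨hn, hs, hp, hL⟩
      positivity
    · filter_upwards [h.eventually_basic, hl0] with n ⟨hn, hs, hp, hL⟩ hl
      rw [pow_one]
      gcongr
      exact Nat.floor_le hl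
  have hkrs : ∀ᶠ n in atTop, (k - 1) * r n ≤ s n := by
    have h1 := (h.tendsto_augRate_div 0).const_mul (k : ℝ)
    rw [mul_zero] at h1
    filter_upwards [h1.eventually (ge_mem_nhds zero_lt_one), hl0, h.eventually_basic]
      with n h1 h2 ⟨hn, hs, hp, hL⟩
    have hs0 : (0 : ℝ) < s n := by exact_mod_cast hs
    rw [pow_zero, one_mul, ← mul_div_assoc, div_le_one hs0] at h1
    have h3 : (k : ℝ) * r n ≤ s n := le_trans (by gcongr; exact Nat.floor_le h2) h1
    have h4 : k * r n ≤ s n := by exact_mod_cast h3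
    exact (Nat.mul_le_mul_right _ (Nat.sub_le k 1)).trans h4
  have hv : IsCritical k p c (fun n => s n + r n) := by
    refine h.of_near (hrs.congr fun n => ?_)
    push_cast; ring
  have hu' : Tendsto (fun n : ℕ => Real.log n * (((s n - (k - 1) * r n : ℕ) : ℝ) - s n) / s n) atTop
      (𝓝 0) := by
    have h1 := hrs.const_mul (-((k : ℝ) - 1))
    rw [mul_zero] at h1
    refine h1.congr' ?_
    filter_upwards [hkrs] with n h2
    rw [Nat.cast_sub h2]; push_cast; rw [hk1]; ring
  have hu := h.of_near hu'
  -- One constant for all hypotheses: `2 * k!` bounds $pv^{k-1}/\log n$, `2 * exp k` is needed for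
  -- the lower bound on the power of `1 - p`, and `4` for `r`.
  set K : ℝ := 2 * k.factorial + 2 * Real.exp k + 4 with hK
  have hF : (0 : ℝ) < k.factorial := by positivity
  have hX := Real.exp_pos k
  have hfin := tendsto_prob_le_indepNum_add (p := p) (v := fun n => s n + r n) (r := r) (K := K) hk
    (by linarith) h.c_pos hc1 h.pos h.tendsto_p hv.tendsto_atTop hv.le_rpow hv.le_rpow'
    ?_ ?_ ?_ ?_ ?_ ?_
  · exact hfin.congr fun n => by simp
  · filter_upwards [hv.mul_pow_le, h.eventually_basic] with n h1 ⟨hn, hs, hp, hL⟩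
    refine h1.trans ?_
    gcongr
    linarith
  · filter_upwards [hv.pow_choose_le] with n h1
    exact h1.trans (le_mul_of_one_le_left (by positivity) (by linarith))
  · filter_upwards [hv.pow_le_mul_pow_choose, h.p_le (by norm_num : (0 : ℝ) < 1 / 2)] with n h1 h2
    refine h1.trans (mul_le_mul_of_nonneg_right (by linarith) (pow_nonneg (by linarith) _))
  · filter_upwards [h.augRate_le, hl0, h.eventually_basic] with n h1 h2 ⟨hn, hs, hp, hL⟩
    refine (Nat.floor_le h2).trans (h1.trans ?_)
    gcongr
    · linarith
    · exact Nat.le_add_right _ _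
  -- The condition on `r` holds because $n(1-p)^{\binom s{k-1}}\le n(s/n)^k=o(s)$, while
  -- $\binom{s-(k-1)r}k$ has order $s^k$.
  · have h1 := (hu.tendsto_choose k).mul ((h.tendsto_ratio_one hu').pow k)
    rw [one_pow, mul_one] at h1
    have h2 : 1 / (k.factorial : ℝ) / 2 < 1 / (k.factorial : ℝ) := half_lt_self (by positivity)
    have h3 : Tendsto (fun n : ℕ => (s n / n : ℝ) ^ (k - 1)) atTop (𝓝 0) := by
      simpa using h.tendsto_log_mul_pow 0 (by omega : 1 ≤ k - 1)
    filter_upwards [h1.eventually (le_mem_nhds h2), h3.eventually (ge_mem_nhds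
      (by norm_num : (0 : ℝ) < 1 / 2)), hkrs, h.eventually_basic, hu.s_pos, hl0, h.pow_choose_le,
      h.p_le (by norm_num : (0 : ℝ) < 1 / 2), h.pow_mul_div]
      with n h1 h3 h4 ⟨hn, hs, hp, hL⟩ hus hl hq hp2 hdiv
    have hn0 : (0 : ℝ) < n := by exact_mod_cast hn
    have hs0 : (0 : ℝ) < s n := by exact_mod_cast hs
    have hus0 : (0 : ℝ) < (s n - (k - 1) * r n : ℕ) := by exact_mod_cast hus
    have hvu : s n + r n - k * r n = s n - (k - 1) * r n := by
      have : k * r n = (k - 1) * r n + r n := by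
        rw [Nat.sub_mul, one_mul, Nat.sub_add_cancel (Nat.le_mul_of_pos_left _ (by omega))]
      omega
    rw [hvu]
    have h5 : (s n : ℝ) ^ k / (2 * k.factorial) ≤ (s n - (k - 1) * r n).choose k := by
      rw [div_pow, div_mul_div_cancel₀ (by positivity), le_div_iff₀ (by positivity)] at h1
      refine le_trans (le_of_eq ?_) h1
      field_simp
    have hp1 : 0 < 1 - p n := by linarith
    have h6 : (r n : ℝ) * (1 - p n) ≤ augRate n k (p n) (s n) * (1 - p n) := by
      gcongr
      exact Nat.floor_le hl
    have h7 : augRate n k (p n) (s n) * (1 - p n) = p n * (n * (1 - p n) ^ (s n).choose (k - 1) *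
        (s n : ℝ) ^ (k - 1) / k.factorial) := by
      rw [augRate]; field_simp
    have h8 : n * (1 - p n) ^ (s n).choose (k - 1) * (s n : ℝ) ^ (k - 1) / k.factorial ≤
        (s n : ℝ) ^ k / (2 * k.factorial) := by
      have e1 : (n : ℝ) * (s n / n : ℝ) ^ k = (s n / n : ℝ) ^ (k - 1) * s n := by
        rw [← hdiv]; field_simp
      have e2 : (s n : ℝ) ^ k = s n * (s n : ℝ) ^ (k - 1) := by
        rw [← pow_succ', Nat.sub_add_cancel (by omega)]
      calc n * (1 - p n) ^ (s n).choose (k - 1) * (s n : ℝ) ^ (k - 1) / k.factorial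
          ≤ n * (s n / n : ℝ) ^ k * (s n : ℝ) ^ (k - 1) / k.factorial := by gcongr
        _ ≤ (1 / 2) * s n * (s n : ℝ) ^ (k - 1) / k.factorial := by rw [e1]; gcongr
        _ = _ := by rw [e2]; ring
    calc (r n : ℝ) * (1 - p n) ≤ _ := h6
      _ = _ := h7
      _ ≤ _ := by gcongr; exact h8.trans h5
  · have h1 : Tendsto (fun n : ℕ => (Real.log n ^ 1 * (n : ℝ) ^ (-δ))⁻¹) atTop atTop := by
      refine Tendsto.comp tendsto_inv_nhdsGT_zero (tendsto_nhdsWithin_iff.2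
        ⟨tendsto_log_pow_mul_rpow_neg 1 hδ, ?_⟩)
      filter_upwards [h.eventually_basic] with n ⟨hn, hs, hp, hL⟩
      have hn0 : (0 : ℝ) < n := by exact_mod_cast hn
      rw [Set.mem_Ioi, pow_one]
      have : 0 < Real.log n := by linarith
      positivity
    have h2 := h1.const_mul_atTop (by positivity : 0 < Real.exp (-2) / 64)
    refine tendsto_atTop_mono' _ ?_ h2
    filter_upwards [h.expAug_floor_ge, hE, h.augRate_le, hl0, h.eventually_basic]
      with n h3 h4 h5 hl ⟨hn, hs, hp, hL⟩
    have hn0 : (0 : ℝ) < n := by exact_mod_cast hn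
    have hL0 : 0 < Real.log n := by linarith
    refine le_trans ?_ h3
    have h6 : 1 + augRate n k (p n) (s n) ≤ 4 * Real.log n * (1 + n * (s n / n : ℝ) ^ k) := by
      linarith
    have h7 : (n : ℝ) ^ δ / (4 * Real.log n) ≤
        augMain n k (p n) (s n) / (1 + augRate n k (p n) (s n)) := by
      rw [div_le_div_iff₀ (by positivity) (by positivity)]
      calc (n : ℝ) ^ δ * (1 + augRate n k (p n) (s n))
          ≤ (n : ℝ) ^ δ * (4 * Real.log n * (1 + n * (s n / n : ℝ) ^ k)) := by gcongr
        _ = (n : ℝ) ^ δ * (1 + n * (s n / n : ℝ) ^ k) * (4 * Real.log n) := by ring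
        _ ≤ _ := by gcongr
    calc Real.exp (-2) / 64 * (Real.log n ^ 1 * (n : ℝ) ^ (-δ))⁻¹
        = Real.exp (-2) / 16 * ((n : ℝ) ^ δ / (4 * Real.log n)) := by
          rw [Real.rpow_neg hn0.le, pow_one]; field_simp; norm_num
      _ ≤ _ := by gcongr

end IsCritical

end

end RandomHypergraph

/-! ### Uniform estimates in a window below the threshold. -/

namespace RandomHypergraph

noncomputable section

/-- If uniformity failed, choosing a counterexample for each bad `n` would give a sequence
contradicting the hypothesis. This turns limits along sequences into bounds uniform over the window.
-/
theorem eventually_forall_of_forall_seq {S P : ℕ → ℕ → Prop} (s₀ : ℕ → ℕ) (h₀ : ∀ n, S n (s₀ n))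
    (H : ∀ s : ℕ → ℕ, (∀ n, S n (s n)) → ∀ᶠ n in atTop, P n (s n)) :
    ∀ᶠ n in atTop, ∀ j, S n j → P n j := by
  classical
  let s : ℕ → ℕ := fun n => if h : ∃ j, S n j ∧ ¬ P n j then h.choose else s₀ n
  have hs : ∀ n, S n (s n) := fun n => by
    by_cases h : ∃ j, S n j ∧ ¬ P n j
    · simp only [s, dif_pos h]; exact h.choose_spec.1
    · simp only [s, dif_neg h]; exact h₀ n
  filter_upwards [H s hs] with n hn j hj
  by_contra hP
  have h : ∃ j, S n j ∧ ¬ P n j := ⟨j, hj, hP⟩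
  simp only [s, dif_pos h] at hn
  exact h.choose_spec.2 hn

/-- The asymptotic distance of the independence number from the first-moment threshold. -/
def critSize (k n s : ℕ) : ℝ := (s : ℝ) ^ k / (Real.exp 1 ^ k * (n : ℝ) ^ (k - 1))

theorem critSize_nonneg (k n s : ℕ) : 0 ≤ critSize k n s := by unfold critSize; positivity

theorem mul_pow_eq_critSize {k n s : ℕ} (hk : 1 ≤ k) (hn : 0 < n) :
    (n : ℝ) * (s / n : ℝ) ^ k = Real.exp k * critSize k n s := by
  have hn0 : (0 : ℝ) < n := by exact_mod_cast hn
  have h1 : (n : ℝ) ^ k = n ^ (k - 1) * n := by rw [← pow_succ, Nat.sub_add_cancel hk]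
  have h2 : Real.exp k = Real.exp 1 ^ k := by rw [← Real.exp_nat_mul, mul_one]
  rw [critSize, div_pow, h1, h2]
  field_simp

theorem critSize_le_mul_pow {k n s : ℕ} (hk : 1 ≤ k) (hn : 0 < n) :
    critSize k n s ≤ (n : ℝ) * (s / n : ℝ) ^ k := by
  rw [mul_pow_eq_critSize hk hn]
  exact le_mul_of_one_le_left (critSize_nonneg _ _ _) (Real.one_le_exp (by positivity))

/-- `j` lies in the relevant window around `s`. -/
def InWindow (k n s j : ℕ) : Prop := |(j : ℝ) - s| ≤ 2 * critSize k n s + 12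

theorem inWindow_self (k n s : ℕ) : InWindow k n s s := by
  have := critSize_nonneg k n s
  simp only [InWindow, sub_self, abs_zero]; positivity

namespace IsCritical

variable {k : ℕ} {p : ℕ → ℝ} {c ε : ℝ} {s t : ℕ → ℕ}

/-- The window has width $o(s/\log n)$, so `of_near` applies to every sequence inside it. -/
theorem tendsto_window (h : IsCritical k p c s) :
    Tendsto (fun n : ℕ => Real.log n * (2 * critSize k n (s n) + 12) / s n) atTop (𝓝 0) := by
  have hk := h.two_le
  have h1 := ((h.tendsto_log_mul_pow 1 (by omega : 1 ≤ k - 1)).const_mul 2).add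
    (h.log_div.const_mul 12)
  simp only [mul_zero, add_zero] at h1
  refine squeeze_zero' ?_ ?_ h1
  · filter_upwards [h.eventually_basic] with n ⟨hn, hs, hp, hL⟩
    have := critSize_nonneg k n (s n)
    positivity
  · filter_upwards [h.eventually_basic, h.pow_mul_div] with n ⟨hn, hs, hp, hL⟩ hdiv
    rw [← hdiv, pow_one]
    calc Real.log n * (2 * critSize k n (s n) + 12) / s n
        ≤ Real.log n * (2 * (n * (s n / n : ℝ) ^ k) + 12) / s n := by
          gcongr; exact critSize_le_mul_pow (by omega) hn
      _ = _ := by ring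

theorem near_of_window (h : IsCritical k p c s) (ht : ∀ᶠ n in atTop, InWindow k n (s n) (t n)) :
    Tendsto (fun n : ℕ => Real.log n * ((t n : ℝ) - s n) / s n) atTop (𝓝 0) := by
  refine squeeze_zero_norm' ?_ h.tendsto_window
  filter_upwards [h.eventually_basic, ht] with n ⟨hn, hs, hp, hL⟩ ht
  have hs0 : (0 : ℝ) < s n := by exact_mod_cast hs
  have hL0 : (0 : ℝ) < Real.log n := by linarith
  rw [Real.norm_eq_abs, abs_div, abs_mul, abs_of_pos hs0, abs_of_pos hL0]
  gcongr
  exact ht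

theorem of_window (h : IsCritical k p c s) (ht : ∀ᶠ n in atTop, InWindow k n (s n) (t n)) :
    IsCritical k p c t := h.of_near (h.near_of_window ht)

theorem ratio_of_window (h : IsCritical k p c s) (ht : ∀ᶠ n in atTop, InWindow k n (s n) (t n)) :
    Tendsto (fun n : ℕ => (t n / s n : ℝ)) atTop (𝓝 1) := h.tendsto_ratio_one (h.near_of_window ht)

theorem tendsto_log_sub_of_window (h : IsCritical k p c s) (ht : ∀ᶠ n in atTop, InWindow k n (s n) (t n)) :
    Tendsto (fun n : ℕ => Real.log (n / t n) - Real.log (n / s n)) atTop (𝓝 0) := by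
  have h1 := ((h.ratio_of_window ht).log one_ne_zero).neg
  rw [Real.log_one, neg_zero] at h1
  refine h1.congr' ?_
  filter_upwards [h.eventually_basic, (h.of_window ht).s_pos] with n ⟨hn, hs, hp, hL⟩ ht
  have h1 : (0 : ℝ) < s n := by exact_mod_cast hs
  have h2 : (0 : ℝ) < t n := by exact_mod_cast ht
  have h3 : (0 : ℝ) < n := by exact_mod_cast hn
  rw [Real.log_div h2.ne' h1.ne', Real.log_div h3.ne' h1.ne', Real.log_div h3.ne' h2.ne']
  ring

theorem s_le (h : IsCritical k p c s) : ∀ᶠ n in atTop, s n + 1 ≤ n := by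
  filter_upwards [h.lt_one, h.eventually_basic] with n hx ⟨hn, hs, hp, hL⟩
  have hn0 : (0 : ℝ) < n := by exact_mod_cast hn
  rw [div_lt_one hn0] at hx
  have : s n < n := by exact_mod_cast hx
  omega

/-- Along any sequence in the window the difference tends to `k`; the additional `1` makes the bound
uniform. -/
theorem abs_log_expIndep_sub_succ_le (h : IsCritical k p c s) :
    ∀ᶠ n : ℕ in atTop, ∀ j, InWindow k n (s n) j →
      |Real.log (expIndep n k (p n) j) - Real.log (expIndep n k (p n) (j + 1)) -
        (k - 1) * Real.log (n / s n)| ≤ k + 1 := by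
  refine eventually_forall_of_forall_seq (S := fun n j => InWindow k n (s n) j) s
    (fun n => inWindow_self _ _ _) fun t ht => ?_
  replace ht := Eventually.of_forall (f := atTop) ht
  have h' := h.of_window ht
  have hk := h.two_le
  have hk1 : (((k - 1 : ℕ) : ℝ)) = (k : ℝ) - 1 := by rw [Nat.cast_sub (by omega)]; simp
  have h1 := (h'.tendsto_expIndep_succ.log (Real.exp_pos _).ne').neg.add
    ((h.tendsto_log_sub_of_window ht).const_mul ((k : ℝ) - 1))
  rw [Real.log_exp, neg_neg, mul_zero, add_zero] at h1
  filter_upwards [h1.eventually (Metric.ball_mem_nhds _ one_pos), h'.eventually_basic, h'.s_le,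
    h.p_le (by norm_num : (0 : ℝ) < 1 / 2)]
    with n h2 ⟨hn, hs, hp, hL⟩ htn hp2
  have h3 : (0 : ℝ) < t n := by exact_mod_cast hs
  have h4 : (0 : ℝ) < n := by exact_mod_cast hn
  have a1 := expIndep_pos (k := k) (by linarith : p n < 1) htn
  have a2 := expIndep_pos (k := k) (by linarith : p n < 1) (by omega : t n ≤ n)
  rw [Real.dist_eq, Real.log_div a1.ne' (by positivity),
    Real.log_mul a2.ne' (by positivity), Real.log_pow, hk1] at h2
  have h5 : Real.log (t n / n) = - Real.log (n / t n) := by rw [← Real.log_inv, inv_div]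
  rw [h5] at h2
  have hk0 : (0 : ℝ) ≤ k := by positivity
  rw [abs_lt] at h2
  rw [abs_le]
  constructor <;> linarith [h2.1, h2.2]

theorem inWindow_sub {n s j : ℕ} (hj : (j : ℝ) ≤ 2 * critSize k n s + 12) :
    InWindow k n s (s - j) := by
  rw [InWindow]
  rcases le_total j s with h | h
  · rw [Nat.cast_sub h, sub_sub_cancel_left, abs_neg, abs_of_nonneg (by positivity)]
    exact hj
  · rw [Nat.sub_eq_zero_of_le h, Nat.cast_zero, zero_sub, abs_neg, abs_of_nonneg (by positivity)]
    exact le_trans (by exact_mod_cast h) hj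

theorem window_le (h : IsCritical k p c s) :
    ∀ᶠ n : ℕ in atTop, 2 * critSize k n (s n) + 12 ≤ s n := by
  filter_upwards [h.tendsto_window.eventually (ge_mem_nhds one_pos), h.eventually_basic]
    with n h1 ⟨hn, hs, hp, hL⟩
  have h3 : (0 : ℝ) < s n := by exact_mod_cast hs
  rw [div_le_one h3] at h1
  refine le_trans ?_ h1
  have := critSize_nonneg k n (s n)
  exact le_mul_of_one_le_left (by positivity) hL

theorem abs_log_expIndep_sub_le (h : IsCritical k p c s) :
    ∀ᶠ n : ℕ in atTop, ∀ j : ℕ, (j : ℝ) ≤ 2 * critSize k n (s n) + 12 →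
      |Real.log (expIndep n k (p n) (s n - j)) - Real.log (expIndep n k (p n) (s n)) -
        j * ((k - 1) * Real.log (n / s n))| ≤ j * (k + 1) := by
  filter_upwards [h.abs_log_expIndep_sub_succ_le, h.window_le] with n h1 h2 j hj
  induction j with
  | zero => simp
  | succ j ih =>
    have hj' : (j : ℝ) ≤ 2 * critSize k n (s n) + 12 := le_trans (by push_cast; linarith) hj
    have h3 := ih hj'
    have h4 := h1 (s n - (j + 1)) (inWindow_sub hj)
    have h5 : j + 1 ≤ s n := by exact_mod_cast hj.trans h2
    rw [show s n - (j + 1) + 1 = s n - j by omega] at h4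
    rw [abs_le] at h3 h4 ⊢
    push_cast
    constructor <;> linarith [h3.1, h3.2, h4.1, h4.2]

/-- This is `tendsto_gap` read through $n(s/n)^k=e^k\cdot$`critSize`, with all sizes in the window
replaced by `s`. -/
theorem abs_gap_sub_le (h : IsCritical k p c s) {η : ℝ} (hη : 0 < η) :
    ∀ᶠ n : ℕ in atTop, ∀ j, InWindow k n (s n) j →
      |n * atMostOne (p n) (j.choose (k - 1)) - augRate n k (p n) j -
        critSize k n (s n) * ((k - 1) * Real.log (n / s n))| ≤
        η * (critSize k n (s n) * Real.log (n / s n)) := by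
  refine eventually_forall_of_forall_seq (S := fun n j => InWindow k n (s n) j) s
    (fun n => inWindow_self _ _ _) fun t ht => ?_
  replace ht := Eventually.of_forall (f := atTop) ht
  have h' := h.of_window ht
  have hk := h.two_le
  have h1 : Tendsto (fun n : ℕ => Real.log (n / t n) / Real.log (n / s n)) atTop (𝓝 1) := by
    have h2 := ((h.tendsto_log_sub_of_window ht).div_atTop h.tendsto_log).add_const 1
    rw [zero_add] at h2
    refine h2.congr' ?_
    filter_upwards [h.tendsto_log.eventually_gt_atTop 0] with n hl
    field_simp
    ring
  have h2 := ((h'.tendsto_gap.mul ((h.ratio_of_window ht).pow k)).mul h1).const_mul (Real.exp k)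
  have h3 : Real.exp k * (Real.exp (-k) * ((k : ℝ) - 1) * 1 ^ k * 1) = k - 1 := by
    have : Real.exp k * Real.exp (-k) = 1 := by rw [← Real.exp_add]; simp
    rw [one_pow, mul_one, mul_one, ← mul_assoc, this, one_mul]
  rw [h3] at h2
  filter_upwards [h2.eventually (Metric.ball_mem_nhds _ hη), h'.eventually_basic, h.eventually_basic,
    h.tendsto_log.eventually_gt_atTop 0, h'.tendsto_log.eventually_gt_atTop 0]
    with n h4 ⟨hn, ht0, hp, hL⟩ ⟨_, hs, _, _⟩ hl hl'
  have hs0 : (0 : ℝ) < s n := by exact_mod_cast hs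
  have ht1 : (0 : ℝ) < t n := by exact_mod_cast ht0
  have hn0 : (0 : ℝ) < n := by exact_mod_cast hn
  have hA : 0 < critSize k n (s n) := by unfold critSize; positivity
  rw [Real.dist_eq] at h4
  set G := n * atMostOne (p n) ((t n).choose (k - 1)) - augRate n k (p n) (t n)
  have h5 : Real.exp k * (G / (n * (t n / n : ℝ) ^ k * Real.log (n / t n)) * (t n / s n : ℝ) ^ k *
      (Real.log (n / t n) / Real.log (n / s n))) =
      G / (critSize k n (s n) * Real.log (n / s n)) := by
    have h6 : (n : ℝ) * (t n / n : ℝ) ^ k = (Real.exp k * critSize k n (s n)) * (t n / s n : ℝ) ^ k := by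
      rw [← mul_pow_eq_critSize (by omega) hn, mul_assoc, ← mul_pow]
      congr 2; field_simp
    rw [h6]
    have hX : 0 < (t n / s n : ℝ) ^ k := by positivity
    have hE := Real.exp_pos (k : ℝ)
    generalize (t n / s n : ℝ) ^ k = X at *
    generalize Real.log (n / t n) = y at *
    generalize Real.log (n / s n) = z at *
    field_simp
  rw [h5] at h4
  have h7 : G - critSize k n (s n) * ((k - 1) * Real.log (n / s n)) =
      (G / (critSize k n (s n) * Real.log (n / s n)) - (k - 1)) *
        (critSize k n (s n) * Real.log (n / s n)) := by
    field_simp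
  rw [h7, abs_mul, abs_of_pos (mul_pos hA hl)]
  gcongr

/-- The central formula: going down `j` steps gains `j` units of $(k-1)\log(n/s)$ and the exponent
$\lambda-n\beta$ loses `critSize` such units. The bounded errors per step are absorbed because
$\log(n/s)\to\infty$. -/
theorem abs_log_augMain_sub_le (h : IsCritical k p c s) {η : ℝ} (hη : 0 < η) :
    ∀ᶠ n : ℕ in atTop, ∀ j : ℕ, (j : ℝ) ≤ 2 * critSize k n (s n) + 12 →
      |Real.log (augMain n k (p n) (s n - j)) - Real.log (expIndep n k (p n) (s n)) -
        (j - critSize k n (s n)) * ((k - 1) * Real.log (n / s n))| ≤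
        η * ((1 + critSize k n (s n)) * Real.log (n / s n)) := by
  filter_upwards [h.abs_log_expIndep_sub_le, h.abs_gap_sub_le (half_pos hη), h.s_le,
    h.p_le (by norm_num : (0 : ℝ) < 1 / 2),
    h.tendsto_log.eventually_ge_atTop (2 / η * (12 * (k + 1)))] with n h1 h2 hsn hp2 hl j hj
  have h3 := h1 j hj
  have h4 := h2 (s n - j) (inWindow_sub hj)
  have hA := critSize_nonneg k n (s n)
  have ha := expIndep_pos (k := k) (by linarith : p n < 1) (by omega : s n - j ≤ n)
  rw [augMain, Real.log_mul ha.ne' (Real.exp_pos _).ne', Real.log_exp]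
  set A := critSize k n (s n)
  set y := Real.log (n / s n)
  have h5 : (j : ℝ) * (k + 1) ≤ η / 2 * ((1 + A) * y) := by
    have e1 : η / 2 * (2 / η * (12 * (k + 1))) = 12 * (k + 1) := by field_simp
    calc (j : ℝ) * (k + 1) ≤ (12 * (1 + A)) * (k + 1) := by gcongr; linarith
      _ = (1 + A) * (η / 2 * (2 / η * (12 * (k + 1)))) := by rw [e1]; ring
      _ ≤ (1 + A) * (η / 2 * y) := by gcongr
      _ = _ := by ring
  have h6 : η / 2 * (A * y) ≤ η / 2 * ((1 + A) * y) := by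
    have : 0 ≤ y := le_trans (by positivity) hl
    gcongr
    linarith
  have h3' := abs_le.1 (h3.trans h5)
  have h4' := abs_le.1 (h4.trans h6)
  rw [abs_le]
  constructor <;> linarith [h3'.1, h3'.2, h4'.1, h4'.2]

end IsCritical

end

end RandomHypergraph

/-! ### The offset between the first-moment threshold and $s_z$. -/

namespace RandomHypergraph

noncomputable section

/-- The distance from `s` of the largest order below `s` for which augmented independent sets are
plentiful. -/
def augOffset (n k : ℕ) (p δ : ℝ) (s : ℕ) : ℕ :=
  sInf {j : ℕ | (n : ℝ) ^ δ * (1 + n * (s / n : ℝ) ^ k) ≤ augMain n k p (s - j)}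

theorem augMain_pos {n k s : ℕ} {p : ℝ} (hp : p < 1) (hs : s ≤ n) : 0 < augMain n k p s :=
  mul_pos (expIndep_pos hp hs) (Real.exp_pos _)

namespace IsCritical

variable {k : ℕ} {p : ℕ → ℝ} {c ε δ : ℝ} {s : ℕ → ℕ}

/-- At `s + 1` the logarithm is at most $2\varepsilon\log n$; one step down adds $(k-1)\log(n/s)$ up
to a constant. -/
theorem log_expIndep_le (h : IsCritical k p c s)
    (ha' : ∀ᶠ n : ℕ in atTop, expIndep n k (p n) (s n + 1) ≤ (n : ℝ) ^ (2 * ε)) :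
    ∀ᶠ n : ℕ in atTop, Real.log (expIndep n k (p n) (s n)) ≤
      2 * ε * Real.log n + (k - 1) * Real.log (n / s n) + (k + 1) := by
  filter_upwards [ha', h.abs_log_expIndep_sub_succ_le, h.s_le,
    h.p_le (by norm_num : (0 : ℝ) < 1 / 2), h.eventually_basic]
    with n h1 h2 hsn hp2 ⟨hn, hs, hp, hL⟩
  have h3 := (abs_le.1 (h2 _ (inWindow_self _ _ _))).2
  have h4 := Real.log_le_log (expIndep_pos (by linarith) hsn) h1
  rw [Real.log_rpow (by exact_mod_cast hn)] at h4
  linarith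

theorem log_threshold_le {n s : ℕ} (hk : 1 ≤ k) (hn : 0 < n) :
    Real.log ((n : ℝ) ^ δ * (1 + n * (s / n : ℝ) ^ k)) ≤
      δ * Real.log n + k * (1 + critSize k n s) := by
  have hn0 : (0 : ℝ) < n := by exact_mod_cast hn
  have hA := critSize_nonneg k n s
  have hk1 : (1 : ℝ) ≤ k := by exact_mod_cast hk
  rw [Real.log_mul (by positivity) (by positivity), Real.log_rpow hn0, mul_pow_eq_critSize hk hn]
  set A := critSize k n s
  have h1 : (1 : ℝ) + Real.exp k * A ≤ Real.exp k * Real.exp A := by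
    have h2 := Real.one_le_exp (by positivity : (0 : ℝ) ≤ k)
    have h3 := Real.add_one_le_exp A
    nlinarith [Real.exp_pos (k : ℝ)]
  have h2 := Real.log_le_log (by positivity) h1
  rw [← Real.exp_add, Real.log_exp] at h2
  nlinarith

/-- The defining set is nonempty, so the infimum is attained; otherwise it would be the default `0`.
-/
theorem augOffset_spec (h : IsCritical k p c s) (hε : 0 < ε) (hδ : δ ≤ ε)
    (ha : ∀ᶠ n : ℕ in atTop, (n : ℝ) ^ (2 * ε) < expIndep n k (p n) (s n)) :
    ∀ᶠ n : ℕ in atTop,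
      (n : ℝ) ^ δ * (1 + n * (s n / n : ℝ) ^ k) ≤
        augMain n k (p n) (s n - augOffset n k (p n) δ (s n)) ∧
      (augOffset n k (p n) δ (s n) : ℝ) ≤ 2 * critSize k n (s n) + 11 := by
  have hk := h.two_le
  have hk2 : (2 : ℝ) ≤ k := by exact_mod_cast hk
  filter_upwards [ha, h.abs_log_augMain_sub_le (by norm_num : (0 : ℝ) < 1 / 4), h.s_le,
    h.p_le (by norm_num : (0 : ℝ) < 1 / 2), h.eventually_basic,
    h.tendsto_log.eventually_ge_atTop (4 * k : ℝ)] with n h1 h2 hsn hp2 ⟨hn, hs, hp, hL⟩ hl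
  have hn0 : (0 : ℝ) < n := by exact_mod_cast hn
  have hA := critSize_nonneg k n (s n)
  have h4 := Real.log_lt_log (by positivity) h1
  rw [Real.log_rpow hn0] at h4
  have h5 := log_threshold_le (δ := δ) (k := k) (s := s n) (by omega) hn
  set A := critSize k n (s n)
  set y := Real.log (n / s n)
  -- Exceeds `A` by a fixed proportion of `1 + A`, which outweighs the error of the central formula,
  -- and stays inside the window.
  set j := ⌈A + (1 + A) / 2⌉₊
  have hj1 : A + (1 + A) / 2 ≤ j := Nat.le_ceil _
  have hj2 : (j : ℝ) ≤ A + (1 + A) / 2 + 1 := (Nat.ceil_lt_add_one (by positivity)).le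
  have hmem : (n : ℝ) ^ δ * (1 + n * (s n / n : ℝ) ^ k) ≤ augMain n k (p n) (s n - j) := by
    rw [← Real.log_le_log_iff (by positivity) (augMain_pos (by linarith) (by omega))]
    have h6 := (abs_le.1 (h2 j (by linarith))).1
    have h7 : (1 + A) / 2 * y ≤ (j - A) * ((k - 1) * y) := by
      have e1 : (1 + A) / 2 ≤ j - A := by linarith
      have e2 : y ≤ (k - 1) * y := le_mul_of_one_le_left (by linarith) (by linarith)
      exact mul_le_mul e1 e2 (by linarith) (by linarith)
    have h8 : (1 + A) * (4 * k) ≤ (1 + A) * y := by gcongr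
    have h9 : δ * Real.log n ≤ 2 * ε * Real.log n := by gcongr; linarith
    linarith
  refine ⟨Nat.sInf_mem (s := {j : ℕ | (n : ℝ) ^ δ * (1 + n * (s n / n : ℝ) ^ k) ≤
    augMain n k (p n) (s n - j)}) ⟨j, hmem⟩, ?_⟩
  have h6 : augOffset n k (p n) δ (s n) ≤ j := Nat.sInf_le hmem
  have h7 : (augOffset n k (p n) δ (s n) : ℝ) ≤ j := by exact_mod_cast h6
  linarith

theorem augMain_pred_lt {n s : ℕ} {p : ℝ} (h : augOffset n k p δ s ≠ 0) :
    augMain n k p (s - (augOffset n k p δ s - 1)) < (n : ℝ) ^ δ * (1 + n * (s / n : ℝ) ^ k) := by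
  have h1 := Nat.notMem_of_lt_sInf (s := {j : ℕ | (n : ℝ) ^ δ * (1 + n * (s / n : ℝ) ^ k) ≤
    augMain n k p (s - j)}) (m := augOffset n k p δ s - 1) (Nat.pred_lt h)
  rw [Set.mem_ofPred_eq, not_le] at h1
  exact h1

/-- One step before the offset `augMain` is below its bound although $\mathbb
E[X_s]>n^{2\varepsilon}$, so the central formula forces `augOffset - 1 ≤ critSize` up to the error.
The case of offset `0` is trivial. -/
theorem augOffset_le (h : IsCritical k p c s) (hε : 0 < ε) (hδ : δ ≤ ε)
    (ha : ∀ᶠ n : ℕ in atTop, (n : ℝ) ^ (2 * ε) < expIndep n k (p n) (s n)) {η : ℝ} (hη : 0 < η) :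
    ∀ᶠ n : ℕ in atTop, (augOffset n k (p n) δ (s n) : ℝ) ≤
      critSize k n (s n) + 1 + η * (1 + critSize k n (s n)) := by
  have hk := h.two_le
  have hk2 : (2 : ℝ) ≤ k := by exact_mod_cast hk
  filter_upwards [ha, h.augOffset_spec hε hδ ha, h.abs_log_augMain_sub_le (half_pos hη), h.s_le,
    h.p_le (by norm_num : (0 : ℝ) < 1 / 2), h.eventually_basic, h.tendsto_log.eventually_gt_atTop 0,
    h.tendsto_log.eventually_ge_atTop (2 / η * k : ℝ)] with n h1 hspec h2 hsn hp2 ⟨hn, hs, hp, hL⟩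
    hl0 hl
  have hn0 : (0 : ℝ) < n := by exact_mod_cast hn
  have hA := critSize_nonneg k n (s n)
  rcases eq_or_ne (augOffset n k (p n) δ (s n)) 0 with h0 | h0
  · rw [h0, Nat.cast_zero]; positivity
  have h3 := augMain_pred_lt h0
  have h4 := Real.log_lt_log (by positivity) h1
  rw [Real.log_rpow hn0] at h4
  have h5 := log_threshold_le (δ := δ) (k := k) (s := s n) (by omega) hn
  have hξ1 : 1 ≤ augOffset n k (p n) δ (s n) := Nat.one_le_iff_ne_zero.2 h0
  obtain ⟨-, hξ2⟩ := hspec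
  set A := critSize k n (s n)
  set y := Real.log (n / s n)
  set ξ := augOffset n k (p n) δ (s n)
  have hξc : ((ξ - 1 : ℕ) : ℝ) = ξ - 1 := by rw [Nat.cast_sub hξ1]; simp
  have h6 := (abs_le.1 (h2 (ξ - 1) (by rw [hξc]; linarith))).1
  have h7 := Real.log_lt_log (augMain_pos (by linarith) (by omega)) h3
  rw [hξc] at h6
  have h8 : (1 + A) * k ≤ η / 2 * ((1 + A) * y) := by
    have e1 : η / 2 * (2 / η * k) = k := by field_simp
    calc (1 + A) * k = (1 + A) * (η / 2 * (2 / η * k)) := by rw [e1]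
      _ ≤ (1 + A) * (η / 2 * y) := by gcongr
      _ = _ := by ring
  have h9 : δ * Real.log n ≤ 2 * ε * Real.log n := by gcongr; linarith
  have h10 : (ξ - 1 - A) * (k - 1) * y ≤ η * (1 + A) * y := by linarith
  have h11 := le_of_mul_le_mul_right h10 hl0
  by_contra! hc
  have h12 : (0 : ℝ) ≤ η * (1 + A) := by positivity
  have h13 : ξ - 1 - A ≤ (ξ - 1 - A) * (k - 1) :=
    le_mul_of_one_le_right (by linarith) (by linarith)
  linarith

/-- At the offset `augMain` is at least `1`, while $\log\mathbb E[X_s]$ is at most $2\varepsilon\log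
n+(k-1)\log(n/s)+O(1)$. Dividing by $(k-1)\log(n/s)$ gives the terms `1` and
$\frac{2\varepsilon}{k-1}\cdot\frac{\log n}{\log(n/s)}$. -/
theorem augOffset_ge (h : IsCritical k p c s) (hε : 0 < ε) (hδ0 : 0 ≤ δ) (hδ : δ ≤ ε)
    (ha : ∀ᶠ n : ℕ in atTop, (n : ℝ) ^ (2 * ε) < expIndep n k (p n) (s n))
    (ha' : ∀ᶠ n : ℕ in atTop, expIndep n k (p n) (s n + 1) ≤ (n : ℝ) ^ (2 * ε))
    {η : ℝ} (hη : 0 < η) :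
    ∀ᶠ n : ℕ in atTop, critSize k n (s n) - 1 -
      2 * ε / (k - 1) * (Real.log n / Real.log (n / s n)) - η * (1 + critSize k n (s n)) ≤
      (augOffset n k (p n) δ (s n) : ℝ) := by
  have hk := h.two_le
  have hk2 : (2 : ℝ) ≤ k := by exact_mod_cast hk
  filter_upwards [h.log_expIndep_le ha', h.augOffset_spec hε hδ ha,
    h.abs_log_augMain_sub_le (half_pos hη), h.s_le,
    h.p_le (by norm_num : (0 : ℝ) < 1 / 2), h.eventually_basic, h.tendsto_log.eventually_gt_atTop 0,
    h.tendsto_log.eventually_ge_atTop (2 / η * (k + 1) : ℝ)]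
    with n h1 ⟨hspec, hξ⟩ h2 hsn hp2 ⟨hn, hs, hp, hL⟩ hl0 hl
  have hn0 : (0 : ℝ) < n := by exact_mod_cast hn
  have hn1 : (1 : ℝ) ≤ n := by exact_mod_cast hn
  have hA := critSize_nonneg k n (s n)
  have h3 : (1 : ℝ) ≤ (n : ℝ) ^ δ * (1 + n * (s n / n : ℝ) ^ k) := by
    have e1 := Real.one_le_rpow hn1 hδ0
    have e2 : (1 : ℝ) ≤ 1 + n * (s n / n : ℝ) ^ k := by
      have : (0 : ℝ) ≤ n * (s n / n : ℝ) ^ k := by positivity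
      linarith
    exact one_le_mul_of_one_le_of_one_le e1 e2
  have h4 := Real.log_nonneg (h3.trans hspec)
  set A := critSize k n (s n)
  set y := Real.log (n / s n)
  set ξ := augOffset n k (p n) δ (s n)
  have h6 := (abs_le.1 (h2 ξ (by linarith))).2
  have h8 : (k + 1 : ℝ) ≤ η / 2 * ((1 + A) * y) := by
    have e1 : η / 2 * (2 / η * (k + 1)) = (k + 1 : ℝ) := by field_simp
    calc (k + 1 : ℝ) = η / 2 * (2 / η * (k + 1)) := by rw [e1]
      _ ≤ η / 2 * y := by gcongr
      _ ≤ _ := by gcongr; exact le_mul_of_one_le_left hl0.le (by linarith)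
  have hk1 : (0 : ℝ) < k - 1 := by linarith
  have h9 : η * (1 + A) * y ≤ η * (1 + A) * ((k - 1) * y) := by
    gcongr
    exact le_mul_of_one_le_left hl0.le (by linarith)
  have h10 : 2 * ε / (k - 1) * (Real.log n / y) * ((k - 1) * y) = 2 * ε * Real.log n := by
    field_simp
  have h11 : 0 < (k - 1) * y := by positivity
  refine le_of_mul_le_mul_right ?_ h11
  linarith

end IsCritical

end

end RandomHypergraph

/-! ### Two-point concentration. -/

namespace RandomHypergraph

noncomputable section

theorem prob_le_add {n k : ℕ} {p : ℝ} (hp0 : 0 ≤ p) (hp1 : p ≤ 1)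
    {A B C : Finset (Finset (Fin n)) → Prop} (h : ∀ H, A H → B H ∨ C H) :
    prob n k p A ≤ prob n k p B + prob n k p C := by
  classical
  simp only [prob, Finset.sum_filter]
  rw [← Finset.sum_add_distrib]
  refine Finset.sum_le_sum fun H _ => ?_
  have hw : 0 ≤ weight n k p H := by
    have : 0 ≤ 1 - p := by linarith
    unfold weight; positivity
  by_cases hA : A H
  · rcases h H hA with hB | hC
    · rw [if_pos hA, if_pos hB]; split_ifs <;> linarith
    · rw [if_pos hA, if_pos hC]; split_ifs <;> linarith
  · rw [if_neg hA]; split_ifs <;> linarith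

theorem prob_exists_le {n k : ℕ} {p : ℝ} (hp0 : 0 ≤ p) (hp1 : p ≤ 1) {ι : Type*} (I : Finset ι)
    (A : ι → Finset (Finset (Fin n)) → Prop) :
    prob n k p (fun H => ∃ i ∈ I, A i H) ≤ ∑ i ∈ I, prob n k p (A i) := by
  simp only [prob_eq_bernProb]
  exact bernProb_exists_le hp0 hp1 _ I A

/-- Values below `m + d` are treated one by one through augmented sets; the plain first moment
suffices from `m + d` on. -/
theorem prob_le_indepNum_window_le {n k m d : ℕ} {p : ℝ} (hp0 : 0 ≤ p) (hp1 : p ≤ 1) (hk : 1 ≤ k) :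
    prob n k p (fun H => m ≤ indepNum H) ≤ expIndep n k p (m + d) +
      ∑ i ∈ Finset.range d, ∑ r ∈ Finset.range (n + 1), expAug n k p (m + i + r) r := by
  have h1 : prob n k p (fun H => m ≤ indepNum H) ≤ prob n k p (fun H => m + d ≤ indepNum H) +
      prob n k p (fun H => ∃ i ∈ Finset.range d, indepNum H = m + i) := by
    refine prob_le_add hp0 hp1 fun H hH => ?_
    rcases le_or_gt (m + d) (indepNum H) with h | h
    · exact Or.inl h
    · exact Or.inr ⟨indepNum H - m, Finset.mem_range.2 (by omega), by omega⟩
  refine h1.trans (add_le_add (prob_le_indepNum_le hp0 hp1 hk _) ?_)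
  refine (prob_exists_le hp0 hp1 _ _).trans (Finset.sum_le_sum fun i _ => ?_)
  exact prob_indepNum_eq_le hp0 hp1 hk _

namespace IsCritical

variable {k : ℕ} {p : ℕ → ℝ} {c ε δ : ℝ} {s t : ℕ → ℕ}

theorem div_le_two_mul_of_window (h : IsCritical k p c s)
    (ht : ∀ᶠ n in atTop, InWindow k n (s n) (t n)) :
    ∀ᶠ n : ℕ in atTop, (t n : ℝ) ≤ 2 * s n ∧ (s n : ℝ) ≤ 2 * t n := by
  filter_upwards [(h.ratio_of_window ht).eventually (ge_mem_nhds (by norm_num : (1 : ℝ) < 2)),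
    (h.ratio_of_window ht).eventually (le_mem_nhds (by norm_num : (1 / 2 : ℝ) < 1)),
    h.eventually_basic] with n h1 h2 ⟨hn, hs, hp, hL⟩
  have hs0 : (0 : ℝ) < s n := by exact_mod_cast hs
  rw [div_le_iff₀ hs0] at h1
  rw [le_div_iff₀ hs0] at h2
  constructor <;> linarith

theorem augMain_succ_le_of_window (h : IsCritical k p c s) :
    ∀ᶠ n : ℕ in atTop, ∀ j, InWindow k n (s n) j →
      augMain n k (p n) (j + 1) ≤ augMain n k (p n) j * (2 * (s n / n : ℝ)) ^ (k - 1) := by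
  refine eventually_forall_of_forall_seq (S := fun n j => InWindow k n (s n) j) s
    (fun n => inWindow_self _ _ _) fun t ht => ?_
  replace ht := Eventually.of_forall (f := atTop) ht
  have h' := h.of_window ht
  filter_upwards [h'.augMain_succ_le, h.div_le_two_mul_of_window ht, h'.s_le,
    h.p_le (by norm_num : (0 : ℝ) < 1 / 2)] with n h1 h2 h3 h4
  refine h1.trans (mul_le_mul_of_nonneg_left ?_ (augMain_pos (by linarith) (by omega)).le)
  rw [← mul_div_assoc]
  gcongr
  exact h2.1

/-- The cut-off in `r` is fixed in terms of `s` alone; the factor `2 ^ k` in `hB` pays for sizes in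
the window being up to twice `s`. -/
theorem sum_expAug_le_of_window (h : IsCritical k p c s) {B : ℝ}
    (hB : Real.exp 2 * 4 * 2 ^ k ≤ B) :
    ∀ᶠ n : ℕ in atTop, ∀ j, InWindow k n (s n) j →
      ∑ r ∈ Finset.range (n + 1), expAug n k (p n) (j + r) r ≤ 2 * augMain n k (p n) j +
        expIndep n k (p n) j * ((n + 1) *
          Real.exp (-(B * (Real.log n * (1 + n * (s n / n : ℝ) ^ k))))) := by
  refine eventually_forall_of_forall_seq (S := fun n j => InWindow k n (s n) j) s
    (fun n => inWindow_self _ _ _) fun t ht => ?_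
  replace ht := Eventually.of_forall (f := atTop) ht
  have h' := h.of_window ht
  have hB0 : 0 < B := lt_of_lt_of_le (by positivity) hB
  set R : ℕ → ℕ := fun n => ⌈B * (Real.log n * (1 + n * (s n / n : ℝ) ^ k))⌉₊ with hR
  have hmain := h'.sum_expAug_le (R := R) (K := (B + 1) * 2 ^ k) ?_ ?_
  · filter_upwards [hmain, h'.s_le, h.p_le (by norm_num : (0 : ℝ) < 1 / 2)] with n h1 h2 h3
    refine h1.trans ?_
    have := (expIndep_pos (k := k) (by linarith : p n < 1) (by omega : t n ≤ n)).le
    gcongr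
    exact Nat.le_ceil _
  · filter_upwards [h.div_le_two_mul_of_window ht, h.eventually_basic] with n ⟨h1, h2⟩ ⟨hn, hs, hp, hL⟩
    refine le_trans ?_ (Nat.le_ceil _)
    have e1 : (t n / n : ℝ) ^ k ≤ 2 ^ k * (s n / n : ℝ) ^ k := by
      rw [← mul_pow, ← mul_div_assoc]; gcongr
    calc Real.exp 2 * (4 * Real.log n * (n * (t n / n : ℝ) ^ k))
        ≤ Real.exp 2 * (4 * Real.log n * (n * (2 ^ k * (s n / n : ℝ) ^ k))) := by gcongr
      _ = Real.exp 2 * 4 * 2 ^ k * (Real.log n * (n * (s n / n : ℝ) ^ k)) := by ring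
      _ ≤ B * (Real.log n * (1 + n * (s n / n : ℝ) ^ k)) := by
        gcongr
        linarith
  · filter_upwards [h.div_le_two_mul_of_window ht, h.eventually_basic] with n ⟨h1, h2⟩ ⟨hn, hs, hp, hL⟩
    refine (Nat.ceil_lt_add_one (by positivity)).le.trans ?_
    have e1 : (s n / n : ℝ) ^ k ≤ 2 ^ k * (t n / n : ℝ) ^ k := by
      rw [← mul_pow, ← mul_div_assoc]; gcongr
    have e2 : (1 : ℝ) ≤ 2 ^ k := one_le_pow₀ (by norm_num)
    have e3 : (1 : ℝ) ≤ Real.log n * (1 + n * (s n / n : ℝ) ^ k) := by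
      refine one_le_mul_of_one_le_of_one_le hL ?_
      have : (0 : ℝ) ≤ n * (s n / n : ℝ) ^ k := by positivity
      linarith
    calc B * (Real.log n * (1 + n * (s n / n : ℝ) ^ k)) + 1
        ≤ (B + 1) * (Real.log n * (1 + n * (s n / n : ℝ) ^ k)) := by linarith
      _ ≤ (B + 1) * (Real.log n * (2 ^ k + n * (2 ^ k * (t n / n : ℝ) ^ k))) := by gcongr
      _ = _ := by ring

/-- A crude bound: its only use is to be beaten by the tail $e^{-R}$ of the sum over `r`. -/
theorem expIndep_sub_le (h : IsCritical k p c s) (hε : 0 < ε)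
    (ha' : ∀ᶠ n : ℕ in atTop, expIndep n k (p n) (s n + 1) ≤ (n : ℝ) ^ (2 * ε)) :
    ∀ᶠ n : ℕ in atTop, ∀ j : ℕ, (j : ℝ) ≤ 2 * critSize k n (s n) + 12 →
      expIndep n k (p n) (s n - j) ≤
        Real.exp ((2 * ε + 26 * k) * (Real.log n * (1 + n * (s n / n : ℝ) ^ k))) := by
  have hk := h.two_le
  have hk2 : (2 : ℝ) ≤ k := by exact_mod_cast hk
  filter_upwards [h.abs_log_expIndep_sub_le, h.log_expIndep_le ha', h.s_le,
    h.p_le (by norm_num : (0 : ℝ) < 1 / 2), h.eventually_basic, h.log_le]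
    with n h1 h2 hsn hp2 ⟨hn, hs, hp, hL⟩ hy j hj
  have h3 := (abs_le.1 (h1 j hj)).2
  have hA : critSize k n (s n) ≤ n * (s n / n : ℝ) ^ k := critSize_le_mul_pow (by omega) hn
  have hN : (0 : ℝ) ≤ n * (s n / n : ℝ) ^ k := by positivity
  set N := (n : ℝ) * (s n / n : ℝ) ^ k
  set y := Real.log (n / s n)
  set L := Real.log n
  rw [← Real.log_le_iff_le_exp (expIndep_pos (by linarith) (by omega))]
  have e1 : (k - 1) * y ≤ (k - 1) * L := mul_le_mul_of_nonneg_left hy (by linarith)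
  have e2 : (k + 1 : ℝ) ≤ (k + 1) * L := le_mul_of_one_le_right (by linarith) hL
  have e3 : (j : ℝ) * ((k - 1) * y) + j * (k + 1) ≤ 12 * (1 + N) * (2 * k * L) := by
    rw [← mul_add]
    have : (k - 1) * y + (k + 1) ≤ 2 * k * L := by linarith
    calc (j : ℝ) * ((k - 1) * y + (k + 1)) ≤ j * (2 * k * L) := by gcongr
      _ ≤ _ := by gcongr; linarith
  have e4 : 2 * ε * L + (k - 1) * L + (k + 1) * L ≤ (1 + N) * ((2 * ε + 2 * k) * L) := by
    have : 0 ≤ (2 * ε + 2 * k) * L := by positivity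
    nlinarith
  linarith

theorem tendsto_prob_augOffset (h : IsCritical k p c s) (hc1 : c ≤ 1) (hε : 0 < ε) (hδ0 : 0 < δ)
    (hδ : δ ≤ ε) (ha : ∀ᶠ n : ℕ in atTop, (n : ℝ) ^ (2 * ε) < expIndep n k (p n) (s n)) :
    Tendsto (fun n => prob n k (p n)
      (fun H => s n - augOffset n k (p n) δ (s n) ≤ indepNum H)) atTop (𝓝 1) := by
  have hspec := h.augOffset_spec hε hδ ha
  have h' : IsCritical k p c (fun n => s n - augOffset n k (p n) δ (s n)) := by
    refine h.of_window ?_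
    filter_upwards [hspec] with n h1
    exact inWindow_sub (by linarith [h1.2])
  refine h'.tendsto_prob_le_indepNum hc1 hδ0 ?_
  filter_upwards [hspec] with n h1
  refine le_trans ?_ h1.1
  gcongr
  exact Nat.sub_le _ _

/-- By minimality of the offset, `augMain` is below $n^\delta(1+n(s/n)^k)$ one step above $s_z$.
Each further step multiplies it by $O((s/n)^{k-1})$, and $\delta<c$ makes the product small already
at the second step. -/
theorem tendsto_prob_augOffset_add_two (h : IsCritical k p c s) (hε : 0 < ε) (hδc : δ < c)
    (hδ : δ ≤ ε) (ha : ∀ᶠ n : ℕ in atTop, (n : ℝ) ^ (2 * ε) < expIndep n k (p n) (s n))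
    (ha' : ∀ᶠ n : ℕ in atTop, expIndep n k (p n) (s n + 1) ≤ (n : ℝ) ^ (2 * ε))
    (hx : Tendsto (fun n : ℕ => (n : ℝ) ^ (2 * ε) * (s n / n : ℝ) ^ (k - 1)) atTop (𝓝 0)) :
    Tendsto (fun n => prob n k (p n)
      (fun H => s n - augOffset n k (p n) δ (s n) + 2 ≤ indepNum H)) atTop (𝓝 0) := by
  have hk := h.two_le
  have hk2 : (2 : ℝ) ≤ k := by exact_mod_cast hk
  set K : ℝ := 2 * ε + 26 * k with hK
  set B : ℝ := K + 3 + Real.exp 2 * 4 * 2 ^ k with hB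
  have hK0 : 0 < K := by positivity
  have hB' : K + 3 ≤ B := by
    have : 0 < Real.exp 2 * 4 * 2 ^ k := by positivity
    linarith
  -- the upper bound and its limit
  have hx1 : Tendsto (fun n : ℕ => (n : ℝ) ^ δ * (s n / n : ℝ) ^ (k - 1)) atTop (𝓝 0) := by
    refine tendsto_scale 0 (D := 1) (b := c) (f := fun n => (s n / n : ℝ) ^ (k - 1))
      (fun n => by positivity) hδc ?_
    filter_upwards [h.le_rpow, h.lt_one] with n h1 h2
    rw [pow_zero, one_mul, one_mul]
    exact (pow_le_of_le_one (by positivity) h2.le (by omega)).trans h1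
  have hx2 : Tendsto (fun n : ℕ => (n : ℝ) ^ δ * (n * (s n / n : ℝ) ^ (2 * k - 1))) atTop (𝓝 0) := by
    refine tendsto_scale 0 (D := 1) (b := c) (f := fun n => n * (s n / n : ℝ) ^ (2 * k - 1))
      (fun n => by positivity) hδc ?_
    filter_upwards [h.le_rpow', h.lt_one] with n h1 h2
    rw [pow_zero, one_mul, one_mul]
    refine le_trans (mul_le_mul_of_nonneg_left ?_ (by positivity)) h1
    exact pow_le_pow_of_le_one (by positivity) h2.le (by omega)
  have hinv : Tendsto (fun n : ℕ => (n : ℝ)⁻¹) atTop (𝓝 0) := tendsto_inv_atTop_nhds_zero_nat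
  have hlim := ((hx.const_mul (2 ^ (k - 1))).add ((hx1.add hx2).const_mul (4 * 2 ^ (k - 1)))).add
    (hinv.const_mul 2)
  simp only [mul_zero, add_zero] at hlim
  have hy : Tendsto (fun n : ℕ => (2 * (s n / n : ℝ)) ^ (k - 1)) atTop (𝓝 0) := by
    have := (h.tendsto_div.const_mul 2).pow (k - 1)
    rwa [mul_zero, zero_pow (by omega)] at this
  have hsucc : IsCritical k p c (fun n => s n + 1) := by
    refine h.of_window (Eventually.of_forall fun n => ?_)
    have := critSize_nonneg k n (s n)
    rw [InWindow]; push_cast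
    rw [add_sub_cancel_left, abs_one]; linarith
  have hwsucc : ∀ n, InWindow k n (s n) (s n + 1) := fun n => by
    have := critSize_nonneg k n (s n)
    rw [InWindow]; push_cast
    rw [add_sub_cancel_left, abs_one]; linarith
  have hek : Real.exp (-k) < 1 := by
    rw [Real.exp_lt_one_iff]; linarith
  refine squeeze_zero' ?_ ?_ hlim
  · filter_upwards [h.eventually_basic, h.p_le (by norm_num : (0 : ℝ) < 1 / 2)]
      with n ⟨hn, hs, hp, hL⟩ hp2
    exact prob_nonneg hp.le (by linarith) _
  filter_upwards [h.eventually_basic, h.p_le (by norm_num : (0 : ℝ) < 1 / 2),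
    h.augOffset_spec hε hδ ha, h.window_le, h.augMain_succ_le_of_window,
    h.sum_expAug_le_of_window (B := B) (by linarith), h.expIndep_sub_le hε ha', ha',
    hsucc.tendsto_expIndep_succ.eventually (ge_mem_nhds hek), hsucc.s_le, h.s_le,
    hy.eventually (ge_mem_nhds (by norm_num : (0 : ℝ) < 1 / 2)),
    h.div_le_two_mul_of_window (Eventually.of_forall hwsucc)]
    with n ⟨hn, hs, hp, hL⟩ hp2 hspec hwin hE hsum hexp ha' hes hsn1 hsn hy h2s
  have hn0 : (0 : ℝ) < n := by exact_mod_cast hn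
  have hn1 : (1 : ℝ) ≤ n := by exact_mod_cast hn
  have hA := critSize_nonneg k n (s n)
  set ξ := augOffset n k (p n) δ (s n) with hξ
  set y := (2 * (s n / n : ℝ)) ^ (k - 1) with hyd
  set Q := Real.log n * (1 + n * (s n / n : ℝ) ^ k) with hQ
  have hQL : Real.log n ≤ Q := by
    refine le_mul_of_one_le_right (by linarith) ?_
    have : (0 : ℝ) ≤ n * (s n / n : ℝ) ^ k := by positivity
    linarith
  have hξs : ξ ≤ s n := by
    have : (ξ : ℝ) ≤ s n := by linarith [hspec.2]
    exact_mod_cast this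
  set T := (n : ℝ) ^ δ * (1 + n * (s n / n : ℝ) ^ k) with hT
  have hT0 : 0 ≤ T := by positivity
  have hy0 : 0 ≤ y := by positivity
  have hwin' : ∀ m, m ≤ ξ → InWindow k n (s n) (s n - ξ + 1 + m) := by
    intro m hm
    rw [InWindow]
    push_cast [Nat.cast_sub hξs]
    have e1 : (m : ℝ) ≤ ξ := by exact_mod_cast hm
    have e2 := hspec.2
    have e3 := Nat.cast_nonneg (α := ℝ) m
    rw [abs_le]
    constructor <;> linarith
  -- With `d = ξ` the plain first moment is taken at `s + 2`, where it is at most $n^{2\varepsilon}$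
  -- times $O((s/n)^{k-1})$.
  have hbound := prob_le_indepNum_window_le (n := n) (m := s n - ξ + 2) (d := ξ) hp.le
    (by linarith : p n ≤ 1) (by omega : 1 ≤ k)
  refine hbound.trans ?_
  have hterm1 : expIndep n k (p n) (s n - ξ + 2 + ξ) ≤
      2 ^ (k - 1) * ((n : ℝ) ^ (2 * ε) * (s n / n : ℝ) ^ (k - 1)) := by
    rw [show s n - ξ + 2 + ξ = s n + 1 + 1 by omega]
    have a0 := expIndep_pos (k := k) (by linarith : p n < 1) hsn
    rw [div_le_one (by positivity)] at hes
    refine hes.trans ?_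
    calc expIndep n k (p n) (s n + 1) * (((s n + 1 : ℕ) : ℝ) / n) ^ (k - 1)
        ≤ (n : ℝ) ^ (2 * ε) * (2 * s n / n) ^ (k - 1) := by
          gcongr
          exact h2s.1
      _ = _ := by rw [mul_div_assoc, mul_pow]; ring
  -- Starts just above $s_z$, where minimality of `ξ` applies; for `ξ = 0` there is no size left to
  -- treat.
  have hgeo : ∀ m, m ≤ ξ → 0 < ξ → augMain n k (p n) (s n - ξ + 1 + m) ≤ T * y ^ m := by
    intro m hm h0
    induction m with
    | zero =>
      have := augMain_pred_lt (n := n) (k := k) (p := p n) (δ := δ) (s := s n) h0.ne'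
      rw [← hξ, show s n - (ξ - 1) = s n - ξ + 1 + 0 by omega] at this
      rw [pow_zero, mul_one]
      exact this.le
    | succ m ih =>
      have e1 := hE _ (hwin' m (by omega))
      rw [← add_assoc, pow_succ, ← mul_assoc]
      exact e1.trans (mul_le_mul_of_nonneg_right (ih (by omega)) hy0)
  have hterm : ∀ i ∈ Finset.range ξ, ∑ r ∈ Finset.range (n + 1),
      expAug n k (p n) (s n - ξ + 2 + i + r) r ≤
      2 * (T * y * (1 / 2) ^ i) + Real.exp (K * Q) * ((n + 1) * Real.exp (-(B * Q))) := by
    intro i hi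
    rw [Finset.mem_range] at hi
    have e1 := hsum (s n - ξ + 2 + i) (by
      rw [show s n - ξ + 2 + i = s n - ξ + 1 + (i + 1) by ring]
      exact hwin' _ (by omega))
    refine e1.trans (add_le_add ?_ ?_)
    · have e2 := hgeo (i + 1) (by omega) (by omega)
      rw [show s n - ξ + 1 + (i + 1) = s n - ξ + 2 + i by ring, pow_succ] at e2
      have e3 : y ^ i ≤ (1 / 2 : ℝ) ^ i := by gcongr
      calc 2 * augMain n k (p n) (s n - ξ + 2 + i) ≤ 2 * (T * (y ^ i * y)) := by gcongr
        _ = 2 * (T * y * y ^ i) := by ring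
        _ ≤ _ := by gcongr
    · refine mul_le_mul_of_nonneg_right ?_ (by positivity)
      rcases lt_or_ge (s n) (s n - ξ + 2 + i) with hlt | hge
      · have e4 : s n - ξ + 2 + i = s n + 1 := by omega
        rw [e4]
        refine ha'.trans ?_
        rw [Real.rpow_def_of_pos hn0, Real.exp_le_exp]
        have : 0 ≤ Real.log n := by linarith
        have e5 : 2 * ε * Real.log n ≤ K * Q := by
          gcongr
          rw [hK]
          linarith
        linarith
      · have e4 := hexp (s n - (s n - ξ + 2 + i)) (by
          have : ((s n - (s n - ξ + 2 + i) : ℕ) : ℝ) ≤ ξ := by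
            exact_mod_cast (by omega : s n - (s n - ξ + 2 + i) ≤ ξ)
          linarith [hspec.2])
        rwa [show s n - (s n - (s n - ξ + 2 + i)) = s n - ξ + 2 + i by omega] at e4
  have hsum2 := Finset.sum_le_sum hterm
  rw [Finset.sum_add_distrib, ← Finset.mul_sum, ← Finset.mul_sum, Finset.sum_const,
    Finset.card_range, nsmul_eq_mul] at hsum2
  have hgeom := sum_geometric_two_le ξ
  have hmain : 2 * (T * y * ∑ i ∈ Finset.range ξ, (1 / 2 : ℝ) ^ i) ≤
      4 * 2 ^ (k - 1) * ((n : ℝ) ^ δ * (s n / n : ℝ) ^ (k - 1) +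
        (n : ℝ) ^ δ * (n * (s n / n : ℝ) ^ (2 * k - 1))) := by
    have e1 : (s n / n : ℝ) ^ (2 * k - 1) = (s n / n : ℝ) ^ k * (s n / n : ℝ) ^ (k - 1) := by
      rw [← pow_add]; congr 1; omega
    calc 2 * (T * y * ∑ i ∈ Finset.range ξ, (1 / 2 : ℝ) ^ i) ≤ 2 * (T * y * 2) := by gcongr
      _ = _ := by rw [hT, hyd, e1, mul_pow]; ring
  -- `B` exceeds `K` by at least `3`, so each tail term is at most $n^{-3}$, and there are at most
  -- $n(n+1)$ of them.
  have htail : (ξ : ℝ) * (Real.exp (K * Q) * ((n + 1) * Real.exp (-(B * Q)))) ≤ 2 * (n : ℝ)⁻¹ := by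
    have e1 : Real.exp (K * Q) * Real.exp (-(B * Q)) ≤ ((n : ℝ) ^ 3)⁻¹ := by
      rw [← Real.exp_add, ← Real.exp_log (by positivity : (0 : ℝ) < ((n : ℝ) ^ 3)⁻¹),
        Real.exp_le_exp, Real.log_inv, Real.log_pow]
      have : (K + 3) * Q ≤ B * Q := mul_le_mul_of_nonneg_right hB' (by linarith)
      push_cast
      linarith
    have e2 : (ξ : ℝ) ≤ n := by exact_mod_cast (by omega : ξ ≤ n)
    calc (ξ : ℝ) * (Real.exp (K * Q) * ((n + 1) * Real.exp (-(B * Q))))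
        = ξ * (n + 1) * (Real.exp (K * Q) * Real.exp (-(B * Q))) := by ring
      _ ≤ n * (n + n) * ((n : ℝ) ^ 3)⁻¹ := by gcongr
      _ = 2 * (n : ℝ)⁻¹ := by field_simp; ring
  linarith

theorem tendsto_prob_two_point (h : IsCritical k p c s) (hc1 : c ≤ 1) (hε : 0 < ε) (hδ0 : 0 < δ)
    (hδc : δ < c) (hδ : δ ≤ ε)
    (ha : ∀ᶠ n : ℕ in atTop, (n : ℝ) ^ (2 * ε) < expIndep n k (p n) (s n))
    (ha' : ∀ᶠ n : ℕ in atTop, expIndep n k (p n) (s n + 1) ≤ (n : ℝ) ^ (2 * ε))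
    (hx : Tendsto (fun n : ℕ => (n : ℝ) ^ (2 * ε) * (s n / n : ℝ) ^ (k - 1)) atTop (𝓝 0)) :
    Tendsto (fun n => prob n k (p n) (fun H =>
      (indepNum H : ℤ) = (s n - augOffset n k (p n) δ (s n) : ℕ) ∨
      (indepNum H : ℤ) = (s n - augOffset n k (p n) δ (s n) : ℕ) + 1)) atTop (𝓝 1) := by
  have h1 := h.tendsto_prob_augOffset hc1 hε hδ0 hδ ha
  have h2 := h.tendsto_prob_augOffset_add_two hε hδc hδ ha ha' hx
  have h3 := h1.sub h2
  rw [sub_zero] at h3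
  refine tendsto_of_tendsto_of_tendsto_of_le_of_le' h3 tendsto_const_nhds ?_ ?_
  · filter_upwards [h.eventually_basic, h.p_le (by norm_num : (0 : ℝ) < 1 / 2)]
      with n ⟨hn, hs, hp, hL⟩ hp2
    rw [sub_le_iff_le_add]
    refine prob_le_add hp.le (by linarith) fun H hH => ?_
    by_cases h4 : s n - augOffset n k (p n) δ (s n) + 2 ≤ indepNum H
    · exact Or.inr h4
    · left
      generalize s n - augOffset n k (p n) δ (s n) = m at *
      omega
  · filter_upwards [h.eventually_basic, h.p_le (by norm_num : (0 : ℝ) < 1 / 2)]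
      with n ⟨hn, hs, hp, hL⟩ hp2
    exact prob_le_one hp.le (by linarith) _

end IsCritical

end

end RandomHypergraph

/-! ### The critical size in the three regimes of `p`. -/

namespace RandomHypergraph

noncomputable section

namespace IsCritical

variable {k : ℕ} {p : ℕ → ℝ} {c ε δ : ℝ} {s : ℕ → ℕ}

theorem tendsto_log_mul_pow_sub (h : IsCritical k p c s) :
    Tendsto (fun n : ℕ => Real.log (p n * (s n : ℝ) ^ (k - 1)) - Real.log (Real.log (n / s n))) atTop
      (𝓝 (Real.log k.factorial)) := by
  have h1 := h.tendsto_mul_pow_div.log (by positivity)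
  refine h1.congr' ?_
  filter_upwards [h.eventually_basic, h.tendsto_log.eventually_gt_atTop 0]
    with n ⟨hn, hs, hp, hL⟩ hl
  have hs0 : (0 : ℝ) < s n := by exact_mod_cast hs
  rw [Real.log_div (by positivity) hl.ne']

theorem tendsto_log_log_div : Tendsto (fun x : ℝ => Real.log x / x) atTop (𝓝 0) := by
  simpa using Real.isLittleO_log_id_atTop.tendsto_div_nhds_zero

theorem cast_sub_one_pos (h : IsCritical k p c s) : (0 : ℝ) < (k : ℝ) - 1 := by
  have : (2 : ℝ) ≤ k := by exact_mod_cast h.two_le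
  linarith

theorem cast_sub_one (h : IsCritical k p c s) : (((k - 1 : ℕ) : ℝ)) = (k : ℝ) - 1 := by
  rw [Nat.cast_sub (by have := h.two_le; omega)]; simp

/-- The quotient of $d=np^{1/(k-1)}$ by $n/s$ is $(ps^{k-1})^{1/(k-1)}$, a power of $\log(n/s)$ up
to constants; so the logarithms differ by a lower-order term. -/
theorem tendsto_log_degree_div (h : IsCritical k p c s) :
    Tendsto (fun n : ℕ => Real.log ((n : ℝ) * p n ^ (1 / ((k : ℝ) - 1))) / Real.log (n / s n)) atTop
      (𝓝 1) := by
  have h1 := (((h.tendsto_log_mul_pow_sub.div_atTop h.tendsto_log).add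
    (tendsto_log_log_div.comp h.tendsto_log)).const_mul (1 / ((k : ℝ) - 1))).const_add 1
  simp only [add_zero, mul_zero] at h1
  refine h1.congr' ?_
  filter_upwards [h.eventually_basic, h.tendsto_log.eventually_gt_atTop 0]
    with n ⟨hn, hs, hp, hL⟩ hl
  have hs0 : (0 : ℝ) < s n := by exact_mod_cast hs
  have hn0 : (0 : ℝ) < n := by exact_mod_cast hn
  have hk1 := h.cast_sub_one_pos
  have e1 : Real.log (n / s n) = Real.log n - Real.log (s n) := Real.log_div hn0.ne' hs0.ne'
  have e2 : Real.log (p n * (s n : ℝ) ^ (k - 1)) = Real.log (p n) + (k - 1) * Real.log (s n) := by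
    rw [Real.log_mul hp.ne' (by positivity), Real.log_pow, h.cast_sub_one]
  rw [Real.log_mul hn0.ne' (by positivity), Real.log_rpow hp]
  simp only [Function.comp_apply]
  have e3 : Real.log n = Real.log (n / s n) + Real.log (s n) := by rw [e1]; ring
  rw [e2]
  generalize Real.log (n / s n) = y at *
  rw [e3]
  field_simp
  ring

/-- The critical size in terms of the average degree. -/
theorem isEquivalent_critSize (h : IsCritical k p c s) :
    (fun n : ℕ => critSize k n (s n)) ~[atTop] (fun n : ℕ =>
      ((k.factorial : ℝ) * Real.log ((n : ℝ) * p n ^ (1 / ((k : ℝ) - 1)))) ^ ((k : ℝ) / ((k : ℝ) - 1)) /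
        (Real.exp 1 ^ k * p n ^ ((k : ℝ) / ((k : ℝ) - 1)) * (n : ℝ) ^ (k - 1))) := by
  have hk1 := h.cast_sub_one_pos
  have h1 := (h.tendsto_mul_pow_div.div (h.tendsto_log_degree_div.const_mul (k.factorial : ℝ))
    (by positivity)).rpow_const (p := (k : ℝ) / ((k : ℝ) - 1)) (Or.inr (by positivity))
  have hF : (k.factorial : ℝ) ≠ 0 := by positivity
  rw [mul_one, div_self hF, Real.one_rpow] at h1
  have hpos : ∀ᶠ n : ℕ in atTop, 0 < Real.log ((n : ℝ) * p n ^ (1 / ((k : ℝ) - 1))) := by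
    filter_upwards [h.tendsto_log_degree_div.eventually (lt_mem_nhds zero_lt_one),
      h.tendsto_log.eventually_gt_atTop 0] with n h2 h3
    have := mul_pos h2 h3
    rwa [div_mul_cancel₀ _ h3.ne'] at this
  refine isEquivalent_of_tendsto_one (h1.congr' ?_)
  filter_upwards [h.eventually_basic, hpos, h.tendsto_log.eventually_gt_atTop 0]
    with n ⟨hn, hs, hp, hL⟩ hd hl
  have hs0 : (0 : ℝ) < s n := by exact_mod_cast hs
  have hn0 : (0 : ℝ) < n := by exact_mod_cast hn
  simp only [Pi.div_apply]
  generalize Real.log ((n : ℝ) * p n ^ (1 / ((k : ℝ) - 1))) = D at *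
  generalize Real.log (n / s n) = y at *
  have e1 : p n * (s n : ℝ) ^ (k - 1) / y / (k.factorial * (D / y)) =
      p n * (s n : ℝ) ^ (k - 1) / (k.factorial * D) := by field_simp
  have e2 : ((s n : ℝ) ^ (k - 1)) ^ ((k : ℝ) / ((k : ℝ) - 1)) = (s n : ℝ) ^ k := by
    rw [← Real.rpow_natCast, ← Real.rpow_mul hs0.le, h.cast_sub_one, mul_div_cancel₀ _ hk1.ne',
      Real.rpow_natCast]
  have hpp : 0 < p n ^ ((k : ℝ) / ((k : ℝ) - 1)) := by positivity
  have hDD : 0 < (k.factorial * D) ^ ((k : ℝ) / ((k : ℝ) - 1)) := by positivity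
  rw [e1, Real.div_rpow (by positivity) (by positivity), Real.mul_rpow hp.le (by positivity), e2,
    critSize]
  generalize p n ^ ((k : ℝ) / ((k : ℝ) - 1)) = P at *
  generalize (k.factorial * D) ^ ((k : ℝ) / ((k : ℝ) - 1)) = Q at *
  field_simp

/-- Isolates the ratio of $\log n\cdot n^{-(k-1)^2/k}$ to `p`. As $ps^{k-1}$ has the order of $\log
n$, this ratio decides whether `critSize` tends to zero, to a constant or to infinity. -/
theorem critSize_eq (h : IsCritical k p c s) :
    ∀ᶠ n : ℕ in atTop, critSize k n (s n) = (p n * (s n : ℝ) ^ (k - 1) / Real.log n *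
      (Real.log n * (n : ℝ) ^ (-(((k : ℝ) - 1) ^ 2 / k)) / p n) / Real.exp (k - 1)) ^
        ((k : ℝ) / ((k : ℝ) - 1)) := by
  filter_upwards [h.eventually_basic] with n ⟨hn, hs, hp, hL⟩
  have hs0 : (0 : ℝ) < s n := by exact_mod_cast hs
  have hn0 : (0 : ℝ) < n := by exact_mod_cast hn
  have hk1 := h.cast_sub_one_pos
  have hk0 : (k : ℝ) ≠ 0 := by linarith
  have e1 : p n * (s n : ℝ) ^ (k - 1) / Real.log n *
      (Real.log n * (n : ℝ) ^ (-(((k : ℝ) - 1) ^ 2 / k)) / p n) =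
      (s n : ℝ) ^ (k - 1) * (n : ℝ) ^ (-(((k : ℝ) - 1) ^ 2 / k)) := by
    field_simp
  have e2 : ((s n : ℝ) ^ (k - 1)) ^ ((k : ℝ) / ((k : ℝ) - 1)) = (s n : ℝ) ^ k := by
    rw [← Real.rpow_natCast, ← Real.rpow_mul hs0.le, h.cast_sub_one, mul_div_cancel₀ _ hk1.ne',
      Real.rpow_natCast]
  have e3 : ((n : ℝ) ^ (-(((k : ℝ) - 1) ^ 2 / k))) ^ ((k : ℝ) / ((k : ℝ) - 1)) =
      ((n : ℝ) ^ (k - 1))⁻¹ := by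
    rw [← Real.rpow_natCast (n : ℝ) (k - 1), ← Real.rpow_neg hn0.le, ← Real.rpow_mul hn0.le,
      h.cast_sub_one]
    congr 1
    field_simp
  have e4 : Real.exp (k - 1) ^ ((k : ℝ) / ((k : ℝ) - 1)) = Real.exp 1 ^ k := by
    rw [← Real.exp_mul, mul_div_cancel₀ _ hk1.ne', ← Real.exp_nat_mul, mul_one]
  rw [e1, Real.div_rpow (by positivity) (by positivity), Real.mul_rpow (by positivity)
    (by positivity), e2, e3, e4, critSize]
  field_simp

theorem tendsto_critSize_zero (h : IsCritical k p c s)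
    (hp : (fun n : ℕ => Real.log n * (n : ℝ) ^ (-(((k : ℝ) - 1) ^ 2 / k))) =o[atTop] p) :
    Tendsto (fun n => critSize k n (s n)) atTop (𝓝 0) := by
  have hk1 := h.cast_sub_one_pos
  have h1 := hp.tendsto_div_nhds_zero
  have h2 : Tendsto (fun n : ℕ => p n * (s n : ℝ) ^ (k - 1) / Real.log n *
      (Real.log n * (n : ℝ) ^ (-(((k : ℝ) - 1) ^ 2 / k)) / p n)) atTop (𝓝 0) := by
    have h3 := h1.const_mul (2 * k.factorial : ℝ)
    rw [mul_zero] at h3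
    refine squeeze_zero' ?_ ?_ h3
    · filter_upwards [h.eventually_basic] with n ⟨hn, hs, hp, hL⟩
      positivity
    · filter_upwards [h.eventually_basic, h.mul_pow_le] with n ⟨hn, hs, hp, hL⟩ h4
      gcongr
      rw [div_le_iff₀ (by linarith)]
      exact h4
  have h3 := (h2.div_const (Real.exp ((k : ℝ) - 1))).rpow_const (p := (k : ℝ) / ((k : ℝ) - 1))
    (Or.inr (by positivity))
  rw [zero_div, Real.zero_rpow (by have := h.two_le; positivity)] at h3
  exact h3.congr' (h.critSize_eq.mono fun n hn => hn.symm)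

theorem tendsto_critSize_atTop (h : IsCritical k p c s)
    (hp : p =o[atTop] (fun n : ℕ => Real.log n * (n : ℝ) ^ (-(((k : ℝ) - 1) ^ 2 / k)))) :
    Tendsto (fun n => critSize k n (s n)) atTop atTop := by
  have hk1 := h.cast_sub_one_pos
  have h1 : Tendsto (fun n : ℕ => Real.log n * (n : ℝ) ^ (-(((k : ℝ) - 1) ^ 2 / k)) / p n) atTop
      atTop := by
    have h2 : Tendsto (fun n : ℕ => (p n / (Real.log n * (n : ℝ) ^ (-(((k : ℝ) - 1) ^ 2 / k))))⁻¹)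
        atTop atTop := by
      refine Tendsto.comp tendsto_inv_nhdsGT_zero (tendsto_nhdsWithin_iff.2
        ⟨hp.tendsto_div_nhds_zero, ?_⟩)
      filter_upwards [h.eventually_basic] with n ⟨hn, hs, hp, hL⟩
      have hn0 : (0 : ℝ) < n := by exact_mod_cast hn
      have : 0 < Real.log n := by linarith
      rw [Set.mem_Ioi]; positivity
    exact h2.congr fun n => inv_div _ _
  have h2 : Tendsto (fun n : ℕ => p n * (s n : ℝ) ^ (k - 1) / Real.log n *
      (Real.log n * (n : ℝ) ^ (-(((k : ℝ) - 1) ^ 2 / k)) / p n)) atTop atTop := by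
    have hc := h.c_pos
    refine tendsto_atTop_mono' _ ?_ (h1.const_mul_atTop
      (by positivity : 0 < (k.factorial : ℝ) / 2 * c))
    have hF : (k.factorial : ℝ) / 2 < k.factorial := half_lt_self (by positivity)
    filter_upwards [h.eventually_basic, h.tendsto_mul_pow_div.eventually (le_mem_nhds hF), h.log_ge,
      h.tendsto_log.eventually_gt_atTop 0] with n ⟨hn, hs, hp, hL⟩ h4 h5 hl
    have hL0 : 0 < Real.log n := by linarith
    gcongr
    rw [le_div_iff₀ hl] at h4
    rw [le_div_iff₀ hL0]
    refine le_trans ?_ h4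
    rw [mul_assoc]
    gcongr
  have hk0 : (0 : ℝ) < k := by linarith
  have h3 := (tendsto_rpow_atTop (by positivity : 0 < (k : ℝ) / ((k : ℝ) - 1))).comp
    (h2.atTop_div_const (Real.exp_pos ((k : ℝ) - 1)))
  exact h3.congr' (h.critSize_eq.mono fun n hn => hn.symm)

/-- For this `p`, the relation $ps^{k-1}=\Theta(\log(n/s))$ gives $s=n^{(k-1)/k+o(1)}$. -/
theorem tendsto_log_div_log (h : IsCritical k p c s) {C : ℝ} (hC : 0 < C)
    (hp : ∀ᶠ n : ℕ in atTop, p n = C * Real.log n * (n : ℝ) ^ (-(((k : ℝ) - 1) ^ 2 / k))) :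
    Tendsto (fun n : ℕ => Real.log (n / s n) / Real.log n) atTop (𝓝 (1 / k)) := by
  have hk1 := h.cast_sub_one_pos
  have hk0 : (k : ℝ) ≠ 0 := by linarith
  have hlogL : Tendsto (fun n : ℕ => Real.log (Real.log n) / Real.log n) atTop (𝓝 0) :=
    tendsto_log_log_div.comp tendsto_log_natCast
  have hlogy : Tendsto (fun n : ℕ => Real.log (Real.log (n / s n)) / Real.log n) atTop (𝓝 0) := by
    refine squeeze_zero' ?_ ?_ hlogL
    · filter_upwards [h.tendsto_log.eventually_ge_atTop 1, h.eventually_basic]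
        with n h1 ⟨hn, hs, hp, hL⟩
      exact div_nonneg (Real.log_nonneg h1) (by linarith)
    · filter_upwards [h.tendsto_log.eventually_ge_atTop 1, h.eventually_basic, h.log_le]
        with n h1 ⟨hn, hs, hp, hL⟩ h2
      gcongr
  have h1 := (h.tendsto_log_mul_pow_sub.div_atTop tendsto_log_natCast).add hlogy
  have h2 := h1.sub (((tendsto_const_nhds (x := Real.log C)).div_atTop tendsto_log_natCast).add hlogL)
  have h3 := ((h2.const_mul (1 / ((k : ℝ) - 1))).add_const (((k : ℝ) - 1) / k)).const_sub 1
  have h4 : (1 : ℝ) - (1 / ((k : ℝ) - 1) * (0 + 0 - (0 + 0)) + ((k : ℝ) - 1) / k) = 1 / k := by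
    field_simp; ring
  rw [h4] at h3
  refine h3.congr' ?_
  filter_upwards [h.eventually_basic, hp] with n ⟨hn, hs, hp0, hL⟩ hp
  have hs0 : (0 : ℝ) < s n := by exact_mod_cast hs
  have hn0 : (0 : ℝ) < n := by exact_mod_cast hn
  have hL0 : 0 < Real.log n := by linarith
  have e1 : Real.log (n / s n) = Real.log n - Real.log (s n) := Real.log_div hn0.ne' hs0.ne'
  have e2 : Real.log (p n * (s n : ℝ) ^ (k - 1)) = Real.log (p n) + (k - 1) * Real.log (s n) := by
    rw [Real.log_mul hp0.ne' (by positivity), Real.log_pow, h.cast_sub_one]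
  have e3 : Real.log (p n) = Real.log C + Real.log (Real.log n) -
      ((k : ℝ) - 1) ^ 2 / k * Real.log n := by
    rw [hp, Real.log_mul (by positivity) (by positivity), Real.log_mul hC.ne' hL0.ne',
      Real.log_rpow hn0]
    ring
  rw [e2, e3, e1]
  field_simp
  ring

theorem tendsto_critSize_const (h : IsCritical k p c s) {C : ℝ} (hC : 0 < C)
    (hp : ∀ᶠ n : ℕ in atTop, p n = C * Real.log n * (n : ℝ) ^ (-(((k : ℝ) - 1) ^ 2 / k))) :
    Tendsto (fun n => critSize k n (s n)) atTop
      (𝓝 (((k - 1).factorial : ℝ) ^ ((k : ℝ) / ((k : ℝ) - 1)) /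
        (C ^ ((k : ℝ) / ((k : ℝ) - 1)) * Real.exp 1 ^ k))) := by
  have hk1 := h.cast_sub_one_pos
  have hk0 : (k : ℝ) ≠ 0 := by linarith
  have h1 : Tendsto (fun n : ℕ => p n * (s n : ℝ) ^ (k - 1) / Real.log n *
      (Real.log n * (n : ℝ) ^ (-(((k : ℝ) - 1) ^ 2 / k)) / p n)) atTop
      (𝓝 ((k - 1).factorial / C)) := by
    have h2 := (h.tendsto_mul_pow_div.mul (h.tendsto_log_div_log hC hp)).div_const C
    have h3 : (k.factorial : ℝ) * (1 / k) / C = (k - 1).factorial / C := by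
      rw [← Nat.mul_factorial_pred (by have := h.two_le; omega : k ≠ 0)]; push_cast; field_simp
    rw [h3] at h2
    refine h2.congr' ?_
    filter_upwards [h.eventually_basic, hp, h.tendsto_log.eventually_gt_atTop 0]
      with n ⟨hn, hs, hp0, hL⟩ hp hl
    have hn0 : (0 : ℝ) < n := by exact_mod_cast hn
    have hL0 : 0 < Real.log n := by linarith
    have hX : 0 < (n : ℝ) ^ (-(((k : ℝ) - 1) ^ 2 / k)) := by positivity
    have e1 : Real.log n * (n : ℝ) ^ (-(((k : ℝ) - 1) ^ 2 / k)) / p n = 1 / C := by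
      rw [hp]; field_simp
    rw [e1]
    field_simp
  have h3 := (h1.div_const (Real.exp ((k : ℝ) - 1))).rpow_const (p := (k : ℝ) / ((k : ℝ) - 1))
    (Or.inr (by positivity))
  have e4 : Real.exp (k - 1) ^ ((k : ℝ) / ((k : ℝ) - 1)) = Real.exp 1 ^ k := by
    rw [← Real.exp_mul, mul_div_cancel₀ _ hk1.ne', ← Real.exp_nat_mul, mul_one]
  rw [Real.div_rpow (by positivity) (by positivity), Real.div_rpow (by positivity) hC.le, e4,
    div_div] at h3
  exact h3.congr' (h.critSize_eq.mono fun n hn => hn.symm)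

/-- When `critSize` vanishes the exponent $\lambda-n\beta$ is negligible against $\log n$, and
$\mathbb E[X_s]>n^{2\varepsilon}$ leaves a margin over $n^\delta$ since $\delta\le\varepsilon$. So
`j = 0` already qualifies. -/
theorem augOffset_eq_zero (h : IsCritical k p c s) (hε : 0 < ε) (hδ : δ ≤ ε)
    (ha : ∀ᶠ n : ℕ in atTop, (n : ℝ) ^ (2 * ε) < expIndep n k (p n) (s n))
    (hA : Tendsto (fun n => critSize k n (s n)) atTop (𝓝 0)) :
    ∀ᶠ n : ℕ in atTop, augOffset n k (p n) δ (s n) = 0 := by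
  have hk := h.two_le
  have hk1 := h.cast_sub_one_pos
  filter_upwards [ha, h.abs_log_augMain_sub_le (by positivity : 0 < ε / 8), h.s_le,
    h.p_le (by norm_num : (0 : ℝ) < 1 / 2), h.eventually_basic, h.log_le,
    h.tendsto_log.eventually_gt_atTop 0,
    hA.eventually (ge_mem_nhds zero_lt_one),
    hA.eventually (ge_mem_nhds (by positivity : 0 < ε / (4 * (k - 1)))),
    tendsto_log_natCast.eventually_ge_atTop (8 * k / ε)]
    with n h1 h2 hsn hp2 ⟨hn, hs, hp, hL⟩ hy hy0 hA1 hA2 hL2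
  have hn0 : (0 : ℝ) < n := by exact_mod_cast hn
  have hA := critSize_nonneg k n (s n)
  have h4 := Real.log_lt_log (by positivity) h1
  rw [Real.log_rpow hn0] at h4
  have h5 := log_threshold_le (δ := δ) (k := k) (s := s n) (by omega) hn
  have h6 := (abs_le.1 (h2 0 (by push_cast; linarith))).1
  refine Nat.eq_zero_of_le_zero (Nat.sInf_le ?_)
  rw [Set.mem_ofPred_eq, ← Real.log_le_log_iff (by positivity)
    (augMain_pos (by linarith) (by omega))]
  set A := critSize k n (s n)
  set y := Real.log (n / s n)
  set L := Real.log n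
  rw [Nat.cast_zero] at h6
  have e1 : A * ((k - 1) * y) ≤ ε / 4 * L := by
    rw [le_div_iff₀ (by positivity)] at hA2
    calc A * ((k - 1) * y) = A * (4 * (k - 1)) / 4 * y := by ring
      _ ≤ ε / 4 * L := by gcongr
  have e2 : ε / 8 * ((1 + A) * y) ≤ ε / 8 * (2 * L) := by
    gcongr
    linarith
  have e3 : k * (1 + A) ≤ k * 2 := by gcongr; linarith
  have e4 : (k : ℝ) * 2 ≤ ε / 4 * L := by
    rw [div_le_iff₀ hε] at hL2
    linarith
  have e5 : δ * L ≤ ε * L := by gcongr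
  linarith

/-- The additive errors of `augOffset_le` and `augOffset_ge` are bounded, because $\log
n/\log(n/s)\le1/c$, and so are absorbed when `critSize` tends to infinity. -/
theorem isEquivalent_augOffset (h : IsCritical k p c s) (hε : 0 < ε) (hδ0 : 0 ≤ δ) (hδ : δ ≤ ε)
    (ha : ∀ᶠ n : ℕ in atTop, (n : ℝ) ^ (2 * ε) < expIndep n k (p n) (s n))
    (ha' : ∀ᶠ n : ℕ in atTop, expIndep n k (p n) (s n + 1) ≤ (n : ℝ) ^ (2 * ε))
    (hA : Tendsto (fun n => critSize k n (s n)) atTop atTop) :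
    (fun n : ℕ => (augOffset n k (p n) δ (s n) : ℝ)) ~[atTop] (fun n => critSize k n (s n)) := by
  have hk1 := h.cast_sub_one_pos
  rw [IsEquivalent, isLittleO_iff]
  intro κ hκ
  set M := 2 * ε / (k - 1) * (1 / c) with hM
  have hc := h.c_pos
  have hM0 : 0 ≤ M := by positivity
  filter_upwards [h.augOffset_le hε hδ ha (half_pos hκ),
    h.augOffset_ge hε hδ0 hδ ha ha' (half_pos hκ), h.log_ge, h.tendsto_log.eventually_gt_atTop 0,
    hA.eventually_ge_atTop (2 / κ * (1 + M + κ / 2))] with n h1 h2 h3 h4 h5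
  have hA0 := critSize_nonneg k n (s n)
  have e1 : 2 * ε / (k - 1) * (Real.log n / Real.log (n / s n)) ≤ M := by
    rw [hM]
    refine mul_le_mul_of_nonneg_left ?_ (by positivity)
    rw [div_le_div_iff₀ h4 hc]
    linarith
  have e2 : 1 + M + κ / 2 ≤ κ / 2 * critSize k n (s n) := by
    have := mul_le_mul_of_nonneg_left h5 (half_pos hκ).le
    have e3 : κ / 2 * (2 / κ * (1 + M + κ / 2)) = 1 + M + κ / 2 := by field_simp
    linarith
  rw [Pi.sub_apply, Real.norm_eq_abs, Real.norm_eq_abs, abs_of_nonneg hA0, abs_le]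
  constructor <;> linarith

end IsCritical

/-- The difference of the two exponents of `n` is
$\frac{k(k-1)}{k+1}-\frac{(k-1)^2}k=\frac{k-1}{k(k+1)}$; a larger `ε` would contradict the lower
bound on `p`. -/
theorem epsilon_le {k : ℕ} (hk : 2 ≤ k) {ε C : ℝ} {p : ℕ → ℝ}
    (hlow : ∀ᶠ n : ℕ in atTop, (n : ℝ) ^ (-((((k : ℝ) - 1) * k) / ((k : ℝ) + 1)) + ε) < p n)
    (hp : ∀ᶠ n : ℕ in atTop, p n = C * Real.log n * (n : ℝ) ^ (-(((k : ℝ) - 1) ^ 2 / k))) :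
    ε ≤ ((k : ℝ) - 1) / (k * (k + 1)) := by
  by_contra! hlt
  have hk0 : (2 : ℝ) ≤ k := by exact_mod_cast hk
  have h1 := (tendsto_log_pow_mul_rpow_neg 1 (sub_pos.2 hlt)).const_mul C
  rw [mul_zero] at h1
  obtain ⟨n, h2, h3, h4, hn, hL⟩ := (h1.eventually (gt_mem_nhds zero_lt_one) |>.and (hlow.and (hp.and
    ((eventually_gt_atTop 0).and (tendsto_log_natCast.eventually_gt_atTop 0))))).exists
  have hn0 : (0 : ℝ) < n := by exact_mod_cast hn
  rw [h4] at h3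
  rw [pow_one] at h2
  have e1 : (n : ℝ) ^ (-(ε - ((k : ℝ) - 1) / (k * (k + 1)))) =
      (n : ℝ) ^ (-(((k : ℝ) - 1) ^ 2 / k)) / (n : ℝ) ^ (-((((k : ℝ) - 1) * k) / ((k : ℝ) + 1)) + ε) := by
    rw [← Real.rpow_sub hn0]
    congr 1
    field_simp
    ring
  rw [e1, ← mul_assoc, ← mul_div_assoc, div_lt_one (by positivity)] at h2
  linarith

/-- The additive loss in `augOffset_ge` tends to $1+\frac{2\varepsilon k}{k-1}\le1+\frac2{k+1}$. It
is strictly below the constant of the second regime, which leaves room for the error terms. -/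
theorem two_mul_epsilon_bound {k : ℕ} (hk : 2 ≤ k) {ε : ℝ}
    (hε : ε ≤ ((k : ℝ) - 1) / (k * (k + 1))) :
    1 + 2 * ε / (k - 1) * k < (k : ℝ) / (k - 1) + 1 / 2 := by
  have hk0 : (2 : ℝ) ≤ k := by exact_mod_cast hk
  have hk1 : (0 : ℝ) < k - 1 := by linarith
  have e1 : 2 * ε / (k - 1) * k ≤ 2 / (k + 1) := by
    rw [div_mul_eq_mul_div, div_le_div_iff₀ hk1 (by linarith)]
    rw [le_div_iff₀ (by positivity)] at hε
    linarith
  have e2 : (k : ℝ) / (k - 1) = 1 + 1 / (k - 1) := by field_simp; ring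
  have e3 : (2 : ℝ) / (k + 1) < 1 / (k - 1) + 1 / 2 := by
    rw [div_add_div _ _ hk1.ne' (by norm_num), div_lt_div_iff₀ (by linarith) (by linarith)]
    nlinarith
  linarith

namespace IsCritical

variable {k : ℕ} {p : ℕ → ℝ} {c ε δ : ℝ} {s : ℕ → ℕ}

theorem augOffset_mem_Ioo (h : IsCritical k p c s) (hε : 0 < ε) (hδ0 : 0 ≤ δ) (hδ : δ ≤ ε)
    (ha : ∀ᶠ n : ℕ in atTop, (n : ℝ) ^ (2 * ε) < expIndep n k (p n) (s n))
    (ha' : ∀ᶠ n : ℕ in atTop, expIndep n k (p n) (s n + 1) ≤ (n : ℝ) ^ (2 * ε))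
    {A : ℝ} (hA : Tendsto (fun n => critSize k n (s n)) atTop (𝓝 A))
    (hlog : Tendsto (fun n : ℕ => Real.log (n / s n) / Real.log n) atTop (𝓝 (1 / k)))
    (hεk : ε ≤ ((k : ℝ) - 1) / (k * (k + 1))) :
    ∀ᶠ n : ℕ in atTop, (augOffset n k (p n) δ (s n) : ℝ) ∈
      Set.Ioo (A - (k : ℝ) / (k - 1) - 1 / 2) (A + 3 / 2) := by
  have hk := h.two_le
  have hk0 : (2 : ℝ) ≤ k := by exact_mod_cast hk
  have hA0 : 0 ≤ A := ge_of_tendsto' hA fun n => critSize_nonneg _ _ _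
  have hgap := two_mul_epsilon_bound hk hεk
  set g := (k : ℝ) / (k - 1) + 1 / 2 - (1 + 2 * ε / (k - 1) * k) with hg
  have hg0 : 0 < g := by linarith
  -- Chosen so that `η * (1 + A)` is smaller than the slack at either end of the interval.
  set η := min (1 / 4) (g / 2) / (1 + A + 1) with hη
  have hm : 0 < min (1 / 4 : ℝ) (g / 2) := by positivity
  have hη0 : 0 < η := by positivity
  have hinv : Tendsto (fun n : ℕ => Real.log n / Real.log (n / s n)) atTop (𝓝 (k : ℝ)) := by
    have h1 := hlog.inv₀ (by positivity)
    rw [one_div, inv_inv] at h1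
    exact h1.congr fun n => inv_div _ _
  have hlow : Tendsto (fun n : ℕ => critSize k n (s n) - 1 -
      2 * ε / (k - 1) * (Real.log n / Real.log (n / s n)) - η * (1 + critSize k n (s n))) atTop
      (𝓝 (A - 1 - 2 * ε / (k - 1) * k - η * (1 + A))) :=
    ((hA.sub_const 1).sub (hinv.const_mul _)).sub ((hA.const_add 1).const_mul η)
  have hup : Tendsto (fun n : ℕ => critSize k n (s n) + 1 + η * (1 + critSize k n (s n))) atTop
      (𝓝 (A + 1 + η * (1 + A))) := (hA.add_const 1).add ((hA.const_add 1).const_mul η)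
  have hηA : η * (1 + A) ≤ min (1 / 4) (g / 2) := by
    rw [hη, div_mul_eq_mul_div, div_le_iff₀ (by positivity)]
    exact mul_le_mul_of_nonneg_left (by linarith) hm.le
  have h1 : A - (k : ℝ) / (k - 1) - 1 / 2 < A - 1 - 2 * ε / (k - 1) * k - η * (1 + A) := by
    have := hηA.trans (min_le_right _ _)
    linarith
  have h2 : A + 1 + η * (1 + A) < A + 3 / 2 := by
    have := hηA.trans (min_le_left _ _)
    linarith
  filter_upwards [h.augOffset_le hε hδ ha hη0, h.augOffset_ge hε hδ0 hδ ha ha' hη0,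
    hlow.eventually (lt_mem_nhds h1), hup.eventually (gt_mem_nhds h2)] with n a1 a2 a3 a4
  exact ⟨by linarith, by linarith⟩

end IsCritical

end

end RandomHypergraph

/-! ### Assembly of the theorem. -/

namespace RandomHypergraph

noncomputable section

namespace IsCritical

variable {k : ℕ} {p : ℕ → ℝ} {c ε δ : ℝ} {s : ℕ → ℕ}

/-- The offset does not exceed `s`, so the truncated subtraction that defines $s_z$ is a true one.
-/
theorem sub_augOffset_eq (h : IsCritical k p c s) (hε : 0 < ε) (hδ : δ ≤ ε)
    (ha : ∀ᶠ n : ℕ in atTop, (n : ℝ) ^ (2 * ε) < expIndep n k (p n) (s n)) :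
    ∀ᶠ n : ℕ in atTop, (s n : ℤ) - (s n - augOffset n k (p n) δ (s n) : ℕ) =
      augOffset n k (p n) δ (s n) := by
  filter_upwards [h.augOffset_spec hε hδ ha, h.window_le] with n h1 h2
  have h3 : augOffset n k (p n) δ (s n) ≤ s n := by
    have := h1.2.trans (by linarith : _ ≤ (s n : ℝ))
    exact_mod_cast this
  omega

end IsCritical

end

end RandomHypergraph

theorem mainTheorem2 (k : ℕ) (hk : 2 ≤ k) (ε : ℝ) (hε : 0 < ε)
    (hε' : ε < ((k : ℝ) - 1) / ((k : ℝ) + 1)) (p : ℕ → ℝ)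
    (hp : ∀ᶠ n : ℕ in atTop,
      (n : ℝ) ^ (-((((k : ℝ) - 1) * k) / ((k : ℝ) + 1)) + ε) < p n ∧
        p n < Real.log n ^ (-((k : ℝ) - 1))) :
    ∃ sz : ℕ → ℤ,
      Tendsto (fun n : ℕ => RandomHypergraph.prob n k (p n) (fun H =>
        (RandomHypergraph.indepNum H : ℤ) = sz n ∨
          (RandomHypergraph.indepNum H : ℤ) = sz n + 1)) atTop (𝓝 1) ∧
      ((fun n : ℕ => Real.log n * (n : ℝ) ^ (-(((k : ℝ) - 1) ^ 2 / k))) =o[atTop] p →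
        ∀ᶠ n : ℕ in atTop,
          (RandomHypergraph.firstMomentThreshold n k (p n) ε : ℤ) - sz n = 0) ∧
      (∀ C : ℝ, 0 < C →
        (∀ᶠ n : ℕ in atTop, p n = C * Real.log n * (n : ℝ) ^ (-(((k : ℝ) - 1) ^ 2 / k))) →
        ∀ᶠ n : ℕ in atTop,
          (((RandomHypergraph.firstMomentThreshold n k (p n) ε : ℤ) - sz n : ℤ) : ℝ) ∈
            Set.Ioo
              (((k - 1).factorial : ℝ) ^ ((k : ℝ) / ((k : ℝ) - 1)) /
                  (C ^ ((k : ℝ) / ((k : ℝ) - 1)) * Real.exp 1 ^ k)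
                - (k : ℝ) / ((k : ℝ) - 1) - 1 / 2)
              (((k - 1).factorial : ℝ) ^ ((k : ℝ) / ((k : ℝ) - 1)) /
                  (C ^ ((k : ℝ) / ((k : ℝ) - 1)) * Real.exp 1 ^ k)
                + 3 / 2)) ∧
      (p =o[atTop] (fun n : ℕ => Real.log n * (n : ℝ) ^ (-(((k : ℝ) - 1) ^ 2 / k))) →
        (fun n : ℕ =>
            (((RandomHypergraph.firstMomentThreshold n k (p n) ε : ℤ) - sz n : ℤ) : ℝ))
          ~[atTop] (fun n : ℕ =>
            (RandomHypergraph.firstMomentThreshold n k (p n) ε : ℝ) ^ k /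
              (Real.exp 1 ^ k * (n : ℝ) ^ (k - 1))) ∧
        (fun n : ℕ =>
            (RandomHypergraph.firstMomentThreshold n k (p n) ε : ℝ) ^ k /
              (Real.exp 1 ^ k * (n : ℝ) ^ (k - 1)))
          ~[atTop] (fun n : ℕ =>
            ((k.factorial : ℝ) * Real.log ((n : ℝ) * p n ^ (1 / ((k : ℝ) - 1))))
                ^ ((k : ℝ) / ((k : ℝ) - 1)) /
              (Real.exp 1 ^ k * p n ^ ((k : ℝ) / ((k : ℝ) - 1)) * (n : ℝ) ^ (k - 1)))) := by
  have hk2 : (2 : ℝ) ≤ k := by exact_mod_cast hk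
  obtain ⟨h, hx, ha⟩ := RandomHypergraph.isCritical_firstMomentThreshold hk hε hε' hp
  have ha' : ∀ᶠ n : ℕ in atTop, RandomHypergraph.expIndep n k (p n)
      (RandomHypergraph.firstMomentThreshold n k (p n) ε + 1) ≤ (n : ℝ) ^ (2 * ε) :=
    Eventually.of_forall fun n =>
      RandomHypergraph.expIndep_firstMomentThreshold_add_one_le n k (p n) ε
  have hc0 : 0 < ε / (2 * k) := by positivity
  have hcε : ε / (2 * k) ≤ ε := div_le_self hε.le (by linarith)
  have hε1 : ε ≤ 1 := hε'.le.trans ((div_le_one (by linarith)).2 (by linarith))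
  -- The exponent `δ` is half of the critical exponent $c=\varepsilon/(2k)$: positive for the second
  -- moment, below `c` for the upper bound.
  have hδ : ε / (2 * k) / 2 ≤ ε := (half_le_self hc0.le).trans hcε
  have hsub := h.sub_augOffset_eq hε hδ ha
  refine ⟨fun n => (RandomHypergraph.firstMomentThreshold n k (p n) ε -
    RandomHypergraph.augOffset n k (p n) (ε / (2 * k) / 2)
      (RandomHypergraph.firstMomentThreshold n k (p n) ε) : ℕ),
    h.tendsto_prob_two_point (hcε.trans hε1) hε (half_pos hc0) (half_lt_self hc0) hδ ha ha' hx,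
    fun hlarge => ?_, fun C hC hpC => ?_, fun hsmall => ⟨?_, h.isEquivalent_critSize⟩⟩
  · filter_upwards [hsub, h.augOffset_eq_zero hε hδ ha (h.tendsto_critSize_zero hlarge)]
      with n h1 h2
    rw [h1, h2, Nat.cast_zero]
  · filter_upwards [hsub, h.augOffset_mem_Ioo hε (half_pos hc0).le hδ ha ha'
      (h.tendsto_critSize_const hC hpC) (h.tendsto_log_div_log hC hpC)
      (RandomHypergraph.epsilon_le hk (hp.mono fun n hn => hn.1) hpC)] with n h1 h2
    rw [h1, Int.cast_natCast]
    exact h2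
  · refine (h.isEquivalent_augOffset hε (half_pos hc0).le hδ ha ha'
      (h.tendsto_critSize_atTop hsmall)).congr_left ?_
    filter_upwards [hsub] with n h1
    rw [h1, Int.cast_natCast]
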